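/- Let $b>1$, $q=b/(b-1)$ and, for $\operatorname{Re}z>0$, let $f(z)=\sum_{j\ge1}e^{-zj^b}$. Put $X=z^{-1/(b-1)}=z^{1-q}$. For $\sigma=\pm1$ let $t_\sigma=(2\pi i\sigma/b)^{b/(b-1)}$ and $s_\sigma=t_\sigma-2\pi i\sigma\,t_\sigma^{1/b}$ with $t_\sigma^{1/b}=(2\pi i\sigma/b)^{1/(b-1)}$; on the Riemann surface of the logarithm $s_\sigma$ has modulus $2\pi(1-\frac1b)(2\pi/b)^{1/(b-1)}$ and argument $\sigma\frac{(2-b)\pi}{2(b-1)}$, and $s_{\sigma,m}=s_\sigma e^{2\pi i\sigma m/(b-1)}$, $m\in\mathbb Z$, are its other determinations. A *Stokes ray* is a ray $\arg p=\arg s_{\sigma,m}$ on that surface. Let $$\tilde f_0(z)=\Gamma(1+\tfrac1b)z^{-1/b}-\tfrac12+\sum_{j\ge1}a_jz^j,\qquad a_j=\frac{i}{2\pi}\bigl(1-(-1)^{jb}\bigr)\zeta(jb+1)\,b_j,\qquad b_j=\frac{(-1)^{j+1}\Gamma(jb+1)}{j!\,(2\pi i)^{jb}},$$ with $(-1)^{a}=e^{i\pi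 a}$, $i^a=e^{i\pi a/2}$. Then the series of $f$ converges for $\operatorname{Re}z>0$; $f(z)\sim\tilde f_0(z)$ as $z\to0$, uniformly in every sector $|\arg z|\le\frac\pi2-\delta$, $\delta>0$; and the following hold. (i) There is a function $H_b$, analytic at $0$, with $H_b(0)=0$ and Taylor series $H_b(\xi)=\sum_{j\ge1}\frac{a_j}{\Gamma(j(b-1)+1)}\xi^j$ near $0$, such that $H(p)=H_b(p^{b-1})$ has these properties. (a) $H$ is analytic on the Riemann surface of the logarithm with radial cuts from the points $k^qs_{\sigma,m}$ $(k\ge1)$ to infinity. At each of these points $p_0$ and on each side of the cut, $H$ has the form $G(\eta)/\eta$, where $\eta=(\log p-\log p_0)^{1/2}$ and $G$ is analytic at $0$; if $b$ is not an even integer then $G(0)\ne0$, so all these points are genuine square-root branch points. At all other points of the cuts $H$ continues analytically across the cut from each side. (b) For each $\delta>0$ there is $C$ with $|H(p)|\le C|p|^{(b-1)^2/b}$ for all $p$ off the cuts with $|p|\ge1$ and $|\log p-\log(k^qs_{\sigma,m})|\ge\delta/k$ for all $k,\sigma,m$ (logarithms on the surface). (c) $\tilde f_0$ is Borel summable in $X$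 along every ray $\arg X=c$ such that $\arg p=-c$ is not a Stokes ray: there the integral in $$\mathcal{LB}\tilde f_0(z)=\Gamma(1+\tfrac1b)z^{-1/b}-\tfrac12+z^{-1/(b-1)}\int_0^{\infty e^{-ic}}e^{-z^{-1/(b-1)}p}H(p)\,dp$$ converges absolutely, also for all $X$ with $\operatorname{Re}(Xe^{-ic})>0$, and $\mathcal{LB}\tilde f_0(z)\sim\tilde f_0(z)$ as $z\to0$ along the ray. (ii) If $\operatorname{Re}z>0$ and $|\arg z|<(2-b)\pi/2$, then $f(z)=\mathcal{LB}\tilde f_0(z)$, with $c=\arg X=-\arg z/(b-1)$. (iii) There are a function $E$ and numbers $d_j$ ($j\ge0$), depending only on $b$, such that: $E$ is analytic in $\operatorname{Re}u>0$ and $O(1+|u|^{-1/2})$ there; $E(u)=\sum_{j\ge0}d_ju^{j-1/2}$ for small $u$; and $E(u)=\frac1{2i}\bigl(N(i\sqrt u)-N(-i\sqrt u)\bigr)$ for small $u$ with $\operatorname{Re}u>0$, where $N(\omega)=1/(V(\omega)^{b-1}-1)$ and $V$ is the local analytic solution of $bV-V^b=(b-1)(1-\omega^2)$ with $V(0)=1$,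 $V'(0)=-\sqrt{2/b}$. (Thus $E$ is the jump, divided by $2i$, of $dt/ds$ across the cut from $s_\sigma$, where $s=t-2\pi i\sigma t^{1/b}$ and $s=s_\sigma(1+u)$.) With $c^{\sigma,m}_j=\frac1\pi d_j\Gamma(j+\frac12)s_{\sigma,m}^{1/2-j}$, each power series $$\tilde g_{\sigma,m,k}(z)=\sum_{j\ge0}c^{\sigma,m}_j\,k^{\frac{-2jb+2-b}{2(b-1)}}z^{\frac{2j-1}{2(b-1)}}$$ is Borel summable in $X$ in the directions with $|\arg X+\arg s_{\sigma,m}|<\pi/2$: with $c=\arg X$, the integral in $$\mathcal{LB}\tilde g_{\sigma,m,k}(z)=X\int_0^{\infty e^{-ic}}e^{-Xp}\,\frac1{\pi k}E\Bigl(\frac{p}{k^qs_{\sigma,m}}\Bigr)dp$$ converges absolutely, also for all $X$ with $\operatorname{Re}(Xe^{-ic})>0$, and $\mathcal{LB}\tilde g_{\sigma,m,k}\sim\tilde g_{\sigma,m,k}$ as $z\to0$ along the ray. For every $z$ with $\operatorname{Re}z>0$ for which $\arg p=\arg z/(b-1)$ is not a Stokes ray, $$f(z)=\mathcal{LB}\tilde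 f_0(z)+\sum_{\sigma=\pm1}\ \sum_{\substack{m\ge0\\ \sigma\arg z>(2-b)\pi/2+2\pi m}}\ \sum_{k=1}^\infty e^{-s_{\sigma,m}k^qz^{-q+1}}\,\mathcal{LB}\tilde g_{\sigma,m,k}(z),$$ where the inner sums over $k$ converge absolutely. (For $b\le5$ only $m=0$ occurs; for $b\le2$ at most one sign $\sigma$ occurs.) -/

import Mathlib

open Filter Topology Set MeasureTheory

namespace LacBorel

noncomputable section

/-! Points of the Riemann surface of the logarithm are represented by their logarithms: the complex
number `Z` stands for the point of modulus `exp Z.re` and (unrestricted) argument `Z.im`.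
The two signs are the units `σ : ℤˣ`. -/

/-- The lacunary series `f(z) = ∑_{j ≥ 1} exp (-z j ^ b)`. -/
def lacunary (b : ℝ) (z : ℂ) : ℂ :=
  ∑' j : ℕ, Complex.exp (-(z * ((((j : ℝ) + 1) ^ b : ℝ) : ℂ)))

/-- The coefficients `b_j` of `∫_0^∞ exp (-z u - 2 π i k u ^ (1 / b)) du ∼ ∑_{j ≥ 1} b_j k ^ (-j b) z ^ (j - 1)`
(as usual `i ^ a = exp (i π a / 2)`). -/
def lagrangeCoeff (b : ℝ) (j : ℕ) : ℂ :=
  (-1) ^ (j + 1) * (Real.Gamma (j * b + 1) : ℂ) /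
    ((j.factorial : ℂ) * (2 * Real.pi * Complex.I) ^ ((j * b : ℝ) : ℂ))

/-- The coefficient of `z ^ j`, `j ≥ 1`, in the asymptotic series:
`i / (2 π) (1 - (-1) ^ (j b)) ζ(j b + 1) b_j` with `(-1) ^ a = exp (i π a)`. -/
def seriesCoeff (b : ℝ) (j : ℕ) : ℂ :=
  Complex.I / (2 * Real.pi) * (1 - (-1 : ℂ) ^ ((j * b : ℝ) : ℂ)) *
    riemannZeta ((j * b + 1 : ℝ) : ℂ) * lagrangeCoeff b j

/-- `Γ(1 + 1 / b) z ^ (-1 / b) - 1 / 2` at the point `z = exp Z` of the surface of the logarithm. -/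
def leading (b : ℝ) (Z : ℂ) : ℂ :=
  (Real.Gamma (1 + 1 / b) : ℂ) * Complex.exp (-(Z / b)) - 1 / 2

/-- The asymptotic series of `f`, truncated after the power `z ^ N`, at `z = exp Z`. -/
def partialSum (b : ℝ) (N : ℕ) (Z : ℂ) : ℂ :=
  leading b Z + ∑ j ∈ Finset.Icc 1 N, seriesCoeff b j * Complex.exp (j * Z)

/-- `t_σ = (σ 2 π i / b) ^ (b / (b - 1))`. -/
def tPt (b : ℝ) (σ : ℤˣ) : ℂ :=
  (((σ : ℤ) : ℂ) * (2 * Real.pi * Complex.I) / b) ^ ((b / (b - 1) : ℝ) : ℂ)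

/-- `s_σ = t_σ - σ 2 π i t_σ ^ (1 / b)`, where `t_σ ^ (1 / b) = (σ 2 π i / b) ^ (1 / (b - 1))`. -/
def sPt (b : ℝ) (σ : ℤˣ) : ℂ :=
  tPt b σ - ((σ : ℤ) : ℂ) * (2 * Real.pi * Complex.I) *
    (((σ : ℤ) : ℂ) * (2 * Real.pi * Complex.I) / b) ^ ((1 / (b - 1) : ℝ) : ℂ)

/-- The point `s_σ` on the surface of the logarithm. -/
def sLog (b : ℝ) (σ : ℤˣ) : ℂ :=
  ((Real.log (2 * Real.pi * (1 - 1 / b)) + Real.log (2 * Real.pi / b) / (b - 1) : ℝ) : ℂ) +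
    (((σ : ℤ) * ((2 - b) * Real.pi / (2 * (b - 1))) : ℝ) : ℂ) * Complex.I

/-- All the determinations of `s_σ` on the surface of the logarithm
(those of the power `1 / (b - 1)`), numbered by `m`; `m = 0` is `sLog b σ`. -/
def critLog (b : ℝ) (σ : ℤˣ) (m : ℤ) : ℂ :=
  sLog b σ + (((σ : ℤ) * (2 * Real.pi * m / (b - 1)) : ℝ) : ℂ) * Complex.I

/-- The point `k ^ q s_σ`, `q = b / (b - 1)`, on the surface of the logarithm,
for the determination `m` of `s_σ`. -/
def branchPt (b : ℝ) (σ : ℤˣ) (m : ℤ) (k : ℕ) : ℂ :=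
  ((b / (b - 1) * Real.log k : ℝ) : ℂ) + critLog b σ m

/-- The radial cuts from the points `k ^ q s_σ` to infinity. -/
def cutSet (b : ℝ) : Set ℂ :=
  {l | ∃ σ : ℤˣ, ∃ m : ℤ, ∃ k : ℕ, 1 ≤ k ∧ ∃ r : ℝ, 0 ≤ r ∧ l = branchPt b σ m k + r}

/-- `arg p = α` is one of the rays through the points `k ^ q s_σ`. -/
def IsStokes (b α : ℝ) : Prop := ∃ σ : ℤˣ, ∃ m : ℤ, α = (critLog b σ m).im

/-- `H(p) = H_b(p ^ (b - 1))` as a function on the surface of the logarithm, `p = exp l`. -/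
def onLog (b : ℝ) (Hb : ℂ → ℂ) (l : ℂ) : ℂ := Hb (Complex.exp (((b - 1 : ℝ) : ℂ) * l))

/-- The integrand of the Laplace transform along the ray `p = r exp (i α)`, `r > 0`. -/
def rayIntegrand (α : ℝ) (Y : ℂ → ℂ) (X : ℂ) (r : ℝ) : ℂ :=
  Complex.exp (-(X * (r * Complex.exp (α * Complex.I)))) *
    Y ((Real.log r : ℂ) + α * Complex.I) * Complex.exp (α * Complex.I)

/-- The Laplace transform `∫ exp (-X p) Y(p) dp` along the ray `arg p = α` of a function `Y` on the
surface of the logarithm. -/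
def rayLaplace (α : ℝ) (Y : ℂ → ℂ) (X : ℂ) : ℂ :=
  ∫ r in Ioi (0 : ℝ), rayIntegrand α Y X r

/-- `X = z ^ (-1 / (b - 1))` at `z = exp Z`; its argument on the surface is `-Z.im / (b - 1)`. -/
def critVar (b : ℝ) (Z : ℂ) : ℂ := Complex.exp (-(Z / ((b - 1 : ℝ) : ℂ)))

/-- The Borel sum
`Γ(1 + 1 / b) z ^ (-1 / b) - 1 / 2 + z ^ (-1 / (b - 1)) ∫ exp (-z ^ (-1 / (b - 1)) p) H(p) dp`
at `z = exp Z`, the integral being along the ray `arg p = -arg X`, with `X` the critical variable. -/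
def borelSum (b : ℝ) (Hb : ℂ → ℂ) (Z : ℂ) : ℂ :=
  leading b Z + critVar b Z * rayLaplace (Z.im / (b - 1)) (onLog b Hb) (critVar b Z)

/-- The Borel transform (in the critical variable, based at `k ^ q s_σ`) of the power series that
multiplies the exponential `exp (-s_σ k ^ q X)` in the transseries. -/
def transBorel (b : ℝ) (E : ℂ → ℂ) (σ : ℤˣ) (m : ℤ) (k : ℕ) (l : ℂ) : ℂ :=
  E (Complex.exp (l - branchPt b σ m k)) / (Real.pi * k)

/-- The Borel sum of that power series at `z = exp Z`, along `arg p = -arg X`. -/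
def transFactor (b : ℝ) (E : ℂ → ℂ) (σ : ℤˣ) (m : ℤ) (k : ℕ) (Z : ℂ) : ℂ :=
  critVar b Z * rayLaplace (Z.im / (b - 1)) (transBorel b E σ m k) (critVar b Z)

/-- The Borel summed term `exp (-s_σ k ^ q z ^ (-q + 1)) × (Borel sum)` of the transseries
(here `-q + 1 = -1 / (b - 1)`). -/
def transTerm (b : ℝ) (E : ℂ → ℂ) (σ : ℤˣ) (m : ℤ) (k : ℕ) (Z : ℂ) : ℂ :=
  Complex.exp (-(Complex.exp (branchPt b σ m k) * critVar b Z)) * transFactor b E σ m k Z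

/-- The coefficients `c_j` of the power series multiplying the exponentials, in terms of the
coefficients `d_j` of the Puiseux series of the Borel transform. -/
def transCoeff (b : ℝ) (d : ℕ → ℂ) (σ : ℤˣ) (m : ℤ) (j : ℕ) : ℂ :=
  d j * (Real.Gamma ((j : ℝ) + 1 / 2) : ℂ) / Real.pi *
    Complex.exp ((1 / 2 - (j : ℂ)) * critLog b σ m)

/-- The `j`-th term `c_j k ^ ((-2 j b + 2 - b) / (2 (b - 1))) z ^ ((2 j - 1) / (2 (b - 1)))`
of that power series at `z = exp Z`. -/
def transSeriesTerm (b : ℝ) (d : ℕ → ℂ) (σ : ℤˣ) (m : ℤ) (k j : ℕ) (Z : ℂ) : ℂ :=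
  transCoeff b d σ m j *
    (((k : ℝ) ^ ((-2 * j * b + 2 - b) / (2 * (b - 1))) : ℝ) : ℂ) *
    Complex.exp ((((2 * (j : ℝ) - 1) / (2 * (b - 1)) : ℝ) : ℂ) * Z)

/-- The determinations `m ≥ 0` of `s_σ` whose exponentials are present in the direction `arg z = θ`:
those with `σ θ > (2 - b) π / 2 + 2 π m`. -/
def active (b : ℝ) (σ : ℤˣ) (θ : ℝ) : Finset ℕ :=
  Finset.range ⌈((σ : ℤ) * θ - (2 - b) * Real.pi / 2) / (2 * Real.pi)⌉₊

/-- `E` is the jump of `dt/ds` across the cut from the branch point `s_σ`, divided by `2 i`, in the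
variable `u = (s - s_σ) / s_σ`, and `d_j` are its Puiseux coefficients at `u = 0`.
Here `s = t - σ 2 π i t ^ (1 / b)`. In terms of `t = t_σ v ^ b` this relation reads
`(b - 1) s / s_σ = b v - v ^ b`, whence `dt/ds = 1 + 1 / (v ^ (b - 1) - 1)`; near the branch point
`v = V(ω)` is analytic in `ω` with `ω ^ 2 = 1 - s / s_σ = -u`. -/
structure IsCutJump (b : ℝ) (E : ℂ → ℂ) (d : ℕ → ℂ) : Prop where
  analytic : AnalyticOnNhd ℂ E {u | 0 < u.re}
  bound : ∃ C : ℝ, ∀ u : ℂ, 0 < u.re → ‖E u‖ ≤ C * (1 + ‖u‖ ^ (-(1 / 2) : ℝ))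
  puiseux : ∃ ρ : ℝ, 0 < ρ ∧ ∀ u : ℂ, 0 < u.re → ‖u‖ < ρ →
    HasSum (fun j : ℕ => d j * u ^ ((j : ℂ) - 1 / 2)) (E u)
  jump : ∃ V : ℂ → ℂ, AnalyticAt ℂ V 0 ∧ V 0 = 1 ∧ deriv V 0 = -(Real.sqrt (2 / b) : ℂ) ∧
    (∀ᶠ ω in 𝓝 (0 : ℂ), (b : ℂ) * V ω - V ω ^ (b : ℂ) = ((b : ℂ) - 1) * (1 - ω ^ 2)) ∧
    ∀ᶠ ω in 𝓝 (0 : ℂ), 0 < ω.re → 0 < (ω ^ 2).re →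
      E (ω ^ 2) = (1 / (V (Complex.I * ω) ^ ((b - 1 : ℝ) : ℂ) - 1) -
        1 / (V (-(Complex.I * ω)) ^ ((b - 1 : ℝ) : ℂ) - 1)) / (2 * Complex.I)

theorem mem_active {b : ℝ} {σ : ℤˣ} {θ : ℝ} {m : ℕ} :
    m ∈ active b σ θ ↔ (2 - b) * Real.pi / 2 + 2 * Real.pi * m < (σ : ℤ) * θ := by
  have h : (0 : ℝ) < 2 * Real.pi := by positivity
  rw [active, Finset.mem_range, Nat.lt_ceil, lt_div_iff₀ h]
  constructor <;> intro h <;> linarith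

/-- `sLog b σ` is a logarithm of `s_σ`. -/
theorem exp_sLog {b : ℝ} (hb : 1 < b) (σ : ℤˣ) : Complex.exp (sLog b σ) = sPt b σ := by
  have hb0 : (0 : ℝ) < b := by linarith
  have hb1 : (0 : ℝ) < b - 1 := by linarith
  have hbC : (b : ℂ) ≠ 0 := by exact_mod_cast hb0.ne'
  have hbC1 : (b : ℂ) - 1 ≠ 0 := by exact_mod_cast hb1.ne'
  have hpi := Real.pi_pos
  have h1 : (0 : ℝ) < 1 - 1 / b := by
    rw [sub_pos, div_lt_one hb0]; exact hb
  have hA : (0 : ℝ) < 2 * Real.pi * (1 - 1 / b) := by positivity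
  have hB : (0 : ℝ) < 2 * Real.pi / b := by positivity
  -- the base of the powers, in polar form
  have hI : ∀ τ : ℤˣ, ((τ : ℤ) : ℂ) * Complex.I =
      Complex.exp ((((τ : ℤ) * (Real.pi / 2) : ℝ) : ℂ) * Complex.I) := by
    intro τ
    rcases Int.units_eq_one_or τ with rfl | rfl
    · push_cast
      rw [one_mul, one_mul, Complex.exp_pi_div_two_mul_I]
    · push_cast
      simp only [neg_mul, one_mul]
      rw [Complex.exp_neg, Complex.exp_pi_div_two_mul_I, Complex.inv_I]
  have hz : ((σ : ℤ) : ℂ) * (2 * Real.pi * Complex.I) / b =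
      Complex.exp ((Real.log (2 * Real.pi / b) : ℂ) +
        (((σ : ℤ) * (Real.pi / 2) : ℝ) : ℂ) * Complex.I) := by
    rw [Complex.exp_add, ← hI σ, ← Complex.ofReal_exp, Real.exp_log hB]
    push_cast; ring
  have hz0 : ((σ : ℤ) : ℂ) * (2 * Real.pi * Complex.I) / b ≠ 0 := by
    rw [hz]; exact Complex.exp_ne_zero _
  have hlog : Complex.log (((σ : ℤ) : ℂ) * (2 * Real.pi * Complex.I) / b) =
      (Real.log (2 * Real.pi / b) : ℂ) + (((σ : ℤ) * (Real.pi / 2) : ℝ) : ℂ) * Complex.I := by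
    rw [hz]
    apply Complex.log_exp
    · rcases Int.units_eq_one_or σ with rfl | rfl <;> simp <;> linarith
    · rcases Int.units_eq_one_or σ with rfl | rfl <;> simp <;> linarith
  have ht : tPt b σ = (((σ : ℤ) : ℂ) * (2 * Real.pi * Complex.I) / b) *
      (((σ : ℤ) : ℂ) * (2 * Real.pi * Complex.I) / b) ^ ((1 / (b - 1) : ℝ) : ℂ) := by
    have he : ((b / (b - 1) : ℝ) : ℂ) = 1 + ((1 / (b - 1) : ℝ) : ℂ) := by
      push_cast; field_simp; ring
    rw [tPt, he, Complex.cpow_add _ _ hz0, Complex.cpow_one]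
  have hs : sPt b σ = ((2 * Real.pi * (1 - 1 / b) : ℝ) : ℂ) * (((-σ : ℤˣ) : ℤ) * Complex.I) *
      (((σ : ℤ) : ℂ) * (2 * Real.pi * Complex.I) / b) ^ ((1 / (b - 1) : ℝ) : ℂ) := by
    rw [sPt, ht]
    push_cast
    field_simp
    ring
  rw [hs, hI, Complex.cpow_def_of_ne_zero hz0, hlog, sLog, ← Real.exp_log hA,
    Complex.ofReal_exp, ← Complex.exp_add, ← Complex.exp_add, Real.exp_log hA]
  congr 1
  push_cast
  field_simp
  ring

end

end LacBorel

/-! Everything reduces to one universal function. Poisson summation for the even function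
exp(-z|x|^b), with an integration by parts in each Fourier integral, writes f(z) as Γ(1+1/b)
z^(-1/b) - 1/2 plus the sum over k ≥ 1 and σ = ±1 of σ/(2πik) J_{σ,k}(z), where J_{σ,k}(z) = z ∫
exp(-zu + 2πiσk u^(1/b)) du (`lacunary_exp_eq`). Scaling and rotating u turns every J_{σ,k} into the
single integral z ∫ exp(-zu - u^(1/b)) du. Taking the phase zu + u^(1/b) itself as the new variable
Xp, where X is a constant times z^(-1/(b-1)), makes this a Laplace integral X ∫ exp(-Xp) A dp with A
= d(zu)/d(Xp). As a function of ξ = -p^(b-1) the density A is x/(x-1), where x((b-x)/(b-1))^(b-1) =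
ξ; this is `slope` (`lap_stretched_ofReal`, `lap_oscillating_eq`).

The equation for x is studied through ν = log(-x), where it reads `critMap b ν = ζ`. Univalence
holds because the derivative stays in a half plane, and surjectivity onto a cut strip follows from
properness and connectedness (`critMap_injOn`, `critDom_subset_image`). The critical point x = 1 is
simple and has the value ξ = 1. Hence `slope` is analytic off [1, ∞), vanishes at 0, is bounded away
from 1, and behaves like an inverse square root at 1 (`exists_norm_slopeLog_le`, `exists_branch`).
Its Taylor coefficients are found by comparing two expansions of the same integral
(`coeff_eq_slopeCoeff`).

The function H is the sum over k and σ of σ/(2πik) times `slope` at (p/(k^q s_σ))^(b-1). The scaling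
factors have size k^(-b), which gives convergence. The summand is singular where (p/(k^q s_σ))^(b-1)
= 1, that is, once for every determination m of s_σ. In the Taylor coefficients, summation over k
produces ζ(jb+1) and summation over σ produces the factor 1 - (-1)^(jb) (`hasSum_seriesCoeff`). The
growth of H comes from comparing k with the real index x of size |p|^((b-1)/b): the terms are
bounded by x^(b-1) times a sequence that is summable uniformly in x (`exists_div_le_of_dist`).

Each J_{σ,k} is the Laplace integral of its branch along a ray in the sector just before the cut m =
0, whereas the Borel sum uses the ray arg p = -arg X. Rotating one ray into the other crosses the
cuts m = 0, 1, ..., those with 2πm below σ arg z - (2-b)π/2. Each crossing contributes the Laplace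
integral of the jump over the part of the cut beyond the branch point; moving the origin there
extracts the exponential and leaves the Borel sum of E (`weight_mul_amp_sub_amp`,
`weight_mul_osc_eq`). Since the integrals on both sides of a cut are O(k^(-b)), the sums over k
converge absolutely. All asymptotic statements come from one quantitative Watson lemma,
`norm_lap_sub_le`. -/

namespace LacBorel

open Complex (I)
open scoped Real ComplexConjugate FourierTransform

/-! ### Functions with derivative in a half plane, and inverses of injective functions -/

/-- The difference quotient is the mean of f' over the segment, so it inherits a half plane that
contains c f'. Positivity is required only at interior points of the segment, which matters when an
endpoint lies where the derivative leaves the open half plane. -/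
theorem re_slope_pos {s : Set ℂ} (hs : Convex ℝ s) {f f' : ℂ → ℂ} {c : ℂ}
    (hf : ∀ z ∈ s, HasDerivAt f (f' z) z) {a b : ℂ} (ha : a ∈ s) (hb : b ∈ s)
    (hc : ∀ t ∈ Ioo (0 : ℝ) 1, 0 < (c * f' (a + t * (b - a))).re)
    (hab : a ≠ b) : 0 < (c * ((f b - f a) / (b - a))).re := by
  have hba : b - a ≠ 0 := sub_ne_zero.2 hab.symm
  have hmem : ∀ t ∈ Icc (0 : ℝ) 1, a + t * (b - a) ∈ s := by
    intro t ht
    have := hs.add_smul_sub_mem ha hb ht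
    simpa using this
  have hd : ∀ t ∈ Icc (0 : ℝ) 1, HasDerivAt
      (fun t : ℝ => (c * (f (a + t * (b - a)) / (b - a))).re) ((c * f' (a + t * (b - a))).re) t :=
          by
    intro t ht
    have h1 : HasDerivAt (fun t : ℂ => a + t * (b - a)) (b - a) (t : ℂ) := by
      simpa using ((hasDerivAt_id (t : ℂ)).mul_const (b - a)).const_add a
    have h2 := ((hf _ (hmem t ht)).comp (t : ℂ) h1).div_const (b - a) |>.const_mul c
    have h3 := h2.real_of_complex
    rw [mul_div_cancel_right₀ _ hba] at h3
    exact h3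
  have hm : StrictMonoOn (fun t : ℝ => (c * (f (a + t * (b - a)) / (b - a))).re) (Icc 0 1) := by
    apply strictMonoOn_of_deriv_pos (convex_Icc 0 1)
    · intro t ht
      exact (hd t ht).continuousAt.continuousWithinAt
    · intro t ht
      rw [interior_Icc] at ht
      rw [(hd t ⟨ht.1.le, ht.2.le⟩).deriv]
      exact hc t ht
  have := hm (left_mem_Icc.2 zero_le_one) (right_mem_Icc.2 zero_le_one) zero_lt_one
  simp only [Complex.ofReal_zero, zero_mul, add_zero, Complex.ofReal_one, one_mul,
    add_sub_cancel] at this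
  rw [sub_div, mul_sub, Complex.sub_re]
  linarith

section Inverse

variable {U : Set ℂ} {f f' : ℂ → ℂ}

theorem isOpen_image_of_deriv_ne_zero (hU : IsOpen U)
    (hf : ∀ z ∈ U, HasStrictDerivAt f (f' z) z) (h0 : ∀ z ∈ U, f' z ≠ 0) : IsOpen (f '' U) := by
  rw [isOpen_iff_mem_nhds]
  rintro _ ⟨z, hz, rfl⟩
  rw [← (hf z hz).map_nhds_eq (h0 z hz)]
  exact image_mem_map (hU.mem_nhds hz)

theorem invFunOn_apply (hi : InjOn f U) {z : ℂ} (hz : z ∈ U) : Function.invFunOn f U (f z) = z :=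
  hi.leftInvOn_invFunOn hz

/-- Injectivity on all of U identifies the global inverse with the local inverse near every image
point; continuity follows because f maps neighbourhoods onto neighbourhoods. -/
theorem hasDerivAt_invFunOn (hU : IsOpen U) (hi : InjOn f U)
    (hf : ∀ z ∈ U, HasStrictDerivAt f (f' z) z) (h0 : ∀ z ∈ U, f' z ≠ 0) {z : ℂ} (hz : z ∈ U) :
    HasDerivAt (Function.invFunOn f U) (f' z)⁻¹ (f z) := by
  have hinv := invFunOn_apply hi hz
  have hc : ContinuousAt (Function.invFunOn f U) (f z) := by
    rw [ContinuousAt, hinv]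
    intro N hN
    rw [← (hf z hz).map_nhds_eq (h0 z hz), mem_map, mem_map]
    filter_upwards [hN, hU.mem_nhds hz] with w hw hw'
    simpa [invFunOn_apply hi hw'] using hw
  have h := HasDerivAt.of_local_left_inverse (f := f) (f' := f' z) hc
    (by rw [hinv]; exact (hf z hz).hasDerivAt) (h0 z hz) ?_
  · exact h
  · filter_upwards [(isOpen_image_of_deriv_ne_zero hU hf h0).mem_nhds (mem_image_of_mem f hz)]
    rintro _ ⟨w, hw, rfl⟩
    rw [invFunOn_apply hi hw]

end Inverse

/-! ### Laplace integrals along rays, in the logarithmic variable -/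

/-- The integrand of the Laplace transform in the logarithmic variable. -/
noncomputable def lapKer (X : ℂ) (Y : ℂ → ℂ) (l : ℂ) : ℂ :=
  Complex.exp (-(X * Complex.exp l)) * Y l * Complex.exp l

theorem exp_image_univ : Real.exp '' univ = Ioi 0 := by
  rw [image_univ, Real.range_exp]

theorem rayIntegrand_exp (α : ℝ) (Y : ℂ → ℂ) (X : ℂ) (t : ℝ) :
    |Real.exp t| • rayIntegrand α Y X (Real.exp t) = lapKer X Y (t + α * I) := by
  rw [abs_of_pos (Real.exp_pos t), rayIntegrand, lapKer, Real.log_exp, Complex.exp_add,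
    Complex.ofReal_exp, Complex.real_smul, Complex.ofReal_exp]
  ring

theorem rayLaplace_eq (α : ℝ) (Y : ℂ → ℂ) (X : ℂ) :
    rayLaplace α Y X = ∫ t : ℝ, lapKer X Y (t + α * I) := by
  rw [rayLaplace, ← exp_image_univ, integral_image_eq_integral_abs_deriv_smul MeasurableSet.univ
    (fun x _ => (Real.hasDerivAt_exp x).hasDerivWithinAt) Real.exp_injective.injOn]
  simp only [rayIntegrand_exp, Measure.restrict_univ]

theorem integrableOn_rayIntegrand_iff (α : ℝ) (Y : ℂ → ℂ) (X : ℂ) :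
    IntegrableOn (rayIntegrand α Y X) (Ioi 0) ↔
      Integrable fun t : ℝ => lapKer X Y (t + α * I) := by
  rw [← exp_image_univ, integrableOn_image_iff_integrableOn_abs_deriv_smul MeasurableSet.univ
    (fun x _ => (Real.hasDerivAt_exp x).hasDerivWithinAt) Real.exp_injective.injOn]
  simp only [rayIntegrand_exp, integrableOn_univ]

/-- The growth allowed for the Borel transforms. -/
noncomputable def rayBound (a t₀ t : ℝ) : ℝ :=
  Real.exp (-t / 2) + Real.exp (a * t) + |t - t₀| ^ (-(1 / 2) : ℝ)

theorem rayBound_nonneg (a t₀ t : ℝ) : 0 ≤ rayBound a t₀ t := by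
  unfold rayBound; positivity

theorem one_le_rayBound {a : ℝ} (ha : 0 ≤ a) (t₀ t : ℝ) : 1 ≤ rayBound a t₀ t := by
  have h3 : 0 ≤ |t - t₀| ^ (-(1 / 2) : ℝ) := by positivity
  unfold rayBound
  rcases le_total 0 t with h | h
  · have := Real.one_le_exp (mul_nonneg ha h)
    have := Real.exp_pos (-t / 2)
    linarith
  · have : 1 ≤ Real.exp (-t / 2) := Real.one_le_exp (by linarith)
    have := Real.exp_pos (a * t)
    linarith

theorem integrable_exp_exp {c s : ℝ} (hc : 0 < c) (hs : 0 < s) :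
    Integrable fun t : ℝ => Real.exp (-c * Real.exp t) * Real.exp (s * t) := by
  have h := integrableOn_rpow_mul_exp_neg_mul_rpow (p := 1) (s := s - 1) (b := c) (by linarith)
    one_pos hc
  rw [← exp_image_univ, integrableOn_image_iff_integrableOn_abs_deriv_smul MeasurableSet.univ
    (fun x _ => (Real.hasDerivAt_exp x).hasDerivWithinAt) Real.exp_injective.injOn,
    integrableOn_univ] at h
  refine h.congr (Eventually.of_forall fun t => ?_)
  simp only [Real.rpow_one, smul_eq_mul, abs_of_pos (Real.exp_pos t)]
  rw [← Real.exp_mul, mul_comm (Real.exp (t * (s - 1))), ← mul_assoc, mul_comm (Real.exp t),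
    mul_assoc, ← Real.exp_add]
  ring_nf

theorem integrableOn_abs_sub_rpow (t₀ : ℝ) :
    IntegrableOn (fun t : ℝ => |t - t₀| ^ (-(1 / 2) : ℝ)) (Icc (t₀ - 1) (t₀ + 1)) := by
  have h1 : IntervalIntegrable (fun t : ℝ => |t| ^ (-(1 / 2) : ℝ)) volume 0 1 := by
    refine (intervalIntegral.intervalIntegrable_rpow' (r := -(1 / 2)) (by norm_num)).congr ?_
    intro t ht
    rw [uIoc_of_le zero_le_one] at ht
    simp only [abs_of_pos ht.1]
  have h2 : IntervalIntegrable (fun t : ℝ => |t| ^ (-(1 / 2) : ℝ)) volume (-1) 0 := by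
    have := ((IntervalIntegrable.iff_comp_neg (by simp)).1 h1).symm
    simpa using this
  have h3 := (h2.trans h1).comp_sub_right t₀
  rw [intervalIntegrable_iff_integrableOn_Icc_of_le (by linarith)] at h3
  rwa [neg_add_eq_sub, add_comm] at h3

/-- With p = exp t, the three terms of `rayBound` allow a singularity p^(-1/2) at the origin,
polynomial growth at infinity, and an inverse square root singularity at one point of the ray. Each
is integrable against exp(-cp) dp. -/
theorem integrable_rayBound {c a : ℝ} (hc : 0 < c) (ha : 0 ≤ a) (t₀ : ℝ) :
    Integrable fun t : ℝ => Real.exp (-c * Real.exp t) * rayBound a t₀ t * Real.exp t := by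
  have h1 := integrable_exp_exp hc (s := 1 / 2) (by norm_num)
  have h2 := integrable_exp_exp hc (s := a + 1) (by linarith)
  have h3 := integrable_exp_exp hc (s := 1) one_pos
  -- Near t₀ the weight exp(-c exp t) exp t is at most 1/c; outside the unit neighbourhood the
  -- singular factor is at most 1.
  have h4 : Integrable ((Icc (t₀ - 1) (t₀ + 1)).indicator
      fun t : ℝ => (1 / c) * |t - t₀| ^ (-(1 / 2) : ℝ)) :=
    (integrable_indicator_iff measurableSet_Icc).2 ((integrableOn_abs_sub_rpow t₀).const_mul _)
  refine (((h1.add h2).add h3).add h4).mono' (by unfold rayBound; fun_prop)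
    (Eventually.of_forall fun t => ?_)
  rw [Real.norm_of_nonneg (by have := rayBound_nonneg a t₀ t; positivity)]
  have hE : Real.exp (-c * Real.exp t) * Real.exp t ≤ 1 / c := by
    rw [le_div_iff₀ hc, neg_mul, Real.exp_neg]
    have := Real.add_one_le_exp (c * Real.exp t)
    have h0 := Real.exp_pos (c * Real.exp t)
    rw [mul_assoc, inv_mul_le_iff₀ h0]
    linarith
  have h5 : Real.exp (-c * Real.exp t) * |t - t₀| ^ (-(1 / 2) : ℝ) * Real.exp t ≤
      Real.exp (-c * Real.exp t) * Real.exp (1 * t) + (Icc (t₀ - 1) (t₀ + 1)).indicator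
      (fun t : ℝ => (1 / c) * |t - t₀| ^ (-(1 / 2) : ℝ)) t := by
    by_cases ht : t ∈ Icc (t₀ - 1) (t₀ + 1)
    · rw [indicator_of_mem ht]
      have : 0 ≤ |t - t₀| ^ (-(1 / 2) : ℝ) := by positivity
      have := mul_le_mul_of_nonneg_right hE this
      have : 0 < Real.exp (-c * Real.exp t) * Real.exp (1 * t) := by positivity
      linarith
    · rw [indicator_of_notMem ht, add_zero, one_mul]
      have h6 : |t - t₀| ^ (-(1 / 2) : ℝ) ≤ 1 := by
        apply Real.rpow_le_one_of_one_le_of_nonpos _ (by norm_num)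
        by_contra! h
        rw [abs_lt] at h
        exact ht ⟨by linarith, by linarith⟩
      have := Real.exp_pos t
      have := Real.exp_pos (-c * Real.exp t)
      nlinarith [mul_pos this (Real.exp_pos t)]
  have e1 : Real.exp (1 / 2 * t) = Real.exp (-t / 2) * Real.exp t := by
    rw [← Real.exp_add]; ring_nf
  have e2 : Real.exp ((a + 1) * t) = Real.exp (a * t) * Real.exp t := by
    rw [← Real.exp_add]; ring_nf
  simp only [Pi.add_apply]
  rw [e1, e2, rayBound]
  linarith

theorem norm_lapKer_le {X : ℂ} {Y : ℂ → ℂ} {l : ℂ} {c B : ℝ}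
    (hc : c ≤ (X * Complex.exp (l.im * I)).re) (hY : ‖Y l‖ ≤ B) :
    ‖lapKer X Y l‖ ≤ Real.exp (-c * Real.exp l.re) * B * Real.exp l.re := by
  have h1 : Complex.exp l = Real.exp l.re * Complex.exp (l.im * I) := by
    rw [Complex.ofReal_exp, ← Complex.exp_add, Complex.re_add_im]
  have h2 : (-(X * Complex.exp l)).re = -(X * Complex.exp (l.im * I)).re * Real.exp l.re := by
    rw [h1, ← mul_assoc, mul_comm X, mul_assoc, Complex.neg_re, Complex.re_ofReal_mul]
    ring
  rw [lapKer, norm_mul, norm_mul, Complex.norm_exp, Complex.norm_exp, h2]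
  gcongr

theorem continuous_lapKer {α : ℝ} {X : ℂ} {Y : ℂ → ℂ}
    (hc : Continuous fun t : ℝ => Y (t + α * I)) :
    Continuous fun t : ℝ => lapKer X Y (t + α * I) :=
  ((by fun_prop : Continuous fun t : ℝ => Complex.exp (-(X * Complex.exp (t + α * I)))).mul
    hc).mul (by fun_prop)

theorem integrable_lapKer {α : ℝ} {X : ℂ} {Y : ℂ → ℂ} {C a t₀ : ℝ} (ha : 0 ≤ a)
    (hX : 0 < (X * Complex.exp (α * I)).re) (hc : Continuous fun t : ℝ => Y (t + α * I))
    (hY : ∀ t : ℝ, t ≠ t₀ → ‖Y (t + α * I)‖ ≤ C * rayBound a t₀ t) :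
    Integrable fun t : ℝ => lapKer X Y (t + α * I) := by
  refine ((integrable_rayBound hX ha t₀).const_mul C).mono' ?_ ?_
  · exact (continuous_lapKer hc).aestronglyMeasurable
  · filter_upwards [compl_mem_ae_iff.2 (measure_singleton t₀)] with t ht
    have := norm_lapKer_le (X := X) (Y := Y) (l := t + α * I) (c := (X * Complex.exp (α * I)).re)
      (by simp [-Complex.mul_re]) (hY t ht)
    simp only [Complex.add_re, Complex.ofReal_re, Complex.mul_re, Complex.I_re, mul_zero,
      Complex.ofReal_im, Complex.I_im, mul_one, sub_self, add_zero] at this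
    simp only [Complex.mul_re]
    linarith

theorem tendsto_exp_exp_atTop {c s : ℝ} (hc : 0 < c) :
    Tendsto (fun t : ℝ => Real.exp (-c * Real.exp t) * Real.exp (s * t)) atTop (𝓝 0) := by
  have := (tendsto_rpow_mul_exp_neg_mul_atTop_nhds_zero s c hc).comp Real.tendsto_exp_atTop
  refine this.congr fun t => ?_
  simp only [Function.comp]
  rw [← Real.exp_mul, mul_comm, mul_comm s]

theorem tendsto_exp_exp_atBot {c s : ℝ} (hc : 0 < c) (hs : 0 < s) :
    Tendsto (fun t : ℝ => Real.exp (-c * Real.exp t) * Real.exp (s * t)) atBot (𝓝 0) := by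
  have h1 : Tendsto (fun t : ℝ => Real.exp (s * t)) atBot (𝓝 0) :=
    Real.tendsto_exp_atBot.comp (tendsto_id.const_mul_atBot hs)
  refine squeeze_zero (fun t => by positivity) (fun t => ?_) h1
  have : Real.exp (-c * Real.exp t) ≤ 1 := Real.exp_le_one_iff.2 (by
    have := Real.exp_pos t; nlinarith)
  have := Real.exp_pos (s * t)
  nlinarith

theorem tendsto_rayBound {c a : ℝ} (hc : 0 < c) (ha : 0 ≤ a) (t₀ : ℝ) :
    Tendsto (fun t : ℝ => Real.exp (-c * Real.exp t) * rayBound a t₀ t * Real.exp t)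
      atTop (𝓝 0) ∧
    Tendsto (fun t : ℝ => Real.exp (-c * Real.exp t) * rayBound a t₀ t * Real.exp t)
      atBot (𝓝 0) := by
  have key : ∀ t : ℝ, 1 ≤ |t - t₀| →
      Real.exp (-c * Real.exp t) * rayBound a t₀ t * Real.exp t ≤
      Real.exp (-c * Real.exp t) * Real.exp (1 / 2 * t) +
      Real.exp (-c * Real.exp t) * Real.exp ((a + 1) * t) +
      Real.exp (-c * Real.exp t) * Real.exp (1 * t) := by
    intro t ht
    have e1 : Real.exp (1 / 2 * t) = Real.exp (-t / 2) * Real.exp t := by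
      rw [← Real.exp_add]; ring_nf
    have e2 : Real.exp ((a + 1) * t) = Real.exp (a * t) * Real.exp t := by
      rw [← Real.exp_add]; ring_nf
    have h6 : |t - t₀| ^ (-(1 / 2) : ℝ) ≤ 1 :=
      Real.rpow_le_one_of_one_le_of_nonpos ht (by norm_num)
    rw [e1, e2, rayBound, one_mul]
    have := mul_pos (Real.exp_pos (-c * Real.exp t)) (Real.exp_pos t)
    nlinarith
  have n0 : ∀ t : ℝ, 0 ≤ Real.exp (-c * Real.exp t) * rayBound a t₀ t * Real.exp t := fun t => by
    have := rayBound_nonneg a t₀ t; positivity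
  constructor
  · have h := ((tendsto_exp_exp_atTop hc (s := 1 / 2)).add
      (tendsto_exp_exp_atTop hc (s := a + 1))).add (tendsto_exp_exp_atTop hc (s := 1))
    rw [add_zero, add_zero] at h
    refine squeeze_zero' (Eventually.of_forall n0) ?_ h
    filter_upwards [eventually_ge_atTop (t₀ + 1)] with t ht
    exact key t (by rw [le_abs]; left; linarith)
  · have h := ((tendsto_exp_exp_atBot hc (s := 1 / 2) (by norm_num)).add
      (tendsto_exp_exp_atBot hc (s := a + 1) (by linarith))).add
      (tendsto_exp_exp_atBot hc (s := 1) one_pos)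
    rw [add_zero, add_zero] at h
    refine squeeze_zero' (Eventually.of_forall n0) ?_ h
    filter_upwards [eventually_le_atBot (t₀ - 1)] with t ht
    exact key t (by rw [le_abs]; right; linarith)

section Strip

variable {Y : ℂ → ℂ} {X : ℂ} {C a t₀ α₁ α₂ c : ℝ}

theorem continuous_line (hY : DifferentiableOn ℂ Y {l | α₁ < l.im ∧ l.im < α₂}) {α : ℝ}
    (hα : α ∈ Ioo α₁ α₂) : Continuous fun t : ℝ => Y (t + α * I) := by
  refine hY.continuousOn.comp_continuous (by fun_prop) fun t => ?_
  simpa using hα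

theorem isOpen_strip (α₁ α₂ : ℝ) : IsOpen {l : ℂ | α₁ < l.im ∧ l.im < α₂} :=
  (isOpen_lt continuous_const Complex.continuous_im).inter
    (isOpen_lt Complex.continuous_im continuous_const)

/-- Cauchy's theorem on rectangles of width 2L. The vertical sides vanish as L grows: on the right
by the decay of exp(-cp), on the left because the Jacobian exp t beats the permitted exp(-t/2). -/
theorem integral_lapKer_eq_of_le (ha : 0 ≤ a) (hc : 0 < c)
    (hY : DifferentiableOn ℂ Y {l | α₁ < l.im ∧ l.im < α₂})
    (hb : ∀ l : ℂ, α₁ < l.im → l.im < α₂ → l.re ≠ t₀ → ‖Y l‖ ≤ C * rayBound a t₀ l.re)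
    (hX : ∀ α ∈ Ioo α₁ α₂, c ≤ (X * Complex.exp (α * I)).re) {α β : ℝ}
    (hα : α ∈ Ioo α₁ α₂) (hβ : β ∈ Ioo α₁ α₂) (hαβ : α ≤ β) :
    ∫ t : ℝ, lapKer X Y (t + α * I) = ∫ t : ℝ, lapKer X Y (t + β * I) := by
  have hI : ∀ γ ∈ Ioo α₁ α₂, Integrable fun t : ℝ => lapKer X Y (t + γ * I) := by
    intro γ hγ
    refine integrable_lapKer ha (hc.trans_le (hX γ hγ)) (continuous_line hY hγ) (C := C) (t₀ := t₀)
      fun t ht => ?_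
    have := hb (t + γ * I) (by simpa using hγ.1) (by simpa using hγ.2) (by simpa using ht)
    simpa using this
  have hd : DifferentiableOn ℂ (lapKer X Y) {l | α₁ < l.im ∧ l.im < α₂} := by
    unfold lapKer
    exact ((by fun_prop : Differentiable ℂ _).differentiableOn.mul hY).mul
      (by fun_prop : Differentiable ℂ _).differentiableOn
  have hsub : ∀ y ∈ Icc α β, y ∈ Ioo α₁ α₂ := fun y hy =>
    ⟨hα.1.trans_le hy.1, hy.2.trans_lt hβ.2⟩
  have hrect : ∀ L : ℝ, (∫ x in (-L)..L, lapKer X Y (x + α * I)) -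
      (∫ x in (-L)..L, lapKer X Y (x + β * I)) +
      I • (∫ y in α..β, lapKer X Y (L + y * I)) - I • (∫ y in α..β, lapKer X Y ((-L : ℝ) + y * I))
      = 0 := by
    intro L
    have := Complex.integral_boundary_rect_eq_zero_of_differentiableOn (lapKer X Y)
      ⟨-L, α⟩ ⟨L, β⟩ (hd.mono ?_)
    · exact this
    · intro l hl
      rw [Complex.mem_reProdIm, uIcc_of_le hαβ] at hl
      exact hsub _ hl.2
  -- The bound on Y is available off Re l = t₀ only, so the sides must avoid this abscissa, which
  -- they eventually do.
  have hside : ∀ (F : Filter ℝ), Tendsto (fun t : ℝ => Real.exp (-c * Real.exp t) *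
      rayBound a t₀ t * Real.exp t) F (𝓝 0) → (∀ᶠ t in F, t ≠ t₀) →
      Tendsto (fun L : ℝ => ∫ y in α..β, lapKer X Y (L + y * I)) F (𝓝 0) := by
    intro F hF hne
    rw [tendsto_zero_iff_norm_tendsto_zero]
    refine squeeze_zero' (Eventually.of_forall fun _ => norm_nonneg _) (g := fun L =>
      C * (Real.exp (-c * Real.exp L) * rayBound a t₀ L * Real.exp L) * |β - α|) ?_ ?_
    · filter_upwards [hne] with L hL
      refine intervalIntegral.norm_integral_le_of_norm_le_const fun y hy => ?_
      rw [uIoc_of_le hαβ] at hy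
      have hy' := hsub y ⟨hy.1.le, hy.2⟩
      have := norm_lapKer_le (X := X) (Y := Y) (l := L + y * I) (c := c)
        (by simpa using hX y hy') (hb _ (by simpa using hy'.1) (by simpa using hy'.2)
          (by simpa using hL))
      simp only [Complex.add_re, Complex.ofReal_re, Complex.mul_re, Complex.I_re, mul_zero,
        Complex.ofReal_im, Complex.I_im, mul_one, sub_self, add_zero] at this
      linarith
    · simpa using (hF.const_mul C).mul_const |β - α|
  obtain ⟨hT, hB⟩ := tendsto_rayBound hc ha t₀
  have h1 := intervalIntegral_tendsto_integral (hI α hα) tendsto_neg_atTop_atBot tendsto_id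
  have h2 := intervalIntegral_tendsto_integral (hI β hβ) tendsto_neg_atTop_atBot tendsto_id
  have h3 := hside atTop hT (eventually_ne_atTop t₀)
  have h4 := (hside atBot hB (eventually_ne_atBot t₀)).comp tendsto_neg_atTop_atBot
  have h5 := ((h1.sub h2).add (h3.const_smul I)).sub (h4.const_smul I)
  have h6 := tendsto_nhds_unique h5 (by
    refine tendsto_const_nhds.congr' (Eventually.of_forall fun L => (hrect L).symm))
  simpa [sub_eq_zero] using h6

theorem integral_lapKer_eq (ha : 0 ≤ a) (hc : 0 < c)
    (hY : DifferentiableOn ℂ Y {l | α₁ < l.im ∧ l.im < α₂})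
    (hb : ∀ l : ℂ, α₁ < l.im → l.im < α₂ → l.re ≠ t₀ → ‖Y l‖ ≤ C * rayBound a t₀ l.re)
    (hX : ∀ α ∈ Ioo α₁ α₂, c ≤ (X * Complex.exp (α * I)).re) {α β : ℝ}
    (hα : α ∈ Ioo α₁ α₂) (hβ : β ∈ Ioo α₁ α₂) :
    ∫ t : ℝ, lapKer X Y (t + α * I) = ∫ t : ℝ, lapKer X Y (t + β * I) := by
  rcases le_total α β with h | h
  · exact integral_lapKer_eq_of_le ha hc hY hb hX hα hβ h
  · exact (integral_lapKer_eq_of_le ha hc hY hb hX hβ hα h).symm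

/-- The Laplace integrals inside a strip have the value of the integral of the boundary values. -/
theorem integral_lapKer_eq_boundary (ha : 0 ≤ a) (hc : 0 < c)
    (hY : DifferentiableOn ℂ Y {l | α₁ < l.im ∧ l.im < α₂})
    (hb : ∀ l : ℂ, α₁ < l.im → l.im < α₂ → l.re ≠ t₀ → ‖Y l‖ ≤ C * rayBound a t₀ l.re)
    (hX : ∀ α ∈ Ioo α₁ α₂, c ≤ (X * Complex.exp (α * I)).re) {α β : ℝ}
    (hα : α ∈ Ioo α₁ α₂) (hβ : β ∈ Icc α₁ α₂) {Y₁ : ℂ → ℂ}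
    (hl : ∀ t : ℝ, t ≠ t₀ → Tendsto (fun γ : ℝ => Y (t + γ * I)) (𝓝[Ioo α₁ α₂] β)
      (𝓝 (Y₁ (t + β * I)))) :
    ∫ t : ℝ, lapKer X Y (t + α * I) = ∫ t : ℝ, lapKer X Y₁ (t + β * I) := by
  have hne : (𝓝[Ioo α₁ α₂] β).NeBot := by
    rw [← mem_closure_iff_nhdsWithin_neBot, closure_Ioo (hα.1.trans hα.2).ne]
    exact hβ
  have h1 : Tendsto (fun γ : ℝ => ∫ t : ℝ, lapKer X Y (t + γ * I)) (𝓝[Ioo α₁ α₂] β)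
      (𝓝 (∫ t : ℝ, lapKer X Y₁ (t + β * I))) := by
    refine tendsto_integral_filter_of_dominated_convergence
      (fun t => C * (Real.exp (-c * Real.exp t) * rayBound a t₀ t * Real.exp t)) ?_ ?_
      ((integrable_rayBound hc ha t₀).const_mul C) ?_
    · filter_upwards [self_mem_nhdsWithin] with γ hγ
      exact (continuous_lapKer (continuous_line hY hγ)).aestronglyMeasurable
    · filter_upwards [self_mem_nhdsWithin] with γ hγ
      filter_upwards [compl_mem_ae_iff.2 (measure_singleton t₀)] with t ht
      have := norm_lapKer_le (X := X) (Y := Y) (l := t + γ * I) (c := c)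
        (by simpa using hX γ hγ) (hb _ (by simpa using hγ.1) (by simpa using hγ.2)
          (by simpa using ht))
      simp only [Complex.add_re, Complex.ofReal_re, Complex.mul_re, Complex.I_re, mul_zero,
        Complex.ofReal_im, Complex.I_im, mul_one, sub_self, add_zero] at this
      linarith
    · filter_upwards [compl_mem_ae_iff.2 (measure_singleton t₀)] with t ht
      unfold lapKer
      have hcont : Continuous fun γ : ℝ => Complex.exp (t + γ * I) := by fun_prop
      have h2 := (hcont.tendsto β).mono_left (nhdsWithin_le_nhds (s := Ioo α₁ α₂))
      have hcont' : Continuous fun γ : ℝ => Complex.exp (-(X * Complex.exp (t + γ * I))) := by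
        fun_prop
      have h3 := (hcont'.tendsto β).mono_left (nhdsWithin_le_nhds (s := Ioo α₁ α₂))
      exact (h3.mul (hl t ht)).mul h2
  refine tendsto_nhds_unique (tendsto_const_nhds.congr' ?_) h1
  filter_upwards [self_mem_nhdsWithin] with γ hγ
  exact integral_lapKer_eq ha hc hY hb hX hα hγ

theorem differentiableAt_integral_lapKer {α : ℝ} (ha : 0 ≤ a)
    (hcont : Continuous fun t : ℝ => Y (t + α * I))
    (hb : ∀ t : ℝ, t ≠ t₀ → ‖Y (t + α * I)‖ ≤ C * rayBound a t₀ t)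
    (hX : 0 < (X * Complex.exp (α * I)).re) :
    DifferentiableAt ℂ (fun X => ∫ t : ℝ, lapKer X Y (t + α * I)) X := by
  -- Half of the decay rate is shared by all points near X.
  set c := (X * Complex.exp (α * I)).re / 2 with hcdef
  have hc : 0 < c := by positivity
  have hs : {X : ℂ | c < (X * Complex.exp (α * I)).re} ∈ 𝓝 X := by
    apply IsOpen.mem_nhds (isOpen_lt continuous_const (by fun_prop))
    rw [mem_ofPred_eq]; linarith
  refine (hasDerivAt_integral_of_dominated_loc_of_deriv_le (𝕜 := ℂ)
    (F := fun X t => lapKer X Y (t + α * I))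
    (F' := fun X t => -Complex.exp (t + α * I) * lapKer X Y (t + α * I))
    (bound := fun t => (2 / c) * (C * (Real.exp (-(c / 2) * Real.exp t) * rayBound a t₀ t *
      Real.exp t))) hs
    ?_ (integrable_lapKer ha hX hcont hb) ?_ ?_ ?_ ?_).2.differentiableAt
  · exact Eventually.of_forall fun X => (continuous_lapKer hcont).aestronglyMeasurable
  · exact ((by fun_prop : Continuous fun t : ℝ => -Complex.exp (t + α * I)).mul
      (continuous_lapKer hcont)).aestronglyMeasurable
  · filter_upwards [compl_mem_ae_iff.2 (measure_singleton t₀)] with t ht X' hX'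
    have := norm_lapKer_le (X := X') (Y := Y) (l := t + α * I) (c := c)
      (by simpa using hX'.le) (hb t ht)
    simp only [Complex.add_re, Complex.ofReal_re, Complex.mul_re, Complex.I_re, mul_zero,
      Complex.ofReal_im, Complex.I_im, mul_one, sub_self, add_zero] at this
    rw [norm_mul, norm_neg, Complex.norm_exp]
    simp only [Complex.add_re, Complex.ofReal_re, Complex.mul_re, Complex.I_re, mul_zero,
      Complex.ofReal_im, Complex.I_im, mul_one, sub_self, add_zero]
    have h0 : 0 ≤ C * rayBound a t₀ t := (norm_nonneg _).trans (hb t ht)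
    -- The factor exp t produced by differentiation is absorbed by half of the remaining decay.
    have h1 : Real.exp t ≤ (2 / c) * Real.exp (c / 2 * Real.exp t) := by
      have := Real.add_one_le_exp (c / 2 * Real.exp t)
      rw [div_mul_eq_mul_div, le_div_iff₀ hc]
      linarith
    have h2 : Real.exp (-c * Real.exp t) * Real.exp (c / 2 * Real.exp t) =
        Real.exp (-(c / 2) * Real.exp t) := by
      rw [← Real.exp_add]; ring_nf
    calc Real.exp t * ‖lapKer X' Y (t + α * I)‖
        ≤ ((2 / c) * Real.exp (c / 2 * Real.exp t)) *
          (Real.exp (-c * Real.exp t) * (C * rayBound a t₀ t) * Real.exp t) := by gcongr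
      _ = (2 / c) * (C * ((Real.exp (-c * Real.exp t) * Real.exp (c / 2 * Real.exp t)) *
          rayBound a t₀ t * Real.exp t)) := by ring
      _ = _ := by rw [h2]
  · exact ((integrable_rayBound (by linarith) ha t₀).const_mul C).const_mul _
  · refine Eventually.of_forall fun t X' _ => ?_
    unfold lapKer
    have h1 : HasDerivAt (fun X : ℂ => -(X * Complex.exp (t + α * I)))
        (-Complex.exp (t + α * I)) X' := by
      have := ((hasDerivAt_id X').mul_const (Complex.exp (t + α * I))).neg
      rwa [one_mul] at this
    have := (h1.cexp.mul_const (Y (t + α * I))).mul_const (Complex.exp (t + α * I))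
    refine this.congr_deriv ?_
    ring

end Strip

/-! ### Laplace transforms on the surface of the logarithm -/

/-- The Laplace transform at the point `exp W`, along `arg p = α`. -/
noncomputable def lap (Y : ℂ → ℂ) (α : ℝ) (W : ℂ) : ℂ :=
  ∫ t : ℝ, lapKer (Complex.exp W) Y (t + α * I)

theorem rayLaplace_exp (α : ℝ) (Y : ℂ → ℂ) (W : ℂ) :
    rayLaplace α Y (Complex.exp W) = lap Y α W := rayLaplace_eq _ _ _

theorem re_exp_mul_exp (W : ℂ) (α : ℝ) :
    (Complex.exp W * Complex.exp (α * I)).re = Real.exp W.re * Real.cos (W.im + α) := by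
  rw [← Complex.exp_add, Complex.exp_re]
  simp

theorem re_exp_mul_exp_pos {W : ℂ} {α : ℝ} (h : |W.im + α| < π / 2) :
    0 < (Complex.exp W * Complex.exp (α * I)).re := by
  rw [re_exp_mul_exp]
  rw [abs_lt] at h
  exact mul_pos (Real.exp_pos _) (Real.cos_pos_of_mem_Ioo ⟨by linarith, h.2⟩)

section Strip

variable {Y : ℂ → ℂ} {C a t₀ α₁ α₂ : ℝ}

theorem lap_eq_boundary_of_le (ha : 0 ≤ a)
    (hY : DifferentiableOn ℂ Y {l | α₁ < l.im ∧ l.im < α₂})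
    (hb : ∀ l : ℂ, α₁ < l.im → l.im < α₂ → l.re ≠ t₀ → ‖Y l‖ ≤ C * rayBound a t₀ l.re)
    {α β : ℝ} {W : ℂ} (hα : α ∈ Ioo α₁ α₂) (hβ : β ∈ Icc α₁ α₂)
    (hWα : |W.im + α| < π / 2) (hWβ : |W.im + β| < π / 2) {Y₁ : ℂ → ℂ}
    (hl : ∀ t : ℝ, t ≠ t₀ → Tendsto (fun γ : ℝ => Y (t + γ * I)) (𝓝[Ioo α₁ α₂] β)
      (𝓝 (Y₁ (t + β * I)))) :
    lap Y α W = lap Y₁ β W := by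
  -- The interval between α and β, enlarged by ε, still has |Im W + γ| ≤ π/2 - ε. This yields a
  -- uniform positive decay rate, as the contour shift requires.
  set ε := min ((π / 2 - |W.im + α|) / 2) ((π / 2 - |W.im + β|) / 2) with hε
  have hε0 : 0 < ε := lt_min (by linarith) (by linarith)
  have hε1 : ε ≤ (π / 2 - |W.im + α|) / 2 := min_le_left _ _
  have hε2 : ε ≤ (π / 2 - |W.im + β|) / 2 := min_le_right _ _
  obtain ⟨m1, M1⟩ := abs_le.1 (le_refl |W.im + α|)
  obtain ⟨m2, M2⟩ := abs_le.1 (le_refl |W.im + β|)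
  set γ₁ := max α₁ (min α β - ε) with hγ₁
  set γ₂ := min α₂ (max α β + ε) with hγ₂
  have hsub : Ioo γ₁ γ₂ ⊆ Ioo α₁ α₂ := Ioo_subset_Ioo (le_max_left _ _) (min_le_left _ _)
  have hnn : 0 ≤ |W.im + α| := abs_nonneg _
  have hcpos : 0 < Real.exp W.re * Real.cos (π / 2 - ε) :=
    mul_pos (Real.exp_pos _) (Real.cos_pos_of_mem_Ioo ⟨by linarith, by linarith⟩)
  refine integral_lapKer_eq_boundary (α₁ := γ₁) (α₂ := γ₂) ha hcpos
    (hY.mono fun l hl => hsub hl)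
    (fun l h1 h2 => hb l (hsub ⟨h1, h2⟩).1 (hsub ⟨h1, h2⟩).2) ?_ ?_ ?_ ?_
  · intro γ hγ
    rw [re_exp_mul_exp]
    refine mul_le_mul_of_nonneg_left ?_ (Real.exp_pos _).le
    rw [← Real.cos_abs (W.im + γ)]
    refine Real.cos_le_cos_of_nonneg_of_le_pi (abs_nonneg _) (by linarith [Real.pi_pos]) ?_
    have h1 : min α β - ε < γ := (le_max_right _ _).trans_lt hγ.1
    have h2 : γ < max α β + ε := hγ.2.trans_le (min_le_right _ _)
    rw [abs_le]
    constructor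
    · rcases min_choice α β with h | h <;> rw [h] at h1 <;> linarith
    · rcases max_choice α β with h | h <;> rw [h] at h2 <;> linarith
  · refine ⟨max_lt hα.1 ?_, lt_min hα.2 ?_⟩
    · have := min_le_left α β; linarith
    · have := le_max_left α β; linarith
  · refine ⟨max_le hβ.1 ?_, le_min hβ.2 ?_⟩
    · have := min_le_right α β; linarith
    · have := le_max_right α β; linarith
  · exact fun t ht => (hl t ht).mono_left (nhdsWithin_mono _ hsub)

theorem lap_eq_of_strip (ha : 0 ≤ a)
    (hY : DifferentiableOn ℂ Y {l | α₁ < l.im ∧ l.im < α₂})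
    (hb : ∀ l : ℂ, α₁ < l.im → l.im < α₂ → l.re ≠ t₀ → ‖Y l‖ ≤ C * rayBound a t₀ l.re)
    {α β : ℝ} {W : ℂ} (hα : α ∈ Ioo α₁ α₂) (hβ : β ∈ Ioo α₁ α₂)
    (hWα : |W.im + α| < π / 2) (hWβ : |W.im + β| < π / 2) :
    lap Y α W = lap Y β W := by
  refine lap_eq_boundary_of_le ha hY hb hα (Ioo_subset_Icc_self hβ) hWα hWβ fun t _ => ?_
  have h1 : ContinuousAt Y (t + β * I) :=
    (hY.differentiableAt ((isOpen_strip α₁ α₂).mem_nhds (by simpa using hβ))).continuousAt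
  have h2 : Tendsto (fun γ : ℝ => (t : ℂ) + γ * I) (𝓝[Ioo α₁ α₂] β) (𝓝 (t + β * I)) :=
    ((by fun_prop : Continuous fun γ : ℝ => (t : ℂ) + γ * I).tendsto β).mono_left
      nhdsWithin_le_nhds
  exact h1.tendsto.comp h2

theorem differentiableAt_lap {α : ℝ} {W : ℂ} (ha : 0 ≤ a)
    (hcont : Continuous fun t : ℝ => Y (t + α * I))
    (hb : ∀ t : ℝ, t ≠ t₀ → ‖Y (t + α * I)‖ ≤ C * rayBound a t₀ t)
    (hW : |W.im + α| < π / 2) : DifferentiableAt ℂ (lap Y α) W := by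
  have := differentiableAt_integral_lapKer ha hcont hb (re_exp_mul_exp_pos hW)
  exact this.comp W Complex.differentiableAt_exp

/-- Rotating the path of integration, the Laplace transform of a function on a strip continues
analytically to a strip that is wider by a right angle. -/
theorem exists_continuation_lap {h : ℝ} (hh : 0 < h) (ha : 0 ≤ a)
    (hY : DifferentiableOn ℂ Y {l | -h < l.im ∧ l.im < h})
    (hb : ∀ l : ℂ, -h < l.im → l.im < h → l.re ≠ t₀ → ‖Y l‖ ≤ C * rayBound a t₀ l.re) :
    ∃ S : ℂ → ℂ, DifferentiableOn ℂ S {W | -(h + π / 2) < W.im ∧ W.im < h + π / 2} ∧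
      ∀ W : ℂ, ∀ α ∈ Ioo (-h) h, |W.im + α| < π / 2 → S W = Complex.exp W * lap Y α W := by
  have hπ := Real.pi_pos
  -- The direction -r Im W is linear in Im W: over the wide strip it fills exactly (-h, h), while (1
  -- - r) Im W stays within a right angle. One formula thus serves everywhere.
  set r : ℝ := h / (h + π / 2) with hr
  have hpos : 0 < h + π / 2 := by positivity
  have hr0 : 0 < r := by positivity
  have hr1 : r * (h + π / 2) = h := by rw [hr]; field_simp
  have hr2 : (1 - r) * (h + π / 2) = π / 2 := by linarith
  have hr3 : r < 1 := by rw [hr, div_lt_one hpos]; linarith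
  have hA : ∀ y : ℝ, -(h + π / 2) < y → y < h + π / 2 → -(r * y) ∈ Ioo (-h) h := by
    intro y h1 h2
    constructor <;> nlinarith
  have hB : ∀ y : ℝ, -(h + π / 2) < y → y < h + π / 2 → |y + -(r * y)| < π / 2 := by
    intro y h1 h2
    rw [abs_lt]
    constructor <;> nlinarith
  have key : ∀ W : ℂ, ∀ α ∈ Ioo (-h) h, |W.im + α| < π / 2 →
      lap Y (-(r * W.im)) W = lap Y α W := by
    intro W α hα hW
    have h1 := abs_lt.1 hW
    have h2 : -(h + π / 2) < W.im := by linarith [hα.2]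
    have h3 : W.im < h + π / 2 := by linarith [hα.1]
    exact lap_eq_of_strip ha hY hb (hA _ h2 h3) hα (hB _ h2 h3) hW
  refine ⟨fun W => Complex.exp W * lap Y (-(r * W.im)) W, ?_, fun W α hα hW => by
    simp only [key W α hα hW]⟩
  rintro W ⟨h1, h2⟩
  apply DifferentiableAt.differentiableWithinAt
  have hd : DifferentiableAt ℂ (fun V => Complex.exp V * lap Y (-(r * W.im)) V) W := by
    refine Complex.differentiableAt_exp.mul (differentiableAt_lap (C := C) (t₀ := t₀) ha
      (continuous_line hY (hA _ h1 h2)) (fun t ht => ?_) (hB _ h1 h2))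
    have := hb (t + (-(r * W.im) : ℝ) * I) (by simpa using (hA _ h1 h2).1)
      (by simpa using (hA _ h1 h2).2) (by simpa using ht)
    simpa using this
  refine hd.congr_of_eventuallyEq ?_
  -- The direction in the formula varies with W; near a given point it can be frozen, because
  -- admissible directions give the same value.
  have ho : ∀ᶠ V : ℂ in 𝓝 W, |V.im + -(r * W.im)| < π / 2 := by
    have : Continuous fun V : ℂ => |V.im + -(r * W.im)| := by fun_prop
    exact this.continuousAt.eventually_lt_const (hB _ h1 h2)
  filter_upwards [ho] with V hV
  simp only [key V _ (hA _ h1 h2) hV]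

end Strip

/-- This is the substitution p ↦ exp(lam) p on the surface: the real part of lam translates the
logarithmic variable and its imaginary part rotates the ray. It reduces all branches to a universal
one. -/
theorem lap_translate (Y : ℂ → ℂ) (α : ℝ) (W lam : ℂ) :
    Complex.exp W * lap (fun l => Y (l - lam)) α W =
      Complex.exp (W + lam) * lap Y (α - lam.im) (W + lam) := by
  unfold lap
  have h := integral_add_right_eq_self (μ := volume) (fun t : ℝ => lapKer (Complex.exp W)
    (fun l => Y (l - lam)) (t + α * I)) lam.re
  rw [← h, ← integral_const_mul, ← integral_const_mul]
  congr 1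
  ext t
  have e : ((t + lam.re : ℝ) : ℂ) + α * I = (t + (α - lam.im : ℝ) * I) + lam := by
    apply Complex.ext <;> simp
  rw [e]
  unfold lapKer
  simp only [add_sub_cancel_right]
  rw [Complex.exp_add _ lam, Complex.exp_add W]
  ring_nf

/-! ### The equation `x ((b - x) / (b - 1)) ^ (b - 1) = ξ` -/

/-- The logarithm of `-x ((b - x) / (b - 1)) ^ (b - 1)` in terms of `ν = log (-x)`. -/
noncomputable def critMap (b : ℝ) (ν : ℂ) : ℂ :=
  ν + ((b - 1 : ℝ) : ℂ) * Complex.log (((b : ℂ) + Complex.exp ν) / ((b - 1 : ℝ) : ℂ))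

/-- The strip on which `critMap` is considered. -/
def critStrip : Set ℂ := {ν | -π < ν.im ∧ ν.im < π}

/-- The strip `|Im ζ| < b π` with two cuts. -/
def critDom (b : ℝ) : Set ℂ := {ζ | |ζ.im| < b * π ∧ (|ζ.im| = π → 0 < ζ.re)}

section CritMap

variable {b : ℝ} (hb : 1 < b)

theorem re_quot (ν : ℂ) : (((b : ℂ) + Complex.exp ν) / ((b - 1 : ℝ) : ℂ)).re =
    (b + Real.exp ν.re * Real.cos ν.im) / (b - 1) := by
  rw [Complex.div_ofReal_re, Complex.add_re, Complex.ofReal_re, Complex.exp_re]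

theorem im_quot (ν : ℂ) : (((b : ℂ) + Complex.exp ν) / ((b - 1 : ℝ) : ℂ)).im =
    Real.exp ν.re * Real.sin ν.im / (b - 1) := by
  rw [Complex.div_ofReal_im, Complex.add_im, Complex.ofReal_im, Complex.exp_im, zero_add]

include hb

theorem quot_mem_slitPlane {ν : ℂ} (hν : ν ∈ critStrip) :
    ((b : ℂ) + Complex.exp ν) / ((b - 1 : ℝ) : ℂ) ∈ Complex.slitPlane := by
  have hb1 : 0 < b - 1 := by linarith
  rw [Complex.mem_slitPlane_iff, re_quot, im_quot]
  by_cases h : ν.im = 0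
  · left
    rw [h, Real.cos_zero]
    have := Real.exp_pos ν.re
    exact div_pos (by linarith) hb1
  · right
    refine div_ne_zero (mul_ne_zero (Real.exp_pos _).ne' ?_) hb1.ne'
    rw [Ne, Real.sin_eq_zero_iff_of_lt_of_lt hν.1 hν.2]
    exact h

theorem quot_ne_zero {ν : ℂ} (hν : ν ∈ critStrip) : (b : ℂ) + Complex.exp ν ≠ 0 := by
  intro h
  have := quot_mem_slitPlane hb hν
  rw [h, zero_div] at this
  exact Complex.zero_notMem_slitPlane this

omit hb in
theorem one_add_exp_ne_zero {ν : ℂ} (hν : ν ∈ critStrip) : 1 + Complex.exp ν ≠ 0 := by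
  intro h
  have h1 : Complex.exp ν = -1 := by linear_combination h
  have h2 := congrArg Complex.log h1
  rw [Complex.log_exp hν.1 hν.2.le, Complex.log_neg_one] at h2
  have := hν.2
  rw [h2] at this
  simp at this

theorem hasStrictDerivAt_critMap_of_mem {ν : ℂ}
    (hν : ((b : ℂ) + Complex.exp ν) / ((b - 1 : ℝ) : ℂ) ∈ Complex.slitPlane) :
    HasStrictDerivAt (critMap b) (b * (1 + Complex.exp ν) / (b + Complex.exp ν)) ν := by
  have hb1 : ((b - 1 : ℝ) : ℂ) ≠ 0 := by
    have : b - 1 ≠ 0 := by linarith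
    exact_mod_cast this
  have h0 : (b : ℂ) + Complex.exp ν ≠ 0 := by
    intro h
    rw [h, zero_div] at hν
    exact Complex.zero_notMem_slitPlane hν
  have h1 : HasStrictDerivAt (fun ν => ((b : ℂ) + Complex.exp ν) / ((b - 1 : ℝ) : ℂ))
      (Complex.exp ν / ((b - 1 : ℝ) : ℂ)) ν :=
    ((Complex.hasStrictDerivAt_exp ν).const_add _).div_const _
  have h2 := (hasStrictDerivAt_id ν).add
    ((h1.clog hν).const_mul ((b - 1 : ℝ) : ℂ))
  refine h2.congr_deriv ?_
  field_simp
  push_cast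
  ring

theorem hasStrictDerivAt_critMap {ν : ℂ} (hν : ν ∈ critStrip) :
    HasStrictDerivAt (critMap b) (b * (1 + Complex.exp ν) / (b + Complex.exp ν)) ν :=
  hasStrictDerivAt_critMap_of_mem hb (quot_mem_slitPlane hb hν)

omit hb in
theorem im_deriv_critMap (w : ℂ) : ((b : ℂ) * (1 + w) / (b + w)).im =
    b * (b - 1) * w.im / Complex.normSq (b + w) := by
  rw [Complex.div_im]
  simp only [Complex.mul_re, Complex.mul_im, Complex.add_re, Complex.add_im, Complex.ofReal_re,
    Complex.ofReal_im, Complex.one_re, Complex.one_im]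
  ring

omit hb in
theorem convex_halfStrip : Convex ℝ {ν : ℂ | 0 ≤ ν.im ∧ ν.im < π} :=
  (convex_halfSpace_im_ge 0).inter (convex_halfSpace_im_lt π)

omit hb in
theorem halfStrip_subset {ν : ℂ} (h : ν ∈ {ν : ℂ | 0 ≤ ν.im ∧ ν.im < π}) : ν ∈ critStrip :=
  ⟨by have := Real.pi_pos; linarith [h.1], h.2⟩

/-- For 0 < Im ν < π the derivative has positive imaginary part, and on the real axis it is
positive. A segment in the half strip either lies on the real axis or has its interior in the open
half strip, so one of the two half planes always applies. -/
theorem critMap_injOn_half : InjOn (critMap b) {ν | 0 ≤ ν.im ∧ ν.im < π} := by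
  intro x hx y hy hxy
  by_contra hne
  have hd := fun z hz => (hasStrictDerivAt_critMap hb (halfStrip_subset (ν := z) hz)).hasDerivAt
  have hseg : ∀ t ∈ Ioo (0 : ℝ) 1, x + t * (y - x) ∈ {ν : ℂ | 0 ≤ ν.im ∧ ν.im < π} := by
    intro t ht
    have := convex_halfStrip.add_smul_sub_mem hx hy ⟨ht.1.le, ht.2.le⟩
    simpa using this
  by_cases h0 : x.im = 0 ∧ y.im = 0
  · have := re_slope_pos convex_halfStrip (c := 1) hd hx hy (fun t ht => ?_) hne
    · rw [hxy, sub_self, zero_div, mul_zero] at this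
      exact lt_irrefl _ this
    · have him : (x + t * (y - x)).im = 0 := by simp [h0.1, h0.2]
      set z := x + t * (y - x)
      have hz : Complex.exp z = (Real.exp z.re : ℂ) := by
        rw [← Complex.re_add_im z, him]; simp
      rw [hz, one_mul]
      have : ((b : ℂ) * (1 + (Real.exp z.re : ℂ)) / (b + (Real.exp z.re : ℂ))) =
        ((b * (1 + Real.exp z.re) / (b + Real.exp z.re) : ℝ) : ℂ) := by push_cast; rfl
      rw [this, Complex.ofReal_re]
      have := Real.exp_pos z.re
      positivity
  · have := re_slope_pos convex_halfStrip (c := -I) hd hx hy (fun t ht => ?_) hne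
    · rw [hxy, sub_self, zero_div, mul_zero] at this
      exact lt_irrefl _ this
    · have hz := hseg t ht
      have him : 0 < (x + t * (y - x)).im := by
        have e : (x + t * (y - x)).im = (1 - t) * x.im + t * y.im := by simp; ring
        rw [e]
        rcases lt_or_eq_of_le hx.1 with h | h
        · have := mul_pos (sub_pos.2 ht.2) h
          have := mul_nonneg ht.1.le hy.1
          linarith
        · have h' : y.im ≠ 0 := fun h'' => h0 ⟨h.symm, h''⟩
          have := mul_pos ht.1 (lt_of_le_of_ne hy.1 h'.symm)
          rw [← h]; linarith
      set z := x + t * (y - x)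
      have e2 : ∀ w : ℂ, (-I * w).re = w.im := by intro w; simp
      rw [e2, im_deriv_critMap, Complex.exp_im]
      have hsin := Real.sin_pos_of_pos_of_lt_pi him hz.2
      have := Complex.normSq_pos.2 (quot_ne_zero hb (halfStrip_subset hz))
      have hb1 : 0 < b - 1 := by linarith
      positivity

theorem critMap_conj {ν : ℂ} (hν : ν ∈ critStrip) : critMap b (conj ν) = conj (critMap b ν) := by
  have h := (Complex.slitPlane_arg_ne_pi (quot_mem_slitPlane hb hν))
  unfold critMap
  rw [map_add, map_mul, Complex.conj_ofReal, ← Complex.log_conj _ h, map_div₀, map_add,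
    Complex.conj_ofReal, Complex.conj_ofReal, Complex.exp_conj]

omit hb in
theorem conj_mem_critStrip {ν : ℂ} (hν : ν ∈ critStrip) : conj ν ∈ critStrip :=
  ⟨by simpa using hν.2, by have := hν.1; simp only [Complex.conj_im]; linarith⟩

/-- The quotient inside the logarithm lies in the closed upper half plane, so its argument only adds
to Im ν. Hence the upper and lower half strips have images that can meet only on the real axis,
which extends injectivity to the whole strip. -/
theorem im_critMap_nonneg {ν : ℂ} (h0 : 0 ≤ ν.im) (h1 : ν.im < π) :
    ν.im ≤ (critMap b ν).im := by
  have hb1 : 0 < b - 1 := by linarith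
  rw [critMap, Complex.add_im, Complex.im_ofReal_mul, Complex.log_im]
  have : 0 ≤ Complex.arg (((b : ℂ) + Complex.exp ν) / ((b - 1 : ℝ) : ℂ)) := by
    rw [Complex.arg_nonneg_iff, im_quot]
    have := Real.sin_nonneg_of_nonneg_of_le_pi h0 h1.le
    positivity
  have := mul_nonneg hb1.le this
  linarith

theorem im_critMap_nonpos {ν : ℂ} (h0 : ν.im ≤ 0) (h1 : -π < ν.im) :
    (critMap b ν).im ≤ ν.im := by
  have hπ := Real.pi_pos
  have hs : ν ∈ critStrip := ⟨h1, by linarith⟩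
  have := im_critMap_nonneg hb (ν := conj ν) (by simpa using h0)
    (by simp only [Complex.conj_im]; linarith)
  rw [critMap_conj hb hs, Complex.conj_im, Complex.conj_im] at this
  linarith

theorem critMap_injOn : InjOn (critMap b) critStrip := by
  intro x hx y hy hxy
  have hπ := Real.pi_pos
  rcases le_total 0 x.im with h | h
  · rcases le_total 0 y.im with h' | h'
    · exact critMap_injOn_half hb ⟨h, hx.2⟩ ⟨h', hy.2⟩ hxy
    · have h1 := im_critMap_nonneg hb h hx.2
      have h2 := im_critMap_nonpos hb h' hy.1
      rw [hxy] at h1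
      have : y.im = 0 := by linarith
      exact critMap_injOn_half hb ⟨h, hx.2⟩ ⟨by linarith, hy.2⟩ hxy
  · have hneg : y.im ≤ 0 := by
      by_contra! h'
      have h1 := im_critMap_nonpos hb h hx.1
      have h2 := im_critMap_nonneg hb h'.le hy.2
      rw [hxy] at h1
      linarith
    have := critMap_injOn_half hb (x₁ := conj x) (x₂ := conj y)
      ⟨by simpa using h, (conj_mem_critStrip hx).2⟩
      ⟨by simpa using hneg, (conj_mem_critStrip hy).2⟩
      (by rw [critMap_conj hb hx, critMap_conj hb hy, hxy])
    exact (starRingEnd ℂ).injective this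

omit hb in
theorem isOpen_critStrip : IsOpen critStrip := isOpen_strip _ _

theorem deriv_critMap_ne_zero {ν : ℂ} (hν : ν ∈ critStrip) :
    (b : ℂ) * (1 + Complex.exp ν) / (b + Complex.exp ν) ≠ 0 := by
  have : (b : ℂ) ≠ 0 := by exact_mod_cast (by linarith : b ≠ 0)
  exact div_ne_zero (mul_ne_zero this (one_add_exp_ne_zero hν)) (quot_ne_zero hb hν)

theorem isOpen_image_critMap : IsOpen (critMap b '' critStrip) :=
  isOpen_image_of_deriv_ne_zero isOpen_critStrip (fun _ => hasStrictDerivAt_critMap hb)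
    fun _ => deriv_critMap_ne_zero hb

omit hb in
theorem isOpen_critDom : IsOpen (critDom b) := by
  have : critDom b = {ζ | |ζ.im| < b * π} ∩ ({ζ | |ζ.im| ≠ π} ∪ {ζ | 0 < ζ.re}) := by
    ext ζ
    simp only [critDom, mem_ofPred_eq, mem_inter_iff, mem_union, imp_iff_not_or, Ne]
  rw [this]
  have hc : Continuous fun ζ : ℂ => |ζ.im| := by fun_prop
  exact (isOpen_lt hc continuous_const).inter ((isOpen_ne_fun hc continuous_const).union
    (isOpen_lt continuous_const Complex.continuous_re))

/-- The part Re ζ > 0 is a convex half strip, and every point is joined to it by the horizontal ray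
to its right, which avoids the two cuts. -/
theorem isPreconnected_critDom : IsPreconnected (critDom b) := by
  have hπ := Real.pi_pos
  have hbπ : 0 < b * π := by positivity
  have hconv : Convex ℝ {ζ : ℂ | 0 < ζ.re ∧ -(b * π) < ζ.im ∧ ζ.im < b * π} :=
    (convex_halfSpace_re_gt 0).inter
      ((convex_halfSpace_im_gt _).inter (convex_halfSpace_im_lt _))
  apply isPreconnected_of_forall (1 : ℂ)
  intro y hy
  have hy1 := abs_lt.1 hy.1
  have hray : Convex ℝ {ζ : ℂ | (y.im ≤ ζ.im ∧ ζ.im ≤ y.im) ∧ y.re ≤ ζ.re} :=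
    ((convex_halfSpace_im_ge _).inter (convex_halfSpace_im_le _)).inter (convex_halfSpace_re_ge _)
  refine ⟨_ ∪ _, union_subset ?_ ?_, Or.inl ?_, Or.inr ?_,
    hconv.isPreconnected.union (⟨|y.re| + 1, y.im⟩ : ℂ) ?_ ?_ hray.isPreconnected⟩
  · rintro ζ ⟨h1, h2, h3⟩
    exact ⟨abs_lt.2 ⟨h2, h3⟩, fun _ => h1⟩
  · rintro ζ ⟨⟨h1, h2⟩, h3⟩
    have h : ζ.im = y.im := le_antisymm h2 h1
    exact ⟨by rw [h]; exact hy.1, fun h' => (hy.2 (by rw [← h]; exact h')).trans_le h3⟩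
  · simp [hbπ]
  · exact ⟨⟨le_rfl, le_rfl⟩, le_rfl⟩
  · exact ⟨by show 0 < |y.re| + 1; positivity, hy1.1, hy1.2⟩
  · exact ⟨⟨le_rfl, le_rfl⟩, by show y.re ≤ |y.re| + 1; linarith [le_abs_self y.re]⟩

omit hb in
theorem re_critMap (ν : ℂ) : (critMap b ν).re =
    ν.re + (b - 1) * Real.log ‖((b : ℂ) + Complex.exp ν) / ((b - 1 : ℝ) : ℂ)‖ := by
  rw [critMap, Complex.add_re, Complex.re_ofReal_mul, Complex.log_re]

theorem norm_quot (ν : ℂ) : ‖((b : ℂ) + Complex.exp ν) / ((b - 1 : ℝ) : ℂ)‖ =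
    ‖(b : ℂ) + Complex.exp ν‖ / (b - 1) := by
  rw [norm_div, Complex.norm_real, Real.norm_of_nonneg (by linarith)]

/-- Properness in the real direction. For Re ν < 0 the logarithmic term is bounded above, and for
exp(Re ν) ≥ 2b it is nonnegative because then |b + exp ν| ≥ b > b - 1; so Re ν cannot escape while
the image stays bounded. -/
theorem exists_re_bound (M : ℝ) : ∃ R : ℝ, ∀ ν ∈ critStrip, |(critMap b ν).re| ≤ M →
    |ν.re| ≤ R := by
  have hb1 : 0 < b - 1 := by linarith
  refine ⟨max (max M (Real.log (2 * b))) (M + (b - 1) * Real.log ((b + 1) / (b - 1))),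
    fun ν hν h => ?_⟩
  rw [re_critMap, norm_quot hb] at h
  have hpos : 0 < ‖(b : ℂ) + Complex.exp ν‖ := norm_pos_iff.2 (quot_ne_zero hb hν)
  have hnb : ‖(b : ℂ)‖ = b := by rw [Complex.norm_real, Real.norm_of_nonneg (by linarith)]
  rw [abs_le] at h
  rw [abs_le]
  constructor
  · by_cases h0 : 0 ≤ ν.re
    · have h1 : 0 < Real.log (2 * b) := Real.log_pos (by linarith)
      have := le_max_right M (Real.log (2 * b))
      have := le_max_left (max M (Real.log (2 * b)))
        (M + (b - 1) * Real.log ((b + 1) / (b - 1)))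
      linarith
    · have h1 : ‖(b : ℂ) + Complex.exp ν‖ ≤ b + 1 := by
        refine (norm_add_le _ _).trans ?_
        rw [hnb, Complex.norm_exp]
        have : Real.exp ν.re ≤ 1 := Real.exp_le_one_iff.2 (by linarith)
        linarith
      have h2 : Real.log (‖(b : ℂ) + Complex.exp ν‖ / (b - 1)) ≤
          Real.log ((b + 1) / (b - 1)) := Real.log_le_log (by positivity) (by gcongr)
      have := mul_le_mul_of_nonneg_left h2 hb1.le
      have := le_max_right (max M (Real.log (2 * b)))
        (M + (b - 1) * Real.log ((b + 1) / (b - 1)))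
      linarith
  · refine le_trans ?_ (le_max_left _ _)
    by_cases h0 : Real.log (2 * b) ≤ ν.re
    · refine le_trans ?_ (le_max_left _ _)
      have h1 : 2 * b ≤ Real.exp ν.re := (Real.log_le_iff_le_exp (by linarith)).1 h0
      have h2 : Real.exp ν.re - b ≤ ‖(b : ℂ) + Complex.exp ν‖ := by
        have := norm_sub_norm_le (Complex.exp ν) (-(b : ℂ))
        rw [norm_neg, hnb, Complex.norm_exp, sub_neg_eq_add, add_comm (Complex.exp ν)] at this
        exact this
      have h3 : 0 ≤ Real.log (‖(b : ℂ) + Complex.exp ν‖ / (b - 1)) := by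
        apply Real.log_nonneg
        rw [le_div_iff₀ hb1]
        linarith
      have := mul_nonneg hb1.le h3
      linarith
    · exact (not_le.1 h0).le.trans (le_max_right _ _)

/-- By properness, preimages of a convergent sequence subconverge. A limit point on Im ν = π is
impossible: according as exp(Re ν) is less than, equal to or greater than b, the image limit would
lie on the removed cut, have real part -∞, or have imaginary part bπ. -/
theorem closure_image_half : closure (critMap b '' {ν | 0 ≤ ν.im ∧ ν.im < π}) ∩ critDom b ⊆
    critMap b '' critStrip := by
  have hb1 : 0 < b - 1 := by linarith
  have hπ := Real.pi_pos
  rintro ζ ⟨hζ, hdom⟩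
  obtain ⟨x, hx, hlim⟩ := mem_closure_iff_seq_limit.1 hζ
  choose ν hν hνx using hx
  obtain ⟨M, hM⟩ := (hlim.norm).bddAbove_range
  obtain ⟨R, hR⟩ := exists_re_bound hb M
  have hbox : ∀ n, ν n ∈ Icc (-R) R ×ℂ Icc 0 π := by
    intro n
    rw [Complex.mem_reProdIm]
    refine ⟨abs_le.1 (hR _ (halfStrip_subset (hν n)) ?_), (hν n).1, (hν n).2.le⟩
    rw [hνx]
    exact (Complex.abs_re_le_norm _).trans (hM (mem_range_self n))
  obtain ⟨ν₀, hν₀, φ, hφ, hφlim⟩ :=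
    (isCompact_Icc.reProdIm isCompact_Icc).tendsto_subseq hbox
  rw [Complex.mem_reProdIm] at hν₀
  have hlim' : Tendsto (fun n => critMap b (ν (φ n))) atTop (𝓝 ζ) := by
    simp only [hνx]
    exact hlim.comp hφ.tendsto_atTop
  have hlt : ν₀.im ≤ π := hν₀.2.2
  rcases lt_or_eq_of_le hlt with hlt | heq
  · have hmem : ν₀ ∈ critStrip := halfStrip_subset ⟨hν₀.2.1, hlt⟩
    have h1 := ((hasStrictDerivAt_critMap hb hmem).hasDerivAt.continuousAt.tendsto.comp hφlim)
    exact ⟨ν₀, hmem, tendsto_nhds_unique h1 hlim'⟩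
  exfalso
  set Q : ℂ → ℂ := fun ν => ((b : ℂ) + Complex.exp ν) / ((b - 1 : ℝ) : ℂ) with hQ
  have hQc : Continuous Q := by rw [hQ]; fun_prop
  have hQlim : Tendsto (fun n => Q (ν (φ n))) atTop (𝓝 (Q ν₀)) := (hQc.tendsto _).comp hφlim
  have hQre : (Q ν₀).re = (b - Real.exp ν₀.re) / (b - 1) := by
    rw [hQ, re_quot, heq, Real.cos_pi]; ring
  have hQim : (Q ν₀).im = 0 := by rw [hQ, im_quot, heq, Real.sin_pi]; ring
  have hlogcase : Tendsto (fun n => Complex.log (Q (ν (φ n)))) atTop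
      (𝓝 (Complex.log (Q ν₀))) → ζ = ν₀ + ((b - 1 : ℝ) : ℂ) * Complex.log (Q ν₀) := by
    intro h
    exact tendsto_nhds_unique hlim' (hφlim.add (h.const_mul _))
  rcases lt_trichotomy (Real.exp ν₀.re) b with h | h | h
  · have hpos : 0 < (Q ν₀).re := by rw [hQre]; exact div_pos (by linarith) hb1
    have hz := hlogcase (hQlim.clog (Or.inl hpos))
    have hreal : Q ν₀ = ((Q ν₀).re : ℂ) := Complex.ext rfl (by simp [hQim])
    have him : ζ.im = π := by
      rw [hz, hreal, ← Complex.ofReal_log hpos.le, Complex.add_im, Complex.im_ofReal_mul,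
        Complex.ofReal_im, heq]
      ring
    have hre : ζ.re = ν₀.re + (b - 1) * Real.log (Q ν₀).re := by
      rw [hz, hreal, ← Complex.ofReal_log hpos.le, Complex.add_re, Complex.re_ofReal_mul,
        Complex.ofReal_re, Complex.ofReal_re]
    have h1 := hdom.2 (by rw [him, abs_of_pos hπ])
    -- Together with 1 + Re ν ≤ exp(Re ν), this inequality forces Re ζ ≤ 0 on the line Im ζ = π,
    -- which is exactly the part removed from `critDom`.
    have h2 := Real.log_le_sub_one_of_pos hpos
    have h3 : (b - 1) * Real.log (Q ν₀).re ≤ 1 - Real.exp ν₀.re := by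
      refine (mul_le_mul_of_nonneg_left h2 hb1.le).trans_eq ?_
      rw [hQre]
      field_simp
      ring
    have h4 := Real.add_one_le_exp ν₀.re
    linarith
  · have h0 : Q ν₀ = 0 := Complex.ext (by rw [hQre, h]; simp) (by rw [hQim]; simp)
    rw [h0] at hQlim
    have h1 : Tendsto (fun n => Real.exp (((critMap b (ν (φ n))).re - (ν (φ n)).re) / (b - 1)))
        atTop (𝓝 (Real.exp ((ζ.re - ν₀.re) / (b - 1)))) :=
      (Real.continuous_exp.tendsto _).comp ((((Complex.continuous_re.tendsto _).comp hlim').sub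
        ((Complex.continuous_re.tendsto _).comp hφlim)).div_const _)
    have h2 : Tendsto (fun n => Real.exp (((critMap b (ν (φ n))).re - (ν (φ n)).re) / (b - 1)))
        atTop (𝓝 0) := by
      have := hQlim.norm
      rw [norm_zero] at this
      refine this.congr fun n => ?_
      have hpos : 0 < ‖Q (ν (φ n))‖ := norm_pos_iff.2 (div_ne_zero
        (quot_ne_zero hb (halfStrip_subset (hν _))) (by exact_mod_cast hb1.ne'))
      rw [re_critMap, add_sub_cancel_left, mul_div_cancel_left₀ _ hb1.ne', Real.exp_log hpos]
    exact (Real.exp_pos _).ne' (tendsto_nhds_unique h1 h2)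
  · have hneg : (Q ν₀).re < 0 := by rw [hQre]; exact div_neg_of_neg_of_pos (by linarith) hb1
    -- On the negative axis the logarithm has only one-sided limits. The quotients approach from the
    -- upper half plane, where the limiting argument is π.
    have hw : Tendsto (fun n => Q (ν (φ n))) atTop (𝓝[{z | 0 ≤ z.im}] (Q ν₀)) := by
      refine tendsto_nhdsWithin_iff.2 ⟨hQlim, Eventually.of_forall fun n => ?_⟩
      show 0 ≤ (Q (ν (φ n))).im
      rw [hQ, im_quot]
      have := Real.sin_nonneg_of_nonneg_of_le_pi (hν (φ n)).1 (hν (φ n)).2.le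
      positivity
    have hz := hlogcase
      ((Complex.continuousWithinAt_log_of_re_neg_of_im_zero hneg hQim).tendsto.comp hw)
    have him : ζ.im = b * π := by
      rw [hz, Complex.add_im, Complex.im_ofReal_mul, Complex.log_im,
        Complex.arg_eq_pi_iff.2 ⟨hneg, hQim⟩, heq]
      ring
    have := (abs_lt.1 hdom.1).2
    linarith

/-- The image is open, meets the connected set `critDom`, and contains its own limit points there,
so it contains all of `critDom`. The lower half strip is handled by conjugation. -/
theorem critDom_subset_image : critDom b ⊆ critMap b '' critStrip := by
  have hπ := Real.pi_pos
  refine (isPreconnected_critDom hb).subset_of_closure_inter_subset (isOpen_image_critMap hb) ?_ ?_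
  · refine ⟨critMap b 0, ?_, mem_image_of_mem _ (by simp [critStrip, hπ])⟩
    have h1 := im_critMap_nonneg hb (ν := 0) (by simp) (by simpa using hπ)
    have h2 := im_critMap_nonpos hb (ν := 0) (by simp) (by simpa using hπ)
    simp only [Complex.zero_im] at h1 h2
    have h3 : (critMap b 0).im = 0 := le_antisymm h2 h1
    refine ⟨by rw [h3, abs_zero]; positivity, fun h => ?_⟩
    rw [h3, abs_zero] at h
    exact absurd h hπ.ne
  · have hun : critStrip = {ν | 0 ≤ ν.im ∧ ν.im < π} ∪ conj '' {ν : ℂ | 0 ≤ ν.im ∧ ν.im < π} := by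
      ext ν
      constructor
      · intro h
        rcases le_total 0 ν.im with h' | h'
        · exact Or.inl ⟨h', h.2⟩
        · exact Or.inr ⟨conj ν, ⟨by simpa using h', (conj_mem_critStrip h).2⟩, by simp⟩
      · rintro (h | ⟨z, h, rfl⟩)
        · exact halfStrip_subset h
        · exact conj_mem_critStrip (halfStrip_subset h)
    have himg : critMap b '' critStrip = critMap b '' {ν | 0 ≤ ν.im ∧ ν.im < π} ∪
        conj '' (critMap b '' {ν : ℂ | 0 ≤ ν.im ∧ ν.im < π}) := by
      conv_lhs => rw [hun, image_union]
      congr 1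
      rw [image_image, image_image]
      exact image_congr fun ν hν => critMap_conj hb (halfStrip_subset hν)
    rintro ζ ⟨hζ, hd⟩
    rw [himg, closure_union] at hζ
    rcases hζ with hζ | hζ
    · exact closure_image_half hb ⟨hζ, hd⟩
    · have h1 : conj ζ ∈ closure (critMap b '' {ν : ℂ | 0 ≤ ν.im ∧ ν.im < π}) := by
        have := map_mem_closure (f := conj) Complex.continuous_conj hζ
          (t := critMap b '' {ν : ℂ | 0 ≤ ν.im ∧ ν.im < π}) ?_
        · exact this
        · rintro _ ⟨w, hw, rfl⟩
          rwa [Complex.conj_conj]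
      obtain ⟨ν, hν, h2⟩ := closure_image_half hb ⟨h1, by
        refine ⟨?_, ?_⟩
        · simpa using hd.1
        · simpa using hd.2⟩
      refine ⟨conj ν, conj_mem_critStrip hν, ?_⟩
      rw [critMap_conj hb hν, h2, Complex.conj_conj]

end CritMap

/-! ### Inversion of the critical equation -/

/-- The inverse of `critMap`. -/
noncomputable def critInv (b : ℝ) : ℂ → ℂ := Function.invFunOn (critMap b) critStrip

/-- The function `x / (x - 1)`, where `x ((b - x) / (b - 1)) ^ (b - 1) = -exp ζ`. -/
noncomputable def slopeLog (b : ℝ) (ζ : ℂ) : ℂ :=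
  Complex.exp (critInv b ζ) / (1 + Complex.exp (critInv b ζ))

/-- The function `x ((b - x) / (b - 1)) ^ (b - 1)`. -/
noncomputable def discMap (b : ℝ) (x : ℂ) : ℂ :=
  x * (((b : ℂ) - x) / ((b - 1 : ℝ) : ℂ)) ^ ((b - 1 : ℝ) : ℂ)

open scoped Classical in
/-- The function `x / (x - 1)`, where `x ((b - x) / (b - 1)) ^ (b - 1) = ξ`. -/
noncomputable def slope (b : ℝ) (ξ : ℂ) : ℂ :=
  if ξ ∈ discMap b '' {x | ‖x‖ < 1} then
    Function.invFunOn (discMap b) {x | ‖x‖ < 1} ξ /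
      (Function.invFunOn (discMap b) {x | ‖x‖ < 1} ξ - 1)
  else slopeLog b (Complex.log (-ξ))

section

variable {b : ℝ} (hb : 1 < b)

include hb

theorem critInv_mem {ζ : ℂ} (hζ : ζ ∈ critDom b) : critInv b ζ ∈ critStrip :=
  Function.invFunOn_mem (critDom_subset_image hb hζ)

theorem critMap_critInv {ζ : ℂ} (hζ : ζ ∈ critDom b) : critMap b (critInv b ζ) = ζ :=
  Function.invFunOn_eq (critDom_subset_image hb hζ)

theorem critInv_critMap {ν : ℂ} (hν : ν ∈ critStrip) : critInv b (critMap b ν) = ν :=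
  invFunOn_apply (critMap_injOn hb) hν

theorem slopeLog_critMap {ν : ℂ} (hν : ν ∈ critStrip) :
    slopeLog b (critMap b ν) = Complex.exp ν / (1 + Complex.exp ν) := by
  rw [slopeLog, critInv_critMap hb hν]

theorem differentiableAt_slopeLog {ζ : ℂ} (hζ : ζ ∈ critDom b) :
    DifferentiableAt ℂ (slopeLog b) ζ := by
  have h := hasDerivAt_invFunOn isOpen_critStrip (critMap_injOn hb)
    (fun _ => hasStrictDerivAt_critMap hb) (fun _ => deriv_critMap_ne_zero hb) (critInv_mem hb hζ)
  rw [critMap_critInv hb hζ] at h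
  have h1 : DifferentiableAt ℂ (critInv b) ζ := h.differentiableAt
  unfold slopeLog
  exact h1.cexp.div (h1.cexp.const_add 1) (one_add_exp_ne_zero (critInv_mem hb hζ))

theorem analyticAt_slopeLog {ζ : ℂ} (hζ : ζ ∈ critDom b) : AnalyticAt ℂ (slopeLog b) ζ :=
  DifferentiableOn.analyticAt (s := critDom b)
    (fun _ h => (differentiableAt_slopeLog hb h).differentiableWithinAt)
    (isOpen_critDom.mem_nhds hζ)

/-- The derivative is b(1 - x)/(x(b - x)), which vanishes to first order at x = 1, as does the
function itself; integration gives a quadratic bound. The constant comes from |x| ≥ 1/2 and |b - x|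
≥ (b - 1)/2. -/
theorem exists_norm_log_le : ∃ r > 0, ∃ K > 0, r < 1 ∧ ∀ x : ℂ, ‖x - 1‖ < r →
    ‖Complex.log x + ((b - 1 : ℝ) : ℂ) * Complex.log (((b : ℂ) - x) / ((b - 1 : ℝ) : ℂ))‖ ≤
      K * ‖x - 1‖ ^ 2 := by
  have hb1 : 0 < b - 1 := by linarith
  have hb1' : ((b - 1 : ℝ) : ℂ) ≠ 0 := by exact_mod_cast hb1.ne'
  refine ⟨min (1 / 2) ((b - 1) / 2), by positivity, 4 * b / (b - 1), by positivity,
    (min_le_left _ _).trans_lt (by norm_num), fun x hx => ?_⟩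
  set s := Metric.closedBall (1 : ℂ) ‖x - 1‖
  have hre : ∀ y ∈ s, |y.re - 1| < 1 / 2 ∧ |y.re - 1| < (b - 1) / 2 := by
    intro y hy
    have h1 : ‖y - 1‖ ≤ ‖x - 1‖ := by simpa [s, dist_eq_norm] using hy
    have h2 : |y.re - 1| ≤ ‖y - 1‖ := by simpa using Complex.abs_re_le_norm (y - 1)
    exact ⟨(h2.trans h1).trans_lt (hx.trans_le (min_le_left _ _)),
      (h2.trans h1).trans_lt (hx.trans_le (min_le_right _ _))⟩
  have hq : ∀ y ∈ s, ((b : ℂ) - y) / ((b - 1 : ℝ) : ℂ) ∈ Complex.slitPlane := by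
    intro y hy
    left
    rw [Complex.div_ofReal_re, Complex.sub_re, Complex.ofReal_re]
    have := (abs_lt.1 (hre y hy).2).2
    exact div_pos (by linarith) hb1
  have hd : ∀ y ∈ s, HasDerivWithinAt (fun x => Complex.log x +
      ((b - 1 : ℝ) : ℂ) * Complex.log (((b : ℂ) - x) / ((b - 1 : ℝ) : ℂ)))
      (b * (1 - y) / (y * (b - y))) s y := by
    intro y hy
    have hy0 : y ∈ Complex.slitPlane := Or.inl (by
      have := (abs_lt.1 (hre y hy).1).1; linarith)
    have h1 : HasDerivAt (fun x => ((b : ℂ) - x) / ((b - 1 : ℝ) : ℂ))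
        (-1 / ((b - 1 : ℝ) : ℂ)) y := ((hasDerivAt_id y).const_sub _).div_const _
    have h2 := (Complex.hasDerivAt_log hy0).add ((h1.clog (hq y hy)).const_mul ((b - 1 : ℝ) : ℂ))
    refine (h2.congr_deriv ?_).hasDerivWithinAt
    have hy1 : y ≠ 0 := Complex.slitPlane_ne_zero hy0
    have hy2 : (b : ℂ) - y ≠ 0 := by
      intro h
      have := hq y hy
      rw [h, zero_div] at this
      exact Complex.zero_notMem_slitPlane this
    field_simp
    push_cast
    ring
  have hbd : ∀ y ∈ s, ‖(b : ℂ) * (1 - y) / (y * (b - y))‖ ≤ 4 * b / (b - 1) * ‖x - 1‖ := by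
    intro y hy
    obtain ⟨h1, h2⟩ := hre y hy
    rw [abs_lt] at h1 h2
    have n1 : 1 / 2 ≤ ‖y‖ := by
      have := Complex.re_le_norm y; linarith
    have n2 : (b - 1) / 2 ≤ ‖(b : ℂ) - y‖ := by
      have := Complex.re_le_norm ((b : ℂ) - y)
      rw [Complex.sub_re, Complex.ofReal_re] at this
      linarith
    have n3 : ‖1 - y‖ ≤ ‖x - 1‖ := by
      rw [norm_sub_rev]; simpa [s, dist_eq_norm] using hy
    rw [norm_div, norm_mul, norm_mul, Complex.norm_real, Real.norm_of_nonneg (by linarith),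
      div_le_iff₀ (mul_pos (by linarith) (by linarith))]
    have n4 : (1 / 2) * ((b - 1) / 2) ≤ ‖y‖ * ‖(b : ℂ) - y‖ := by gcongr
    calc b * ‖1 - y‖ ≤ b * ‖x - 1‖ := by gcongr
      _ = 4 * b / (b - 1) * ‖x - 1‖ * ((1 / 2) * ((b - 1) / 2)) := by field_simp; ring
      _ ≤ _ := by gcongr
  have := (convex_closedBall (1 : ℂ) ‖x - 1‖).norm_image_sub_le_of_norm_hasDerivWithin_le hd hbd
    (Metric.mem_closedBall_self (norm_nonneg _)) (show x ∈ s by simp [s, dist_eq_norm])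
  have e : ((b : ℂ) - 1) / ((b - 1 : ℝ) : ℂ) = 1 := by
    rw [div_eq_one_iff_eq hb1']; push_cast; rfl
  simp only [e, Complex.log_one, mul_zero, add_zero, sub_zero] at this
  rw [pow_two, ← mul_assoc]
  exact this

/-- Since the function equals 1 - 1/(1 + exp ν), it is large only when x = -exp ν is near 1. There
the quadratic bound gives |ζ ∓ πi| ≤ K |1 + exp ν|², with the sign determined by that of Im ν, and
inversion yields the exponent -1/2. -/
theorem exists_norm_slopeLog_le : ∃ C ≥ 0, ∀ ζ ∈ critDom b, ‖slopeLog b ζ‖ ≤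
    C * (1 + ‖ζ - π * I‖ ^ (-(1 / 2) : ℝ) + ‖ζ + π * I‖ ^ (-(1 / 2) : ℝ)) := by
  obtain ⟨r, hr, K, hK, hr1, hL⟩ := exists_norm_log_le hb
  have hπ := Real.pi_pos
  refine ⟨1 + 1 / r + K ^ (1 / 2 : ℝ), by positivity, fun ζ hζ => ?_⟩
  set ν := critInv b ζ with hν
  have hmem := critInv_mem hb hζ
  rw [← hν] at hmem
  have hmap := critMap_critInv hb hζ
  rw [← hν] at hmap
  have hne := one_add_exp_ne_zero hmem
  have hd : 0 < ‖1 + Complex.exp ν‖ := norm_pos_iff.2 hne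
  have e0 : slopeLog b ζ = 1 - 1 / (1 + Complex.exp ν) := by
    rw [slopeLog, ← hν]; field_simp; ring
  have hle : ‖slopeLog b ζ‖ ≤ 1 + ‖1 + Complex.exp ν‖⁻¹ := by
    rw [e0]
    refine (norm_sub_le _ _).trans ?_
    rw [norm_one, norm_div, norm_one, one_div]
  have p1 : 0 ≤ ‖ζ - π * I‖ ^ (-(1 / 2) : ℝ) := by positivity
  have p2 : 0 ≤ ‖ζ + π * I‖ ^ (-(1 / 2) : ℝ) := by positivity
  have p3 : 0 ≤ K ^ (1 / 2 : ℝ) := by positivity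
  have p4 : 0 < 1 / r := by positivity
  by_cases hcase : r ≤ ‖1 + Complex.exp ν‖
  · have h1 : ‖1 + Complex.exp ν‖⁻¹ ≤ 1 / r := by rw [one_div]; gcongr
    nlinarith [mul_nonneg p4.le p1, mul_nonneg p4.le p2, mul_nonneg p3 p1, mul_nonneg p3 p2]
  · push Not at hcase
    have key : ∀ ω : ℂ, ω ≠ 0 → ‖ω‖ ≤ K * ‖1 + Complex.exp ν‖ ^ 2 →
        ‖1 + Complex.exp ν‖⁻¹ ≤ K ^ (1 / 2 : ℝ) * ‖ω‖ ^ (-(1 / 2) : ℝ) := by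
      intro ω hω h
      have hω' : 0 < ‖ω‖ := norm_pos_iff.2 hω
      have h2 : (K * ‖1 + Complex.exp ν‖ ^ 2) ^ (-(1 / 2) : ℝ) ≤ ‖ω‖ ^ (-(1 / 2) : ℝ) :=
        Real.rpow_le_rpow_of_nonpos hω' h (by norm_num)
      rw [Real.mul_rpow hK.le (by positivity), ← Real.rpow_natCast, ← Real.rpow_mul hd.le] at h2
      have h3 : ‖1 + Complex.exp ν‖ ^ (((2 : ℕ) : ℝ) * (-(1 / 2) : ℝ)) =
          ‖1 + Complex.exp ν‖⁻¹ := by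
        rw [show ((2 : ℕ) : ℝ) * (-(1 / 2) : ℝ) = -1 by norm_num, Real.rpow_neg_one]
      rw [h3, Real.rpow_neg hK.le] at h2
      calc ‖1 + Complex.exp ν‖⁻¹ = K ^ (1 / 2 : ℝ) * ((K ^ (1 / 2 : ℝ))⁻¹ *
            ‖1 + Complex.exp ν‖⁻¹) := by
            have : K ^ (1 / 2 : ℝ) ≠ 0 := (Real.rpow_pos_of_pos hK _).ne'
            field_simp
        _ ≤ _ := by gcongr
    have hx1 : ‖-Complex.exp ν - 1‖ < r := by
      rw [show -Complex.exp ν - 1 = -(1 + Complex.exp ν) by ring, norm_neg]; exact hcase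
    have hx2 := hL _ hx1
    rw [show -Complex.exp ν - 1 = -(1 + Complex.exp ν) by ring, norm_neg, sub_neg_eq_add] at hx2
    have hζne : ∀ s : ℝ, |s| = 1 → ζ ≠ (s * π : ℝ) * I := by
      intro s hs h
      have h1 : ζ.im = s * π := by rw [h]; simp
      have h2 : ζ.re = 0 := by rw [h]; simp
      have := hζ.2 (by rw [h1, abs_mul, hs, abs_of_pos hπ, one_mul])
      linarith
    have hfin : ‖1 + Complex.exp ν‖⁻¹ ≤ K ^ (1 / 2 : ℝ) * ‖ζ - π * I‖ ^ (-(1 / 2) : ℝ) ∨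
        ‖1 + Complex.exp ν‖⁻¹ ≤ K ^ (1 / 2 : ℝ) * ‖ζ + π * I‖ ^ (-(1 / 2) : ℝ) := by
      have him : ν.im ≠ 0 := by
        intro h
        have h1 : Complex.exp ν = (Real.exp ν.re : ℂ) := by
          rw [← Complex.re_add_im ν, h]; simp
        rw [h1, ← Complex.ofReal_one, ← Complex.ofReal_add, Complex.norm_real,
          Real.norm_of_nonneg (by positivity)] at hcase
        have := Real.exp_pos ν.re
        linarith
      rcases lt_or_gt_of_ne him with h | h
      · right
        refine key _ ?_ ?_
        · intro h0
          exact hζne (-1) (by norm_num) (by push_cast; linear_combination h0)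
        · have h1 : Complex.log (-Complex.exp ν) = ν + π * I := by
            rw [← Complex.log_exp (x := ν + π * I) (by simp; linarith [hmem.1]) (by simp; linarith),
              Complex.exp_add, Complex.exp_pi_mul_I]
            ring_nf
          rw [h1] at hx2
          convert hx2 using 2
          rw [← hmap, critMap]; ring
      · left
        refine key _ ?_ ?_
        · intro h0
          exact hζne 1 (by norm_num) (by push_cast; linear_combination h0)
        · have h1 : Complex.log (-Complex.exp ν) = ν - π * I := by
            rw [← Complex.log_exp (x := ν - π * I) (by simp; linarith) (by simp; linarith [hmem.2]),
              Complex.exp_sub, Complex.exp_pi_mul_I]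
            ring_nf
          rw [h1] at hx2
          convert hx2 using 2
          rw [← hmap, critMap]; ring
    rcases hfin with h | h <;>
    nlinarith [mul_nonneg p4.le p1, mul_nonneg p4.le p2, mul_nonneg p3 p1, mul_nonneg p3 p2]

/-! ### The unit disc -/

theorem quot_mem_slitPlane_of_re_neg {ν : ℂ} (hν : ν.re < 0) :
    ((b : ℂ) + Complex.exp ν) / ((b - 1 : ℝ) : ℂ) ∈ Complex.slitPlane := by
  left
  rw [Complex.div_ofReal_re, Complex.add_re, Complex.ofReal_re]
  have h1 := abs_le.1 (Complex.abs_re_le_norm (Complex.exp ν))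
  rw [Complex.norm_exp] at h1
  have h2 : Real.exp ν.re < 1 := Real.exp_lt_one_iff.2 hν
  exact div_pos (by linarith) (by linarith)

/-- The half plane Re ν < 0 corresponds to |x| < 1, where Re((1 + exp ν)/(b + exp ν)) > 0. This
gives univalence in the disc, including x = 0 at infinity of the ν-plane. -/
theorem re_slope_critMap_pos {x y : ℂ} (hx : x.re < 0) (hy : y.re < 0) (hxy : x ≠ y) :
    0 < ((critMap b y - critMap b x) / (y - x)).re := by
  have hconv : Convex ℝ {ν : ℂ | ν.re < 0} := convex_halfSpace_re_lt 0
  have := re_slope_pos hconv (c := 1) (fun z hz => (hasStrictDerivAt_critMap_of_mem hb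
    (quot_mem_slitPlane_of_re_neg hb hz)).hasDerivAt) hx hy (fun t ht => ?_) hxy
  · rwa [one_mul] at this
  · have hz : (x + t * (y - x)).re < 0 := by
      have := hconv.add_smul_sub_mem hx hy ⟨ht.1.le, ht.2.le⟩
      simpa using this
    set z := x + t * (y - x)
    have h1 := abs_le.1 (Complex.abs_re_le_norm (Complex.exp z))
    rw [Complex.norm_exp] at h1
    have h2 : Real.exp z.re < 1 := Real.exp_lt_one_iff.2 hz
    have h3 : 0 < Complex.normSq ((b : ℂ) + Complex.exp z) := by
      apply Complex.normSq_pos.2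
      intro h
      have := congrArg Complex.re h
      rw [Complex.add_re, Complex.ofReal_re, Complex.zero_re] at this
      linarith
    have e : ((b : ℂ) * (1 + Complex.exp z) / (b + Complex.exp z)).re =
        b * ((1 + (Complex.exp z).re) * (b + (Complex.exp z).re) + (Complex.exp z).im ^ 2) /
          Complex.normSq ((b : ℂ) + Complex.exp z) := by
      rw [Complex.div_re]
      simp only [Complex.mul_re, Complex.mul_im, Complex.add_re, Complex.add_im, Complex.ofReal_re,
        Complex.ofReal_im, Complex.one_re, Complex.one_im]
      ring
    rw [one_mul, e]
    have h4 : 0 < 1 + (Complex.exp z).re := by linarith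
    have h5 : 0 < b + (Complex.exp z).re := by linarith
    positivity

theorem critMap_injOn_re_neg : InjOn (critMap b) {ν | ν.re < 0} := by
  intro x hx y hy hxy
  by_contra hne
  have := re_slope_critMap_pos hb hx hy hne
  rw [hxy, sub_self, zero_div] at this
  exact lt_irrefl _ this

theorem exp_critMap {ν : ℂ} (h : (b : ℂ) + Complex.exp ν ≠ 0) :
    Complex.exp (critMap b ν) = -discMap b (-Complex.exp ν) := by
  have hb1 : ((b - 1 : ℝ) : ℂ) ≠ 0 := by
    have : b - 1 ≠ 0 := by linarith
    exact_mod_cast this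
  rw [critMap, discMap, sub_neg_eq_add, Complex.exp_add,
    Complex.cpow_def_of_ne_zero (div_ne_zero h hb1)]
  ring_nf

omit hb in
theorem critMap_add_int (ν : ℂ) (n : ℤ) :
    critMap b (ν + n * (2 * π * I)) = critMap b ν + n * (2 * π * I) := by
  unfold critMap
  rw [Complex.exp_periodic.int_mul n ν]
  ring

theorem quot_disc_mem_slitPlane {x : ℂ} (hx : ‖x‖ < 1) :
    ((b : ℂ) - x) / ((b - 1 : ℝ) : ℂ) ∈ Complex.slitPlane := by
  left
  rw [Complex.div_ofReal_re, Complex.sub_re, Complex.ofReal_re]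
  have h1 := Complex.re_le_norm x
  exact div_pos (by linarith) (by linarith)

theorem sub_disc_ne_zero {x : ℂ} (hx : ‖x‖ < 1) : (b : ℂ) - x ≠ 0 := by
  intro h
  have := quot_disc_mem_slitPlane hb hx
  rw [h, zero_div] at this
  exact Complex.zero_notMem_slitPlane this

theorem quot_cpow_ne_zero {x : ℂ} (hx : ‖x‖ < 1) :
    (((b : ℂ) - x) / ((b - 1 : ℝ) : ℂ)) ^ ((b - 1 : ℝ) : ℂ) ≠ 0 := by
  rw [Complex.cpow_def_of_ne_zero (Complex.slitPlane_ne_zero (quot_disc_mem_slitPlane hb hx))]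
  exact Complex.exp_ne_zero _

omit hb in
theorem re_log_neg {x : ℂ} (hx : ‖x‖ < 1) (h0 : x ≠ 0) : (Complex.log (-x)).re < 0 := by
  rw [Complex.log_re, norm_neg]
  exact Real.log_neg (norm_pos_iff.2 h0) hx

/-- Equal values have logarithms differing by 2πin. Since `critMap` commutes with translation by
2πin, the difference can be moved to the argument, and injectivity on Re ν < 0 applies after
exponentiation. -/
theorem discMap_injOn : InjOn (discMap b) {x | ‖x‖ < 1} := by
  have hzero : ∀ x : ℂ, ‖x‖ < 1 → discMap b x = 0 → x = 0 := by
    intro x hx h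
    exact (mul_eq_zero.1 h).resolve_right (quot_cpow_ne_zero hb hx)
  intro x hx y hy hxy
  by_cases h0 : x = 0
  · rw [h0, discMap, zero_mul] at hxy
    rw [h0, hzero y hy hxy.symm]
  have h0' : y ≠ 0 := by
    intro h
    rw [h, discMap, discMap, zero_mul] at hxy
    exact h0 (hzero x hx hxy)
  have ex : ∀ z : ℂ, ‖z‖ < 1 → z ≠ 0 → Complex.exp (critMap b (Complex.log (-z))) =
      -discMap b z := by
    intro z hz hz0
    rw [exp_critMap hb, Complex.exp_log (neg_ne_zero.2 hz0), neg_neg]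
    rw [Complex.exp_log (neg_ne_zero.2 hz0), ← sub_eq_add_neg]
    exact sub_disc_ne_zero hb hz
  have h1 : Complex.exp (critMap b (Complex.log (-x))) =
      Complex.exp (critMap b (Complex.log (-y))) := by
    rw [ex x hx h0, ex y hy h0', hxy]
  obtain ⟨n, hn⟩ := Complex.exp_eq_exp_iff_exists_int.1 h1
  rw [← critMap_add_int] at hn
  have h2 := critMap_injOn_re_neg hb (re_log_neg hx h0) (by
    show (Complex.log (-y) + n * (2 * π * I)).re < 0
    have := re_log_neg hy h0'
    simpa using this) hn
  have h3 := congrArg Complex.exp h2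
  rw [Complex.exp_periodic.int_mul n, Complex.exp_log (neg_ne_zero.2 h0),
    Complex.exp_log (neg_ne_zero.2 h0')] at h3
  exact neg_injective h3

theorem hasStrictDerivAt_discMap {x : ℂ} (hx : ‖x‖ < 1) : HasStrictDerivAt (discMap b)
    ((((b : ℂ) - x) / ((b - 1 : ℝ) : ℂ)) ^ ((b - 1 : ℝ) : ℂ) * (b * (1 - x) / (b - x))) x := by
  have hb1 : ((b - 1 : ℝ) : ℂ) ≠ 0 := by
    have : b - 1 ≠ 0 := by linarith
    exact_mod_cast this
  have h0 := sub_disc_ne_zero hb hx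
  have h1 : HasStrictDerivAt (fun x => ((b : ℂ) - x) / ((b - 1 : ℝ) : ℂ))
      (-1 / ((b - 1 : ℝ) : ℂ)) x := by
    have := ((hasStrictDerivAt_id x).const_sub (b : ℂ)).div_const ((b - 1 : ℝ) : ℂ)
    exact this
  have hq := quot_disc_mem_slitPlane hb hx
  have h2 := (hasStrictDerivAt_id x).mul
    (h1.cpow (hasStrictDerivAt_const x ((b - 1 : ℝ) : ℂ)) hq)
  refine h2.congr_deriv ?_
  rw [Complex.cpow_sub _ _ (Complex.slitPlane_ne_zero hq), Complex.cpow_one]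
  simp only [id]
  field_simp
  push_cast
  ring

theorem deriv_discMap_ne_zero {x : ℂ} (hx : ‖x‖ < 1) :
    (((b : ℂ) - x) / ((b - 1 : ℝ) : ℂ)) ^ ((b - 1 : ℝ) : ℂ) * (b * (1 - x) / (b - x)) ≠ 0 := by
  have : (b : ℂ) ≠ 0 := by exact_mod_cast (by linarith : b ≠ 0)
  have h1 : (1 : ℂ) - x ≠ 0 := by
    intro h
    rw [← sub_eq_zero.1 h, norm_one] at hx
    exact lt_irrefl _ hx
  exact mul_ne_zero (quot_cpow_ne_zero hb hx)
    (div_ne_zero (mul_ne_zero this h1) (sub_disc_ne_zero hb hx))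

omit hb in
theorem isOpen_disc : IsOpen {x : ℂ | ‖x‖ < 1} := isOpen_lt continuous_norm continuous_const

theorem isOpen_image_disc : IsOpen (discMap b '' {x | ‖x‖ < 1}) :=
  isOpen_image_of_deriv_ne_zero isOpen_disc (fun _ => hasStrictDerivAt_discMap hb)
    fun _ => deriv_discMap_ne_zero hb

theorem slope_discMap {x : ℂ} (hx : ‖x‖ < 1) : slope b (discMap b x) = x / (x - 1) := by
  rw [slope, if_pos (mem_image_of_mem (discMap b) (show x ∈ {x : ℂ | ‖x‖ < 1} from hx)),
    invFunOn_apply (discMap_injOn hb) hx]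

/-- On the line Im ν = π with Re ν < 0 the imaginary part is exactly π. Comparison with the point of
this line having the same real part, through the positive real part of the slope, gives the strict
inequality. Thus principal logarithms suffice for |x| < 1. -/
theorem im_critMap_lt {ν : ℂ} (hre : ν.re < 0) (h1 : ν.im < π) : (critMap b ν).im < π := by
  have hne : ((ν.re : ℂ) + π * I) ≠ ν := by
    intro h
    have := congrArg Complex.im h
    simp at this
    linarith
  have h := re_slope_critMap_pos hb (x := (ν.re : ℂ) + π * I) (y := ν) (by simpa using hre) hre hne
  have e1 : (critMap b ((ν.re : ℂ) + π * I)).im = π := by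
    have h2 : Complex.exp ((ν.re : ℂ) + π * I) = ((-Real.exp ν.re : ℝ) : ℂ) := by
      rw [Complex.exp_add, Complex.exp_pi_mul_I]; push_cast; ring
    have h3 : ((b : ℂ) + Complex.exp ((ν.re : ℂ) + π * I)) / ((b - 1 : ℝ) : ℂ) =
        (((b - Real.exp ν.re) / (b - 1) : ℝ) : ℂ) := by
      rw [h2]; push_cast; ring
    have h4 : 0 ≤ (b - Real.exp ν.re) / (b - 1) := by
      have := Real.exp_lt_one_iff.2 hre
      exact div_nonneg (by linarith) (by linarith)
    rw [critMap, h3, ← Complex.ofReal_log h4, ← Complex.ofReal_mul]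
    simp
  have e2 : ν - ((ν.re : ℂ) + π * I) = ((ν.im - π : ℝ) : ℂ) * I := by
    apply Complex.ext <;> simp
  rw [e2, ← div_div, Complex.div_I, Complex.neg_re, Complex.mul_I_re,
    neg_neg, Complex.div_ofReal_im, Complex.sub_im, e1] at h
  have h5 : ν.im - π < 0 := by linarith
  rw [div_pos_iff] at h
  rcases h with h | h <;> linarith [h.1, h.2]

theorem abs_im_critMap_lt {ν : ℂ} (hre : ν.re < 0) (h : ν ∈ critStrip) :
    |(critMap b ν).im| < π := by
  have hπ := Real.pi_pos
  have h2 := im_critMap_lt hb (ν := conj ν) (by simpa using hre) (conj_mem_critStrip h).2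
  rw [critMap_conj hb h, Complex.conj_im] at h2
  exact abs_lt.2 ⟨by linarith, im_critMap_lt hb hre h.2⟩

omit hb in
theorem log_mem_critStrip {z : ℂ} (hz : z ∈ Complex.slitPlane) : Complex.log z ∈ critStrip := by
  refine ⟨?_, ?_⟩
  · rw [Complex.log_im]; exact Complex.neg_pi_lt_arg _
  · rw [Complex.log_im]
    exact lt_of_le_of_ne (Complex.arg_le_pi _) (Complex.slitPlane_arg_ne_pi hz)

theorem mem_critDom_of_abs_lt {ζ : ℂ} (h : |ζ.im| < π) : ζ ∈ critDom b := by
  have hπ := Real.pi_pos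
  exact ⟨h.trans (by nlinarith), fun h' => absurd h' h.ne⟩

theorem discMap_ofReal {s : ℝ} (hs : s ∈ Icc (0 : ℝ) 1) :
    discMap b s = ((s * ((b - s) / (b - 1)) ^ (b - 1) : ℝ) : ℂ) := by
  have : 0 ≤ (b - s) / (b - 1) := div_nonneg (by linarith [hs.2]) (by linarith)
  rw [discMap, Complex.ofReal_mul, Complex.ofReal_cpow this]
  push_cast
  rfl

/-- On the disc image the value `critMap b (log (-x))` has imaginary part in (-π, π), so it is the
principal logarithm of -ξ. Hence the disc branch and the strip branch coincide wherever both are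
defined. -/
theorem slope_eq_slopeLog {ξ : ℂ} (hξ : -ξ ∈ Complex.slitPlane) :
    slope b ξ = slopeLog b (Complex.log (-ξ)) := by
  by_cases h : ξ ∈ discMap b '' {x | ‖x‖ < 1}
  · obtain ⟨x, hx, rfl⟩ := h
    rw [slope_discMap hb hx]
    have hx0 : -x ∈ Complex.slitPlane := by
      by_contra hcon
      rw [Complex.mem_slitPlane_iff] at hcon
      push Not at hcon
      simp only [Complex.neg_re, Complex.neg_im, neg_eq_zero, Left.neg_nonpos_iff] at hcon
      have hxr : x = (x.re : ℂ) := Complex.ext rfl (by simp [hcon.2])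
      have hx1 : x.re ∈ Icc (0 : ℝ) 1 :=
        ⟨hcon.1, (Complex.re_le_norm x).trans (le_of_lt hx)⟩
      rw [hxr, discMap_ofReal hb hx1, ← Complex.ofReal_neg, Complex.ofReal_mem_slitPlane] at hξ
      have : 0 ≤ (b - x.re) / (b - 1) := div_nonneg (by linarith [hx1.2]) (by linarith)
      have := mul_nonneg hx1.1 (Real.rpow_nonneg this (b - 1))
      linarith
    have hxne : x ≠ 0 := by
      intro h
      rw [h, neg_zero] at hx0
      exact Complex.zero_notMem_slitPlane hx0
    have hs := log_mem_critStrip hx0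
    have habs := abs_lt.1 (abs_im_critMap_lt hb (re_log_neg hx hxne) hs)
    have he : Complex.exp (critMap b (Complex.log (-x))) = -discMap b x := by
      rw [exp_critMap hb (quot_ne_zero hb hs), Complex.exp_log (neg_ne_zero.2 hxne), neg_neg]
    rw [← he, Complex.log_exp habs.1 habs.2.le, slopeLog_critMap hb hs,
      Complex.exp_log (neg_ne_zero.2 hxne)]
    rw [← neg_div_neg_eq]
    ring_nf
  · rw [slope, if_neg h]

/-- The values in [0, 1) are those where -ξ is on the slit but no singularity occurs; the
intermediate value theorem on 0 ≤ x < 1 shows that the disc branch covers them. -/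
theorem mem_image_disc {s : ℝ} (h0 : 0 ≤ s) (h1 : s < 1) :
    (s : ℂ) ∈ discMap b '' {x | ‖x‖ < 1} := by
  have hc : ContinuousOn (fun s : ℝ => s * ((b - s) / (b - 1)) ^ (b - 1)) (Icc 0 1) := by
    have : Continuous fun s : ℝ => s * ((b - s) / (b - 1)) ^ (b - 1) :=
      continuous_id.mul (Continuous.rpow_const (by fun_prop) fun _ => Or.inr (by linarith))
    exact this.continuousOn
  have := intermediate_value_Ico zero_le_one hc
  have e1 : (1 : ℝ) * ((b - 1) / (b - 1)) ^ (b - 1) = 1 := by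
    rw [div_self (by linarith), Real.one_rpow, mul_one]
  obtain ⟨x, hx, hxs⟩ := this (show s ∈ Ico _ _ by
    simp only [zero_mul, e1]; exact ⟨h0, h1⟩)
  refine ⟨x, ?_, ?_⟩
  · show ‖(x : ℂ)‖ < 1
    rw [Complex.norm_real, Real.norm_of_nonneg hx.1]; exact hx.2
  · rw [discMap_ofReal hb ⟨hx.1, hx.2.le⟩]
    exact congrArg _ hxs

theorem differentiableAt_slope {ξ : ℂ} (hξ : 1 - ξ ∈ Complex.slitPlane) :
    DifferentiableAt ℂ (slope b) ξ := by
  by_cases h : -ξ ∈ Complex.slitPlane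
  · have ho : ∀ᶠ z in 𝓝 ξ, -z ∈ Complex.slitPlane :=
      (Complex.isOpen_slitPlane.preimage continuous_neg).mem_nhds h
    have heq : slope b =ᶠ[𝓝 ξ] fun z => slopeLog b (Complex.log (-z)) := by
      filter_upwards [ho] with z hz using slope_eq_slopeLog hb hz
    refine DifferentiableAt.congr_of_eventuallyEq ?_ heq
    have hs := log_mem_critStrip h
    exact (differentiableAt_slopeLog hb (mem_critDom_of_abs_lt hb (abs_lt.2 hs))).comp ξ
      ((differentiableAt_id.neg).clog h)
  · have hmem : ξ ∈ discMap b '' {x | ‖x‖ < 1} := by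
      rw [Complex.mem_slitPlane_iff] at h hξ
      push Not at h
      simp only [Complex.neg_re, Complex.neg_im, neg_eq_zero, Left.neg_nonpos_iff] at h
      have hxr : ξ = (ξ.re : ℂ) := Complex.ext rfl (by simp [h.2])
      rw [hxr]
      refine mem_image_disc hb h.1 ?_
      rcases hξ with h' | h'
      · simp at h'; exact h'
      · simp [h.2] at h'
    obtain ⟨x, hx, rfl⟩ := hmem
    have heq : slope b =ᶠ[𝓝 (discMap b x)] fun z =>
        Function.invFunOn (discMap b) {x | ‖x‖ < 1} z /
        (Function.invFunOn (discMap b) {x | ‖x‖ < 1} z - 1) := by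
      filter_upwards [(isOpen_image_disc hb).mem_nhds (mem_image_of_mem _ hx)] with z hz
      rw [slope, if_pos hz]
    refine DifferentiableAt.congr_of_eventuallyEq ?_ heq
    have hd := (hasDerivAt_invFunOn isOpen_disc (discMap_injOn hb)
      (fun _ => hasStrictDerivAt_discMap hb) (fun _ => deriv_discMap_ne_zero hb)
      hx).differentiableAt
    refine hd.div (hd.sub_const 1) ?_
    rw [invFunOn_apply (discMap_injOn hb) hx]
    intro h
    rw [sub_eq_zero] at h
    have hx' : ‖x‖ < 1 := hx
    rw [h, norm_one] at hx'
    exact lt_irrefl _ hx'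

theorem analyticAt_slope {ξ : ℂ} (hξ : 1 - ξ ∈ Complex.slitPlane) : AnalyticAt ℂ (slope b) ξ :=
  DifferentiableOn.analyticAt (s := {ξ | 1 - ξ ∈ Complex.slitPlane})
    (fun _ h => (differentiableAt_slope hb h).differentiableWithinAt)
    ((Complex.isOpen_slitPlane.preimage (by fun_prop : Continuous fun ξ : ℂ => 1 - ξ)).mem_nhds hξ)

theorem slope_zero : slope b 0 = 0 := by
  have h := slope_discMap hb (x := 0) (by simp)
  simpa [discMap] using h

theorem slope_exp_of_pos {ζ : ℂ} (h0 : 0 < ζ.im) (h1 : ζ.im < 2 * π) :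
    slope b (Complex.exp ζ) = slopeLog b (ζ - π * I) := by
  have e : -Complex.exp ζ = Complex.exp (ζ - π * I) := by
    rw [Complex.exp_sub, Complex.exp_pi_mul_I]; ring
  have hl : Complex.log (-Complex.exp ζ) = ζ - π * I := by
    rw [e]; exact Complex.log_exp (by simp; linarith) (by simp; linarith)
  rw [slope_eq_slopeLog hb, hl]
  rw [Complex.mem_slitPlane_iff_arg, ← Complex.log_im, hl]
  refine ⟨?_, neg_ne_zero.2 (Complex.exp_ne_zero _)⟩
  simp only [Complex.sub_im, Complex.mul_im, Complex.ofReal_re, Complex.I_im, mul_one,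
    Complex.ofReal_im, Complex.I_re, mul_zero, add_zero]
  intro h; linarith

theorem slope_exp_of_neg {ζ : ℂ} (h0 : ζ.im < 0) (h1 : -(2 * π) < ζ.im) :
    slope b (Complex.exp ζ) = slopeLog b (ζ + π * I) := by
  have h := slope_exp_of_pos hb (ζ := ζ + 2 * π * I) (by simp; linarith) (by simp; linarith)
  have e : ζ + 2 * π * I - π * I = ζ + π * I := by ring
  rwa [Complex.exp_periodic, e] at h

end

/-! ### Branches at the critical points -/

theorem analyticAt_dslope {f : ℂ → ℂ} {a : ℂ} (hf : AnalyticAt ℂ f a) :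
    AnalyticAt ℂ (dslope f a) a :=
  (hf.hasFPowerSeriesAt.has_fpower_series_dslope_fslope).analyticAt

section

variable {b : ℝ} (hb : 1 < b)

include hb

/-- The square root of `1 - (b v - v ^ b) / (b - 1)` at `v = 1`. -/
theorem exists_local_sqrt : ∃ r : ℂ → ℂ, AnalyticAt ℂ r 1 ∧ r 1 = 0 ∧
    deriv r 1 = -(Real.sqrt (b / 2) : ℂ) ∧
    ∀ᶠ v in 𝓝 (1 : ℂ), (b : ℂ) * v - v ^ (b : ℂ) = ((b : ℂ) - 1) * (1 - r v ^ 2) := by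
  have hbC1 : (b : ℂ) - 1 ≠ 0 := by exact_mod_cast (by linarith : b - 1 ≠ 0)
  have h1s : (1 : ℂ) ∈ Complex.slitPlane := Complex.one_mem_slitPlane
  set Q : ℂ → ℂ := fun v => 1 - ((b : ℂ) * v - v ^ (b : ℂ)) / ((b : ℂ) - 1) with hQ
  have hQd : ∀ v ∈ Complex.slitPlane,
      HasDerivAt Q ((b : ℂ) / ((b : ℂ) - 1) * (v ^ ((b : ℂ) - 1) - 1)) v := by
    intro v hv
    have h1 : HasDerivAt (fun v : ℂ => v ^ (b : ℂ)) ((b : ℂ) * v ^ ((b : ℂ) - 1)) v := by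
      simpa using (hasDerivAt_id v).cpow_const (c := (b : ℂ)) hv
    have h2 := ((((hasDerivAt_id v).const_mul (b : ℂ)).sub h1).div_const
      ((b : ℂ) - 1)).const_sub 1
    refine h2.congr_deriv ?_
    field_simp
    ring
  have hQa : AnalyticAt ℂ Q 1 := DifferentiableOn.analyticAt (s := Complex.slitPlane)
    (fun v hv => (hQd v hv).differentiableAt.differentiableWithinAt)
    (Complex.isOpen_slitPlane.mem_nhds h1s)
  have hQ1 : Q 1 = 0 := by
    simp only [hQ, mul_one, Complex.one_cpow]
    rw [div_self hbC1, sub_self]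
  have hQ1' : deriv Q 1 = 0 := by rw [(hQd 1 h1s).deriv]; simp
  -- Q has a double zero at v = 1, so two divided differences give Q(v) = (v - 1)² q(v) with q
  -- analytic.
  set q : ℂ → ℂ := dslope (dslope Q 1) 1 with hq
  have hqa : AnalyticAt ℂ q 1 := analyticAt_dslope (analyticAt_dslope hQa)
  have hQq : ∀ v, Q v = (v - 1) ^ 2 * q v := by
    intro v
    have h1 := sub_smul_dslope Q 1 v
    have h2 := sub_smul_dslope (dslope Q 1) 1 v
    rw [dslope_same, hQ1', sub_zero] at h2
    rw [hQ1, sub_zero, ← h2, smul_eq_mul, smul_eq_mul, ← mul_assoc, ← pow_two] at h1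
    exact h1.symm
  -- Differentiating (v - 1)² q gives (v - 1)(2q + (v - 1)q'), which must agree with Q'. A further
  -- derivative at 1 yields 2 q(1) = b.
  have hq1 : q 1 = (b : ℂ) / 2 := by
    have hg : HasDerivAt (fun v : ℂ => (b : ℂ) / ((b : ℂ) - 1) * (v ^ ((b : ℂ) - 1) - 1)) (b : ℂ)
        1 := by
      have h1 := (((hasDerivAt_id (1 : ℂ)).cpow_const (c := (b : ℂ) - 1) h1s).sub_const
        (1 : ℂ)).const_mul ((b : ℂ) / ((b : ℂ) - 1))
      refine h1.congr_deriv ?_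
      simp only [id, Complex.one_cpow, mul_one]
      field_simp
    have hh : HasDerivAt (fun v => (v - 1) * (2 * q v + (v - 1) * deriv q v)) (2 * q 1) 1 := by
      have h1 := ((hasDerivAt_id (1 : ℂ)).sub_const 1).mul
        (((hqa.differentiableAt.const_mul 2).add
          ((differentiableAt_id.sub_const 1).mul hqa.deriv.differentiableAt)).hasDerivAt)
      refine h1.congr_deriv ?_
      simp
    have heq : (fun v => (v - 1) * (2 * q v + (v - 1) * deriv q v)) =ᶠ[𝓝 (1 : ℂ)]
        fun v : ℂ => (b : ℂ) / ((b : ℂ) - 1) * (v ^ ((b : ℂ) - 1) - 1) := by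
      filter_upwards [hqa.eventually_analyticAt, Complex.isOpen_slitPlane.mem_nhds h1s] with v hv hs
      have h1 : HasDerivAt (fun v => (v - 1) ^ 2 * q v)
          ((v - 1) * (2 * q v + (v - 1) * deriv q v)) v := by
        have := (((hasDerivAt_id v).sub_const 1).pow 2).mul hv.differentiableAt.hasDerivAt
        refine this.congr_deriv ?_
        simp
        ring
      have h2 := hQd v hs
      rw [show Q = fun v => (v - 1) ^ 2 * q v from funext hQq] at h2
      exact h1.unique h2
    have := hh.unique (hg.congr_of_eventuallyEq heq)
    linear_combination this / 2
  have hqs : q 1 ∈ Complex.slitPlane := by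
    rw [hq1]; left
    simp; linarith
  have hsa : AnalyticAt ℂ (fun v => q v ^ (1 / 2 : ℂ)) 1 := hqa.cpow analyticAt_const hqs
  -- The negative root is chosen so that the inverse function has derivative -√(2/b).
  refine ⟨fun v => -((v - 1) * q v ^ (1 / 2 : ℂ)), ?_, by simp, ?_, ?_⟩
  · exact ((analyticAt_id.sub analyticAt_const).mul hsa).neg
  · have h1 := (((hasDerivAt_id (1 : ℂ)).sub_const 1).mul
      hsa.differentiableAt.hasDerivAt).neg
    refine h1.deriv.trans ?_
    simp only [one_mul, id, sub_self, zero_mul, add_zero, hq1]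
    rw [Real.sqrt_eq_rpow, Complex.ofReal_cpow (by positivity)]
    push_cast
    rfl
  · filter_upwards [hqa.continuousAt.eventually (Complex.isOpen_slitPlane.mem_nhds hqs)] with v hv
    have h1 : (q v ^ (1 / 2 : ℂ)) ^ 2 = q v := by
      rw [← Complex.cpow_nat_mul]
      norm_num
    have h2 := hQq v
    simp only [hQ] at h2
    rw [neg_sq, mul_pow, h1, ← h2]
    field_simp
    ring

theorem exists_local_inverse : ∃ V : ℂ → ℂ, AnalyticAt ℂ V 0 ∧ V 0 = 1 ∧
    HasDerivAt V (-(Real.sqrt (2 / b) : ℂ)) 0 ∧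
    ∀ᶠ ω in 𝓝 (0 : ℂ), (b : ℂ) * V ω - V ω ^ (b : ℂ) = ((b : ℂ) - 1) * (1 - ω ^ 2) := by
  obtain ⟨r, ha, hr1, hr', hev⟩ := exists_local_sqrt hb
  have hpos : 0 < Real.sqrt (b / 2) := Real.sqrt_pos.2 (by linarith)
  have hne : deriv r 1 ≠ 0 := by
    rw [hr', neg_ne_zero]; exact_mod_cast hpos.ne'
  have hs := ha.hasStrictDerivAt
  set V := hs.localInverse _ _ _ hne with hV
  have h1 : AnalyticAt ℂ V (r 1) := ha.analyticAt_localInverse hne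
  have h2 : V (r 1) = 1 := HasStrictFDerivAt.localInverse_apply_image ..
  have h3 : HasStrictDerivAt V (deriv r 1)⁻¹ (r 1) := hs.to_localInverse hne
  have h4 : ∀ᶠ ω in 𝓝 (r 1), r (V ω) = ω := hs.eventually_right_inverse hne
  rw [hr1] at h1 h2 h3 h4
  refine ⟨V, h1, h2, ?_, ?_⟩
  · refine h3.hasDerivAt.congr_deriv ?_
    rw [hr', inv_neg, ← Complex.ofReal_inv, ← Real.sqrt_inv, inv_div]
  · have h5 : Tendsto V (𝓝 0) (𝓝 1) := by
      have := h1.continuousAt.tendsto; rwa [h2] at this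
    filter_upwards [h5.eventually hev, h4] with ω e1 e2
    rw [e1, e2]

/-- The behaviour of `slopeLog` at its branch points. -/
theorem exists_branch : ∃ V n : ℂ → ℂ, AnalyticAt ℂ V 0 ∧ V 0 = 1 ∧
    deriv V 0 = -(Real.sqrt (2 / b) : ℂ) ∧
    (∀ᶠ ω in 𝓝 (0 : ℂ), (b : ℂ) * V ω - V ω ^ (b : ℂ) = ((b : ℂ) - 1) * (1 - ω ^ 2)) ∧
    AnalyticAt ℂ n 0 ∧ n 0 ≠ 0 ∧
    (∀ᶠ w in 𝓝 (0 : ℂ), w ≠ 0 → 1 / (V w ^ ((b - 1 : ℝ) : ℂ) - 1) = n w / w) ∧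
    ∀ᶠ w in 𝓝 (0 : ℂ), (‖w‖ < 2 * w.im →
        slopeLog b (((b - 1 : ℝ) : ℂ) * Complex.log (1 - w ^ 2) + π * I) = 1 + n w / w) ∧
      (‖w‖ < -(2 * w.im) →
        slopeLog b (((b - 1 : ℝ) : ℂ) * Complex.log (1 - w ^ 2) - π * I) = 1 + n w / w) := by
  obtain ⟨V, ha, hV0, hV', hev⟩ := exists_local_inverse hb
  have hb1 : 0 < b - 1 := by linarith
  have hb1C : ((b - 1 : ℝ) : ℂ) ≠ 0 := by exact_mod_cast hb1.ne'
  have hπ := Real.pi_pos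
  set κ := Real.sqrt (2 / b) with hκ
  have hκ0 : 0 < κ := Real.sqrt_pos.2 (by positivity)
  have hVs : V 0 ∈ Complex.slitPlane := by rw [hV0]; exact Complex.one_mem_slitPlane
  set x : ℂ → ℂ := fun w => V w ^ ((b - 1 : ℝ) : ℂ) with hx
  have hxa : AnalyticAt ℂ x 0 := ha.cpow analyticAt_const hVs
  have hx0 : x 0 = 1 := by simp only [hx, hV0, Complex.one_cpow]
  have hx' : HasDerivAt x (-(((b - 1) * κ : ℝ) : ℂ)) 0 := by
    have := hV'.cpow_const (c := ((b - 1 : ℝ) : ℂ)) hVs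
    refine this.congr_deriv ?_
    rw [hV0, Complex.one_cpow]
    push_cast
    ring
  -- Here x = V^(b-1) is the solution of the critical equation, and x - 1 = w k(w) with k(0) ≠ 0.
  -- The numerator n is 1/k.
  set k : ℂ → ℂ := dslope x 0 with hk
  have hka : AnalyticAt ℂ k 0 := analyticAt_dslope hxa
  have hk0 : k 0 ≠ 0 := by
    rw [hk, dslope_same, hx'.deriv, neg_ne_zero]
    exact_mod_cast (mul_pos hb1 hκ0).ne'
  have hxk : ∀ w, x w - 1 = w * k w := by
    intro w
    have := sub_smul_dslope x 0 w
    rw [sub_zero, hx0, smul_eq_mul] at this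
    exact this.symm
  have hN : ∀ w : ℂ, w ≠ 0 → 1 / (x w - 1) = (k w)⁻¹ / w := by
    intro w hw
    rw [hxk, one_div, mul_inv, div_eq_mul_inv, mul_comm]
  refine ⟨V, fun w => (k w)⁻¹, ha, hV0, hV'.deriv, hev, hka.inv hk0, inv_ne_zero hk0,
    Eventually.of_forall hN, ?_⟩
  -- the logarithm of `V`
  have hlog : HasDerivAt (fun w => Complex.log (V w)) (-(κ : ℂ)) 0 := by
    refine (hV'.clog hVs).congr_deriv ?_
    rw [hV0, div_one]
  have hlog0 : Complex.log (V 0) = 0 := by rw [hV0, Complex.log_one]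
  -- Since log V(w) is close to -κw within (κ/2)|w|, in the cones |w| < 2|Im w| the sign of Im log V
  -- is opposite to that of Im w.
  have hsmall : ∀ᶠ w in 𝓝 (0 : ℂ), ‖Complex.log (V w) + κ * w‖ ≤ κ / 2 * ‖w‖ := by
    have := (hasDerivAt_iff_isLittleO.1 hlog).def (c := κ / 2) (by positivity)
    filter_upwards [this] with w hw
    rw [mul_comm (κ : ℂ)]
    simpa [hlog0] using hw
  have hc1 : Tendsto (fun w => Complex.log (V w)) (𝓝 0) (𝓝 0) := by
    have := hlog.continuousAt.tendsto; rwa [hlog0] at this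
  have hq0 : ((b : ℂ) - x 0) / ((b - 1 : ℝ) : ℂ) = 1 := by
    rw [hx0, div_eq_one_iff_eq hb1C]; push_cast; rfl
  have hc2 : Tendsto (fun w => Complex.log (((b : ℂ) - x w) / ((b - 1 : ℝ) : ℂ))) (𝓝 0) (𝓝 0) := by
    have h1 : ContinuousAt (fun w => ((b : ℂ) - x w) / ((b - 1 : ℝ) : ℂ)) 0 :=
      (continuousAt_const.sub hxa.continuousAt).div_const _
    have := (h1.clog (by rw [hq0]; exact Complex.one_mem_slitPlane)).tendsto
    rwa [hq0, Complex.log_one] at this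
  have hc3 : Tendsto (fun w : ℂ => Complex.log (1 - w ^ 2)) (𝓝 0) (𝓝 0) := by
    have h1 : ContinuousAt (fun w : ℂ => 1 - w ^ 2) 0 := by fun_prop
    have := (h1.clog (by simp)).tendsto
    simpa using this
  have small : ∀ {g : ℂ → ℂ} (c : ℝ), 0 < c → Tendsto g (𝓝 0) (𝓝 0) →
      ∀ᶠ w in 𝓝 (0 : ℂ), |(g w).im| < c := by
    intro g c hc hg
    have := (Complex.continuous_im.tendsto 0).comp hg
    have := this.abs
    simp only [Complex.zero_im, abs_zero] at this
    exact this.eventually_lt_const hc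
  have hVne : ∀ᶠ w in 𝓝 (0 : ℂ), V w ≠ 0 :=
    ha.continuousAt.eventually_ne (by rw [hV0]; exact one_ne_zero)
  have hqne : ∀ᶠ w in 𝓝 (0 : ℂ), ((b : ℂ) - x w) / ((b - 1 : ℝ) : ℂ) ≠ 0 := by
    have h1 : ContinuousAt (fun w => ((b : ℂ) - x w) / ((b - 1 : ℝ) : ℂ)) 0 :=
      (continuousAt_const.sub hxa.continuousAt).div_const _
    exact h1.eventually_ne (by rw [hq0]; exact one_ne_zero)
  have hune : ∀ᶠ w in 𝓝 (0 : ℂ), (1 : ℂ) - w ^ 2 ≠ 0 :=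
    (by fun_prop : ContinuousAt (fun w : ℂ => 1 - w ^ 2) 0).eventually_ne (by simp)
  filter_upwards [hev, hsmall, small (π / 2) (by positivity) hc1, small (π / b) (by positivity) hc1,
    small (π / 2) (by positivity) hc2, small (π / 2) (by positivity) hc3, hVne, hqne, hune]
    with w hw1 hw2 hi1 hi1' hi2 hi3 hn1 hn2 hn3
  have hlogx : Complex.log (x w) = ((b - 1 : ℝ) : ℂ) * Complex.log (V w) := by
    have e : x w = Complex.exp (((b - 1 : ℝ) : ℂ) * Complex.log (V w)) := by
      rw [hx]; simp only []
      rw [Complex.cpow_def_of_ne_zero hn1, mul_comm]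
    have h1 : |(((b - 1 : ℝ) : ℂ) * Complex.log (V w)).im| < π := by
      rw [Complex.im_ofReal_mul, abs_mul, abs_of_pos hb1]
      calc (b - 1) * |(Complex.log (V w)).im| ≤ b * |(Complex.log (V w)).im| := by
            gcongr; linarith
        _ < b * (π / b) := by gcongr
        _ = π := by field_simp
    rw [abs_lt] at h1
    rw [e, Complex.log_exp h1.1 h1.2.le]
  -- The defining equation of V says V (b - V^(b-1))/(b - 1) = 1 - w². The imaginary parts are small
  -- enough to exclude a 2πi ambiguity on taking logarithms.
  have hsum : Complex.log (V w) + Complex.log (((b : ℂ) - x w) / ((b - 1 : ℝ) : ℂ)) =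
      Complex.log (1 - w ^ 2) := by
    have h1 : Complex.exp (Complex.log (V w) + Complex.log (((b : ℂ) - x w) / ((b - 1 : ℝ) : ℂ))) =
        1 - w ^ 2 := by
      rw [Complex.exp_add, Complex.exp_log hn1, Complex.exp_log hn2]
      have h2 : V w * x w = V w ^ (b : ℂ) := by
        rw [hx]; simp only []
        rw [Complex.ofReal_sub, Complex.cpow_sub _ _ hn1, Complex.ofReal_one, Complex.cpow_one]
        field_simp
      have h3 : ((b - 1 : ℝ) : ℂ) = (b : ℂ) - 1 := by push_cast; rfl
      rw [h3] at hb1C ⊢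
      field_simp
      rw [mul_sub, h2, mul_comm (V w), hw1]
    rw [← h1, Complex.log_exp]
    · rw [abs_lt] at hi1 hi2; rw [Complex.add_im]; linarith
    · rw [abs_lt] at hi1 hi2; rw [Complex.add_im]; linarith
  have him : |(Complex.log (V w)).im + κ * w.im| ≤ κ / 2 * ‖w‖ := by
    have := (Complex.abs_im_le_norm (Complex.log (V w) + κ * w)).trans hw2
    rwa [Complex.add_im, Complex.im_ofReal_mul] at this
  rw [abs_le] at him
  have hxne : x w ≠ 0 := by
    rw [hx]; simp only []
    rw [Complex.cpow_def_of_ne_zero hn1]; exact Complex.exp_ne_zero _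
  have hlim : (Complex.log (x w)).im = (b - 1) * (Complex.log (V w)).im := by
    rw [hlogx, Complex.im_ofReal_mul]
  have hexp : Complex.exp (Complex.log (x w)) = x w := Complex.exp_log hxne
  have harg1 : -π < (Complex.log (x w)).im := Complex.neg_pi_lt_log_im _
  have harg2 : (Complex.log (x w)).im < π := by
    rw [hlim]
    rw [abs_lt] at hi1'
    have : b * (Complex.log (V w)).im < b * (π / b) := by gcongr; exact hi1'.2
    rw [mul_div_cancel₀ _ (by linarith : b ≠ 0)] at this
    rcases le_total 0 (Complex.log (V w)).im with h | h <;> nlinarith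
  -- A point ν of the strip with exp ν = -x is log x + πi or log x - πi, whichever lies in the
  -- strip; the sign of Im log x decides.
  have hfin : ∀ ν : ℂ, ν ∈ critStrip → Complex.exp ν = -x w →
      critMap b ν = ν - Complex.log (x w) + ((b - 1 : ℝ) : ℂ) * Complex.log (1 - w ^ 2) ∧
      (w ≠ 0 → slopeLog b (critMap b ν) = 1 + (k w)⁻¹ / w) := by
    intro ν hν hνx
    refine ⟨?_, fun hw0 => ?_⟩
    · rw [critMap, hνx, ← sub_eq_add_neg, ← hsum, hlogx]; ring
    · rw [slopeLog_critMap hb hν, hνx, ← hN w hw0]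
      have h1 := one_add_exp_ne_zero hν
      rw [hνx] at h1
      have h2 : x w - 1 ≠ 0 := by
        intro h; apply h1; linear_combination -h
      field_simp
      ring
  constructor
  · intro h
    have hneg : (Complex.log (V w)).im < 0 := by nlinarith [him.2]
    have hw0 : w ≠ 0 := by
      rintro rfl; simp at h
    have hmem : Complex.log (x w) + π * I ∈ critStrip := by
      constructor
      · simp; linarith
      · simp; rw [hlim]; nlinarith
    obtain ⟨e1, e2⟩ := hfin _ hmem (by rw [Complex.exp_add, hexp, Complex.exp_pi_mul_I]; ring)
    rw [← e2 hw0, e1]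
    congr 1; ring
  · intro h
    have hpos : 0 < (Complex.log (V w)).im := by nlinarith [him.1]
    have hw0 : w ≠ 0 := by
      rintro rfl; simp at h
    have hmem : Complex.log (x w) - π * I ∈ critStrip := by
      constructor
      · simp; rw [hlim]; nlinarith
      · simp; linarith
    obtain ⟨e1, e2⟩ := hfin _ hmem (by rw [Complex.exp_sub, hexp, Complex.exp_pi_mul_I]; ring)
    rw [← e2 hw0, e1]
    congr 1; ring

end

/-! ### The jump across the cut -/

/-- The jump of the derivative of the inverse function, divided by `2 i`. -/
noncomputable def cutJump (b : ℝ) (u : ℂ) : ℂ :=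
  (slopeLog b (((b - 1 : ℝ) : ℂ) * Complex.log (1 + u) + π * I) -
    slopeLog b (((b - 1 : ℝ) : ℂ) * Complex.log (1 + u) - π * I)) / (2 * I)

section

variable {b : ℝ} (hb : 1 < b)

theorem one_add_mem_slitPlane {u : ℂ} (hu : 0 < u.re) : 1 + u ∈ Complex.slitPlane := by
  left; rw [Complex.add_re, Complex.one_re]; linarith

include hb

omit hb in
-- For Re u > 0 one has |1 + u|² ≥ 1 + |u|². The positive real part keeps the arguments of
-- `slopeLog` in `cutJump` off the cuts of `critDom`.
theorem re_log_one_add_pos {u : ℂ} (hu : 0 < u.re) :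
    Real.log (1 + ‖u‖ ^ 2) / 2 ≤ (Complex.log (1 + u)).re := by
  rw [Complex.log_re]
  have h1 : 1 + ‖u‖ ^ 2 ≤ ‖1 + u‖ ^ 2 := by
    rw [← Complex.normSq_eq_norm_sq, ← Complex.normSq_eq_norm_sq, Complex.normSq_apply,
      Complex.normSq_apply]
    simp only [Complex.add_re, Complex.one_re, Complex.add_im, Complex.one_im]
    nlinarith
  have h2 := Real.log_le_log (by positivity) h1
  rw [Real.log_pow] at h2
  push_cast at h2
  linarith

/-- The imaginary part is below (b - 1)π/2 + π, which is less than bπ because b > 1. This is where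
the extent of `critDom` beyond |Im ζ| = π is needed. -/
theorem cutJump_dom {u : ℂ} (hu : 0 < u.re) {s : ℝ} (hs : |s| ≤ π) :
    ((b - 1 : ℝ) : ℂ) * Complex.log (1 + u) + s * I ∈ critDom b := by
  have hb1 : 0 < b - 1 := by linarith
  have hπ := Real.pi_pos
  have h1 : |(Complex.log (1 + u)).im| < π / 2 := by
    rw [Complex.log_im, Complex.abs_arg_lt_pi_div_two_iff]
    left; rw [Complex.add_re, Complex.one_re]; linarith
  have hre : 0 < (Complex.log (1 + u)).re := by
    refine lt_of_lt_of_le ?_ (re_log_one_add_pos hu)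
    have : 0 < ‖u‖ := norm_pos_iff.2 (by rintro rfl; simp at hu)
    have : 0 < Real.log (1 + ‖u‖ ^ 2) := Real.log_pos (by nlinarith)
    linarith
  constructor
  · rw [Complex.add_im, Complex.im_ofReal_mul, Complex.im_ofReal_mul, Complex.I_im, mul_one]
    rw [abs_lt] at h1 ⊢
    rw [abs_le] at hs
    constructor <;> nlinarith [h1.1, h1.2]
  · intro _
    rw [Complex.add_re, Complex.re_ofReal_mul, Complex.re_ofReal_mul, Complex.I_re, mul_zero,
      add_zero]
    positivity

theorem cutJump_dom_add {u : ℂ} (hu : 0 < u.re) :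
    ((b - 1 : ℝ) : ℂ) * Complex.log (1 + u) + π * I ∈ critDom b :=
  cutJump_dom hb hu (by rw [abs_of_pos Real.pi_pos])

theorem cutJump_dom_sub {u : ℂ} (hu : 0 < u.re) :
    ((b - 1 : ℝ) : ℂ) * Complex.log (1 + u) - π * I ∈ critDom b := by
  have := cutJump_dom hb hu (s := -π) (by rw [abs_neg, abs_of_pos Real.pi_pos])
  rw [Complex.ofReal_neg, neg_mul, ← sub_eq_add_neg] at this
  exact this

theorem differentiableAt_cutJump {u : ℂ} (hu : 0 < u.re) :
    DifferentiableAt ℂ (cutJump b) u := by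
  have h : DifferentiableAt ℂ (fun u : ℂ => ((b - 1 : ℝ) : ℂ) * Complex.log (1 + u)) u :=
    ((differentiableAt_id.const_add 1).clog (one_add_mem_slitPlane hu)).const_mul _
  unfold cutJump
  refine DifferentiableAt.div_const (DifferentiableAt.sub ?_ ?_) _
  · exact DifferentiableAt.comp u (g := slopeLog b)
      (differentiableAt_slopeLog hb (cutJump_dom_add hb hu)) (h.add_const _)
  · exact DifferentiableAt.comp u (g := slopeLog b)
      (differentiableAt_slopeLog hb (cutJump_dom_sub hb hu)) (h.sub_const _)

/-- For |u| ≥ ρ both arguments of `slopeLog` have real part at least a fixed c > 0, hence stay at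
distance c from the singular points ±πi. -/
theorem exists_norm_cutJump_le {ρ : ℝ} (hρ : 0 < ρ) : ∃ C ≥ 0, ∀ u : ℂ, 0 < u.re → ρ ≤ ‖u‖ →
    ‖cutJump b u‖ ≤ C := by
  obtain ⟨C, hC, h⟩ := exists_norm_slopeLog_le hb
  have hb1 : 0 < b - 1 := by linarith
  set c := (b - 1) * (Real.log (1 + ρ ^ 2) / 2) with hc
  have hc0 : 0 < c := by
    have : 0 < Real.log (1 + ρ ^ 2) := Real.log_pos (by nlinarith)
    positivity
  refine ⟨C * (1 + c ^ (-(1 / 2) : ℝ) + c ^ (-(1 / 2) : ℝ)), by positivity, fun u hu hu' => ?_⟩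
  have hre : c ≤ (((b - 1 : ℝ) : ℂ) * Complex.log (1 + u)).re := by
    rw [Complex.re_ofReal_mul]
    have h1 := re_log_one_add_pos hu
    have h2 : Real.log (1 + ρ ^ 2) ≤ Real.log (1 + ‖u‖ ^ 2) :=
      Real.log_le_log (by positivity) (by gcongr)
    rw [hc]
    gcongr
    linarith
  have hnorm : ∀ s : ℝ, ‖((b - 1 : ℝ) : ℂ) * Complex.log (1 + u) + s * I‖ ^ (-(1 / 2) : ℝ) ≤
      c ^ (-(1 / 2) : ℝ) := by
    intro s
    refine Real.rpow_le_rpow_of_nonpos hc0 ?_ (by norm_num)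
    have := Complex.re_le_norm (((b - 1 : ℝ) : ℂ) * Complex.log (1 + u) + s * I)
    rw [Complex.add_re, Complex.re_ofReal_mul s, Complex.I_re, mul_zero, add_zero] at this
    linarith
  have key : ∀ z ∈ critDom b, (∃ s : ℝ, z = ((b - 1 : ℝ) : ℂ) * Complex.log (1 + u) + s * I) →
      ‖slopeLog b z‖ ≤ C * (1 + c ^ (-(1 / 2) : ℝ) + c ^ (-(1 / 2) : ℝ)) := by
    rintro z hz ⟨s, hs⟩
    refine (h z hz).trans ?_
    have h1 := hnorm (s - π)
    have h2 := hnorm (s + π)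
    have e1 : z - π * I = ((b - 1 : ℝ) : ℂ) * Complex.log (1 + u) + ((s - π : ℝ) : ℂ) * I := by
      rw [hs]; push_cast; ring
    have e2 : z + π * I = ((b - 1 : ℝ) : ℂ) * Complex.log (1 + u) + ((s + π : ℝ) : ℂ) * I := by
      rw [hs]; push_cast; ring
    rw [e1, e2]
    exact mul_le_mul_of_nonneg_left (by linarith) hC
  have k1 := key _ (cutJump_dom_add hb hu) ⟨π, rfl⟩
  have k2 := key _ (cutJump_dom_sub hb hu) ⟨-π, by push_cast; ring⟩
  rw [cutJump, norm_div, norm_mul, Complex.norm_I, mul_one]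
  have := norm_sub_le (slopeLog b (((b - 1 : ℝ) : ℂ) * Complex.log (1 + u) + π * I))
    (slopeLog b (((b - 1 : ℝ) : ℂ) * Complex.log (1 + u) - π * I))
  have h2 : ‖(2 : ℂ)‖ = 2 := by norm_num
  rw [h2, div_le_iff₀ two_pos]
  linarith

/-- With u = ω² the two sides of the cut correspond to w = iω and w = -iω, since 1 - w² = 1 + u for
both. The jump is then -(n(iω) + n(-iω))/(2ω): an even series divided by ω, so only the powers
u^(j-1/2) survive. -/
theorem isCutJump_cutJump : ∃ d : ℕ → ℂ, IsCutJump b (cutJump b) d := by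
  obtain ⟨V, n, hVa, hV0, hV', hVe, hna, hn0, hN, hS⟩ := exists_branch hb
  have hIt : Tendsto (fun w : ℂ => I * w) (𝓝 0) (𝓝 0) := by
    have : Continuous fun w : ℂ => I * w := by fun_prop
    simpa using this.tendsto 0
  have hIt' : Tendsto (fun w : ℂ => -(I * w)) (𝓝 0) (𝓝 0) := by
    have : Continuous fun w : ℂ => -(I * w) := by fun_prop
    simpa using this.tendsto 0
  have hjump : ∀ᶠ ω in 𝓝 (0 : ℂ), 0 < ω.re → 0 < (ω ^ 2).re →
      cutJump b (ω ^ 2) = ((1 + n (I * ω) / (I * ω)) - (1 + n (-(I * ω)) / (-(I * ω)))) / (2 *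
          I) := by
    filter_upwards [hIt.eventually hS, hIt'.eventually hS] with ω h1 h2 hω hω2
    -- The right half plane in u means |arg ω| < π/4, which puts iω and -iω into the cones where the
    -- local branches are known.
    have hnorm : ‖ω‖ < 2 * ω.re := by
      have e : ‖ω‖ ^ 2 = ω.re ^ 2 + ω.im ^ 2 := by
        rw [← Complex.normSq_eq_norm_sq, Complex.normSq_apply]; ring
      have e2 : (ω ^ 2).re = ω.re ^ 2 - ω.im ^ 2 := by rw [pow_two, Complex.mul_re]; ring
      rw [e2] at hω2
      by_contra! hcon
      have := norm_nonneg ω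
      nlinarith
    have k1 := h1.1 (by simpa using hnorm)
    have k2 := h2.2 (by simpa using hnorm)
    have e1 : 1 - (I * ω) ^ 2 = 1 + ω ^ 2 := by rw [mul_pow, Complex.I_sq]; ring
    have e2 : 1 - (-(I * ω)) ^ 2 = 1 + ω ^ 2 := by rw [neg_sq, mul_pow, Complex.I_sq]; ring
    rw [e1] at k1
    rw [e2] at k2
    rw [cutJump, k1, k2]
  obtain ⟨p, hp⟩ := hna
  obtain ⟨R, hR⟩ := hp
  have hsum : ∀ᶠ w in 𝓝 (0 : ℂ), HasSum (fun j : ℕ => w ^ j * p.coeff j) (n w) := by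
    have := hR.eventually_hasSum
    filter_upwards [this] with w hw
    simpa using hw
  have hpui : ∀ᶠ ω in 𝓝 (0 : ℂ), 0 < ω.re → 0 < (ω ^ 2).re →
      HasSum (fun j : ℕ => (-((-1) ^ j * p.coeff (2 * j))) * (ω ^ (2 * j) / ω))
        (cutJump b (ω ^ 2)) := by
    filter_upwards [hjump, hIt.eventually hsum, hIt'.eventually hsum] with ω h1 h2 h3 hω hω2
    rw [h1 hω hω2]
    have hω0 : ω ≠ 0 := by rintro rfl; simp at hω
    have h4 := ((h2.add h3).mul_left (-(1 / (2 * ω))))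
    have h5 : (-(1 / (2 * ω))) * (n (I * ω) + n (-(I * ω))) =
        ((1 + n (I * ω) / (I * ω)) - (1 + n (-(I * ω)) / (-(I * ω)))) / (2 * I) := by
      have hI := Complex.I_ne_zero
      have hI2 := Complex.I_sq
      field_simp
      rw [hI2]
      ring
    rw [h5] at h4
    have hinj : Function.Injective fun j : ℕ => 2 * j := fun i j h => by simpa using h
    -- The odd terms cancel between iω and -iω, so the sum is over even indices only.
    rw [← hinj.hasSum_iff] at h4
    · refine Eq.mpr (congrArg (fun f => HasSum f _) (funext fun j => ?_)) h4
      have e1 : (I * ω) ^ (2 * j) = (-1) ^ j * ω ^ (2 * j) := by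
        rw [mul_pow, pow_mul I, Complex.I_sq]
      have e2 : (-(I * ω)) ^ (2 * j) = (-1) ^ j * ω ^ (2 * j) := by
        rw [pow_mul, neg_sq, ← pow_mul, e1]
      simp only [Function.comp, e1, e2]
      field_simp
      ring
    · intro j hj
      have hodd : Odd j := by
        rw [← Nat.not_even_iff_odd]
        rintro ⟨m, hm⟩
        exact hj ⟨m, by simp only []; omega⟩
      rw [Odd.neg_pow hodd]
      ring
  set d : ℕ → ℂ := fun j => -((-1) ^ j * p.coeff (2 * j)) with hd
  have hsqrt : ∀ u : ℂ, 0 < u.re → (u ^ (1 / 2 : ℂ)) ^ 2 = u ∧ 0 < (u ^ (1 / 2 : ℂ)).re ∧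
      ‖u ^ (1 / 2 : ℂ)‖ = ‖u‖ ^ (1 / 2 : ℝ) := by
    intro u hu
    have hu0 : u ≠ 0 := by rintro rfl; simp at hu
    refine ⟨?_, ?_, ?_⟩
    · rw [← Complex.cpow_nat_mul]; norm_num
    · rw [Complex.cpow_def_of_ne_zero hu0, Complex.exp_re]
      refine mul_pos (Real.exp_pos _) (Real.cos_pos_of_mem_Ioo ?_)
      have h1 := Complex.neg_pi_lt_log_im u
      have h2 := Complex.log_im_le_pi u
      have h3 : (Complex.log u * (1 / 2)).im = (Complex.log u).im / 2 := by
        rw [show (1 / 2 : ℂ) = ((1 / 2 : ℝ) : ℂ) by push_cast; rfl, Complex.im_mul_ofReal]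
        ring
      rw [h3]
      have h4 : (Complex.log u).im < π := by
        refine lt_of_le_of_ne h2 ?_
        rw [Complex.log_im]
        exact Complex.slitPlane_arg_ne_pi (Or.inl hu)
      constructor <;> linarith
    · have := Complex.norm_cpow_real u (1 / 2)
      push_cast at this
      exact this
  have hroot : Tendsto (fun u : ℂ => u ^ (1 / 2 : ℂ)) (𝓝 0) (𝓝 0) := by
    have h1 : ContinuousAt (fun u : ℂ => u ^ (1 / 2 : ℂ)) 0 :=
      Complex.continuousAt_cpow_const_of_re_pos (Or.inl le_rfl) (by norm_num)
    have := h1.tendsto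
    rwa [Complex.zero_cpow (by norm_num)] at this
  obtain ⟨ρ, hρ, hρs⟩ := Metric.eventually_nhds_iff.1 (hroot.eventually
    (hpui.and (hjump.and ((hIt.eventually
      (hR.analyticAt.continuousAt.norm.eventually_lt_const (lt_add_one ‖n 0‖))).and
      (hIt'.eventually
      (hR.analyticAt.continuousAt.norm.eventually_lt_const (lt_add_one ‖n 0‖)))))))
  refine ⟨d, ?_, ?_, ?_, V, hVa, hV0, hV', hVe, ?_⟩
  · intro u hu
    exact DifferentiableOn.analyticAt (s := {u : ℂ | 0 < u.re})
      (fun v hv => (differentiableAt_cutJump hb hv).differentiableWithinAt)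
      ((isOpen_lt continuous_const Complex.continuous_re).mem_nhds hu)
  · obtain ⟨C, hC, hCb⟩ := exists_norm_cutJump_le hb hρ
    refine ⟨C + (‖n 0‖ + 1), fun u hu => ?_⟩
    have hr : 0 ≤ ‖u‖ ^ (-(1 / 2) : ℝ) := by positivity
    have hn := norm_nonneg (n 0)
    rcases le_or_gt ρ ‖u‖ with h | h
    · have := hCb u hu h
      nlinarith [mul_nonneg hC hr, mul_nonneg hn hr]
    · obtain ⟨h1, h2, h3, h4⟩ := hρs (y := u) (by simpa using h)
      obtain ⟨e1, e2, e3⟩ := hsqrt u hu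
      have h5 := h2 e2 (by rw [e1]; exact hu)
      rw [e1] at h5
      set ω := u ^ (1 / 2 : ℂ) with hω
      have hω0 : ω ≠ 0 := by intro h; rw [h] at e2; simp at e2
      have hωn : ‖ω‖⁻¹ = ‖u‖ ^ (-(1 / 2) : ℝ) := by
        rw [e3, Real.rpow_neg (norm_nonneg _)]
      have h6 : cutJump b u = -(1 / 2) * ((n (I * ω) + n (-(I * ω))) * ω⁻¹) := by
        rw [h5]
        have hI := Complex.I_ne_zero
        have hI2 := Complex.I_sq
        field_simp
        rw [hI2]
        ring
      rw [h6, norm_mul, norm_mul, norm_inv, hωn]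
      have h7 := norm_add_le (n (I * ω)) (n (-(I * ω)))
      have h8 : ‖(-(1 / 2) : ℂ)‖ = 1 / 2 := by norm_num
      rw [h8]
      have h9 : ‖n (I * ω) + n (-(I * ω))‖ ≤ 2 * (‖n 0‖ + 1) := by linarith
      have := mul_le_mul_of_nonneg_right h9 hr
      nlinarith [mul_nonneg hC hr]
  · refine ⟨ρ, hρ, fun u hu hu' => ?_⟩
    obtain ⟨h1, -⟩ := hρs (y := u) (by simpa using hu')
    obtain ⟨e1, e2, e3⟩ := hsqrt u hu
    have h5 := h1 e2 (by rw [e1]; exact hu)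
    rw [e1] at h5
    have hu0 : u ≠ 0 := by rintro rfl; simp at hu
    refine Eq.mpr (congrArg (fun f => HasSum f _) (funext fun j => ?_)) h5
    rw [Complex.cpow_sub _ _ hu0, Complex.cpow_natCast, pow_mul, e1]
  · filter_upwards [hjump, hIt.eventually hN, hIt'.eventually hN] with ω h1 h2 h3 hω hω2
    have hω0 : ω ≠ 0 := by rintro rfl; simp at hω
    have hI := Complex.I_ne_zero
    rw [h1 hω hω2, h2 (mul_ne_zero hI hω0), h3 (neg_ne_zero.2 (mul_ne_zero hI hω0))]
    ring

end

/-! ### Expansions of Laplace transforms -/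

theorem integral_exp_exp {c s : ℝ} (hc : 0 < c) (hs : 0 < s) :
    ∫ t : ℝ, Real.exp (-c * Real.exp t) * Real.exp (s * t) = Real.Gamma s * c ^ (-s) := by
  have h := Real.integral_rpow_mul_exp_neg_mul_Ioi hs hc
  rw [← exp_image_univ, integral_image_eq_integral_abs_deriv_smul MeasurableSet.univ
    (fun x _ => (Real.hasDerivAt_exp x).hasDerivWithinAt) Real.exp_injective.injOn,
    Measure.restrict_univ] at h
  rw [one_div, Real.inv_rpow hc.le, ← Real.rpow_neg hc.le, mul_comm] at h
  rw [← h]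
  congr 1
  ext t
  rw [abs_of_pos (Real.exp_pos t), smul_eq_mul, ← Real.exp_mul, ← Real.exp_add, ← Real.exp_add,
    ← Real.exp_add]
  congr 1
  ring

theorem norm_lap_le {Y : ℂ → ℂ} {β a C : ℝ} {W : ℂ} (ha : -1 < a) (hW : |W.im + β| < π / 2)
    (hY : ∀ t : ℝ, ‖Y (t + β * I)‖ ≤ C * Real.exp (a * t)) :
    ‖Complex.exp W * lap Y β W‖ ≤ C * Real.Gamma (a + 1) * Real.exp (-a * W.re) *
      Real.cos (W.im + β) ^ (-(a + 1)) := by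
  have hcos : 0 < Real.cos (W.im + β) :=
    Real.cos_pos_of_mem_Ioo ⟨by linarith [(abs_lt.1 hW).1], (abs_lt.1 hW).2⟩
  have hc : 0 < Real.exp W.re * Real.cos (W.im + β) := by positivity
  have h1 : ‖lap Y β W‖ ≤ ∫ t : ℝ, C * (Real.exp (-(Real.exp W.re * Real.cos (W.im + β)) *
      Real.exp t) * Real.exp ((a + 1) * t)) := by
    refine norm_integral_le_of_norm_le ((integrable_exp_exp hc (by linarith)).const_mul C)
      (Eventually.of_forall fun t => ?_)
    have := norm_lapKer_le (X := Complex.exp W) (Y := Y) (l := t + β * I)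
      (c := Real.exp W.re * Real.cos (W.im + β)) (by
        have := (re_exp_mul_exp W β).ge
        simpa [-Complex.mul_re] using this) (hY t)
    refine this.trans (le_of_eq ?_)
    simp only [Complex.add_re, Complex.ofReal_re, Complex.mul_re, Complex.I_re, mul_zero,
      Complex.ofReal_im, Complex.I_im, mul_one, sub_self, add_zero]
    rw [show (a + 1) * t = a * t + t by ring, Real.exp_add]
    ring
  rw [integral_const_mul, integral_exp_exp hc (by linarith), Real.mul_rpow (Real.exp_pos _).le
    hcos.le, ← Real.exp_mul] at h1
  rw [norm_mul, Complex.norm_exp]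
  refine (mul_le_mul_of_nonneg_left h1 (Real.exp_pos _).le).trans (le_of_eq ?_)
  rw [show -a * W.re = W.re + W.re * -(a + 1) by ring, Real.exp_add]
  ring

/-- Along the direction -Im W the exponent is real and the integral is Euler's; every other
admissible ray gives the same value by rotation. The restriction a ≥ -1/2 is what the growth class
`rayBound` permits at the origin. -/
theorem lap_exp {a β : ℝ} {W : ℂ} (ha : -(1 / 2) ≤ a) (hW : |W.im + β| < π / 2) :
    Complex.exp W * lap (fun l => Complex.exp (a * l)) β W =
      Real.Gamma (a + 1) * Complex.exp (-(a * W)) := by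
  have hπ := Real.pi_pos
  have h1 := lap_eq_of_strip (Y := fun l => Complex.exp (a * l)) (C := 1) (a := max a 0) (t₀ := 0)
    (α₁ := -(|β| + |W.im| + 1)) (α₂ := |β| + |W.im| + 1) (α := β) (β := -W.im) (W := W)
    (le_max_right _ _) (by fun_prop) (fun l _ _ _ => by
      have h2 : 0 ≤ |l.re - 0| ^ (-(1 / 2) : ℝ) := by positivity
      rw [one_mul, rayBound, Complex.norm_exp, Complex.re_ofReal_mul]
      rcases le_total 0 l.re with h | h
      · have : Real.exp (a * l.re) ≤ Real.exp (max a 0 * l.re) :=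
          Real.exp_le_exp.2 (mul_le_mul_of_nonneg_right (le_max_left _ _) h)
        have := Real.exp_pos (-l.re / 2)
        linarith
      · have : Real.exp (a * l.re) ≤ Real.exp (-l.re / 2) := Real.exp_le_exp.2 (by nlinarith)
        have := Real.exp_pos (max a 0 * l.re)
        linarith)
    (by
      have := abs_le.1 (le_refl |β|); have := abs_nonneg W.im
      constructor <;> linarith)
    (by
      have := abs_le.1 (le_refl |W.im|); have := abs_nonneg β
      constructor <;> linarith) hW (by rw [add_neg_cancel, abs_zero]; positivity)
  have e1 : ∀ t : ℝ, lapKer (Complex.exp W) (fun l => Complex.exp (a * l)) (t + (-W.im : ℝ) * I) =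
      Complex.exp (-((a + 1) * (W.im * I))) *
        ((Real.exp (-Real.exp W.re * Real.exp t) * Real.exp ((a + 1) * t) : ℝ) : ℂ) := by
    intro t
    have e2 : Complex.exp W * Complex.exp (t + (-W.im : ℝ) * I) = Complex.exp (W.re + t) := by
      rw [← Complex.exp_add]
      congr 1
      nth_rewrite 1 [← Complex.re_add_im W]
      push_cast
      ring
    rw [lapKer, e2]
    push_cast
    simp only [neg_mul, ← Complex.exp_add]
    congr 1
    ring
  rw [h1, lap]
  simp_rw [e1]
  rw [integral_const_mul, integral_complex_ofReal, integral_exp_exp (Real.exp_pos _) (by linarith),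
    ← Real.exp_mul, Complex.ofReal_mul, Complex.ofReal_exp, mul_left_comm, mul_left_comm _
    (Real.Gamma (a + 1) : ℂ), ← Complex.exp_add, mul_left_comm, ← Complex.exp_add]
  congr 2
  push_cast
  linear_combination -((a : ℂ) + 1) * Complex.re_add_im W

theorem integrable_lapKer_exp {a β : ℝ} {W : ℂ} (ha : -1 < a) (hW : |W.im + β| < π / 2) (c : ℂ) :
    Integrable fun t : ℝ => lapKer (Complex.exp W) (fun l => c * Complex.exp (a * l))
      (t + β * I) := by
  refine ((integrable_exp_exp (re_exp_mul_exp_pos hW) (s := a + 1) (by linarith)).const_mul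
    ‖c * Complex.exp (a * (β * I))‖).mono'
    (continuous_lapKer (by fun_prop)).aestronglyMeasurable (Eventually.of_forall fun t => ?_)
  have := norm_lapKer_le (X := Complex.exp W) (Y := fun l => c * Complex.exp (a * l))
    (l := t + β * I) (c := (Complex.exp W * Complex.exp (β * I)).re)
      (by simp [-Complex.mul_re]) (B := ‖c * Complex.exp (a * (β * I))‖ * Real.exp (a * t)) (by
        rw [mul_add, Complex.exp_add, mul_left_comm, norm_mul, Complex.norm_exp]
        simp [mul_comm])
  refine this.trans (le_of_eq ?_)
  simp only [Complex.add_re, Complex.ofReal_re, Complex.mul_re, Complex.I_re, mul_zero,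
    Complex.ofReal_im, Complex.I_im, mul_one, sub_self, add_zero]
  rw [show (a + 1) * t = a * t + t by ring, Real.exp_add]
  ring

/-- A quantitative form of Watson's lemma. -/
theorem norm_lap_sub_le {ι : Type*} {Y : ℂ → ℂ} {β a C : ℝ} {W : ℂ} (s : Finset ι) (c : ι → ℂ)
    (e : ι → ℝ) (ha : -1 < a) (he : ∀ i ∈ s, -(1 / 2) ≤ e i) (hW : |W.im + β| < π / 2)
    (hint : Integrable fun t : ℝ => lapKer (Complex.exp W) Y (t + β * I))
    (hY : ∀ t : ℝ, ‖Y (t + β * I) - ∑ i ∈ s, c i * Complex.exp (e i * (t + β * I))‖ ≤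
      C * Real.exp (a * t)) :
    ‖Complex.exp W * lap Y β W - ∑ i ∈ s, c i * (Real.Gamma (e i + 1) *
      Complex.exp (-(e i * W)))‖ ≤ C * Real.Gamma (a + 1) * Real.exp (-a * W.re) *
      Real.cos (W.im + β) ^ (-(a + 1)) := by
  have h1 : Complex.exp W * lap Y β W - ∑ i ∈ s, c i * (Real.Gamma (e i + 1) *
      Complex.exp (-(e i * W))) = Complex.exp W *
      lap (fun l => Y l - ∑ i ∈ s, c i * Complex.exp (e i * l)) β W := by
    have h2 : lap (fun l => Y l - ∑ i ∈ s, c i * Complex.exp (e i * l)) β W =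
        lap Y β W - ∑ i ∈ s, c i * lap (fun l => Complex.exp (e i * l)) β W := by
      unfold lap
      have h3 : ∀ i ∈ s, Integrable fun t : ℝ => lapKer (Complex.exp W)
          (fun l => c i * Complex.exp (e i * l)) (t + β * I) := fun i hi =>
        integrable_lapKer_exp (by linarith [he i hi]) hW (c i)
      simp_rw [← integral_const_mul]
      have e3 : ∀ i, ∀ t : ℝ, c i * lapKer (Complex.exp W) (fun l => Complex.exp (e i * l))
          (t + β * I) = lapKer (Complex.exp W) (fun l => c i * Complex.exp (e i * l))
          (t + β * I) := by
        intro i t; simp only [lapKer]; ring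
      simp_rw [e3]
      rw [← integral_finsetSum _ h3, ← integral_sub hint (integrable_finsetSum _ h3)]
      congr 1
      ext t
      simp only [lapKer]
      rw [mul_sub, sub_mul, Finset.mul_sum, Finset.sum_mul]
    rw [h2, mul_sub, Finset.mul_sum]
    congr 1
    refine Finset.sum_congr rfl fun i hi => ?_
    rw [mul_left_comm (Complex.exp W), lap_exp (he i hi) hW]
  rw [h1]
  exact norm_lap_le ha hW hY

/-- Uniqueness of asymptotic coefficients: once the lower ones vanish, dividing the remainder
estimate by w^j leaves |c_j| ≤ C w. -/
theorem eq_zero_of_asymptotic {c : ℕ → ℂ}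
    (h : ∀ N : ℕ, ∃ C : ℝ, ∀ᶠ w : ℝ in 𝓝[>] (0 : ℝ),
      ‖∑ j ∈ Finset.range (N + 1), c j * (w : ℂ) ^ j‖ ≤ C * w ^ (N + 1)) (j : ℕ) : c j = 0 := by
  induction j using Nat.strong_induction_on with
  | _ j ih =>
    obtain ⟨C, hC⟩ := h j
    have h1 : ∀ᶠ w : ℝ in 𝓝[>] (0 : ℝ), ‖c j‖ ≤ C * w := by
      filter_upwards [hC, self_mem_nhdsWithin] with w hw hw0
      have hw0 : (0 : ℝ) < w := hw0
      rw [Finset.sum_range_succ, Finset.sum_eq_zero (fun i hi => by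
        rw [ih i (Finset.mem_range.1 hi), zero_mul]), zero_add, norm_mul, norm_pow,
        Complex.norm_real, Real.norm_of_nonneg hw0.le, pow_succ, mul_comm (w ^ j), ← mul_assoc]
        at hw
      exact le_of_mul_le_mul_right hw (by positivity)
    have h2 : Tendsto (fun w : ℝ => C * w) (𝓝[>] 0) (𝓝 0) := by
      have : Continuous fun w : ℝ => C * w := by fun_prop
      simpa using (this.tendsto 0).mono_left nhdsWithin_le_nhds
    exact norm_le_zero_iff.1 (ge_of_tendsto h2 h1)

theorem eqOn_strip_of_real {h : ℝ} (hh : 0 < h) {f g : ℂ → ℂ}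
    (hf : DifferentiableOn ℂ f {W | -h < W.im ∧ W.im < h})
    (hg : DifferentiableOn ℂ g {W | -h < W.im ∧ W.im < h}) (hfg : ∀ t : ℝ, f t = g t) :
    EqOn f g {W | -h < W.im ∧ W.im < h} := by
  have ho := isOpen_strip (-h) h
  have hconv : Convex ℝ {W : ℂ | -h < W.im ∧ W.im < h} :=
    (convex_halfSpace_im_gt _).inter (convex_halfSpace_im_lt _)
  refine AnalyticOnNhd.eqOn_of_preconnected_of_frequently_eq
    (hf.analyticOnNhd ho) (hg.analyticOnNhd ho) hconv.isPreconnected (z₀ := 0) (by simp [hh]) ?_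
  have h1 : Tendsto (fun t : ℝ => (t : ℂ)) (𝓝[≠] 0) (𝓝[≠] 0) := by
    refine tendsto_nhdsWithin_iff.2 ⟨?_, ?_⟩
    · have := (Complex.continuous_ofReal.tendsto 0).mono_left (nhdsWithin_le_nhds (s := {0}ᶜ))
      simpa using this
    · filter_upwards [self_mem_nhdsWithin] with t ht
      simpa using ht
  exact h1.frequently (Eventually.of_forall hfg).frequently

/-! ### The universal function and the stretched exponential -/

section

variable {b : ℝ} (hb : 1 < b)

include hb

theorem exists_norm_slopeLog_le_re : ∃ C ≥ 0, ∀ ζ ∈ critDom b, ζ.re ≠ 0 →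
    ‖slopeLog b ζ‖ ≤ C * (1 + |ζ.re| ^ (-(1 / 2) : ℝ)) := by
  obtain ⟨C, hC, h⟩ := exists_norm_slopeLog_le hb
  refine ⟨2 * C, by positivity, fun ζ hζ h0 => (h ζ hζ).trans ?_⟩
  have h1 : ∀ z : ℂ, z.re = ζ.re → ‖z‖ ^ (-(1 / 2) : ℝ) ≤ |ζ.re| ^ (-(1 / 2) : ℝ) := by
    intro z hz
    refine Real.rpow_le_rpow_of_nonpos (abs_pos.2 h0) ?_ (by norm_num)
    rw [← hz]; exact Complex.abs_re_le_norm z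
  have h2 := h1 (ζ - π * I) (by simp)
  have h3 := h1 (ζ + π * I) (by simp)
  have : 0 ≤ |ζ.re| ^ (-(1 / 2) : ℝ) := by positivity
  nlinarith

/-- The bound for the universal function in the logarithmic variable. -/
theorem exists_norm_slope_exp_le : ∃ C ≥ 0, ∀ ζ : ℂ, 1 - Complex.exp ζ ∈ Complex.slitPlane →
    ζ.re ≠ 0 → ‖slope b (Complex.exp ζ)‖ ≤ C * (1 + |ζ.re| ^ (-(1 / 2) : ℝ)) := by
  obtain ⟨C, hC, h⟩ := exists_norm_slopeLog_le_re hb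
  have key : ∀ ζ : ℂ, -Complex.exp ζ ∈ Complex.slitPlane → ζ.re ≠ 0 →
      ‖slope b (Complex.exp ζ)‖ ≤ C * (1 + |ζ.re| ^ (-(1 / 2) : ℝ)) := by
    intro ζ hζ h0
    have hre : (Complex.log (-Complex.exp ζ)).re = ζ.re := by
      rw [Complex.log_re, norm_neg, Complex.norm_exp, Real.log_exp]
    have := h _ (mem_critDom_of_abs_lt hb (abs_lt.2 (log_mem_critStrip hζ))) (by rwa [hre])
    rwa [← slope_eq_slopeLog hb hζ, hre] at this
  refine ⟨C, hC, fun ζ hζ h0 => ?_⟩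
  by_cases h' : -Complex.exp ζ ∈ Complex.slitPlane
  · exact key ζ h' h0
  have hreal : 0 ≤ (Complex.exp ζ).re ∧ (Complex.exp ζ).im = 0 := by
    rw [Complex.mem_slitPlane_iff] at h'
    push Not at h'
    simpa using h'
  have hpos : 0 < (Complex.exp ζ).re := by
    refine lt_of_le_of_ne hreal.1 fun he => Complex.exp_ne_zero ζ (Complex.ext he.symm hreal.2)
  -- If exp ζ is real and positive, `slopeLog` at the principal logarithm is not available. Such
  -- points lie in the domain of analyticity of `slope`, so the bound passes to the limit from
  -- slightly larger arguments.
  have hc : Continuous fun ε : ℝ => ζ + ε * I := by fun_prop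
  have ht : Tendsto (fun ε : ℝ => ζ + ε * I) (𝓝[>] 0) (𝓝 ζ) := by
    have := (hc.tendsto 0).mono_left (nhdsWithin_le_nhds (s := Ioi 0))
    simpa using this
  have ht2 : Tendsto (fun ε : ℝ => ‖slope b (Complex.exp (ζ + ε * I))‖) (𝓝[>] 0)
      (𝓝 ‖slope b (Complex.exp ζ)‖) := by
    have h1 : ContinuousAt (fun z => slope b (Complex.exp z)) ζ :=
      ContinuousAt.comp (g := slope b) (differentiableAt_slope hb hζ).continuousAt
        Complex.continuous_exp.continuousAt
    exact (h1.tendsto.comp ht).norm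
  refine le_of_tendsto ht2 ?_
  have hev : ∀ᶠ ε : ℝ in 𝓝[>] (0 : ℝ), ε < 1 :=
    (eventually_lt_nhds one_pos).filter_mono nhdsWithin_le_nhds
  filter_upwards [self_mem_nhdsWithin, hev] with ε h1 h2
  have h1 : (0 : ℝ) < ε := h1
  have h3 := key (ζ + ε * I) ?_ (by simpa using h0)
  · simpa using h3
  · right
    rw [Complex.exp_add, Complex.neg_im, Complex.mul_im, hreal.2, zero_mul, add_zero,
      Complex.exp_ofReal_mul_I_im]
    have : 0 < Real.sin ε := Real.sin_pos_of_pos_of_lt_pi h1 (by linarith [Real.pi_gt_three])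
    exact neg_ne_zero.2 (mul_pos hpos this).ne'

/-- The real form of `critMap`, divided by `b - 1`. -/
theorem hasDerivAt_realMap (ν : ℝ) :
    HasDerivAt (fun ν : ℝ => ν / (b - 1) + Real.log ((b + Real.exp ν) / (b - 1)))
      (b * (1 + Real.exp ν) / ((b - 1) * (b + Real.exp ν))) ν := by
  have hb1 : 0 < b - 1 := by linarith
  have hx := Real.exp_pos ν
  have h1 : HasDerivAt (fun ν : ℝ => (b + Real.exp ν) / (b - 1)) (Real.exp ν / (b - 1)) ν :=
    ((Real.hasDerivAt_exp ν).const_add b).div_const _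
  have h2 := ((hasDerivAt_id ν).div_const (b - 1)).add (h1.log (by positivity))
  refine h2.congr_deriv ?_
  field_simp
  ring

theorem realMap_image : (fun ν : ℝ => ν / (b - 1) + Real.log ((b + Real.exp ν) / (b - 1))) '' univ =
    univ := by
  have hb1 : 0 < b - 1 := by linarith
  rw [image_univ, range_eq_univ]
  have hc : Continuous fun ν : ℝ => ν / (b - 1) + Real.log ((b + Real.exp ν) / (b - 1)) :=
    continuous_iff_continuousAt.2 fun ν => (hasDerivAt_realMap hb ν).continuousAt
  have hdiv : Tendsto (fun ν : ℝ => ν / (b - 1)) atTop atTop := tendsto_id.atTop_div_const hb1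
  have hdiv' : Tendsto (fun ν : ℝ => ν / (b - 1)) atBot atBot := tendsto_id.atBot_div_const hb1
  refine hc.surjective ?_ ?_
  · refine tendsto_atTop_mono (fun ν => ?_) hdiv
    have : 0 ≤ Real.log ((b + Real.exp ν) / (b - 1)) := Real.log_nonneg (by
      rw [one_le_div hb1]; linarith [Real.exp_pos ν])
    linarith
  · refine tendsto_atBot_mono' _ ?_ (tendsto_atBot_add_const_right _
      (Real.log ((b + 1) / (b - 1))) hdiv')
    filter_upwards [eventually_le_atBot 0] with ν hν
    have hx := Real.exp_pos ν
    have : Real.log ((b + Real.exp ν) / (b - 1)) ≤ Real.log ((b + 1) / (b - 1)) :=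
      Real.log_le_log (by positivity) (by
        have := Real.exp_le_one_iff.2 hν
        gcongr)
    linarith

theorem realMap_injOn :
    InjOn (fun ν : ℝ => ν / (b - 1) + Real.log ((b + Real.exp ν) / (b - 1))) univ := by
  have hb1 : 0 < b - 1 := by linarith
  refine (StrictMono.injective ?_).injOn
  intro x y hxy
  have hx := Real.exp_pos x
  have h1 : Real.log ((b + Real.exp x) / (b - 1)) ≤ Real.log ((b + Real.exp y) / (b - 1)) :=
    Real.log_le_log (by positivity) (by gcongr)
  have h2 : x / (b - 1) < y / (b - 1) := by gcongr
  simp only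
  linarith

theorem ofReal_realMap (ν : ℝ) : ((b - 1 : ℝ) : ℂ) *
    ((ν / (b - 1) + Real.log ((b + Real.exp ν) / (b - 1)) : ℝ) : ℂ) = critMap b ν := by
  have hb1 : 0 < b - 1 := by linarith
  have hx := Real.exp_pos ν
  have h1 : (0 : ℝ) ≤ (b + Real.exp ν) / (b - 1) := by positivity
  have h2 : ((b - 1 : ℝ) : ℂ) ≠ 0 := by exact_mod_cast hb1.ne'
  rw [critMap, Complex.ofReal_add, Complex.ofReal_log h1, mul_add, Complex.ofReal_div,
    mul_div_cancel₀ _ h2]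
  push_cast
  rfl

/-- The change of variables that relates the Laplace integral of `exp (-u ^ (1 / b))` to that of
the universal function. -/
theorem lap_stretched_ofReal (V : ℝ) :
    Complex.exp (((b - 1) * Real.log (b - 1) - b * Real.log b - (b - 1) * V : ℝ) : ℂ) *
      lap (fun l => Complex.exp (-Complex.exp (l / b))) 0
        (((b - 1) * Real.log (b - 1) - b * Real.log b - (b - 1) * V : ℝ) : ℂ) =
    Complex.exp V * lap (fun l => slopeLog b (((b - 1 : ℝ) : ℂ) * l)) 0 V := by
  have hb0 : 0 < b := by linarith
  have hb1 : 0 < b - 1 := by linarith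
  set W : ℝ := (b - 1) * Real.log (b - 1) - b * Real.log b - (b - 1) * V with hW
  -- Both integrals are parametrized by the real ν of the critical equation. This is log u as an
  -- affine function of ν.
  have hJ : ∀ F : ℝ → ℂ, ∫ t : ℝ, F t =
      ∫ ν : ℝ, (b / (b - 1)) • F (b * (V + Real.log (b / (b - 1)) + ν / (b - 1))) := by
    intro F
    have hd : ∀ ν : ℝ, HasDerivAt (fun ν : ℝ => b * (V + Real.log (b / (b - 1)) + ν / (b - 1)))
        (b / (b - 1)) ν := by
      intro ν
      refine ((((hasDerivAt_id ν).div_const (b - 1)).const_add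
        (V + Real.log (b / (b - 1)))).const_mul b).congr_deriv ?_
      ring
    have hinj : InjOn (fun ν : ℝ => b * (V + Real.log (b / (b - 1)) + ν / (b - 1))) univ := by
      intro x _ y _ hxy
      have h1 : x / (b - 1) = y / (b - 1) := by
        have := mul_left_cancel₀ hb0.ne' hxy
        linarith
      exact (div_left_inj' hb1.ne').1 h1
    have himg : (fun ν : ℝ => b * (V + Real.log (b / (b - 1)) + ν / (b - 1))) '' univ = univ := by
      rw [image_univ, range_eq_univ]
      intro y
      refine ⟨(b - 1) * (y / b - (V + Real.log (b / (b - 1)))), ?_⟩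
      field_simp
      ring
    have := integral_image_eq_integral_abs_deriv_smul MeasurableSet.univ
      (fun x _ => (hd x).hasDerivWithinAt) hinj F
    rwa [himg, Measure.restrict_univ, abs_of_pos (div_pos hb0 hb1)] at this
  -- This is log p as a function of ν, namely the real form of `critMap` divided by b - 1.
  have hA : ∀ F : ℝ → ℂ, ∫ t : ℝ, F t =
      ∫ ν : ℝ, (b * (1 + Real.exp ν) / ((b - 1) * (b + Real.exp ν))) •
        F (ν / (b - 1) + Real.log ((b + Real.exp ν) / (b - 1))) := by
    intro F
    have := integral_image_eq_integral_abs_deriv_smul MeasurableSet.univ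
      (fun x _ => (hasDerivAt_realMap hb x).hasDerivWithinAt) (realMap_injOn hb) F
    rw [realMap_image hb, Measure.restrict_univ] at this
    rw [this]
    congr 1
    ext ν
    have hx := Real.exp_pos ν
    rw [abs_of_pos (by positivity)]
  unfold lap
  rw [hJ fun t : ℝ => lapKer (Complex.exp W) (fun l => Complex.exp (-Complex.exp (l / b)))
      (t + (0 : ℝ) * I),
    hA fun t : ℝ => lapKer (Complex.exp V) (fun l => slopeLog b (((b - 1 : ℝ) : ℂ) * l))
      (t + (0 : ℝ) * I), ← integral_const_mul, ← integral_const_mul]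
  congr 1
  ext ν
  have hx := Real.exp_pos ν
  have hstrip : (ν : ℂ) ∈ critStrip := ⟨by simp [Real.pi_pos], by simp [Real.pi_pos]⟩
  simp only [lapKer, Complex.ofReal_zero, zero_mul, add_zero, ofReal_realMap hb,
    slopeLog_critMap hb hstrip, Complex.real_smul]
  have e1 : Real.exp (b * (V + Real.log (b / (b - 1)) + ν / (b - 1))) =
      Real.exp V * Real.exp (ν / (b - 1)) * Real.exp ν / (b - 1) / Real.exp W := by
    rw [eq_div_iff (Real.exp_pos _).ne', ← Real.exp_add, eq_div_iff hb1.ne', hW]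
    refine (congrArg _ (Real.exp_log hb1).symm).trans ?_
    rw [← Real.exp_add, ← Real.exp_add, ← Real.exp_add, Real.log_div hb0.ne' hb1.ne']
    congr 1
    field_simp
    ring
  have e2 : Real.exp (b * (V + Real.log (b / (b - 1)) + ν / (b - 1)) / b) =
      Real.exp V * (b / (b - 1)) * Real.exp (ν / (b - 1)) := by
    rw [mul_div_cancel_left₀ _ hb0.ne', Real.exp_add, Real.exp_add, Real.exp_log (by positivity)]
  have e3 : Real.exp (ν / (b - 1) + Real.log ((b + Real.exp ν) / (b - 1))) =
      Real.exp (ν / (b - 1)) * ((b + Real.exp ν) / (b - 1)) := by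
    rw [Real.exp_add, Real.exp_log (by positivity)]
  have hWp := Real.exp_pos W
  have key : Real.exp W * ((b / (b - 1)) * (Real.exp (-(Real.exp W *
        Real.exp (b * (V + Real.log (b / (b - 1)) + ν / (b - 1))))) *
      Real.exp (-Real.exp (b * (V + Real.log (b / (b - 1)) + ν / (b - 1)) / b)) *
      Real.exp (b * (V + Real.log (b / (b - 1)) + ν / (b - 1))))) =
      Real.exp V * ((b * (1 + Real.exp ν) / ((b - 1) * (b + Real.exp ν))) *
      (Real.exp (-(Real.exp V * Real.exp (ν / (b - 1) + Real.log ((b + Real.exp ν) / (b - 1))))) *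
      (Real.exp ν / (1 + Real.exp ν)) *
      Real.exp (ν / (b - 1) + Real.log ((b + Real.exp ν) / (b - 1))))) := by
    rw [e1, e2, e3, ← Real.exp_add (-_)]
    -- The phases agree: exp(W) u + u^(1/b) = exp(V) p. The remaining factors agree because
    -- exp(ν)/(1 + exp ν) is the ratio of exp(W) du to exp(V) dp.
    have e4 : -(Real.exp W * (Real.exp V * Real.exp (ν / (b - 1)) * Real.exp ν / (b - 1) /
        Real.exp W)) + -(Real.exp V * (b / (b - 1)) * Real.exp (ν / (b - 1))) =
        -(Real.exp V * (Real.exp (ν / (b - 1)) * ((b + Real.exp ν) / (b - 1)))) := by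
      field_simp
      ring
    rw [e4]
    field_simp
  have := congrArg (fun x : ℝ => (x : ℂ)) key
  push_cast at this ⊢
  exact this

end

/-! ### The branches of the Borel transform -/

/-- The constant `(b - 1) log (b - 1) - b log b`. -/
noncomputable def shiftConst (b : ℝ) : ℝ := (b - 1) * Real.log (b - 1) - b * Real.log b

/-- The universal function, with its branch point moved to `branchPt b σ 0 k`. -/
noncomputable def branchSlope (b : ℝ) (σ : ℤˣ) (k : ℕ) (l : ℂ) : ℂ :=
  slope b (Complex.exp (((b - 1 : ℝ) : ℂ) * (l - branchPt b σ 0 k)))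

/-- The Taylor coefficients of `slope b`. -/
noncomputable def slopeCoeff (b : ℝ) (j : ℕ) : ℂ :=
  if j = 0 then 0 else -((Real.exp (j * shiftConst b) * Real.Gamma (b * j + 1) /
    (j.factorial * Real.Gamma (j * (b - 1) + 1)) : ℝ) : ℂ)

theorem im_branchPt (b : ℝ) (σ : ℤˣ) (m : ℤ) (k : ℕ) : (branchPt b σ m k).im =
    (σ : ℤ) * ((2 - b) * π / (2 * (b - 1)) + 2 * π * m / (b - 1)) := by
  rw [branchPt, critLog, sLog]
  simp only [Complex.add_im, Complex.ofReal_im, Complex.im_ofReal_mul, Complex.I_im]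
  ring

theorem im_critLog (b : ℝ) (σ : ℤˣ) (m : ℤ) : (critLog b σ m).im =
    (σ : ℤ) * ((2 - b) * π / (2 * (b - 1)) + 2 * π * m / (b - 1)) := by
  rw [critLog, sLog]
  simp only [Complex.add_im, Complex.ofReal_im, Complex.im_ofReal_mul, Complex.I_im]
  ring

theorem re_branchPt (b : ℝ) (σ : ℤˣ) (m : ℤ) (k : ℕ) : (branchPt b σ m k).re =
    b / (b - 1) * Real.log k + (Real.log (2 * π * (1 - 1 / b)) + Real.log (2 * π / b) / (b -
        1)) := by
  rw [branchPt, critLog, sLog]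
  simp only [Complex.add_re, Complex.ofReal_re, Complex.re_ofReal_mul, Complex.I_re]
  ring

section

variable {b : ℝ} (hb : 1 < b)

include hb

theorem differentiableAt_slopeLog_mul {l : ℂ} (h : |l.im| < π / (b - 1)) :
    DifferentiableAt ℂ (fun l => slopeLog b (((b - 1 : ℝ) : ℂ) * l)) l := by
  have hb1 : 0 < b - 1 := by linarith
  have : |(((b - 1 : ℝ) : ℂ) * l).im| < π := by
    rw [Complex.im_ofReal_mul, abs_mul, abs_of_pos hb1, mul_comm]
    exact (lt_div_iff₀ hb1).1 h
  exact DifferentiableAt.comp l (g := slopeLog b)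
    (differentiableAt_slopeLog hb (mem_critDom_of_abs_lt hb this)) (by fun_prop)

theorem exists_norm_slopeLog_mul_le : ∃ C ≥ 0, ∀ l : ℂ, |l.im| < π / (b - 1) → l.re ≠ 0 →
    ‖slopeLog b (((b - 1 : ℝ) : ℂ) * l)‖ ≤ C * rayBound 0 0 l.re := by
  have hb1 : 0 < b - 1 := by linarith
  obtain ⟨C, hC, h⟩ := exists_norm_slopeLog_le_re hb
  refine ⟨C * (1 + (b - 1) ^ (-(1 / 2) : ℝ)), by positivity, fun l hl h0 => ?_⟩
  have h1 : |(((b - 1 : ℝ) : ℂ) * l).im| < π := by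
    rw [Complex.im_ofReal_mul, abs_mul, abs_of_pos hb1, mul_comm]
    exact (lt_div_iff₀ hb1).1 hl
  have h2 := h _ (mem_critDom_of_abs_lt hb h1) (by
    rw [Complex.re_ofReal_mul]; exact mul_ne_zero hb1.ne' h0)
  rw [Complex.re_ofReal_mul, abs_mul, abs_of_pos hb1, Real.mul_rpow hb1.le (abs_nonneg _)] at h2
  refine h2.trans ?_
  rw [mul_assoc]
  refine mul_le_mul_of_nonneg_left ?_ hC
  rw [rayBound, zero_mul, Real.exp_zero, sub_zero]
  have e1 := Real.exp_pos (-l.re / 2)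
  have e2 : 0 < (b - 1) ^ (-(1 / 2) : ℝ) := by positivity
  have e3 : 0 ≤ |l.re| ^ (-(1 / 2) : ℝ) := by positivity
  nlinarith [mul_pos e1 e2]

/-- The common continuation of the Laplace integrals of `exp (-u ^ (1 / b))` and of the universal
function. -/
theorem exists_common_continuation : ∃ S : ℂ → ℂ,
    (∀ W : ℂ, ∀ α : ℝ, |α| < π / (b - 1) → |W.im + α| < π / 2 →
      Complex.exp W * lap (fun l => slopeLog b (((b - 1 : ℝ) : ℂ) * l)) α W = S W) ∧
    ∀ Z : ℂ, ∀ α : ℝ, |α| ≤ b * π / 2 → |Z.im + α| < π / 2 →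
      Complex.exp Z * lap (fun l => Complex.exp (-Complex.exp (l / b))) α Z =
        S ((shiftConst b - Z) / ((b - 1 : ℝ) : ℂ)) := by
  have hb0 : 0 < b := by linarith
  have hb1 : 0 < b - 1 := by linarith
  have hπ := Real.pi_pos
  obtain ⟨C, hC, hA⟩ := exists_norm_slopeLog_mul_le hb
  have hYJ : ∀ l : ℂ, |l.im| ≤ b * π / 2 → ‖Complex.exp (-Complex.exp (l / b))‖ ≤ 1 := by
    intro l hl
    rw [Complex.norm_exp, Real.exp_le_one_iff, Complex.neg_re, Complex.exp_re, neg_nonpos]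
    refine mul_nonneg (Real.exp_pos _).le (Real.cos_nonneg_of_mem_Icc ?_)
    rw [Complex.div_ofReal_im]
    rw [abs_le] at hl
    constructor
    · rw [le_div_iff₀ hb0]; linarith
    · rw [div_le_iff₀ hb0]; linarith
  have hdJ : Differentiable ℂ fun l : ℂ => Complex.exp (-Complex.exp (l / b)) := by fun_prop
  obtain ⟨SA, hSAd, hSA⟩ := exists_continuation_lap (Y := fun l => slopeLog b (((b - 1 : ℝ) : ℂ) *
      l))
    (h := π / (b - 1)) (by positivity) le_rfl
    (fun l hl => (differentiableAt_slopeLog_mul hb (abs_lt.2 hl)).differentiableWithinAt)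
    (fun l h1 h2 h0 => hA l (abs_lt.2 ⟨h1, h2⟩) h0)
  have hbJ : ∀ l : ℂ, |l.im| ≤ b * π / 2 → ‖Complex.exp (-Complex.exp (l / b))‖ ≤
      1 * rayBound 0 0 l.re := fun l hl => by
    rw [one_mul]; exact (hYJ l hl).trans (one_le_rayBound le_rfl _ _)
  obtain ⟨SJ, hSJd, hSJ⟩ := exists_continuation_lap
    (Y := fun l : ℂ => Complex.exp (-Complex.exp (l / b)))
    (h := b * π / 2) (by positivity) le_rfl hdJ.differentiableOn
    (fun l h1 h2 _ => hbJ l (abs_le.2 ⟨h1.le, h2.le⟩))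
  -- On the real axis the change of variables gives equality. Both continuations live on matching
  -- strips, since (b - 1)(π/(b - 1) + π/2) = bπ/2 + π/2, so they agree throughout.
  have hSS := eqOn_strip_of_real (h := b * π / 2 + π / 2) (by positivity) hSJd
    (g := fun Z => SA ((shiftConst b - Z) / ((b - 1 : ℝ) : ℂ))) (by
      refine hSAd.comp (by fun_prop) ?_
      intro Z hZ
      have e : ((shiftConst b - Z) / ((b - 1 : ℝ) : ℂ)).im = -Z.im / (b - 1) := by
        rw [Complex.div_ofReal_im]; simp
      have e1 : π / (b - 1) + π / 2 = (b * π / 2 + π / 2) / (b - 1) := by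
        field_simp; ring
      show -(π / (b - 1) + π / 2) < _ ∧ _ < π / (b - 1) + π / 2
      rw [e, e1, ← neg_div]
      obtain ⟨h1, h2⟩ := hZ
      constructor
      · gcongr
      · gcongr; linarith)
    (fun t => by
      rw [hSJ t 0 ⟨neg_lt_zero.2 (by positivity), by positivity⟩
        (by rw [Complex.ofReal_im, add_zero, abs_zero]; positivity)]
      have e : (shiftConst b - t : ℂ) / ((b - 1 : ℝ) : ℂ) =
          (((shiftConst b - t) / (b - 1) : ℝ) : ℂ) := by push_cast; rfl
      simp only [e]
      rw [hSA _ 0 ⟨neg_lt_zero.2 (by positivity), by positivity⟩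
        (by rw [Complex.ofReal_im, add_zero, abs_zero]; positivity),
        ← lap_stretched_ofReal hb]
      have e2 : (b - 1) * Real.log (b - 1) - b * Real.log b -
          (b - 1) * ((shiftConst b - t) / (b - 1)) = t := by
        rw [mul_div_cancel₀ _ hb1.ne', shiftConst]; ring
      rw [e2])
  refine ⟨SA, fun W α h1 h2 => (hSA W α (abs_lt.1 h1) h2).symm, fun Z α h1 h2 => ?_⟩
  have hα := abs_le.1 h1
  have h2' := abs_lt.1 h2
  have hSS' : SJ Z = SA ((shiftConst b - Z) / ((b - 1 : ℝ) : ℂ)) :=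
    hSS (show _ ∧ _ from ⟨by linarith, by linarith⟩)
  rw [← hSS']
  -- On the edges |α| = bπ/2 the function exp(-u^(1/b)) is purely oscillating. They are reached as
  -- boundary values from (1 - δ)α, with δ small enough to keep the direction admissible.
  set ε : ℝ := (π / 2 - |Z.im + α|) / (b * π) with hε
  have hε0 : 0 < ε := by
    have : 0 < π / 2 - |Z.im + α| := by linarith
    positivity
  have hε2 : ε * (b * π) = π / 2 - |Z.im + α| := by rw [hε]; field_simp
  set δ := min ε (1 / 2) with hδ
  have hδ0 : 0 < δ := lt_min hε0 (by norm_num)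
  have hδ1 : δ ≤ 1 / 2 := min_le_right _ _
  have hδ2 : δ * (b * π) ≤ π / 2 - |Z.im + α| := by
    rw [← hε2]; gcongr; exact min_le_left _ _
  have hbp : 0 < b * π := by positivity
  have habs := abs_le.1 (le_refl |Z.im + α|)
  have hα' : (1 - δ) * α ∈ Ioo (-(b * π / 2)) (b * π / 2) := by
    constructor
    · rcases le_total 0 α with h | h
      · nlinarith [mul_nonneg (by linarith : 0 ≤ 1 - δ) h]
      · nlinarith
    · rcases le_total 0 α with h | h
      · nlinarith
      · nlinarith [mul_nonneg (by linarith : 0 ≤ 1 - δ) (neg_nonneg.2 h)]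
  have hα'' : |Z.im + (1 - δ) * α| < π / 2 := by
    rw [abs_lt]
    constructor <;> nlinarith
  rw [hSJ Z _ hα' hα'']
  congr 1
  symm
  refine lap_eq_boundary_of_le (C := 1) (a := 0) (t₀ := 0) le_rfl hdJ.differentiableOn
    (fun l h1 h2 _ => hbJ l (abs_le.2 ⟨h1.le, h2.le⟩)) hα' hα hα'' h2 fun t _ => ?_
  have : Continuous fun γ : ℝ => Complex.exp (-Complex.exp ((t + γ * I) / b)) := by fun_prop
  exact (this.tendsto α).mono_left nhdsWithin_le_nhds

omit hb in
theorem units_cast_cases (σ : ℤˣ) : ((σ : ℤ) : ℝ) = 1 ∨ ((σ : ℤ) : ℝ) = -1 := by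
  rcases Int.units_eq_one_or σ with rfl | rfl <;> simp

/-- In the sector next to the positive real direction, the branch is that of `slopeLog`. -/
theorem branchSlope_eq_slopeLog (σ : ℤˣ) (k : ℕ) {l : ℂ}
    (h0 : (σ : ℤ) * ((b - 1) * (l.im - (branchPt b σ 0 k).im)) < 0)
    (h1 : -(2 * π) < (σ : ℤ) * ((b - 1) * (l.im - (branchPt b σ 0 k).im))) :
    branchSlope b σ k l = slopeLog b (((b - 1 : ℝ) : ℂ) *
      (l - (branchPt b σ 0 k - (((σ : ℤ) * (π / (b - 1)) : ℝ) : ℂ) * I))) := by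
  have hb1 : 0 < b - 1 := by linarith
  have hbC : (b : ℂ) - 1 ≠ 0 := by exact_mod_cast hb1.ne'
  have him : (((b - 1 : ℝ) : ℂ) * (l - branchPt b σ 0 k)).im =
    (b - 1) * (l.im - (branchPt b σ 0 k).im) := by rw [Complex.im_ofReal_mul, Complex.sub_im]
  rw [branchSlope]
  rcases Int.units_eq_one_or σ with rfl | rfl
  · simp only [Units.val_one, Int.cast_one, one_mul] at h0 h1 ⊢
    rw [slope_exp_of_neg hb (by rw [him]; exact h0) (by rw [him]; exact h1)]
    congr 1
    push_cast
    field_simp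
    ring
  · simp only [Units.val_neg, Units.val_one, Int.cast_neg, Int.cast_one,
      neg_mul, one_mul] at h0 h1 ⊢
    rw [slope_exp_of_pos hb (by rw [him]; linarith) (by rw [him]; linarith)]
    congr 1
    push_cast
    field_simp
    ring

/-- The Laplace integral of an oscillating exponential, as a Laplace integral in the critical
variable. -/
theorem lap_oscillating_eq (σ : ℤˣ) {k : ℕ} (hk : 1 ≤ k) {Z : ℂ} (hZ : |Z.im| < π / 2) {β : ℝ}
    (h0 : (σ : ℤ) * ((b - 1) * (β - (branchPt b σ 0 k).im)) < 0)
    (h1 : -(2 * π) < (σ : ℤ) * ((b - 1) * (β - (branchPt b σ 0 k).im)))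
    (hβ : |β - Z.im / (b - 1)| < π / 2) :
    Complex.exp Z * lap (fun l => Complex.exp (2 * π * I * (σ : ℤ) * k * Complex.exp (l / b))) 0 Z =
      Complex.exp (-(Z / ((b - 1 : ℝ) : ℂ))) *
        lap (branchSlope b σ k) β (-(Z / ((b - 1 : ℝ) : ℂ))) := by
  have hb0 : 0 < b := by linarith
  have hb1 : 0 < b - 1 := by linarith
  have hbC : (b : ℂ) - 1 ≠ 0 := by exact_mod_cast hb1.ne'
  have hbC0 : (b : ℂ) ≠ 0 := by exact_mod_cast hb0.ne'
  have hπ := Real.pi_pos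
  have hk0 : (0 : ℝ) < k := by exact_mod_cast hk
  obtain ⟨S, hSA, hSJ⟩ := exists_common_continuation hb
  -- This translation satisfies exp(-lamJ/b) = -2πiσk, so it turns exp(-u^(1/b)) into exp(2πiσk
  -- u^(1/b)). The companion `lamA` places the universal branch in the sector before its cut m = 0.
  set lamJ : ℂ := ((-(b * Real.log (2 * π * k)) : ℝ) : ℂ) + (((σ : ℤ) * (b * π / 2) : ℝ) : ℂ) * I
    with hlamJ
  set lamA : ℂ := branchPt b σ 0 k - (((σ : ℤ) * (π / (b - 1)) : ℝ) : ℂ) * I with hlamA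
  have hJim : lamJ.im = (σ : ℤ) * (b * π / 2) := by
    rw [hlamJ, Complex.add_im, Complex.im_ofReal_mul, Complex.I_im, mul_one, Complex.ofReal_im,
      zero_add]
  have hAim : lamA.im = (branchPt b σ 0 k).im - (σ : ℤ) * (π / (b - 1)) := by
    rw [hlamA, Complex.sub_im, Complex.im_ofReal_mul, Complex.I_im, mul_one]
  have hσ := units_cast_cases σ
  have e1 : (fun l => Complex.exp (2 * π * I * (σ : ℤ) * k * Complex.exp (l / b))) =
      fun l => (fun l => Complex.exp (-Complex.exp (l / b))) (l - lamJ) := by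
    funext l
    simp only
    congr 1
    have e2 : Complex.exp (-(lamJ / b)) = 2 * π * k * (-((σ : ℤ) * I)) := by
      have e3 : -(lamJ / b) = (Real.log (2 * π * k) : ℂ) + -((((σ : ℤ) * (π / 2) : ℝ) : ℂ) * I) :=
          by
        rw [hlamJ]; push_cast; field_simp; ring
      rw [e3, Complex.exp_add, ← Complex.ofReal_exp, Real.exp_log (by positivity)]
      push_cast
      congr 1
      rcases Int.units_eq_one_or σ with rfl | rfl
      · simp [Complex.exp_neg, Complex.exp_pi_div_two_mul_I]
      · simp [Complex.exp_pi_div_two_mul_I]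
    rw [sub_div, sub_eq_add_neg, Complex.exp_add, e2]
    ring
  rw [e1, lap_translate (fun l => Complex.exp (-Complex.exp (l / b))), hSJ]
  · have e4 : lap (branchSlope b σ k) β (-(Z / ((b - 1 : ℝ) : ℂ))) =
        lap (fun l => (fun l => slopeLog b (((b - 1 : ℝ) : ℂ) * l)) (l - lamA)) β
          (-(Z / ((b - 1 : ℝ) : ℂ))) := by
      unfold lap
      congr 1
      ext t
      rw [lapKer, lapKer, branchSlope_eq_slopeLog hb σ k (by simpa using h0) (by simpa using h1)]
    rw [e4, lap_translate (fun l => slopeLog b (((b - 1 : ℝ) : ℂ) * l)), hSA]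
    · congr 1
      -- The modulus of the branch point is exactly the one that makes the two translations
      -- correspond under Z ↦ (shiftConst b - Z)/(b - 1).
      have e5 : ((Real.log (2 * π * k) * b + shiftConst b : ℝ) : ℂ) =
          (((b - 1) * (branchPt b σ 0 k).re : ℝ) : ℂ) := by
        congr 1
        have h1b : 1 - 1 / b = (b - 1) / b := by field_simp
        rw [re_branchPt, shiftConst, Real.log_mul (x := 2 * π) (by positivity) hk0.ne', h1b,
          Real.log_mul (x := 2 * π) (y := (b - 1) / b) (by positivity) (by positivity),
              Real.log_div hb1.ne' hb0.ne',
          Real.log_div (by positivity) hb0.ne']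
        field_simp
        ring
      have e6 : branchPt b σ 0 k = ((branchPt b σ 0 k).re : ℂ) +
          (((σ : ℤ) * ((2 - b) * π / (2 * (b - 1))) : ℝ) : ℂ) * I := by
        have := (Complex.re_add_im (branchPt b σ 0 k)).symm
        rw [im_branchPt] at this
        simpa using this
      rw [hlamA, e6, hlamJ, div_eq_iff (by exact_mod_cast hb1.ne')]
      push_cast at e5 ⊢
      field_simp
      linear_combination 2 * e5
    · rw [hAim]
      rw [lt_div_iff₀ hb1, ← abs_of_pos hb1, ← abs_mul, abs_of_pos hb1]
      have e7 : (β - ((branchPt b σ 0 k).im - (σ : ℤ) * (π / (b - 1)))) * (b - 1) =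
          (b - 1) * (β - (branchPt b σ 0 k).im) + (σ : ℤ) * π := by field_simp; ring
      rw [e7, abs_lt]
      rcases hσ with h | h <;> rw [h] at h0 h1 ⊢ <;> constructor <;> linarith
    · have e8 : (-(Z / ((b - 1 : ℝ) : ℂ)) + lamA).im + (β - lamA.im) = β - Z.im / (b - 1) := by
        rw [Complex.add_im, Complex.neg_im, Complex.div_ofReal_im]; ring
      rwa [e8]
  · rw [hJim]
    have : |((σ : ℤ) : ℝ)| = 1 := by rcases hσ with h | h <;> rw [h] <;> simp
    rw [zero_sub, abs_neg, abs_mul, this, one_mul, abs_of_pos (by positivity)]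
  · rw [Complex.add_im]
    have : Z.im + lamJ.im + (0 - lamJ.im) = Z.im := by ring
    rwa [this]

end

/-! ### Bounds away from the cut -/

/-- For y ≤ 1 this is Taylor's formula; for y ≥ 1 the exponential and every term of degree below N
are at most y^N in modulus. -/
theorem exists_norm_exp_neg_sub_le (N : ℕ) : ∃ C ≥ 0, ∀ y : ℝ, 0 ≤ y →
    ‖Complex.exp (-y) - ∑ i ∈ Finset.range N, (-(y : ℂ)) ^ i / i.factorial‖ ≤ C * y ^ N := by
  refine ⟨1 + N + Real.exp 1, by positivity, fun y hy => ?_⟩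
  rcases le_total y 1 with h | h
  · have h1 := Complex.norm_exp_sub_sum_le_norm_mul_exp (-(y : ℂ)) N
    rw [norm_neg, Complex.norm_real, Real.norm_of_nonneg hy] at h1
    refine h1.trans ?_
    rw [mul_comm]
    have : Real.exp y ≤ Real.exp 1 := Real.exp_le_exp.2 h
    have hN : (0 : ℝ) ≤ N := by positivity
    gcongr
    linarith
  · have h1 : ‖Complex.exp (-(y : ℂ))‖ ≤ 1 := by
      rw [Complex.norm_exp, Real.exp_le_one_iff]; simpa using hy
    have h2 : ‖∑ i ∈ Finset.range N, (-(y : ℂ)) ^ i / i.factorial‖ ≤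
        ∑ i ∈ Finset.range N, y ^ N := by
      refine norm_sum_le_of_le _ fun i hi => ?_
      rw [norm_div, norm_pow, norm_neg, Complex.norm_real, Real.norm_of_nonneg hy,
        Complex.norm_natCast]
      refine (div_le_self (by positivity) ?_).trans
        (pow_le_pow_right₀ h (Finset.mem_range.1 hi).le)
      exact_mod_cast Nat.one_le_iff_ne_zero.2 (Nat.factorial_ne_zero i)
    rw [Finset.sum_const, Finset.card_range, nsmul_eq_mul] at h2
    have h3 := norm_sub_le (Complex.exp (-(y : ℂ)))
      (∑ i ∈ Finset.range N, (-(y : ℂ)) ^ i / i.factorial)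
    have h4 : 1 ≤ y ^ N := one_le_pow₀ h
    have := Real.exp_pos 1
    nlinarith

section

variable {b : ℝ} (hb : 1 < b)

include hb

/-- The expansion at zero of the Laplace integral of `exp (-u ^ (1 / b))`. -/
theorem exists_norm_lap_stretched_sub_le (N : ℕ) : ∃ C : ℝ, ∀ w : ℝ, 0 < w →
    ‖Complex.exp (Real.log w) * lap (fun l => Complex.exp (-Complex.exp (l / b))) 0 (Real.log w) -
      ∑ i ∈ Finset.range N, (-1) ^ i * (Real.Gamma (b * (i + 1 : ℕ) + 1) : ℂ) /
        ((i + 1).factorial : ℂ) * (w : ℂ) ^ (i + 1)‖ ≤ C * w ^ (N + 1) := by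
  have hb0 : 0 < b := by linarith
  have hbC : (b : ℂ) ≠ 0 := by exact_mod_cast hb0.ne'
  obtain ⟨C, hC, hexp⟩ := exists_norm_exp_neg_sub_le N
  refine ⟨b * C * Real.Gamma ((N * b + (b - 1)) + 1), fun w hw => ?_⟩
  -- The substitution u = p^b exchanges the roles: exp(-u^(1/b)) becomes the Laplace kernel exp(-p),
  -- and exp(-wu) = exp(-w p^b) becomes the function to be expanded in powers of w.
  set Y : ℂ → ℂ := fun l => b * Complex.exp ((b - 1) * l) * Complex.exp (-(w * Complex.exp (b * l)))
    with hY
  have hlog : Complex.exp (Real.log w) = w := by rw [← Complex.ofReal_exp, Real.exp_log hw]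
  have h1 : lap (fun l => Complex.exp (-Complex.exp (l / b))) 0 (Real.log w) = lap Y 0 0 := by
    have h := Measure.integral_comp_mul_left (fun t : ℝ => lapKer (Complex.exp (Real.log w))
      (fun l => Complex.exp (-Complex.exp (l / b))) (t + (0 : ℝ) * I)) b
    rw [abs_of_pos (inv_pos.2 hb0), eq_comm, inv_smul_eq_iff₀ hb0.ne', ← integral_smul] at h
    rw [lap, h, lap]
    congr 1
    ext t
    simp only [lapKer, hY, hlog, Complex.real_smul, Complex.ofReal_zero, zero_mul, add_zero,
      Complex.exp_zero, one_mul]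
    have e1 : ((b * t : ℝ) : ℂ) / b = t := by push_cast; field_simp
    rw [e1]
    have e2 : Complex.exp ((b * t : ℝ) : ℂ) = Complex.exp ((b - 1) * t) * Complex.exp t := by
      rw [← Complex.exp_add]; congr 1; push_cast; ring
    have e3 : Complex.exp (b * t) = Complex.exp ((b * t : ℝ) : ℂ) := by push_cast; rfl
    rw [e3]
    nth_rewrite 2 [e2]
    ring
  have hcont : Continuous fun t : ℝ => Y (t + (0 : ℝ) * I) := by
    simp only [hY]; fun_prop
  have hYr : ∀ t : ℝ, Y (t + (0 : ℝ) * I) = ((b * Real.exp ((b - 1) * t) : ℝ) : ℂ) *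
      Complex.exp (-((w * Real.exp (b * t) : ℝ) : ℂ)) := by
    intro t; simp [hY]
  have h0 : |(0 : ℂ).im + 0| < π / 2 := by simp; positivity
  have h2 := norm_lap_sub_le (Y := Y) (β := 0) (W := 0) (a := N * b + (b - 1)) (C := b * C * w ^ N)
    (Finset.range N) (fun i => b * (-(w : ℂ)) ^ i / i.factorial) (fun i => i * b + (b - 1))
    (by have : (0 : ℝ) ≤ N * b := by positivity
        linarith)
    (fun i _ => by have : (0 : ℝ) ≤ i * b := by positivity
                   linarith) h0
    (integrable_lapKer (C := b) (a := b - 1) (t₀ := 0) (by linarith) (by simp) hcont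
      (fun t _ => by
        rw [hYr, norm_mul, Complex.norm_real, Real.norm_of_nonneg (by positivity), mul_assoc]
        refine mul_le_mul_of_nonneg_left ?_ hb0.le
        have e1 : ‖Complex.exp (-((w * Real.exp (b * t) : ℝ) : ℂ))‖ ≤ 1 := by
          rw [Complex.norm_exp, Real.exp_le_one_iff, Complex.neg_re, Complex.ofReal_re, neg_nonpos]
          positivity
        have e2 : 0 ≤ |t - 0| ^ (-(1 / 2) : ℝ) := by positivity
        have e3 := Real.exp_pos (-t / 2)
        have e4 := Real.exp_pos ((b - 1) * t)
        rw [rayBound]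
        nlinarith))
    (fun t => by
      have hy : 0 ≤ w * Real.exp (b * t) := by positivity
      have h3 := hexp _ hy
      have e1 : ∑ i ∈ Finset.range N, (b * (-(w : ℂ)) ^ i / i.factorial) *
          Complex.exp ((i * b + (b - 1) : ℝ) * (t + (0 : ℝ) * I)) =
          ((b * Real.exp ((b - 1) * t) : ℝ) : ℂ) *
          ∑ i ∈ Finset.range N, (-((w * Real.exp (b * t) : ℝ) : ℂ)) ^ i / i.factorial := by
        rw [Finset.mul_sum]
        refine Finset.sum_congr rfl fun i _ => ?_
        have e2 : Complex.exp ((i * b + (b - 1) : ℝ) * (t + (0 : ℝ) * I)) =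
            Complex.exp ((b - 1) * t) * Complex.exp (b * t) ^ i := by
          rw [← Complex.exp_nat_mul, ← Complex.exp_add]; congr 1; push_cast; ring
        rw [e2]
        push_cast
        rw [← neg_mul, mul_pow]
        ring
      rw [hYr, e1, ← mul_sub, norm_mul, Complex.norm_real, Real.norm_of_nonneg (by positivity)]
      refine (mul_le_mul_of_nonneg_left h3 (by positivity)).trans (le_of_eq ?_)
      rw [add_mul, Real.exp_add, mul_pow, ← Real.exp_nat_mul]
      ring_nf)
  rw [Complex.exp_zero, one_mul] at h2
  simp only [Complex.zero_re, Complex.zero_im, add_zero, Real.cos_zero, Real.one_rpow, mul_zero,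
    Real.exp_zero, mul_one, neg_zero, Complex.exp_zero] at h2
  rw [h1, hlog]
  have e3 : (w : ℂ) * lap Y 0 0 - ∑ i ∈ Finset.range N,
      (-1) ^ i * (Real.Gamma (b * (i + 1 : ℕ) + 1) : ℂ) / ((i + 1).factorial : ℂ) *
        (w : ℂ) ^ (i + 1) = w * (lap Y 0 0 - ∑ i ∈ Finset.range N,
          (b * (-(w : ℂ)) ^ i / i.factorial) * (Real.Gamma (i * b + (b - 1) + 1) : ℂ)) := by
    rw [mul_sub, Finset.mul_sum]
    congr 1
    refine Finset.sum_congr rfl fun i _ => ?_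
    have hi : (0 : ℝ) < b * (i + 1 : ℕ) := by positivity
    rw [Real.Gamma_add_one hi.ne', Nat.factorial_succ,
      show (i : ℝ) * b + (b - 1) + 1 = b * (i + 1 : ℕ) by push_cast; ring]
    have hf : (i.factorial : ℂ) ≠ 0 := by exact_mod_cast Nat.factorial_ne_zero i
    have hi1 : (i : ℂ) + 1 ≠ 0 := by exact_mod_cast Nat.succ_ne_zero i
    push_cast
    rw [neg_pow (w : ℂ), pow_succ]
    field_simp
  rw [e3, norm_mul, Complex.norm_real, Real.norm_of_nonneg hw.le]
  refine (mul_le_mul_of_nonneg_left h2 hw.le).trans (le_of_eq ?_)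
  ring

/-- The universal function is bounded away from the positive real axis. -/
theorem exists_norm_slope_exp_le_of_le {η : ℝ} (hη : 0 < η) : ∃ C ≥ 0, ∀ ζ : ℂ,
    (∀ n : ℤ, η ≤ |ζ.im - 2 * π * n|) → ‖slope b (Complex.exp ζ)‖ ≤ C := by
  obtain ⟨C, hC, h⟩ := exists_norm_slopeLog_le hb
  refine ⟨C * (1 + η ^ (-(1 / 2) : ℝ) + η ^ (-(1 / 2) : ℝ)), by positivity, fun ζ hζ => ?_⟩
  have hsl : -Complex.exp ζ ∈ Complex.slitPlane := by
    by_contra hcon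
    rw [Complex.mem_slitPlane_iff] at hcon
    push Not at hcon
    simp only [Complex.neg_re, Complex.neg_im, neg_eq_zero, Left.neg_nonpos_iff] at hcon
    have h1 : Complex.exp ζ = Complex.exp (Real.log (Complex.exp ζ).re) := by
      have h2 : 0 < (Complex.exp ζ).re := lt_of_le_of_ne hcon.1
        fun he => Complex.exp_ne_zero ζ (Complex.ext he.symm hcon.2)
      rw [← Complex.ofReal_exp, Real.exp_log h2]
      exact Complex.ext rfl (by simp [hcon.2])
    obtain ⟨n, hn⟩ := Complex.exp_eq_exp_iff_exists_int.1 h1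
    have h3 := hζ n
    have h4 : ζ.im - 2 * π * n = 0 := by
      rw [hn]; simp; ring
    rw [h4, abs_zero] at h3
    linarith
  rw [slope_eq_slopeLog hb hsl]
  set μ := Complex.log (-Complex.exp ζ) with hμ
  have h1 : Complex.exp μ = Complex.exp (ζ + π * I) := by
    rw [hμ, Complex.exp_log (neg_ne_zero.2 (Complex.exp_ne_zero _)), Complex.exp_add,
      Complex.exp_pi_mul_I]
    ring
  obtain ⟨n, hn⟩ := Complex.exp_eq_exp_iff_exists_int.1 h1
  have him : μ.im = ζ.im + π + 2 * π * n := by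
    rw [hn]; simp; ring
  have key : ∀ z : ℂ, η ≤ |z.im| → ‖z‖ ^ (-(1 / 2) : ℝ) ≤ η ^ (-(1 / 2) : ℝ) := fun z hz =>
    Real.rpow_le_rpow_of_nonpos hη (hz.trans (Complex.abs_im_le_norm z)) (by norm_num)
  refine (h μ (mem_critDom_of_abs_lt hb (abs_lt.2 (log_mem_critStrip hsl)))).trans ?_
  have k1 := key (μ - π * I) (by
    have := hζ (-n)
    convert this using 2
    simp [him]
    ring)
  have k2 := key (μ + π * I) (by
    have := hζ (-(n + 1))
    convert this using 2
    simp [him]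
    ring)
  exact mul_le_mul_of_nonneg_left (by linarith) hC

/-- Near ξ = 0 this is the analytic remainder. For |ξ| ≥ ρ the function is bounded away from the
positive axis and every lower power is dominated by |ξ|^N, so the estimate becomes global, as
Watson's lemma needs. -/
theorem exists_norm_slope_sub_partialSum_le {p : FormalMultilinearSeries ℂ ℂ ℂ}
    (hp : HasFPowerSeriesAt (slope b) p 0) {η : ℝ} (hη : 0 < η) (N : ℕ) : ∃ C ≥ 0, ∀ ζ : ℂ,
    (∀ n : ℤ, η ≤ |ζ.im - 2 * π * n|) →
      ‖slope b (Complex.exp ζ) - ∑ j ∈ Finset.range N, p.coeff j * Complex.exp (j * ζ)‖ ≤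
        C * Real.exp (N * ζ.re) := by
  obtain ⟨C₁, hC₁, h1⟩ := exists_norm_slope_exp_le_of_le hb hη
  obtain ⟨C₂, h2⟩ := (hp.isBigO_sub_partialSum_pow N).bound
  obtain ⟨ρ, hρ, h3⟩ := Metric.eventually_nhds_iff.1 h2
  set K : ℝ := ∑ j ∈ Finset.range N, ‖p.coeff j‖ * ρ ^ ((j : ℝ) - N) with hK
  have hK0 : 0 ≤ K := Finset.sum_nonneg fun j _ => by positivity
  refine ⟨max C₂ (C₁ * ρ ^ (-(N : ℝ)) + K), le_max_of_le_right (by positivity), fun ζ hζ => ?_⟩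
  have hsum : ∀ ξ : ℂ, p.partialSum N ξ = ∑ j ∈ Finset.range N, p.coeff j * ξ ^ j := by
    intro ξ
    rw [FormalMultilinearSeries.partialSum]
    refine Finset.sum_congr rfl fun j _ => ?_
    rw [FormalMultilinearSeries.apply_eq_pow_smul_coeff, smul_eq_mul, mul_comm]
  have hexp : ∀ j : ℕ, Complex.exp (j * ζ) = Complex.exp ζ ^ j := fun j => Complex.exp_nat_mul _ _
  have hre : Real.exp (N * ζ.re) = ‖Complex.exp ζ‖ ^ N := by
    rw [Complex.norm_exp, Real.exp_nat_mul]
  have hx : 0 < ‖Complex.exp ζ‖ := norm_pos_iff.2 (Complex.exp_ne_zero _)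
  simp_rw [hexp]
  rw [hre]
  rcases lt_or_ge ‖Complex.exp ζ‖ ρ with h | h
  · have h4 := h3 (y := Complex.exp ζ) (by simpa using h)
    rw [zero_add, hsum, norm_pow, norm_norm] at h4
    refine h4.trans ?_
    gcongr
    exact le_max_left _ _
  · have hkey : ∀ j : ℕ, j ≤ N → ‖Complex.exp ζ‖ ^ j ≤
        ρ ^ ((j : ℝ) - N) * ‖Complex.exp ζ‖ ^ N := by
      intro j hj
      have h5 : ‖Complex.exp ζ‖ ^ j = ‖Complex.exp ζ‖ ^ ((j : ℝ) - N) * ‖Complex.exp ζ‖ ^ N := by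
        rw [← Real.rpow_natCast, ← Real.rpow_natCast, ← Real.rpow_add hx, sub_add_cancel]
      rw [h5]
      refine mul_le_mul_of_nonneg_right ?_ (by positivity)
      refine Real.rpow_le_rpow_of_nonpos hρ h ?_
      have : (j : ℝ) ≤ N := by exact_mod_cast hj
      linarith
    have h5 : ‖∑ j ∈ Finset.range N, p.coeff j * Complex.exp ζ ^ j‖ ≤ K * ‖Complex.exp ζ‖ ^ N := by
      rw [hK, Finset.sum_mul]
      refine norm_sum_le_of_le _ fun j hj => ?_
      rw [norm_mul, norm_pow, mul_assoc]
      exact mul_le_mul_of_nonneg_left (hkey j (Finset.mem_range.1 hj).le) (norm_nonneg _)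
    have h6 := hkey 0 (Nat.zero_le _)
    rw [pow_zero, Nat.cast_zero, zero_sub] at h6
    have h7 := norm_sub_le (slope b (Complex.exp ζ))
      (∑ j ∈ Finset.range N, p.coeff j * Complex.exp ζ ^ j)
    have h8 := h1 ζ hζ
    have h9 := le_max_right C₂ (C₁ * ρ ^ (-(N : ℝ)) + K)
    have h10 : 0 < ‖Complex.exp ζ‖ ^ N := by positivity
    nlinarith [mul_le_mul_of_nonneg_left h6 hC₁, mul_le_mul_of_nonneg_right h9 h10.le]

end

/-! ### The Taylor expansion of the universal function -/

section

variable {b : ℝ} (hb : 1 < b)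

include hb

/-- The same integral is expanded twice as w → 0: directly, by expanding exp(-w p^b), and by
Watson's lemma applied to its Laplace representation with density `slope`. Uniqueness of asymptotic
coefficients replaces Lagrange inversion. -/
theorem coeff_eq_slopeCoeff {p : FormalMultilinearSeries ℂ ℂ ℂ}
    (hp : HasFPowerSeriesAt (slope b) p 0) (j : ℕ) : p.coeff j = slopeCoeff b j := by
  have hb0 : 0 < b := by linarith
  have hb1 : 0 < b - 1 := by linarith
  have hb1C : ((b - 1 : ℝ) : ℂ) ≠ 0 := by exact_mod_cast hb1.ne'
  have hπ := Real.pi_pos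
  obtain ⟨S, hSA, hSJ⟩ := exists_common_continuation hb
  obtain ⟨C₀, hC₀, hA⟩ := exists_norm_slopeLog_mul_le hb
  -- Watson's lemma turns p^(j(b-1)) into Γ(j(b-1)+1) X^(-j(b-1)), and X^(-(b-1)) is exp(-shiftConst
  -- b) w. The sign (-1)^j enters because the density is `slope` at -p^(b-1).
  set G : ℕ → ℂ := fun j => (-1) ^ j * ((Real.Gamma (j * (b - 1) + 1) : ℝ) : ℂ) *
    Complex.exp (-(j * shiftConst b)) with hG
  set T : ℕ → ℂ := fun j => if j = 0 then 0 else
    -((-1) ^ j * (Real.Gamma (b * j + 1) : ℂ) / (j.factorial : ℂ)) with hT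
  have h0 := eq_zero_of_asymptotic (c := fun j => p.coeff j * G j - T j) (fun N => by
    obtain ⟨C₁, hC₁⟩ := exists_norm_lap_stretched_sub_le hb N
    obtain ⟨C₂, hC₂, h2⟩ := exists_norm_slope_sub_partialSum_le hb hp hπ (N + 1)
    refine ⟨C₂ * Real.Gamma ((N + 1) * (b - 1) + 1) * Real.exp (-((N + 1) * shiftConst b)) + C₁, ?_⟩
    filter_upwards [self_mem_nhdsWithin] with w hw
    have hw : (0 : ℝ) < w := hw
    have h1 := hC₁ w hw
    set V : ℝ := (shiftConst b - Real.log w) / (b - 1) with hV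
    have hVC : ((shiftConst b - Real.log w : ℂ)) / ((b - 1 : ℝ) : ℂ) = (V : ℂ) := by
      rw [hV]; push_cast; rfl
    rw [hSJ _ 0 (by rw [abs_zero]; positivity) (by simp; positivity), hVC,
      ← hSA V 0 (by rw [abs_zero]; positivity) (by simp; positivity)] at h1
    have hYζ : ∀ t : ℝ, slopeLog b (((b - 1 : ℝ) : ℂ) * (t + (0 : ℝ) * I)) =
        slope b (Complex.exp (((b - 1) * t : ℝ) + π * I)) := by
      intro t
      rw [slope_exp_of_pos hb (by simp; positivity) (by simp; linarith)]
      congr 1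
      push_cast
      ring
    have h3 := norm_lap_sub_le (Y := fun l => slopeLog b (((b - 1 : ℝ) : ℂ) * l)) (β := 0)
      (W := (V : ℂ)) (a := (N + 1) * (b - 1)) (C := C₂) (Finset.range (N + 1))
      (fun j => p.coeff j * (-1) ^ j) (fun j => j * (b - 1))
      (by have : (0 : ℝ) ≤ (N + 1) * (b - 1) := by positivity
          linarith)
      (fun i _ => by have : (0 : ℝ) ≤ i * (b - 1) := by positivity
                     linarith) (by simp; positivity)
      (integrable_lapKer (C := C₀) (a := 0) (t₀ := 0) le_rfl
        (re_exp_mul_exp_pos (by simp; positivity))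
        (continuous_line (α₁ := -(π / (b - 1))) (α₂ := π / (b - 1))
          (fun l hl => (differentiableAt_slopeLog_mul hb (abs_lt.2 hl)).differentiableWithinAt)
          ⟨neg_lt_zero.2 (by positivity), by positivity⟩)
        (fun t ht => by
          have := hA (t + (0 : ℝ) * I) (by simp; positivity) (by simpa using ht)
          simpa using this))
      (fun t => by
        rw [hYζ]
        have := h2 (((b - 1) * t : ℝ) + π * I) (fun n => by
          have e : (((((b - 1) * t : ℝ) : ℂ) + π * I)).im - 2 * π * n = π * (1 - 2 * n : ℤ) := by
            push_cast
            rw [Complex.add_im, Complex.im_ofReal_mul, Complex.I_im]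
            simp
            ring
          rw [e, abs_mul, abs_of_pos hπ]
          have h5 : (1 : ℝ) ≤ |((1 - 2 * n : ℤ) : ℝ)| := by
            have : (1 : ℤ) ≤ |1 - 2 * n| := Int.one_le_abs (by omega)
            exact_mod_cast this
          nlinarith)
        refine (le_of_eq ?_).trans (this.trans (le_of_eq ?_))
        · congr 2
          refine Finset.sum_congr rfl fun j _ => ?_
          rw [mul_assoc]
          congr 1
          have : Complex.exp ((j : ℂ) * ((((b - 1) * t : ℝ) : ℂ) + π * I)) =
              Complex.exp (j * ((b - 1) * t)) * Complex.exp (π * I) ^ j := by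
            rw [← Complex.exp_nat_mul, ← Complex.exp_add]; congr 1; push_cast; ring
          rw [this, Complex.exp_pi_mul_I, mul_comm]
          congr 2
          push_cast
          ring
        · congr 2
          rw [Complex.add_re, Complex.re_ofReal_mul]
          simp
          ring)
    have e3 : ∀ j : ℕ, (p.coeff j * (-1) ^ j) * ((Real.Gamma (j * (b - 1) + 1) : ℂ) *
        Complex.exp (-(((j * (b - 1) : ℝ) : ℂ) * V))) = p.coeff j * G j * (w : ℂ) ^ j := by
      intro j
      have : Complex.exp (-(((j * (b - 1) : ℝ) : ℂ) * V)) =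
          Complex.exp (-(j * shiftConst b)) * (w : ℂ) ^ j := by
        have hw' : (w : ℂ) = Complex.exp (Real.log w) := by
          rw [← Complex.ofReal_exp, Real.exp_log hw]
        rw [hw', ← Complex.exp_nat_mul, ← Complex.exp_add, ← hVC]
        congr 1
        push_cast at hb1C ⊢
        field_simp
        ring
      rw [this, hG]
      ring
    simp_rw [e3] at h3
    have e4 : ∑ i ∈ Finset.range N, (-1) ^ i * (Real.Gamma (b * (i + 1 : ℕ) + 1) : ℂ) /
        ((i + 1).factorial : ℂ) * (w : ℂ) ^ (i + 1) =
        ∑ j ∈ Finset.range (N + 1), T j * (w : ℂ) ^ j := by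
      rw [Finset.sum_range_succ']
      simp only [hT, if_true, zero_mul, add_zero, Nat.succ_ne_zero, if_false]
      refine Finset.sum_congr rfl fun i _ => ?_
      rw [pow_succ (-1 : ℂ)]
      ring
    rw [e4] at h1
    have e5 : Real.exp (-((N + 1) * (b - 1)) * (V : ℂ).re) =
        Real.exp (-((N + 1) * shiftConst b)) * w ^ (N + 1) := by
      have hw2 : w ^ (N + 1) = Real.exp ((N + 1 : ℕ) * Real.log w) := by
        rw [Real.exp_nat_mul, Real.exp_log hw]
      rw [hw2, ← Real.exp_add, Complex.ofReal_re, hV]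
      congr 1
      push_cast
      field_simp
      ring
    rw [e5] at h3
    simp only [Complex.ofReal_im, add_zero, Real.cos_zero, Real.one_rpow, mul_one] at h3
    have e6 : ∑ j ∈ Finset.range (N + 1), (p.coeff j * G j - T j) * (w : ℂ) ^ j =
        (Complex.exp V * lap (fun l => slopeLog b (((b - 1 : ℝ) : ℂ) * l)) 0 V -
          ∑ j ∈ Finset.range (N + 1), T j * (w : ℂ) ^ j) -
        (Complex.exp V * lap (fun l => slopeLog b (((b - 1 : ℝ) : ℂ) * l)) 0 V -
          ∑ j ∈ Finset.range (N + 1), p.coeff j * G j * (w : ℂ) ^ j) := by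
      simp_rw [sub_mul]
      rw [Finset.sum_sub_distrib]
      ring
    rw [e6]
    refine (norm_sub_le _ _).trans ?_
    linarith) j
  have hΓ : 0 < Real.Gamma (j * (b - 1) + 1) := Real.Gamma_pos_of_pos (by positivity)
  have hΓC : ((Real.Gamma (j * (b - 1) + 1) : ℝ) : ℂ) ≠ 0 := by exact_mod_cast hΓ.ne'
  have hE := Complex.exp_ne_zero (-(j * shiftConst b) : ℂ)
  have h1 : p.coeff j * G j = T j := sub_eq_zero.1 h0
  have hm : ((-1 : ℂ) ^ j) ≠ 0 := pow_ne_zero _ (by norm_num)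
  have hf : (j.factorial : ℂ) ≠ 0 := by exact_mod_cast Nat.factorial_ne_zero j
  have hGne : G j ≠ 0 := mul_ne_zero (mul_ne_zero hm hΓC) hE
  refine mul_right_cancel₀ hGne ?_
  rw [h1, hT, slopeCoeff]
  by_cases hj : j = 0
  · simp [hj]
  · simp only [hj, if_false]
    rw [hG]
    simp only []
    push_cast
    rw [Complex.exp_neg]
    have hE' := Complex.exp_ne_zero (j * shiftConst b : ℂ)
    field_simp

/-- The Taylor expansion of the universal function. -/
theorem exists_hasSum_slope : ∃ ρ : ℝ, 0 < ρ ∧ (∀ ξ : ℂ, ‖ξ‖ < ρ →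
    HasSum (fun j : ℕ => slopeCoeff b j * ξ ^ j) (slope b ξ)) ∧
    Summable fun j : ℕ => ‖slopeCoeff b j‖ * ρ ^ j := by
  obtain ⟨p, hp⟩ := analyticAt_slope hb (ξ := 0) (by simp)
  obtain ⟨r, hr⟩ := hp
  obtain ⟨ρ, hρ0, hρ⟩ := ENNReal.lt_iff_exists_nnreal_btwn.1 hr.r_pos
  have hρ1 : (0 : ℝ) < ρ := by exact_mod_cast hρ0
  refine ⟨ρ, hρ1, fun ξ hξ => ?_, ?_⟩
  · have := hr.hasSum (y := ξ) (by
      rw [Metric.mem_eball, edist_zero_right]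
      refine lt_trans ?_ hρ
      rw [enorm_eq_nnnorm]
      exact_mod_cast hξ)
    simp only [zero_add, FormalMultilinearSeries.apply_eq_pow_smul_coeff, smul_eq_mul,
      coeff_eq_slopeCoeff hb hr.hasFPowerSeriesAt] at this
    simpa only [mul_comm] using this
  · have := p.summable_norm_mul_pow (r := ρ) (hρ.trans_le hr.r_le)
    simpa only [← coeff_eq_slopeCoeff hb hr.hasFPowerSeriesAt,
      FormalMultilinearSeries.norm_apply_eq_norm_coef] using this

theorem exists_norm_slope_sub_le {η : ℝ} (hη : 0 < η) (N : ℕ) : ∃ C ≥ 0, ∀ ζ : ℂ,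
    (∀ n : ℤ, η ≤ |ζ.im - 2 * π * n|) →
      ‖slope b (Complex.exp ζ) - ∑ j ∈ Finset.range N, slopeCoeff b j * Complex.exp (j * ζ)‖ ≤
        C * Real.exp (N * ζ.re) := by
  obtain ⟨p, hp⟩ := analyticAt_slope hb (ξ := 0) (by simp)
  have := exists_norm_slope_sub_partialSum_le hb hp hη N
  simpa only [coeff_eq_slopeCoeff hb hp] using this

end

/-! ### Laplace integrals of the branches -/

theorem one_sub_exp_mem_slitPlane {ζ : ℂ} (h : ∀ n : ℤ, ζ.im = 2 * π * n → ζ.re < 0) :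
    1 - Complex.exp ζ ∈ Complex.slitPlane := by
  by_contra hcon
  rw [Complex.mem_slitPlane_iff] at hcon
  push Not at hcon
  simp only [Complex.sub_re, Complex.one_re, Complex.sub_im, Complex.one_im, zero_sub,
    neg_eq_zero] at hcon
  have h2 : 0 < (Complex.exp ζ).re := by linarith
  have h1 : Complex.exp ζ = Complex.exp (Real.log (Complex.exp ζ).re) := by
    rw [← Complex.ofReal_exp, Real.exp_log h2]
    exact Complex.ext rfl (by simp [hcon.2])
  obtain ⟨n, hn⟩ := Complex.exp_eq_exp_iff_exists_int.1 h1
  have h3 : ζ.im = 2 * π * n := by rw [hn]; simp; ring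
  have h4 := h n h3
  have h5 : (Complex.exp ζ).re ≤ ‖Complex.exp ζ‖ := Complex.re_le_norm _
  rw [Complex.norm_exp] at h5
  have := Real.exp_lt_one_iff.2 h4
  linarith

theorem exists_dist_pos {x : ℝ} (h : ∀ n : ℤ, x ≠ 2 * π * n) :
    ∃ η > 0, ∀ n : ℤ, η ≤ |x - 2 * π * n| := by
  have hπ : 0 < 2 * π := by positivity
  refine ⟨2 * π * |x / (2 * π) - round (x / (2 * π))|, mul_pos hπ (abs_pos.2 fun h0 => ?_),
    fun n => ?_⟩
  · refine h (round (x / (2 * π))) ?_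
    rw [sub_eq_zero, div_eq_iff hπ.ne'] at h0
    linarith
  · have h1 := mul_le_mul_of_nonneg_left (round_le (x / (2 * π)) n) hπ.le
    refine h1.trans (le_of_eq ?_)
    rw [← abs_of_pos hπ, ← abs_mul, abs_of_pos hπ, mul_sub, mul_div_cancel₀ _ hπ.ne']

/-- The phase `(b - 1) (α - arg)` of the direction `α` relative to a branch point. -/
noncomputable def phase (b : ℝ) (σ : ℤˣ) (α : ℝ) : ℝ := (b - 1) * α - (σ : ℤ) * ((2 - b) * π / 2)

/-- The Laplace integral of one branch. -/
noncomputable def amp (b : ℝ) (σ : ℤˣ) (k : ℕ) (β : ℝ) (Z : ℂ) : ℂ :=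
  Complex.exp (-(Z / ((b - 1 : ℝ) : ℂ))) * lap (branchSlope b σ k) β (-(Z / ((b - 1 : ℝ) : ℂ)))

/-- The Laplace integral of an oscillating exponential. -/
noncomputable def osc (b : ℝ) (σ : ℤˣ) (k : ℕ) (Z : ℂ) : ℂ :=
  Complex.exp Z * lap (fun l => Complex.exp (2 * π * I * (σ : ℤ) * k * Complex.exp (l / b))) 0 Z

/-- The coefficients of the expansion of the Laplace integrals `amp`. -/
noncomputable def ampCoeff (b : ℝ) (σ : ℤˣ) (k j : ℕ) : ℂ :=
  slopeCoeff b j * Complex.exp (-(j * ((b - 1 : ℝ) : ℂ) * branchPt b σ 0 k)) *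
    (Real.Gamma (j * (b - 1) + 1) : ℂ)

section

variable {b : ℝ} (hb : 1 < b)

include hb

theorem phase_eq (σ : ℤˣ) (k : ℕ) (α : ℝ) :
    phase b σ α = (b - 1) * (α - (branchPt b σ 0 k).im) := by
  have hb1 : b - 1 ≠ 0 := by linarith
  rw [phase, im_branchPt]
  push_cast
  field_simp
  ring

omit hb in
theorem im_branch_arg (σ : ℤˣ) (k : ℕ) (l : ℂ) : (((b - 1 : ℝ) : ℂ) * (l - branchPt b σ 0 k)).im =
    (b - 1) * (l.im - (branchPt b σ 0 k).im) := by
  rw [Complex.im_ofReal_mul, Complex.sub_im]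

theorem im_branch_arg' (σ : ℤˣ) (k : ℕ) (l : ℂ) :
    (((b - 1 : ℝ) : ℂ) * (l - branchPt b σ 0 k)).im = phase b σ l.im := by
  rw [im_branch_arg, phase_eq hb]

theorem exists_phase_dist {α : ℝ} (h : ¬ IsStokes b α) :
    ∃ η > 0, ∀ (σ : ℤˣ) (n : ℤ), η ≤ |phase b σ α - 2 * π * n| := by
  have hb1 : b - 1 ≠ 0 := by linarith
  have h1 : ∀ σ : ℤˣ, ∃ η > 0, ∀ n : ℤ, η ≤ |phase b σ α - 2 * π * n| := by
    intro σ
    refine exists_dist_pos fun n hn => h ⟨σ, σ * n, ?_⟩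
    rw [im_critLog]
    rw [phase] at hn
    have hσ : ((σ : ℤ) : ℝ) * ((σ : ℤ) : ℝ) = 1 := by
      rcases units_cast_cases σ with h | h <;> rw [h] <;> norm_num
    push_cast
    field_simp
    linear_combination 2 * hn - 4 * π * n * hσ
  obtain ⟨η₁, h₁, k₁⟩ := h1 1
  obtain ⟨η₂, h₂, k₂⟩ := h1 (-1)
  refine ⟨min η₁ η₂, lt_min h₁ h₂, fun σ n => ?_⟩
  rcases Int.units_eq_one_or σ with rfl | rfl
  · exact (min_le_left _ _).trans (k₁ n)
  · exact (min_le_right _ _).trans (k₂ n)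

theorem differentiableAt_branchSlope (σ : ℤˣ) (k : ℕ) {l : ℂ}
    (h : ∀ n : ℤ, phase b σ l.im = 2 * π * n → l.re < (branchPt b σ 0 k).re) :
    DifferentiableAt ℂ (branchSlope b σ k) l := by
  have hb1 : 0 < b - 1 := by linarith
  have h1 : 1 - Complex.exp (((b - 1 : ℝ) : ℂ) * (l - branchPt b σ 0 k)) ∈ Complex.slitPlane := by
    refine one_sub_exp_mem_slitPlane fun n hn => ?_
    rw [im_branch_arg' hb] at hn
    have := h n hn
    rw [Complex.re_ofReal_mul, Complex.sub_re]
    exact mul_neg_of_pos_of_neg hb1 (by linarith)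
  exact DifferentiableAt.comp l (g := slope b) (differentiableAt_slope hb h1) (by fun_prop)

theorem continuous_branchSlope (σ : ℤˣ) (k : ℕ) {α : ℝ} (h : ∀ n : ℤ, phase b σ α ≠ 2 * π * n) :
    Continuous fun t : ℝ => branchSlope b σ k (t + α * I) := by
  refine continuous_iff_continuousAt.2 fun t => ?_
  have := (differentiableAt_branchSlope hb σ k (l := t + α * I)
    (fun n hn => absurd (by simpa using hn) (h n))).continuousAt
  exact ContinuousAt.comp (g := branchSlope b σ k) this (by fun_prop)

omit hb in
theorem phase_ne_of_dist {σ : ℤˣ} {α η : ℝ} (hη : 0 < η)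
    (h : ∀ n : ℤ, η ≤ |phase b σ α - 2 * π * n|) (n : ℤ) : phase b σ α ≠ 2 * π * n := by
  intro h1
  have := h n
  rw [h1, sub_self, abs_zero] at this
  linarith

theorem exists_norm_branchSlope_le {η : ℝ} (hη : 0 < η) : ∃ C ≥ 0, ∀ (σ : ℤˣ) (k : ℕ) (l : ℂ),
    (∀ n : ℤ, η ≤ |phase b σ l.im - 2 * π * n|) → ‖branchSlope b σ k l‖ ≤ C := by
  obtain ⟨C, hC, h⟩ := exists_norm_slope_exp_le_of_le hb hη
  refine ⟨C, hC, fun σ k l hl => h _ fun n => ?_⟩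
  rw [im_branch_arg' hb]
  exact hl n

theorem integrable_branchSlope (σ : ℤˣ) (k : ℕ) {α η : ℝ} (hη : 0 < η)
    (h : ∀ n : ℤ, η ≤ |phase b σ α - 2 * π * n|) {X : ℂ}
    (hX : 0 < (X * Complex.exp (α * I)).re) :
    Integrable fun t : ℝ => lapKer X (branchSlope b σ k) (t + α * I) := by
  obtain ⟨C, hC, hb'⟩ := exists_norm_branchSlope_le hb hη
  refine integrable_lapKer (C := C) (a := 0) (t₀ := 0) le_rfl hX
    (continuous_branchSlope hb σ k (phase_ne_of_dist hη h)) fun t _ => ?_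
  refine (hb' σ k _ (by simpa using h)).trans ?_
  exact le_mul_of_one_le_right hC (one_le_rayBound le_rfl _ _)

/-- The modulus of the k-th branch point is k^(b/(b-1)) times a constant. The resulting factor
k^(-bN) with N = 1 is the source of all convergence in k. -/
theorem exp_re_branchPt : ∃ c > 0, ∀ (σ : ℤˣ) (k : ℕ), 1 ≤ k → ∀ N : ℕ,
    Real.exp (-(N * (b - 1) * (branchPt b σ 0 k).re)) = c ^ N * (k : ℝ) ^ (-(b * N)) := by
  have hb1 : 0 < b - 1 := by linarith
  refine ⟨Real.exp (-((b - 1) * (Real.log (2 * π * (1 - 1 / b)) + Real.log (2 * π / b) / (b - 1)))),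
    Real.exp_pos _, fun σ k hk N => ?_⟩
  have hk0 : (0 : ℝ) < k := by exact_mod_cast hk
  rw [← Real.exp_nat_mul, Real.rpow_def_of_pos hk0, ← Real.exp_add, re_branchPt]
  congr 1
  field_simp
  ring

/-- The asymptotic expansion of the Laplace integrals of the branches, uniformly in the branch. -/
theorem exists_norm_amp_sub_le {η : ℝ} (hη : 0 < η) (hη2 : η < π / 2) (N : ℕ) :
    ∃ C ≥ 0, ∀ (σ : ℤˣ) (k : ℕ) (β : ℝ) (Z : ℂ), 1 ≤ k →
      (∀ n : ℤ, η ≤ |phase b σ β - 2 * π * n|) → |β - Z.im / (b - 1)| ≤ π / 2 - η →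
      ‖amp b σ k β Z - ∑ j ∈ Finset.range N, ampCoeff b σ k j * Complex.exp (j * Z)‖ ≤
        C * (Real.exp (N * Z.re) * (k : ℝ) ^ (-(b * N))) := by
  have hb1 : 0 < b - 1 := by linarith
  have hb1C : (b : ℂ) - 1 ≠ 0 := by exact_mod_cast hb1.ne'
  obtain ⟨C, hC, h⟩ := exists_norm_slope_sub_le hb hη N
  obtain ⟨c, hc, hck⟩ := exp_re_branchPt hb
  have hsin : 0 < Real.sin η := Real.sin_pos_of_pos_of_lt_pi hη (by linarith)
  refine ⟨C * c ^ N * Real.Gamma (N * (b - 1) + 1) * Real.sin η ^ (-(N * (b - 1) + 1)), ?_,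
    fun σ k β Z hk hβ hZ => ?_⟩
  · have : 0 < Real.Gamma (N * (b - 1) + 1) := Real.Gamma_pos_of_pos (by positivity)
    positivity
  set W := -(Z / ((b - 1 : ℝ) : ℂ)) with hW
  have hWim : W.im + β = β - Z.im / (b - 1) := by
    rw [hW, Complex.neg_im, Complex.div_ofReal_im]; ring
  have hWre : W.re = -(Z.re / (b - 1)) := by rw [hW, Complex.neg_re, Complex.div_ofReal_re]
  have hW2 : |W.im + β| < π / 2 := by rw [hWim]; linarith
  have h1 := norm_lap_sub_le (Y := branchSlope b σ k) (β := β) (W := W) (a := N * (b - 1))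
    (C := C * (c ^ N * (k : ℝ) ^ (-(b * N)))) (Finset.range N)
    (fun j => slopeCoeff b j * Complex.exp (-(j * ((b - 1 : ℝ) : ℂ) * branchPt b σ 0 k)))
    (fun j => j * (b - 1))
    (by have : (0 : ℝ) ≤ N * (b - 1) := by positivity
        linarith)
    (fun i _ => by have : (0 : ℝ) ≤ i * (b - 1) := by positivity
                   linarith) hW2
    (integrable_branchSlope hb σ k hη hβ (re_exp_mul_exp_pos hW2))
    (fun t => by
      have h2 := h (((b - 1 : ℝ) : ℂ) * ((t + β * I) - branchPt b σ 0 k)) (fun n => by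
        rw [im_branch_arg' hb]; simpa using hβ n)
      refine (le_of_eq ?_).trans (h2.trans (le_of_eq ?_))
      · rw [branchSlope]
        congr 2
        refine Finset.sum_congr rfl fun j _ => ?_
        rw [mul_assoc, ← Complex.exp_add]
        congr 2
        push_cast
        ring
      · rw [mul_assoc, ← hck σ k hk N, ← Real.exp_add, Complex.re_ofReal_mul, Complex.sub_re]
        congr 2
        simp
        ring)
  have e1 : ∀ j : ℕ, slopeCoeff b j * Complex.exp (-(j * ((b - 1 : ℝ) : ℂ) * branchPt b σ 0 k)) *
      ((Real.Gamma (j * (b - 1) + 1) : ℂ) * Complex.exp (-(((j * (b - 1) : ℝ) : ℂ) * W))) =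
      ampCoeff b σ k j * Complex.exp (j * Z) := by
    intro j
    have : -(((j * (b - 1) : ℝ) : ℂ) * W) = j * Z := by
      rw [hW]; push_cast; field_simp
    rw [this, ampCoeff]
    ring
  simp_rw [e1] at h1
  refine h1.trans ?_
  have e2 : -(N * (b - 1)) * W.re = N * Z.re := by rw [hWre]; field_simp
  -- The margin η in the angle bounds the cosine below by sin η, uniformly in the direction; the
  -- exponent is negative.
  have e3 : Real.cos (W.im + β) ^ (-(N * (b - 1) + 1)) ≤ Real.sin η ^ (-(N * (b - 1) + 1)) := by
    refine Real.rpow_le_rpow_of_nonpos hsin ?_ (by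
      have : (0 : ℝ) ≤ N * (b - 1) := by positivity
      linarith)
    rw [hWim, ← Real.cos_abs, ← Real.cos_pi_div_two_sub]
    exact Real.cos_le_cos_of_nonneg_of_le_pi (abs_nonneg _) (by linarith [Real.pi_pos]) hZ
  rw [e2]
  have hΓ : 0 < Real.Gamma (N * (b - 1) + 1) := Real.Gamma_pos_of_pos (by positivity)
  calc _ ≤ C * (c ^ N * (k : ℝ) ^ (-(b * N))) * Real.Gamma (N * (b - 1) + 1) *
        Real.exp (N * Z.re) * Real.sin η ^ (-(N * (b - 1) + 1)) :=
        mul_le_mul_of_nonneg_left e3 (by positivity)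
    _ = _ := by ring

/-- A direction in the sector next to the positive real direction that is admissible for `arg z =
θ`. -/
theorem exists_sector_angle {δ θ : ℝ} (hδ : 0 < δ) (hδ2 : δ ≤ π / 2) (hδ3 : δ ≤ (b - 1) * π)
    (hθ : |θ| ≤ π / 2 - δ) (σ : ℤˣ) :
    ∃ β : ℝ, (σ : ℤ) * phase b σ β ≤ -(δ / 2) ∧ -(2 * π - δ / 2) ≤ (σ : ℤ) * phase b σ β ∧
      |β - θ / (b - 1)| ≤ π / 2 - δ / 2 / (b - 1) := by
  have hb1 : 0 < b - 1 := by linarith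
  have hπ := Real.pi_pos
  obtain ⟨hθ1, hθ2⟩ := abs_le.1 hθ
  -- In terms of x = (b - 1)σβ, the ideal direction for arg z = θ is x = σθ. It is clamped to stay
  -- below the first cut, at distance δ/2.
  set x : ℝ := min ((σ : ℤ) * θ) ((2 - b) * π / 2 - δ / 2) with hx
  have hσ := units_cast_cases σ
  have hσ2 : ((σ : ℤ) : ℝ) * ((σ : ℤ) : ℝ) = 1 := by
    rcases hσ with h | h <;> rw [h] <;> norm_num
  have hσθ : -(π / 2 - δ) ≤ (σ : ℤ) * θ ∧ (σ : ℤ) * θ ≤ π / 2 - δ := by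
    rcases hσ with h | h <;> rw [h] <;> constructor <;> linarith
  have hph : (σ : ℤ) * phase b σ ((σ : ℤ) * x / (b - 1)) = x - (2 - b) * π / 2 := by
    rw [phase, mul_div_cancel₀ _ hb1.ne']
    linear_combination (x - (2 - b) * π / 2) * hσ2
  refine ⟨(σ : ℤ) * x / (b - 1), ?_, ?_, ?_⟩
  · rw [hph]
    have := min_le_right ((σ : ℤ) * θ) ((2 - b) * π / 2 - δ / 2)
    linarith
  · rw [hph]
    rcases min_choice ((σ : ℤ) * θ) ((2 - b) * π / 2 - δ / 2) with h | h <;> rw [hx, h] <;>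
      nlinarith
  · rw [← sub_div, abs_div, abs_of_pos hb1, div_le_iff₀ hb1]
    have e1 : (π / 2 - δ / 2 / (b - 1)) * (b - 1) = (b - 1) * π / 2 - δ / 2 := by field_simp
    have e2 : |(σ : ℤ) * x - θ| = |x - (σ : ℤ) * θ| := by
      rcases hσ with h | h <;> rw [h]
      · ring_nf
      · rw [← abs_neg]; ring_nf
    rw [e1, e2, abs_le]
    have h1 : x ≤ (σ : ℤ) * θ := min_le_left _ _
    have h2 : 0 ≤ (b - 1) * π / 2 - δ / 2 := by linarith
    constructor
    · rcases min_choice ((σ : ℤ) * θ) ((2 - b) * π / 2 - δ / 2) with h | h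
      · rw [hx, h]; linarith
      · rw [hx, h]; linarith
    · linarith

theorem osc_eq_amp (σ : ℤˣ) {k : ℕ} (hk : 1 ≤ k) {Z : ℂ} (hZ : |Z.im| < π / 2) {β : ℝ}
    (h0 : (σ : ℤ) * phase b σ β < 0) (h1 : -(2 * π) < (σ : ℤ) * phase b σ β)
    (hβ : |β - Z.im / (b - 1)| < π / 2) : osc b σ k Z = amp b σ k β Z := by
  rw [phase_eq hb σ k] at h0 h1
  exact lap_oscillating_eq hb σ hk hZ h0 h1 hβ

/-- The asymptotic expansion of the Laplace integrals of the oscillating exponentials. -/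
theorem exists_norm_osc_sub_le {δ₀ : ℝ} (hδ₀ : 0 < δ₀) (hδ₂ : δ₀ ≤ π / 2) (N : ℕ) :
    ∃ C ≥ 0, ∀ (σ : ℤˣ) (k : ℕ) (Z : ℂ), 1 ≤ k → |Z.im| ≤ π / 2 - δ₀ →
      ‖osc b σ k Z - ∑ j ∈ Finset.range N, ampCoeff b σ k j * Complex.exp (j * Z)‖ ≤
        C * (Real.exp (N * Z.re) * (k : ℝ) ^ (-(b * N))) := by
  have hb1 : 0 < b - 1 := by linarith
  have hπ := Real.pi_pos
  set δ : ℝ := min δ₀ ((b - 1) * π) with hδ'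
  have hδ : 0 < δ := lt_min hδ₀ (by positivity)
  have hδδ : δ ≤ δ₀ := min_le_left _ _
  have hδ2 : δ ≤ π / 2 := hδδ.trans hδ₂
  set η : ℝ := min (δ / 2) (δ / 2 / (b - 1)) with hη
  have hη0 : 0 < η := lt_min (by positivity) (by positivity)
  have hη1 : η ≤ δ / 2 := min_le_left _ _
  have hη2 : η ≤ δ / 2 / (b - 1) := min_le_right _ _
  obtain ⟨C, hC, h⟩ := exists_norm_amp_sub_le hb hη0 (by linarith) N
  refine ⟨C, hC, fun σ k Z hk hZ => ?_⟩
  obtain ⟨β, h1, h2, h3⟩ := exists_sector_angle hb hδ hδ2 (min_le_right _ _)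
    (hZ.trans (by linarith : _ ≤ π / 2 - δ)) σ
  have h4 : |β - Z.im / (b - 1)| ≤ π / 2 - η := by linarith
  rw [osc_eq_amp hb σ hk (by linarith) (by linarith) (by linarith) (by linarith : _ < π / 2)]
  refine h σ k β Z hk (fun n => ?_) h4
  have h5 : |phase b σ β - 2 * π * n| = |(σ : ℤ) * phase b σ β - 2 * π * ((σ * n : ℤ) : ℝ)| := by
    rcases Int.units_eq_one_or σ with rfl | rfl
    · simp
    · rw [← abs_neg]; congr 1; push_cast; ring
  rw [h5]
  generalize (σ * n : ℤ) = m
  rcases le_or_gt 0 m with hm | hm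
  · have : (0 : ℝ) ≤ m := by exact_mod_cast hm
    rw [le_abs]; right
    nlinarith
  · have : (m : ℝ) ≤ -1 := by exact_mod_cast Int.le_sub_one_of_lt hm
    rw [le_abs]; left
    nlinarith

end

/-! ### The lacunary series -/

section

variable {b : ℝ} (hb : 1 < b)

include hb

theorem summable_lacunary {z : ℂ} (hz : 0 < z.re) :
    Summable fun j : ℕ => Complex.exp (-(z * ((((j : ℝ) + 1) ^ b : ℝ) : ℂ))) := by
  have hr : Real.exp (-z.re) < 1 := Real.exp_lt_one_iff.2 (by linarith)
  refine Summable.of_norm_bounded (summable_geometric_of_lt_one (Real.exp_pos _).le hr) fun j => ?_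
  rw [Complex.norm_exp, Complex.neg_re, Complex.re_mul_ofReal, ← Real.exp_nat_mul]
  refine Real.exp_le_exp.2 ?_
  have h1 : (j : ℝ) + 1 ≤ ((j : ℝ) + 1) ^ b :=
    Real.self_le_rpow_of_one_le (by linarith [(Nat.cast_nonneg j : (0 : ℝ) ≤ j)]) hb.le
  nlinarith

theorem integrableOn_stretched {z : ℂ} (hz : 0 < z.re) {φ : ℝ → ℂ} (hφ : Continuous φ) {C s : ℝ}
    (hs : 0 ≤ s) (hφC : ∀ x : ℝ, 0 < x → ‖φ x‖ ≤ C * x ^ s) :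
    IntegrableOn (fun x : ℝ => φ x * Complex.exp (-(z * ((x ^ b : ℝ) : ℂ)))) (Ioi 0) := by
  have h1 := (integrableOn_rpow_mul_exp_neg_mul_rpow (p := b) (s := s) (b := z.re) (by linarith)
    (by linarith) hz).const_mul C
  refine Integrable.mono' h1 ?_ ?_
  · refine Continuous.aestronglyMeasurable ?_
    have : Continuous fun x : ℝ => x ^ b := Real.continuous_rpow_const (by linarith)
    fun_prop
  · refine (ae_restrict_iff' measurableSet_Ioi).2 (Eventually.of_forall fun x hx => ?_)
    rw [norm_mul, Complex.norm_exp, Complex.neg_re, Complex.re_mul_ofReal, ← mul_assoc, neg_mul]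
    exact mul_le_mul_of_nonneg_right (hφC x hx) (Real.exp_pos _).le

/-- Integration by parts against `exp (-z x ^ b)`. -/
theorem integral_mul_exp_neg_rpow {Z : ℂ} (hz : 0 < (Complex.exp Z).re) {Φ Φ' : ℂ → ℂ}
    (hΦ : ∀ z, HasDerivAt Φ (Φ' z) z) (hΦ' : Continuous Φ') {C : ℝ}
    (h1 : ∀ x : ℝ, 0 < x → ‖Φ x‖ ≤ C * (1 + x)) (h2 : ∀ x : ℝ, 0 < x → ‖Φ' x‖ ≤ C) :
    ∫ x in Ioi (0 : ℝ), Φ' x * Complex.exp (-(Complex.exp Z * ((x ^ b : ℝ) : ℂ))) =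
      -Φ 0 + Complex.exp Z * lap (fun l => Φ (Complex.exp (l / b))) 0 Z := by
  have hb0 : 0 < b := by linarith
  have hbC : (b : ℂ) ≠ 0 := by exact_mod_cast hb0.ne'
  set z := Complex.exp Z with hzdef
  have hΦc : Continuous Φ := continuous_iff_continuousAt.2 fun x => (hΦ x).continuousAt
  have hxb : Continuous fun x : ℝ => x ^ b := Real.continuous_rpow_const (by linarith)
  have hxb1 : Continuous fun x : ℝ => x ^ (b - 1) := Real.continuous_rpow_const (by linarith)
  have hC : 0 ≤ C := (norm_nonneg _).trans (h2 1 one_pos)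
  have hI1 : IntegrableOn (fun x : ℝ => Φ' x * Complex.exp (-(z * ((x ^ b : ℝ) : ℂ)))) (Ioi 0) :=
    integrableOn_stretched hb hz (φ := fun x => Φ' x) (by fun_prop) (C := C) (s := 0) le_rfl
      fun x hx => by rw [Real.rpow_zero, mul_one]; exact h2 x hx
  have hI2 : IntegrableOn (fun x : ℝ => (Φ x * ((z * b) * ((x ^ (b - 1) : ℝ) : ℂ))) *
      Complex.exp (-(z * ((x ^ b : ℝ) : ℂ)))) (Ioi 0) := by
    -- The bound C(1 + x) on Φ is not a single power. The partition 1 = 1/(1 + |x|) + |x|/(1 + |x|)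
    -- splits the integrand into two parts, each bounded by one power times the exponential.
    have e : (fun x : ℝ => (Φ x * ((z * b) * ((x ^ (b - 1) : ℝ) : ℂ))) *
      Complex.exp (-(z * ((x ^ b : ℝ) : ℂ)))) = fun x : ℝ =>
        ((Φ x * (1 / (1 + |x| : ℝ) : ℝ)) * ((z * b) * ((x ^ (b - 1) : ℝ) : ℂ))) *
          Complex.exp (-(z * ((x ^ b : ℝ) : ℂ))) +
        ((Φ x * (|x| / (1 + |x| : ℝ) : ℝ)) * ((z * b) * ((x ^ (b - 1) : ℝ) : ℂ))) *
          Complex.exp (-(z * ((x ^ b : ℝ) : ℂ))) := by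
      funext x
      have h0 : (1 : ℂ) + (|x| : ℝ) ≠ 0 := by
        have : (1 : ℝ) + |x| ≠ 0 := by positivity
        exact_mod_cast this
      push_cast
      field_simp
    have hden : Continuous fun x : ℝ => 1 / (1 + |x|) :=
      continuous_const.div (by fun_prop) fun x => by positivity
    have hden2 : Continuous fun x : ℝ => |x| / (1 + |x|) :=
      continuous_abs.div (by fun_prop) fun x => by positivity
    rw [e]
    refine Integrable.add (integrableOn_stretched hb hz (C := C * ‖z * b‖) (s := b - 1)
      (by fun_prop) (by linarith) fun x hx => ?_)
      (integrableOn_stretched hb hz (C := C * ‖z * b‖) (s := b - 1 + 1)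
      (by fun_prop) (by linarith) fun x hx => ?_)
    · rw [norm_mul, norm_mul, norm_mul (z * b), Complex.norm_real, Complex.norm_real,
        Real.norm_of_nonneg (by positivity), Real.norm_of_nonneg (by positivity), abs_of_pos hx]
      have := h1 x hx
      have h3 : ‖Φ x‖ * (1 / (1 + x)) ≤ C := by
        rw [mul_one_div, div_le_iff₀ (by positivity)]; exact this
      rw [mul_assoc C]
      exact mul_le_mul_of_nonneg_right h3 (by positivity)
    · rw [norm_mul, norm_mul, norm_mul (z * b), Complex.norm_real, Complex.norm_real,
        Real.norm_of_nonneg (by positivity), Real.norm_of_nonneg (by positivity), abs_of_pos hx]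
      have := h1 x hx
      have h3 : ‖Φ x‖ * (x / (1 + x)) ≤ C * x := by
        rw [← mul_div_assoc, div_le_iff₀ (by positivity)]
        nlinarith
      rw [Real.rpow_add_one hx.ne']
      refine (mul_le_mul_of_nonneg_right h3 (by positivity)).trans (le_of_eq ?_)
      ring
  have hderiv : ∀ x ∈ Ioi (0 : ℝ), HasDerivAt
      (fun x : ℝ => Φ x * Complex.exp (-(z * ((x ^ b : ℝ) : ℂ))))
      (Φ' x * Complex.exp (-(z * ((x ^ b : ℝ) : ℂ))) -
        (Φ x * ((z * b) * ((x ^ (b - 1) : ℝ) : ℂ))) * Complex.exp (-(z * ((x ^ b : ℝ) : ℂ)))) x :=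
            by
    intro x hx
    have d1 : HasDerivAt (fun x : ℝ => Φ x) (Φ' x) x := (hΦ x).comp_ofReal
    have d2 : HasDerivAt (fun x : ℝ => ((x ^ b : ℝ) : ℂ)) (((b * x ^ (b - 1) : ℝ)) : ℂ) x :=
      (Real.hasDerivAt_rpow_const (Or.inr hb.le)).ofReal_comp
    have d3 := d1.mul ((d2.const_mul z).neg.cexp)
    refine d3.congr_deriv ?_
    simp only [Pi.neg_apply]
    push_cast
    ring
  have hlim : Tendsto (fun x : ℝ => Φ x * Complex.exp (-(z * ((x ^ b : ℝ) : ℂ)))) atTop (𝓝 0) := by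
    have hexp : Tendsto (fun x : ℝ => (C * 2) * (x ^ (1 : ℝ) * Real.exp (-z.re * x))) atTop (𝓝
        0) := by
      simpa using (tendsto_rpow_mul_exp_neg_mul_atTop_nhds_zero 1 z.re hz).const_mul (C * 2)
    refine squeeze_zero_norm' ?_ hexp
    filter_upwards [eventually_ge_atTop 1] with x hx
    rw [norm_mul, Complex.norm_exp, Complex.neg_re, Complex.re_mul_ofReal, Real.rpow_one,
      ← mul_assoc]
    have h3 : x ≤ x ^ b := Real.self_le_rpow_of_one_le hx hb.le
    have h4 := h1 x (by linarith)
    refine mul_le_mul (by nlinarith) (Real.exp_le_exp.2 (by nlinarith)) (Real.exp_pos _).le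
      (by positivity)
  have h3 := integral_Ioi_of_hasDerivAt_of_tendsto
    (f := fun x : ℝ => Φ x * Complex.exp (-(z * ((x ^ b : ℝ) : ℂ))))
    (by
      refine Continuous.continuousWithinAt ?_
      fun_prop) hderiv (hI1.sub hI2) hlim
  rw [integral_sub hI1 hI2] at h3
  simp only [Complex.ofReal_zero, Real.zero_rpow hb0.ne', mul_zero, neg_zero, Complex.exp_zero,
    mul_one, zero_sub] at h3
  -- This is the substitution u = x^b in logarithmic form, so x = exp(t/b).
  have hsub : ∫ x in Ioi (0 : ℝ), (Φ x * ((z * b) * ((x ^ (b - 1) : ℝ) : ℂ))) *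
      Complex.exp (-(z * ((x ^ b : ℝ) : ℂ))) =
      z * lap (fun l => Φ (Complex.exp (l / b))) 0 Z := by
    have himg : (fun t : ℝ => Real.exp (t / b)) '' univ = Ioi 0 := by
      rw [image_univ, ← Real.range_exp]
      ext y
      constructor
      · rintro ⟨t, rfl⟩; exact ⟨t / b, rfl⟩
      · rintro ⟨t, rfl⟩; exact ⟨b * t, by simp only; rw [mul_div_cancel_left₀ _ hb0.ne']⟩
    rw [← himg, integral_image_eq_integral_abs_deriv_smul (f' := fun t => Real.exp (t / b) / b)
      MeasurableSet.univ
      (fun x _ => ?_) (fun x _ y _ hxy => ?_), Measure.restrict_univ, lap, ← integral_const_mul]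
    · congr 1
      ext t
      have e0 : (0 : ℝ) < Real.exp (t / b) := Real.exp_pos _
      rw [abs_of_pos (by positivity), ← Real.exp_mul, ← Real.exp_mul, div_mul_cancel₀ _ hb0.ne',
        lapKer, Complex.real_smul]
      have e1 : (t : ℂ) + (0 : ℝ) * I = t := by simp
      rw [e1, ← hzdef]
      have e2 : Complex.exp (t : ℂ) = ((Real.exp (t / b) : ℝ) : ℂ) *
          ((Real.exp (t / b * (b - 1)) : ℝ) : ℂ) := by
        rw [← Complex.ofReal_mul, ← Real.exp_add, ← Complex.ofReal_exp]
        congr 2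
        field_simp
        ring
      have e3 : Complex.exp ((t : ℂ) / b) = ((Real.exp (t / b) : ℝ) : ℂ) := by push_cast; rfl
      have e4 : ((Real.exp t : ℝ) : ℂ) = Complex.exp (t : ℂ) := Complex.ofReal_exp t
      rw [e3, e4]
      nth_rewrite 3 [e2]
      push_cast
      field_simp
    · have := (((hasDerivAt_id x).div_const b).exp).hasDerivWithinAt (s := univ)
      refine this.congr_deriv ?_
      simp only [id]
      ring
    · have := Real.exp_injective hxy
      exact (div_left_inj' hb0.ne').1 this
  rw [← hsub]
  linear_combination h3

end

/-! ### Poisson summation -/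

theorem hasSum_int_of_even {f : ℤ → ℂ} (he : ∀ n, f (-n) = f n)
    (hs : Summable fun n : ℕ => f ((n : ℤ) + 1)) :
    HasSum f (f 0 + 2 * ∑' n : ℕ, f ((n : ℤ) + 1)) := by
  have h1 : HasSum (fun n : ℕ => f n) (f 0 + ∑' n : ℕ, f ((n : ℤ) + 1)) := by
    rw [hasSum_nat_add_iff' (f := fun n : ℕ => f n) 1 |>.symm]
    simpa using hs.hasSum
  have h2 : HasSum (fun n : ℕ => f (-((n : ℤ) + 1))) (∑' n : ℕ, f ((n : ℤ) + 1)) := by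
    simp_rw [he]; exact hs.hasSum
  have := h1.of_nat_of_neg_add_one h2
  rwa [add_assoc, ← two_mul] at this

theorem integral_eq_integral_Ioi_add {g : ℝ → ℂ} (h1 : IntegrableOn g (Ioi 0))
    (h2 : IntegrableOn (fun x => g (-x)) (Ioi 0)) :
    ∫ x, g x = (∫ x in Ioi (0 : ℝ), g (-x)) + ∫ x in Ioi (0 : ℝ), g x := by
  have h3 : IntegrableOn g (Iic 0) := by
    rw [integrableOn_Iic_iff_integrableOn_Iio]
    have := (Measure.measurePreserving_neg (volume : Measure ℝ)).integrableOn_comp_preimage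
      (MeasurableEquiv.neg ℝ).measurableEmbedding (f := g) (s := Iio 0)
    refine this.1 ?_
    simpa [Function.comp_def] using h2
  rw [integral_comp_neg_Ioi, neg_zero, ← setIntegral_univ, ← Iic_union_Ioi (a := (0 : ℝ)),
    setIntegral_union (Iic_disjoint_Ioi le_rfl) measurableSet_Ioi h3 h1]

/-- Poisson summation for even functions. -/
theorem poisson_even {F : ℝ → ℂ} (hc : Continuous F)
    (hd : F =O[cocompact ℝ] (fun x : ℝ => |x| ^ (-2 : ℝ)))
    (he : ∀ n : ℤ, F ((-n : ℤ) : ℝ) = F (n : ℝ)) (he' : ∀ n : ℤ, 𝓕 F ((-n : ℤ) : ℝ) = 𝓕 F (n : ℝ))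
    (hs : Summable fun k : ℕ => F (((k : ℤ) + 1 : ℤ) : ℝ))
    (hs' : Summable fun k : ℕ => 𝓕 F (((k : ℤ) + 1 : ℤ) : ℝ)) :
    F ((0 : ℤ) : ℝ) + 2 * ∑' k : ℕ, F (((k : ℤ) + 1 : ℤ) : ℝ) =
      𝓕 F ((0 : ℤ) : ℝ) + 2 * ∑' k : ℕ, 𝓕 F (((k : ℤ) + 1 : ℤ) : ℝ) := by
  have e1 := hasSum_int_of_even (f := fun n : ℤ => F (n : ℝ)) he hs
  have e2 := hasSum_int_of_even (f := fun n : ℤ => 𝓕 F (n : ℝ)) he' hs'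
  have hP := Real.tsum_eq_tsum_fourier_of_rpow_decay_of_summable hc one_lt_two hd e2.summable 0
  simp only [zero_add, QuotientAddGroup.mk_zero, fourier_eval_zero, mul_one] at hP
  rw [← e1.tsum_eq, ← e2.tsum_eq]
  exact hP

theorem sum_units {M : Type*} [AddCommMonoid M] (f : ℤˣ → M) : ∑ σ : ℤˣ, f σ = f 1 + f (-1) := by
  rw [show (Finset.univ : Finset ℤˣ) = {1, -1} by decide, Finset.sum_pair (by decide)]

section

variable {b : ℝ} (hb : 1 < b)

include hb

/-- Integration by parts with Φ(x) = x turns the integral into z ∫ exp(-zu) u^(1/b) du, a Gamma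
integral. -/
theorem leading_eq {Z : ℂ} (hz : 0 < (Complex.exp Z).re) (hZ : |Z.im| < π / 2) :
    ∫ x in Ioi (0 : ℝ), Complex.exp (-(Complex.exp Z * ((x ^ b : ℝ) : ℂ))) = leading b Z + 1 /
        2 := by
  have hb0 : 0 < b := by linarith
  have h := integral_mul_exp_neg_rpow hb hz (Φ := fun x => x) (Φ' := fun _ => 1)
    (fun z => hasDerivAt_id z) continuous_const (C := 1)
    (fun x hx => by rw [Complex.norm_real, Real.norm_of_nonneg hx.le]; linarith)
    (fun x hx => by simp)
  simp only [one_mul, neg_zero, zero_add] at h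
  rw [h, leading]
  have h2 := lap_exp (a := 1 / b) (β := 0) (W := Z) (by
    have : 0 < 1 / b := by positivity
    linarith) (by simpa using hZ)
  have e : (fun l : ℂ => Complex.exp (l / b)) = fun l => Complex.exp (((1 / b : ℝ) : ℂ) * l) := by
    funext l; congr 1; push_cast; ring
  rw [e, h2, sub_add_cancel, add_comm (1 / b)]
  congr 2
  push_cast
  ring

/-- Integration by parts with Φ an antiderivative of the oscillation. The boundary term -1 cancels
between σ = 1 and σ = -1 in the full Fourier transform. -/
theorem fourier_integral_eq {Z : ℂ} (hz : 0 < (Complex.exp Z).re) (σ : ℤˣ) {k : ℕ} (hk : 1 ≤ k) :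
    ∫ x in Ioi (0 : ℝ), Complex.exp (2 * π * I * (σ : ℤ) * k * x) *
      Complex.exp (-(Complex.exp Z * ((x ^ b : ℝ) : ℂ))) =
      ((σ : ℤ) : ℂ) / (2 * π * I * k) * (osc b σ k Z - 1) := by
  have hk0 : (k : ℂ) ≠ 0 := by exact_mod_cast (by omega : k ≠ 0)
  have hπ : (π : ℂ) ≠ 0 := by exact_mod_cast Real.pi_ne_zero
  have hσ : ((σ : ℤ) : ℂ) * ((σ : ℤ) : ℂ) = 1 := by
    rcases Int.units_eq_one_or σ with rfl | rfl <;> norm_num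
  have hσ0 : ((σ : ℤ) : ℂ) ≠ 0 := fun h => by rw [h] at hσ; norm_num at hσ
  set c : ℂ := 2 * π * I * (σ : ℤ) * k with hc
  have hc0 : c ≠ 0 := by
    rw [hc]
    exact mul_ne_zero (mul_ne_zero (mul_ne_zero (mul_ne_zero two_ne_zero hπ) Complex.I_ne_zero)
      hσ0) hk0
  have hn : ∀ x : ℝ, ‖Complex.exp (c * x)‖ = 1 := by
    intro x
    have : c * x = ((2 * π * (σ : ℤ) * k * x : ℝ) : ℂ) * I := by rw [hc]; push_cast; ring
    rw [this, Complex.norm_exp_ofReal_mul_I]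
  have h := integral_mul_exp_neg_rpow hb hz (Φ := fun x => Complex.exp (c * x) / c)
    (Φ' := fun x => Complex.exp (c * x))
    (fun z => by
      have := (((hasDerivAt_id z).const_mul c).cexp).div_const c
      refine this.congr_deriv ?_
      simp only [id]
      field_simp) (by fun_prop) (C := 1 + 1 / ‖c‖)
    (fun x hx => by
      rw [norm_div, hn]
      have : 0 ≤ 1 / ‖c‖ := by positivity
      nlinarith)
    (fun x hx => by
      rw [hn]
      have : 0 ≤ 1 / ‖c‖ := by positivity
      linarith)
  rw [h, osc]
  have e1 : lap (fun l => Complex.exp (c * Complex.exp (l / b)) / c) 0 Z =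
      c⁻¹ * lap (fun l => Complex.exp (c * Complex.exp (l / b))) 0 Z := by
    rw [lap, lap, ← integral_const_mul]
    congr 1
    ext t
    simp only [lapKer]
    ring
  have e2 : c⁻¹ = ((σ : ℤ) : ℂ) / (2 * π * I * k) := by
    have hI := Complex.I_ne_zero
    rw [hc]
    field_simp
    linear_combination -hσ
  rw [e1, ← e2]
  simp only [mul_zero, Complex.exp_zero]
  ring

/-- The Fourier transform of `exp (-z |x| ^ b)`. -/
theorem fourier_exp_neg_abs_rpow {Z : ℂ} (hz : 0 < (Complex.exp Z).re) {k : ℕ} (hk : 1 ≤ k)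
    (n : ℤ) (hn : n.natAbs = k) :
    𝓕 (fun x : ℝ => Complex.exp (-(Complex.exp Z * ((|x| ^ b : ℝ) : ℂ)))) (n : ℝ) =
      ∑ σ : ℤˣ, ((σ : ℤ) : ℂ) / (2 * π * I * k) * osc b σ k Z := by
  have hcont : Continuous fun x : ℝ => |x| ^ b :=
    (Real.continuous_rpow_const (by linarith)).comp continuous_abs
  have hF : ∀ σ : ℤˣ, IntegrableOn (fun x : ℝ => Complex.exp (2 * π * I * (σ : ℤ) * k * x) *
      Complex.exp (-(Complex.exp Z * ((x ^ b : ℝ) : ℂ)))) (Ioi 0) := fun σ =>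
    integrableOn_stretched hb hz (φ := fun x => Complex.exp (2 * π * I * (σ : ℤ) * k * x))
      (by fun_prop) (C := 1) (s := 0) le_rfl fun x _ => by
        have : 2 * π * I * (σ : ℤ) * k * x = ((2 * π * (σ : ℤ) * k * x : ℝ) : ℂ) * I := by
          push_cast; ring
        rw [this, Complex.norm_exp_ofReal_mul_I, Real.rpow_zero, mul_one]
  rw [Real.fourier_real_eq_integral_exp_smul]
  obtain ⟨τ, hτ⟩ : ∃ τ : ℤˣ, n = -((τ : ℤ) * k) := by
    rcases Int.natAbs_eq n with h | h
    · exact ⟨-1, by rw [h, hn]; simp⟩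
    · exact ⟨1, by rw [h, hn]; simp⟩
  have hIoi : ∀ x ∈ Ioi (0 : ℝ), Complex.exp (((-2 * π * x * n : ℝ) : ℂ) * I) •
      Complex.exp (-(Complex.exp Z * ((|x| ^ b : ℝ) : ℂ))) =
      Complex.exp (2 * π * I * (τ : ℤ) * k * x) *
        Complex.exp (-(Complex.exp Z * ((x ^ b : ℝ) : ℂ))) := by
    intro x hx
    rw [abs_of_pos hx, smul_eq_mul, hτ]
    congr 2
    push_cast
    ring
  have hneg : ∀ x ∈ Ioi (0 : ℝ), Complex.exp (((-2 * π * (-x) * n : ℝ) : ℂ) * I) •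
      Complex.exp (-(Complex.exp Z * ((|-x| ^ b : ℝ) : ℂ))) =
      Complex.exp (2 * π * I * ((-τ : ℤˣ) : ℤ) * k * x) *
        Complex.exp (-(Complex.exp Z * ((x ^ b : ℝ) : ℂ))) := by
    intro x hx
    rw [abs_neg, abs_of_pos hx, smul_eq_mul, hτ]
    congr 2
    push_cast
    ring
  set g : ℝ → ℂ := fun x => Complex.exp (((-2 * π * x * n : ℝ) : ℂ) * I) •
      Complex.exp (-(Complex.exp Z * ((|x| ^ b : ℝ) : ℂ))) with hg
  have h1 : IntegrableOn g (Ioi 0) := (hF τ).congr_fun (fun x hx => (hIoi x hx).symm)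
      measurableSet_Ioi
  have h2' : IntegrableOn (fun x => g (-x)) (Ioi 0) :=
    (hF (-τ)).congr_fun (fun x hx => (hneg x hx).symm) measurableSet_Ioi
  rw [integral_eq_integral_Ioi_add h1 h2', setIntegral_congr_fun measurableSet_Ioi hIoi,
    setIntegral_congr_fun measurableSet_Ioi hneg, fourier_integral_eq hb hz _ hk,
    fourier_integral_eq hb hz _ hk]
  rw [sum_units]
  rcases Int.units_eq_one_or τ with rfl | rfl
  · push_cast
    ring
  · rw [neg_neg]
    push_cast
    ring

theorem isBigO_exp_neg_abs_rpow {z : ℂ} (hz : 0 < z.re) :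
    (fun x : ℝ => Complex.exp (-(z * ((|x| ^ b : ℝ) : ℂ)))) =O[cocompact ℝ]
      (fun x : ℝ => |x| ^ (-2 : ℝ)) := by
  refine Asymptotics.IsBigO.of_bound (2 / z.re ^ 2) ?_
  filter_upwards [(tendsto_norm_cocompact_atTop (E := ℝ)).eventually_ge_atTop 1] with x hx
  rw [Real.norm_eq_abs] at hx
  rw [Complex.norm_exp, Complex.neg_re, Complex.re_mul_ofReal,
    Real.norm_of_nonneg (by positivity), Real.rpow_neg (abs_nonneg _), Real.exp_neg]
  have h1 : |x| ≤ |x| ^ b := Real.self_le_rpow_of_one_le hx hb.le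
  have h2 := Real.quadratic_le_exp_of_nonneg (x := z.re * |x| ^ b) (by positivity)
  have h3 : (z.re * |x|) ^ 2 ≤ (z.re * |x| ^ b) ^ 2 := by gcongr
  have h4 : 0 ≤ z.re * |x| ^ b := by positivity
  rw [show (2 : ℝ) = ((2 : ℕ) : ℝ) by norm_num, Real.rpow_natCast, ← div_eq_mul_inv, div_div,
    ← mul_pow, inv_le_comm₀ (Real.exp_pos _) (by positivity), inv_div]
  push_cast
  linarith

/-- The expansion of order N = 1 has no constant term, so its remainder estimate is already a decay
rate k^(-b). -/
theorem norm_osc_le {Z : ℂ} (hZ : |Z.im| < π / 2) : ∃ C ≥ 0, ∀ (σ : ℤˣ) (k : ℕ), 1 ≤ k →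
    ‖osc b σ k Z‖ ≤ C * (k : ℝ) ^ (-b) := by
  obtain ⟨C, hC, h⟩ := exists_norm_osc_sub_le hb (δ₀ := π / 2 - |Z.im|) (by linarith)
    (by linarith [abs_nonneg Z.im]) 1
  refine ⟨C * Real.exp Z.re, by positivity, fun σ k hk => ?_⟩
  have := h σ k Z hk (by linarith)
  simpa [ampCoeff, slopeCoeff, mul_assoc] using this

theorem summable_osc {Z : ℂ} (hZ : |Z.im| < π / 2) (σ : ℤˣ) : Summable fun k : ℕ =>
    ((σ : ℤ) : ℂ) / (2 * π * I * ((k + 1 : ℕ) : ℂ)) * osc b σ (k + 1) Z := by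
  obtain ⟨C, hC, h⟩ := norm_osc_le hb hZ
  have hs : Summable fun k : ℕ => C * ((k + 1 : ℕ) : ℝ) ^ (-b) :=
    ((summable_nat_add_iff 1).2 (Real.summable_nat_rpow.2 (by linarith : -b < -1))).mul_left C
  refine Summable.of_norm_bounded hs fun k => ?_
  rw [norm_mul]
  have h1 : ‖((σ : ℤ) : ℂ) / (2 * π * I * ((k + 1 : ℕ) : ℂ))‖ ≤ 1 := by
    have h2 : ‖((σ : ℤ) : ℂ)‖ = 1 := by rcases Int.units_eq_one_or σ with rfl | rfl <;> simp
    rw [norm_div, h2, norm_mul, norm_mul, norm_mul, Complex.norm_I, Complex.norm_natCast,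
      Complex.norm_real, Real.norm_of_nonneg Real.pi_pos.le, Complex.norm_ofNat]
    rw [div_le_one (by positivity)]
    have h3 : (1 : ℝ) ≤ ((k + 1 : ℕ) : ℝ) := by exact_mod_cast Nat.le_add_left 1 k
    nlinarith [Real.pi_gt_three]
  refine (mul_le_of_le_one_left (norm_nonneg _) h1).trans (h σ (k + 1) (Nat.le_add_left 1 k))

/-- Poisson summation for the lacunary series. -/
theorem lacunary_exp_eq {Z : ℂ} (hZ : |Z.im| < π / 2) :
    lacunary b (Complex.exp Z) = leading b Z +
      ∑' k : ℕ, ∑ σ : ℤˣ, ((σ : ℤ) : ℂ) / (2 * π * I * ((k + 1 : ℕ) : ℂ)) * osc b σ (k + 1) Z := by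
  have hb0 : 0 < b := by linarith
  have hz : 0 < (Complex.exp Z).re := by
    have := re_exp_mul_exp_pos (W := Z) (α := 0) (by simpa using hZ)
    simpa using this
  set F : ℝ → ℂ := fun x : ℝ => Complex.exp (-(Complex.exp Z * ((|x| ^ b : ℝ) : ℂ))) with hF
  have hcont : Continuous F := by
    have : Continuous fun x : ℝ => |x| ^ b :=
      (Real.continuous_rpow_const hb0.le).comp continuous_abs
    rw [hF]; fun_prop
  have hg : ∀ n : ℤ, 𝓕 F (((-n : ℤ)) : ℝ) = 𝓕 F (n : ℝ) := by
    intro n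
    rcases Nat.eq_zero_or_pos n.natAbs with h | h
    · rw [Int.natAbs_eq_zero] at h; rw [h, neg_zero]
    · rw [fourier_exp_neg_abs_rpow hb hz h n rfl,
        fourier_exp_neg_abs_rpow hb hz h (-n) (Int.natAbs_neg n)]
  have hg1 : ∀ k : ℕ, 𝓕 F (((k : ℤ) + 1 : ℤ) : ℝ) = ∑ σ : ℤˣ,
      ((σ : ℤ) : ℂ) / (2 * π * I * ((k + 1 : ℕ) : ℂ)) * osc b σ (k + 1) Z := fun k =>
    fourier_exp_neg_abs_rpow hb hz (Nat.le_add_left 1 k) _ (by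
      have : (k : ℤ) + 1 = ((k + 1 : ℕ) : ℤ) := by push_cast; rfl
      rw [this, Int.natAbs_natCast])
  have hgs : Summable fun k : ℕ => 𝓕 F (((k : ℤ) + 1 : ℤ) : ℝ) := by
    simp_rw [hg1]
    exact summable_sum fun σ _ => summable_osc hb hZ σ
  have h0 : 𝓕 F ((0 : ℤ) : ℝ) = 2 * (leading b Z + 1 / 2) := by
    rw [Real.fourier_real_eq_integral_exp_smul]
    simp only [Int.cast_zero, mul_zero, Complex.ofReal_zero, zero_mul, Complex.exp_zero, one_smul]
    have hI : IntegrableOn (fun x : ℝ => Complex.exp (-(Complex.exp Z * ((x ^ b : ℝ) : ℂ)))) (Ioi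
        0) := by
      simpa using integrableOn_stretched hb hz (φ := fun _ => 1) continuous_const (C := 1) (s := 0)
        le_rfl (fun x _ => by simp)
    have hI1 : ∀ x ∈ Ioi (0 : ℝ), F x = Complex.exp (-(Complex.exp Z * ((x ^ b : ℝ) : ℂ))) := by
      intro x hx; simp only [hF, abs_of_pos hx.out]
    have hI2 : ∀ x ∈ Ioi (0 : ℝ), F (-x) = Complex.exp (-(Complex.exp Z * ((x ^ b : ℝ) : ℂ))) := by
      intro x hx; simp only [hF, abs_neg, abs_of_pos hx.out]
    rw [integral_eq_integral_Ioi_add (hI.congr_fun (fun x hx => (hI1 x hx).symm) measurableSet_Ioi)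
      (hI.congr_fun (fun x hx => (hI2 x hx).symm) measurableSet_Ioi),
      setIntegral_congr_fun measurableSet_Ioi hI1, setIntegral_congr_fun measurableSet_Ioi hI2,
      leading_eq hb hz hZ, two_mul]
  have hFn : ∀ n : ℤ, F (((-n : ℤ)) : ℝ) = F (n : ℝ) := by
    intro n; simp only [hF]; push_cast; rw [abs_neg]
  have hF1 : ∀ k : ℕ, F (((k : ℤ) + 1 : ℤ) : ℝ) =
      Complex.exp (-(Complex.exp Z * ((((k : ℝ) + 1) ^ b : ℝ) : ℂ))) := by
    intro k
    simp only [hF]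
    push_cast
    rw [abs_of_pos (by positivity)]
  have hFs : Summable fun k : ℕ => F (((k : ℤ) + 1 : ℤ) : ℝ) := by
    simp_rw [hF1]; exact summable_lacunary hb hz
  have e3 : F ((0 : ℤ) : ℝ) = 1 := by
    simp only [hF, Int.cast_zero, abs_zero, Real.zero_rpow hb0.ne']
    simp
  -- The value 1 at the origin on the left cancels twice the 1/2 added to `leading` in the zeroth
  -- Fourier coefficient, and halving leaves the series itself.
  have hP := poisson_even hcont (isBigO_exp_neg_abs_rpow hb hz) hFn hg hFs hgs
  rw [h0, e3, tsum_congr hF1, tsum_congr hg1] at hP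
  rw [lacunary]
  generalize (∑' k : ℕ, Complex.exp (-(Complex.exp Z * ((((k : ℝ) + 1) ^ b : ℝ) : ℂ)))) = A at hP ⊢
  linear_combination hP / 2

end

/-! ### The Borel transform of the asymptotic series -/

/-- The weights of the branches in the Borel transform. -/
noncomputable def weight (σ : ℤˣ) (k : ℕ) : ℂ := ((σ : ℤ) : ℂ) / (2 * π * I * ((k + 1 : ℕ) : ℂ))

/-- The Borel transform of the asymptotic series, in the variable `p ^ (b - 1)`. -/
noncomputable def borelFn (b : ℝ) (ξ : ℂ) : ℂ :=
  ∑' k : ℕ, ∑ σ : ℤˣ, weight σ k *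
    slope b (ξ * Complex.exp (-(((b - 1 : ℝ) : ℂ) * branchPt b σ 0 (k + 1))))

theorem norm_weight (σ : ℤˣ) (k : ℕ) : ‖weight σ k‖ = 1 / (2 * π * (k + 1)) := by
  have h2 : ‖((σ : ℤ) : ℂ)‖ = 1 := by rcases Int.units_eq_one_or σ with rfl | rfl <;> simp
  rw [weight, norm_div, h2, norm_mul, norm_mul, norm_mul, Complex.norm_I, Complex.norm_natCast,
    Complex.norm_real, Real.norm_of_nonneg Real.pi_pos.le, Complex.norm_ofNat, mul_one]
  push_cast
  rfl

theorem norm_weight_le_one (σ : ℤˣ) (k : ℕ) : ‖weight σ k‖ ≤ 1 := by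
  rw [norm_weight, div_le_one (by positivity)]
  have : (0 : ℝ) ≤ k := by positivity
  nlinarith [Real.pi_gt_three]

theorem weight_ne_zero (σ : ℤˣ) (k : ℕ) : weight σ k ≠ 0 := by
  rw [← norm_pos_iff, norm_weight]; positivity

theorem onLog_borelFn (b : ℝ) (l : ℂ) : onLog b (borelFn b) l =
    ∑' k : ℕ, ∑ σ : ℤˣ, weight σ k * branchSlope b σ (k + 1) l := by
  rw [onLog, borelFn]
  refine tsum_congr fun k => Finset.sum_congr rfl fun σ _ => ?_
  rw [branchSlope, ← Complex.exp_add]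
  congr 3
  ring

theorem norm_sum_weight_le {k : ℕ} {B : ℝ} {f : ℤˣ → ℂ} (h : ∀ σ, ‖f σ‖ ≤ B) :
    ‖∑ σ : ℤˣ, weight σ k * f σ‖ ≤ 2 * B := by
  rw [sum_units]
  have h1 : ∀ σ, ‖weight σ k * f σ‖ ≤ B := fun σ => by
    rw [norm_mul]
    exact (mul_le_of_le_one_left (norm_nonneg _) (norm_weight_le_one σ k)).trans (h σ)
  have := norm_add_le (weight 1 k * f 1) (weight (-1) k * f (-1))
  linarith [h1 1, h1 (-1)]

theorem summable_succ_rpow {s : ℝ} (hs : 1 < s) : Summable fun k : ℕ => ((k + 1 : ℕ) : ℝ) ^ (-s) :=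
  (summable_nat_add_iff 1).2 (Real.summable_nat_rpow.2 (by linarith : -s < -1))

section

variable {b : ℝ} (hb : 1 < b)

include hb

theorem mul_branchPt (σ : ℤˣ) {k : ℕ} (hk : 1 ≤ k) : ((b - 1 : ℝ) : ℂ) * branchPt b σ 0 k =
    ((shiftConst b + b * Real.log (2 * π * k) : ℝ) : ℂ) +
      (((σ : ℤ) * ((2 - b) * π / 2) : ℝ) : ℂ) * I := by
  have hb0 : 0 < b := by linarith
  have hb1 : 0 < b - 1 := by linarith
  have hk0 : (0 : ℝ) < k := by exact_mod_cast hk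
  have hπ := Real.pi_pos
  have h1b : 1 - 1 / b = (b - 1) / b := by field_simp
  apply Complex.ext
  · rw [Complex.re_ofReal_mul, re_branchPt, Complex.add_re, Complex.ofReal_re,
      Complex.re_ofReal_mul, Complex.I_re, mul_zero, add_zero, shiftConst,
      Real.log_mul (x := 2 * π) (by positivity) hk0.ne', h1b,
      Real.log_mul (x := 2 * π) (y := (b - 1) / b) (by positivity) (by positivity),
      Real.log_div hb1.ne' hb0.ne', Real.log_div (by positivity) hb0.ne']
    field_simp
    ring
  · rw [Complex.im_ofReal_mul, im_branchPt, Complex.add_im, Complex.ofReal_im,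
      Complex.im_ofReal_mul, Complex.I_im]
    push_cast
    field_simp
    ring

/-- Since (b - 1) arg s_σ = σ(π - bπ/2), the exponential contributes (-1)^j and a half-angle phase;
the Gamma factor of Watson's lemma cancels the denominator of `slopeCoeff`. -/
theorem ampCoeff_eq (σ : ℤˣ) {k j : ℕ} (hk : 1 ≤ k) (hj : 1 ≤ j) : ampCoeff b σ k j =
    (-1) ^ (j + 1) * (Real.Gamma (j * b + 1) : ℂ) / (j.factorial : ℂ) *
      (((2 * π * k) ^ (-(j * b)) : ℝ) : ℂ) * Complex.exp ((σ : ℤ) * (π * I * (j * b) / 2)) := by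
  have hb1 : 0 < b - 1 := by linarith
  have hk0 : (0 : ℝ) < k := by exact_mod_cast hk
  have hπ := Real.pi_pos
  have hΓ : 0 < Real.Gamma (j * (b - 1) + 1) := Real.Gamma_pos_of_pos (by positivity)
  have hΓC : ((Real.Gamma (j * (b - 1) + 1) : ℝ) : ℂ) ≠ 0 := by exact_mod_cast hΓ.ne'
  have hf : (j.factorial : ℂ) ≠ 0 := by exact_mod_cast Nat.factorial_ne_zero j
  have e1 : Complex.exp (-(j * ((b - 1 : ℝ) : ℂ) * branchPt b σ 0 k)) =
      Complex.exp (-(j * shiftConst b)) * (((2 * π * k) ^ (-(j * b)) : ℝ) : ℂ) *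
        ((-1) ^ j * Complex.exp ((σ : ℤ) * (π * I * (j * b) / 2))) := by
    have e2 : (-1 : ℂ) ^ j = Complex.exp (j * (-((σ : ℤ) * (π * I)))) := by
      rw [Complex.exp_nat_mul]
      congr 1
      rcases Int.units_eq_one_or σ with rfl | rfl
      · simp [Complex.exp_neg, Complex.exp_pi_mul_I]
      · simp [Complex.exp_pi_mul_I]
    rw [e2, Real.rpow_def_of_pos (by positivity), Complex.ofReal_exp, ← Complex.exp_add,
      ← Complex.exp_add, ← Complex.exp_add, mul_assoc, mul_branchPt hb σ hk]
    congr 1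
    push_cast
    ring
  rw [ampCoeff, e1, slopeCoeff, if_neg (by omega), Complex.exp_neg]
  have hE := Complex.exp_ne_zero (j * shiftConst b : ℂ)
  push_cast
  rw [mul_comm b (j : ℝ), pow_succ]
  field_simp

/-- The factor k^(-jb) of the branch and 1/k of the weight sum to ζ(jb + 1). With E = exp(iπjb/2),
the two signs give E - 1/E, which combines with the power of 2πi in `lagrangeCoeff` into 1 -
(-1)^(jb). -/
theorem hasSum_seriesCoeff {j : ℕ} (hj : 1 ≤ j) :
    HasSum (fun k : ℕ => ∑ σ : ℤˣ, weight σ k * ampCoeff b σ (k + 1) j) (seriesCoeff b j) := by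
  have hb0 : 0 < b := by linarith
  have hj0 : (0 : ℝ) < j := by exact_mod_cast hj
  have hjb : 0 < j * b := by positivity
  have hπ := Real.pi_pos
  have hπC : (π : ℂ) ≠ 0 := by exact_mod_cast hπ.ne'
  have hI := Complex.I_ne_zero
  have hI2 := Complex.I_sq
  set E : ℂ := Complex.exp (π * I * (j * b) / 2) with hE
  have hE0 : E ≠ 0 := Complex.exp_ne_zero _
  set c : ℂ := (-1) ^ (j + 1) * (Real.Gamma (j * b + 1) : ℂ) / (j.factorial : ℂ) *
    (((2 * π) ^ (-(j * b)) : ℝ) : ℂ) * (E - E⁻¹) / (2 * π * I) with hc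
  have h1 : ∀ k : ℕ, ∑ σ : ℤˣ, weight σ k * ampCoeff b σ (k + 1) j =
      c * (((((k : ℝ) + 1) ^ (-(j * b + 1)) : ℝ)) : ℂ) := by
    intro k
    have hk0 : (0 : ℝ) < (k : ℝ) + 1 := by positivity
    have hkC : ((k : ℂ) + 1) ≠ 0 := by exact_mod_cast hk0.ne'
    rw [sum_units, ampCoeff_eq hb _ (Nat.le_add_left 1 k) hj, ampCoeff_eq hb _ (Nat.le_add_left 1
        k) hj]
    have e1 : Complex.exp (((1 : ℤˣ) : ℤ) * (π * I * (j * b) / 2)) = E := by simp [hE]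
    have e2 : Complex.exp (((-1 : ℤˣ) : ℤ) * (π * I * (j * b) / 2)) = E⁻¹ := by
      rw [hE, ← Complex.exp_neg]; simp
    have e3 : (2 * π * ((k + 1 : ℕ) : ℝ)) ^ (-(j * b)) =
        (2 * π) ^ (-(j * b)) * (((k : ℝ) + 1) ^ (-(j * b + 1)) * (k + 1)) := by
      rw [Real.mul_rpow (by positivity) (by positivity), ← Real.rpow_add_one hk0.ne']
      push_cast
      congr 2
      ring
    rw [e1, e2, e3, weight, weight, hc]
    push_cast
    field_simp
    ring
  simp_rw [h1]
  have hs : HasSum (fun k : ℕ => (((((k : ℝ) + 1) ^ (-(j * b + 1)) : ℝ)) : ℂ))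
      (riemannZeta ((j * b + 1 : ℝ) : ℂ)) := by
    rw [zeta_eq_tsum_one_div_nat_add_one_cpow (by rw [Complex.ofReal_re]; linarith)]
    have e4 : ∀ k : ℕ, 1 / ((k : ℂ) + 1) ^ ((j * b + 1 : ℝ) : ℂ) =
        (((((k : ℝ) + 1) ^ (-(j * b + 1)) : ℝ)) : ℂ) := by
      intro k
      rw [Real.rpow_neg (by positivity), Complex.ofReal_inv, Complex.ofReal_cpow (by positivity),
        one_div]
      push_cast
      rfl
    simp_rw [e4]
    refine Summable.hasSum ?_
    have := summable_succ_rpow (s := j * b + 1) (by linarith)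
    push_cast at this
    exact Complex.ofRealCLM.summable this
  have h2 : c * riemannZeta ((j * b + 1 : ℝ) : ℂ) = seriesCoeff b j := by
    have hm : (-1 : ℂ) ^ ((j * b : ℝ) : ℂ) = E ^ 2 := by
      rw [Complex.cpow_def_of_ne_zero (by norm_num), Complex.log_neg_one, hE, ← Complex.exp_nat_mul]
      congr 1
      push_cast
      ring
    have hp : (2 * (π : ℂ) * I) ^ ((j * b : ℝ) : ℂ) = ((((2 * π) ^ (j * b) : ℝ)) : ℂ) * E := by
      have hl : Complex.log (2 * π * I) = (Real.log (2 * π) : ℂ) + π / 2 * I := by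
        have : (2 * π * I : ℂ) = ((2 * π : ℝ) : ℂ) * I := by push_cast; ring
        rw [this, Complex.log_ofReal_mul (by positivity) hI, Complex.log_I]
      rw [Complex.cpow_def_of_ne_zero (by
        exact mul_ne_zero (mul_ne_zero two_ne_zero hπC) hI), hl, Real.rpow_def_of_pos (by
            positivity),
        Complex.ofReal_exp, hE, ← Complex.exp_add]
      congr 1
      push_cast
      ring
    have hP0 : (((2 * π) ^ (j * b) : ℝ) : ℂ) ≠ 0 := by
      have : (0 : ℝ) < (2 * π) ^ (j * b) := by positivity
      exact_mod_cast this.ne'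
    have hf : (j.factorial : ℂ) ≠ 0 := by exact_mod_cast Nat.factorial_ne_zero j
    rw [seriesCoeff, lagrangeCoeff, hm, hp, hc, Real.rpow_neg (by positivity), Complex.ofReal_inv]
    field_simp
    rw [hI2]
    ring
  rw [← h2]
  exact hs.mul_left c

/-- Summation of the expansions of the branches. -/
theorem norm_leading_add_sub_partialSum_le {Z : ℂ} {N : ℕ} {C : ℝ} {a : ℤˣ → ℕ → ℂ}
    (h : ∀ σ k, ‖a σ k - ∑ j ∈ Finset.range (N + 1), ampCoeff b σ (k + 1) j * Complex.exp (j * Z)‖ ≤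
      C * (Real.exp ((N + 1 : ℕ) * Z.re) * ((k + 1 : ℕ) : ℝ) ^ (-(b * (N + 1 : ℕ))))) :
    ‖leading b Z + ∑' k : ℕ, ∑ σ : ℤˣ, weight σ k * a σ k - partialSum b N Z‖ ≤
      2 * C * (∑' k : ℕ, ((k + 1 : ℕ) : ℝ) ^ (-(b * (N + 1 : ℕ)))) * Real.exp ((N + 1 : ℕ) *
          Z.re) := by
  have hbN : 1 < b * (N + 1 : ℕ) := by
    have : (1 : ℝ) ≤ ((N + 1 : ℕ) : ℝ) := by exact_mod_cast Nat.le_add_left 1 N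
    nlinarith
  have hs := summable_succ_rpow hbN
  -- The coefficient with j = 0 vanishes, so the truncations run over 1 ≤ j ≤ N, and each power is
  -- summed over k separately.
  have hS : HasSum (fun k : ℕ => ∑ σ : ℤˣ, weight σ k *
      ∑ j ∈ Finset.range (N + 1), ampCoeff b σ (k + 1) j * Complex.exp (j * Z))
      (∑ j ∈ Finset.Icc 1 N, seriesCoeff b j * Complex.exp (j * Z)) := by
    have h1 : ∀ k : ℕ, ∑ σ : ℤˣ, weight σ k *
        ∑ j ∈ Finset.range (N + 1), ampCoeff b σ (k + 1) j * Complex.exp (j * Z) =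
        ∑ j ∈ Finset.Icc 1 N, (∑ σ : ℤˣ, weight σ k * ampCoeff b σ (k + 1) j) *
          Complex.exp (j * Z) := by
      intro k
      have h2 : ∀ σ : ℤˣ, ∑ j ∈ Finset.range (N + 1), ampCoeff b σ (k + 1) j * Complex.exp (j * Z) =
          ∑ j ∈ Finset.Icc 1 N, ampCoeff b σ (k + 1) j * Complex.exp (j * Z) := by
        intro σ
        symm
        refine Finset.sum_subset (fun j hj => ?_) fun j hj hj' => ?_
        · rw [Finset.mem_Icc] at hj; rw [Finset.mem_range]; omega
        · rw [Finset.mem_range] at hj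
          rw [Finset.mem_Icc] at hj'
          have : j = 0 := by omega
          rw [this, ampCoeff, slopeCoeff, if_pos rfl]
          simp
      simp_rw [h2, Finset.mul_sum, Finset.sum_mul]
      rw [Finset.sum_comm]
      refine Finset.sum_congr rfl fun j _ => Finset.sum_congr rfl fun σ _ => by ring
    simp_rw [h1]
    exact hasSum_sum fun j hj =>
      (hasSum_seriesCoeff hb (Finset.mem_Icc.1 hj).1).mul_right _
  have hbd : ∀ k : ℕ, ‖∑ σ : ℤˣ, weight σ k * (a σ k -
      ∑ j ∈ Finset.range (N + 1), ampCoeff b σ (k + 1) j * Complex.exp (j * Z))‖ ≤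
      (2 * C * Real.exp ((N + 1 : ℕ) * Z.re)) * ((k + 1 : ℕ) : ℝ) ^ (-(b * (N + 1 : ℕ))) := by
    intro k
    refine (norm_sum_weight_le (fun σ => h σ k)).trans (le_of_eq ?_)
    ring
  have hR : Summable fun k : ℕ => ∑ σ : ℤˣ, weight σ k * (a σ k -
      ∑ j ∈ Finset.range (N + 1), ampCoeff b σ (k + 1) j * Complex.exp (j * Z)) :=
    Summable.of_norm_bounded (hs.mul_left _) hbd
  have e : leading b Z + ∑' k : ℕ, ∑ σ : ℤˣ, weight σ k * a σ k - partialSum b N Z =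
      ∑' k : ℕ, ∑ σ : ℤˣ, weight σ k * (a σ k -
        ∑ j ∈ Finset.range (N + 1), ampCoeff b σ (k + 1) j * Complex.exp (j * Z)) := by
    have h3 := (hR.hasSum.add hS).tsum_eq
    have h4 : ∀ k : ℕ, ∑ σ : ℤˣ, weight σ k * (a σ k -
        ∑ j ∈ Finset.range (N + 1), ampCoeff b σ (k + 1) j * Complex.exp (j * Z)) +
        ∑ σ : ℤˣ, weight σ k *
          ∑ j ∈ Finset.range (N + 1), ampCoeff b σ (k + 1) j * Complex.exp (j * Z) =
        ∑ σ : ℤˣ, weight σ k * a σ k := by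
      intro k
      rw [← Finset.sum_add_distrib]
      refine Finset.sum_congr rfl fun σ _ => by ring
    simp_rw [h4] at h3
    rw [h3, partialSum]
    ring
  rw [e]
  refine (tsum_of_norm_bounded (hs.mul_left _).hasSum hbd).trans (le_of_eq ?_)
  rw [tsum_mul_left]
  ring

theorem lacunary_asymptotic {δ : ℝ} (hδ : 0 < δ) (N : ℕ) : ∃ C : ℝ, ∀ z : ℂ, z ≠ 0 → ‖z‖ ≤ 1 →
    |z.arg| ≤ π / 2 - δ →
      ‖lacunary b z - partialSum b N (Complex.log z)‖ ≤ C * ‖z‖ ^ (N + 1) := by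
  rcases lt_or_ge (π / 2) δ with h | h
  · exact ⟨0, fun z _ _ hz => absurd (abs_nonneg z.arg) (by linarith)⟩
  obtain ⟨C, hC, hosc⟩ := exists_norm_osc_sub_le hb hδ h (N + 1)
  refine ⟨2 * C * (∑' k : ℕ, ((k + 1 : ℕ) : ℝ) ^ (-(b * (N + 1 : ℕ)))), fun z hz _ harg => ?_⟩
  have him : (Complex.log z).im = z.arg := Complex.log_im z
  have hexp : Complex.exp (Complex.log z) = z := Complex.exp_log hz
  have h1 := norm_leading_add_sub_partialSum_le hb (Z := Complex.log z) (N := N) (C := C)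
    (a := fun σ k => osc b σ (k + 1) (Complex.log z))
    (fun σ k => hosc σ (k + 1) _ (Nat.le_add_left 1 k) (by rw [him]; exact harg))
  have h2 := lacunary_exp_eq hb (Z := Complex.log z) (by rw [him]; linarith)
  rw [hexp] at h2
  rw [h2]
  refine h1.trans (le_of_eq ?_)
  rw [Real.exp_nat_mul, Complex.log_re, Real.exp_log (norm_pos_iff.2 hz)]

end

/-! ### Convergence of the Borel transform -/

/-- The scaling factor of a branch. -/
noncomputable def scale (b : ℝ) (σ : ℤˣ) (k : ℕ) : ℂ :=
  Complex.exp (-(((b - 1 : ℝ) : ℂ) * branchPt b σ 0 (k + 1)))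

/-- Interchange of an absolutely convergent double series, with the identically zero column j = 0
dropped, since the Taylor series starts at j = 1. -/
theorem hasSum_swap {F : ℕ × ℕ → ℂ} (hF : Summable F) {g c : ℕ → ℂ}
    (h1 : ∀ k, HasSum (fun j => F (k, j)) (g k)) (h0 : ∀ k, F (k, 0) = 0)
    (h2 : ∀ j, HasSum (fun k => F (k, j + 1)) (c j)) : HasSum c (∑' k, g k) := by
  set c' : ℕ → ℂ := fun j => j.casesOn 0 c with hc'
  have h3 : ∀ j, HasSum (fun k => F (k, j)) (c' j) := by
    intro j
    rcases j with _ | j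
    · have : (fun k => F (k, 0)) = fun _ => 0 := funext h0
      rw [this]; exact hasSum_zero
    · exact h2 j
  have h5 : HasSum (fun p : ℕ × ℕ => F (p.2, p.1)) (∑' p, F p) :=
    (Equiv.prodComm ℕ ℕ).hasSum_iff.2 hF.hasSum
  have h6 : HasSum c' (∑' p, F p) := h5.prod_fiberwise h3
  rw [(hF.hasSum.prod_fiberwise h1).tsum_eq]
  have h7 := (hasSum_nat_add_iff' 1).2 h6
  rw [Finset.sum_range_one, sub_eq_self.2 (rfl : c' 0 = 0)] at h7
  exact h7

section

variable {b : ℝ} (hb : 1 < b)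

include hb

theorem exists_norm_scale : ∃ c > 0, ∀ (σ : ℤˣ) (k : ℕ),
    ‖scale b σ k‖ = c * ((k + 1 : ℕ) : ℝ) ^ (-b) := by
  obtain ⟨c, hc, h⟩ := exp_re_branchPt hb
  refine ⟨c, hc, fun σ k => ?_⟩
  have := h σ (k + 1) (Nat.le_add_left 1 k) 1
  rw [scale, Complex.norm_exp, Complex.neg_re, Complex.re_ofReal_mul]
  simpa using this

theorem exists_norm_slope_le_linear : ∃ ρ > 0, ∃ C ≥ 0, ∀ ξ : ℂ, ‖ξ‖ < ρ →
    DifferentiableAt ℂ (slope b) ξ ∧ ‖slope b ξ‖ ≤ C * ‖ξ‖ := by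
  have h1 : DifferentiableAt ℂ (slope b) 0 := differentiableAt_slope hb (by simp)
  have h2 := h1.isBigO_sub
  simp only [slope_zero hb, sub_zero] at h2
  obtain ⟨C, hC⟩ := h2.bound
  obtain ⟨ρ, hρ, h⟩ := Metric.eventually_nhds_iff.1 hC
  refine ⟨min ρ 1, lt_min hρ one_pos, max C 0, le_max_right _ _, fun ξ hξ => ⟨?_, ?_⟩⟩
  · refine differentiableAt_slope hb (Or.inl ?_)
    rw [Complex.sub_re, Complex.one_re]
    have := (Complex.re_le_norm ξ).trans_lt (hξ.trans_le (min_le_right _ _))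
    linarith
  · refine (h (y := ξ) (by simpa using hξ.trans_le (min_le_left _ _))).trans ?_
    gcongr
    exact le_max_left _ _

/-- All but finitely many of the terms of `borelFn` sum to an analytic function on a given disc. -/
theorem exists_tail (R : ℝ) : ∃ K₀ : ℕ, ∀ K ≥ K₀,
    DifferentiableOn ℂ (fun ξ => ∑' k : ℕ, ∑ σ : ℤˣ, weight σ (k + K) *
      slope b (ξ * scale b σ (k + K))) (Metric.ball 0 R) ∧
    ∀ ξ ∈ Metric.ball (0 : ℂ) R, Summable fun k : ℕ => ∑ σ : ℤˣ, weight σ (k + K) *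
      slope b (ξ * scale b σ (k + K)) := by
  obtain ⟨c, hc, hsc⟩ := exists_norm_scale hb
  obtain ⟨ρ, hρ, C, hC, hlin⟩ := exists_norm_slope_le_linear hb
  have ht : Tendsto (fun k : ℕ => |R| * (c * ((k + 1 : ℕ) : ℝ) ^ (-b))) atTop (𝓝 0) := by
    have := ((summable_succ_rpow hb).tendsto_atTop_zero.const_mul c).const_mul |R|
    simpa using this
  obtain ⟨K₀, hK₀⟩ := eventually_atTop.1 (ht.eventually_lt_const hρ)
  refine ⟨K₀, fun K hK => ?_⟩
  have hs : Summable fun k : ℕ => 2 * (C * (|R| * (c * ((k + K + 1 : ℕ) : ℝ) ^ (-b)))) :=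
    (((((summable_nat_add_iff K).2 (summable_succ_rpow hb)).mul_left c).mul_left _).mul_left
      _).mul_left _
  have hsmall : ∀ ξ ∈ Metric.ball (0 : ℂ) R, ∀ (σ : ℤˣ) (k : ℕ), ‖ξ * scale b σ (k + K)‖ < ρ ∧
      ‖ξ * scale b σ (k + K)‖ ≤ |R| * (c * ((k + K + 1 : ℕ) : ℝ) ^ (-b)) := by
    intro ξ hξ σ k
    have h1 : ‖ξ * scale b σ (k + K)‖ ≤ |R| * (c * ((k + K + 1 : ℕ) : ℝ) ^ (-b)) := by
      rw [norm_mul, hsc]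
      have h2 : ‖ξ‖ ≤ |R| := (mem_ball_zero_iff.1 hξ).le.trans (le_abs_self R)
      gcongr
    exact ⟨h1.trans_lt (hK₀ (k + K) (by omega)), h1⟩
  have hbd : ∀ (k : ℕ), ∀ ξ ∈ Metric.ball (0 : ℂ) R, ‖∑ σ : ℤˣ, weight σ (k + K) *
      slope b (ξ * scale b σ (k + K))‖ ≤ 2 * (C * (|R| * (c * ((k + K + 1 : ℕ) : ℝ) ^ (-b)))) := by
    intro k ξ hξ
    refine norm_sum_weight_le fun σ => ?_
    obtain ⟨h1, h2⟩ := hsmall ξ hξ σ k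
    exact (hlin _ h1).2.trans (mul_le_mul_of_nonneg_left h2 hC)
  refine ⟨Complex.differentiableOn_tsum_of_summable_norm hs (fun k => ?_) Metric.isOpen_ball hbd,
    fun ξ hξ => Summable.of_norm_bounded hs fun k => hbd k ξ hξ⟩
  intro ξ hξ
  refine DifferentiableAt.differentiableWithinAt ?_
  refine DifferentiableAt.fun_sum fun σ _ => DifferentiableAt.const_mul ?_ _
  exact DifferentiableAt.comp ξ (g := slope b) (hlin _ (hsmall ξ hξ σ k).1).1
    (differentiableAt_id.mul_const _)

theorem summable_borelFn (ξ : ℂ) : Summable fun k : ℕ => ∑ σ : ℤˣ, weight σ k *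
    slope b (ξ * scale b σ k) := by
  obtain ⟨K, hK⟩ := exists_tail hb (‖ξ‖ + 1)
  exact (summable_nat_add_iff K).1 ((hK K le_rfl).2 ξ (by simp))

theorem borelFn_eq_add (K : ℕ) (ξ : ℂ) : borelFn b ξ =
    ∑ k ∈ Finset.range K, ∑ σ : ℤˣ, weight σ k * slope b (ξ * scale b σ k) +
      ∑' k : ℕ, ∑ σ : ℤˣ, weight σ (k + K) * slope b (ξ * scale b σ (k + K)) :=
  ((summable_borelFn hb ξ).sum_add_tsum_nat_add K).symm

theorem analyticAt_borelFn_zero : AnalyticAt ℂ (borelFn b) 0 := by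
  obtain ⟨K, hK⟩ := exists_tail hb 1
  have h1 : AnalyticAt ℂ (fun ξ => ∑' k : ℕ, ∑ σ : ℤˣ, weight σ (k + K) *
      slope b (ξ * scale b σ (k + K))) 0 :=
    (hK K le_rfl).1.analyticAt (Metric.ball_mem_nhds 0 one_pos)
  have h2 : AnalyticAt ℂ (fun ξ => ∑ k ∈ Finset.range K, ∑ σ : ℤˣ, weight σ k *
      slope b (ξ * scale b σ k)) 0 := by
    refine Finset.analyticAt_fun_sum _ fun k _ => Finset.analyticAt_fun_sum _ fun σ _ => ?_
    refine analyticAt_const.mul (AnalyticAt.fun_comp (g := slope b) ?_ (by fun_prop))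
    rw [zero_mul]
    exact analyticAt_slope hb (by simp)
  refine (h2.add h1).congr (Eventually.of_forall fun ξ => ?_)
  exact (borelFn_eq_add hb K ξ).symm

theorem borelFn_zero : borelFn b 0 = 0 := by
  rw [borelFn]
  simp [slope_zero hb]

/-- The Taylor series of `borelFn` is the Borel transform of the asymptotic series. -/
theorem exists_hasSum_borelFn : ∃ ρ : ℝ, 0 < ρ ∧ ∀ ξ : ℂ, ‖ξ‖ < ρ →
    HasSum (fun j : ℕ => seriesCoeff b (j + 1) / (Real.Gamma (((j : ℝ) + 1) * (b - 1) + 1) : ℂ) *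
      ξ ^ (j + 1)) (borelFn b ξ) := by
  have hb1 : 0 < b - 1 := by linarith
  obtain ⟨c, hc, hsc⟩ := exists_norm_scale hb
  obtain ⟨ρ, hρ, hsum, hsum'⟩ := exists_hasSum_slope hb
  refine ⟨ρ / c, by positivity, fun ξ hξ => ?_⟩
  rw [lt_div_iff₀ hc] at hξ
  have hk1 : ∀ k : ℕ, ((k + 1 : ℕ) : ℝ) ^ (-b) ≤ 1 := fun k =>
    Real.rpow_le_one_of_one_le_of_nonpos (by exact_mod_cast Nat.le_add_left 1 k) (by linarith)
  have hn : ∀ (σ : ℤˣ) (k : ℕ), ‖ξ * scale b σ k‖ ≤ ρ * ((k + 1 : ℕ) : ℝ) ^ (-b) := by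
    intro σ k
    rw [norm_mul, hsc, ← mul_assoc]
    gcongr
  have hn' : ∀ (σ : ℤˣ) (k : ℕ), ‖ξ * scale b σ k‖ < ρ := by
    intro σ k
    rw [norm_mul, hsc, ← mul_assoc]
    exact (mul_le_of_le_one_right (by positivity) (hk1 k)).trans_lt hξ
  set F : ℕ × ℕ → ℂ := fun p => ∑ σ : ℤˣ, weight σ p.1 *
    (slopeCoeff b p.2 * (ξ * scale b σ p.1) ^ p.2) with hF
  -- For j ≥ 1 one has (k+1)^(-bj) ≤ (k+1)^(-b), and the term j = 0 is zero. The majorant is thus a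
  -- product of two convergent series.
  have hFb : ∀ p : ℕ × ℕ, ‖F p‖ ≤ 2 * (((p.1 + 1 : ℕ) : ℝ) ^ (-b) * (‖slopeCoeff b p.2‖ * ρ ^
      p.2)) := by
    rintro ⟨k, j⟩
    refine norm_sum_weight_le fun σ => ?_
    simp only
    rcases Nat.eq_zero_or_pos j with rfl | hj
    · simp [slopeCoeff]
    · rw [norm_mul, norm_pow]
      have h1 : ‖ξ * scale b σ k‖ ^ j ≤ (ρ * ((k + 1 : ℕ) : ℝ) ^ (-b)) ^ j :=
        pow_le_pow_left₀ (norm_nonneg _) (hn σ k) j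
      rw [mul_pow] at h1
      have h2 : (((k + 1 : ℕ) : ℝ) ^ (-b)) ^ j ≤ ((k + 1 : ℕ) : ℝ) ^ (-b) :=
        pow_le_of_le_one (by positivity) (hk1 k) (by omega)
      have h3 : ‖ξ * scale b σ k‖ ^ j ≤ ρ ^ j * ((k + 1 : ℕ) : ℝ) ^ (-b) :=
        h1.trans (mul_le_mul_of_nonneg_left h2 (by positivity))
      calc _ ≤ ‖slopeCoeff b j‖ * (ρ ^ j * ((k + 1 : ℕ) : ℝ) ^ (-b)) :=
            mul_le_mul_of_nonneg_left h3 (norm_nonneg _)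
        _ = _ := by ring
  have hFs : Summable F := by
    refine Summable.of_norm_bounded ?_ hFb
    exact ((summable_succ_rpow hb).mul_of_nonneg hsum' (fun k => by positivity)
      (fun j => by positivity)).mul_left 2
  have h1 : ∀ k : ℕ, HasSum (fun j => F (k, j)) (∑ σ : ℤˣ, weight σ k * slope b (ξ * scale b σ
      k)) := by
    intro k
    simp only [hF, sum_units]
    exact ((hsum _ (hn' 1 k)).mul_left (weight 1 k)).add ((hsum _ (hn' (-1) k)).mul_left _)
  have h3 : ∀ j : ℕ, HasSum (fun k => F (k, j + 1)) (seriesCoeff b (j + 1) /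
      (Real.Gamma (((j : ℝ) + 1) * (b - 1) + 1) : ℂ) * ξ ^ (j + 1)) := by
    intro j
    have h4 := ((hasSum_seriesCoeff hb (Nat.le_add_left 1 j)).div_const
      (Real.Gamma (((j : ℝ) + 1) * (b - 1) + 1) : ℂ)).mul_right (ξ ^ (j + 1))
    have hΓ : 0 < Real.Gamma (((j : ℝ) + 1) * (b - 1) + 1) := Real.Gamma_pos_of_pos (by positivity)
    have hΓC : ((Real.Gamma (((j : ℝ) + 1) * (b - 1) + 1) : ℝ) : ℂ) ≠ 0 := by exact_mod_cast hΓ.ne'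
    refine Eq.mpr (congrArg (fun f => HasSum f _) (funext fun k => ?_)) h4
    simp only [hF]
    rw [Finset.sum_div, Finset.sum_mul]
    refine Finset.sum_congr rfl fun σ _ => ?_
    rw [ampCoeff, mul_pow, scale, ← Complex.exp_nat_mul]
    have e2 : (((j + 1 : ℕ) : ℝ) * (b - 1) + 1) = ((j : ℝ) + 1) * (b - 1) + 1 := by push_cast; ring
    have e3 : -(((j + 1 : ℕ) : ℂ) * ((b - 1 : ℝ) : ℂ) * branchPt b σ 0 (k + 1)) =
        ((j + 1 : ℕ) : ℂ) * -(((b - 1 : ℝ) : ℂ) * branchPt b σ 0 (k + 1)) := by ring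
    rw [e2, e3]
    generalize ((Real.Gamma (((j : ℝ) + 1) * (b - 1) + 1) : ℝ) : ℂ) = g at hΓC ⊢
    field_simp
  exact hasSum_swap hFs h1 (fun k => by simp [hF, slopeCoeff]) h3

/-- This is the global Taylor remainder of order one, with zero constant term; it carries the
summable factor in k and the growth |p|^(b-1). -/
theorem exists_norm_branchSlope_le_exp {η : ℝ} (hη : 0 < η) : ∃ C ≥ 0, ∀ (σ : ℤˣ) (k : ℕ) (l : ℂ),
    (∀ n : ℤ, η ≤ |phase b σ l.im - 2 * π * n|) →
      ‖branchSlope b σ (k + 1) l‖ ≤ C * Real.exp ((b - 1) * l.re) * ((k + 1 : ℕ) : ℝ) ^ (-b) := by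
  obtain ⟨C, hC, h⟩ := exists_norm_slope_sub_le hb hη 1
  obtain ⟨c, hc, hck⟩ := exp_re_branchPt hb
  refine ⟨C * c, by positivity, fun σ k l hl => ?_⟩
  have h1 := h (((b - 1 : ℝ) : ℂ) * (l - branchPt b σ 0 (k + 1))) (fun n => by
    rw [im_branch_arg' hb]; exact hl n)
  rw [Finset.sum_range_one, slopeCoeff, if_pos rfl, zero_mul, sub_zero] at h1
  refine h1.trans (le_of_eq ?_)
  have h2 := hck σ (k + 1) (Nat.le_add_left 1 k) 1
  rw [Nat.cast_one, one_mul, mul_one, pow_one] at h2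
  rw [Nat.cast_one, one_mul, Complex.re_ofReal_mul, Complex.sub_re, mul_sub, sub_eq_add_neg,
    Real.exp_add, h2]
  ring

/-- Along the rays that avoid the branch points, the Borel transform may be integrated termwise. -/
theorem onLog_borelFn_ray {α : ℝ} (hα : ¬ IsStokes b α) :
    ∃ C ≥ 0, (∀ t : ℝ, ‖onLog b (borelFn b) (t + α * I)‖ ≤ C * Real.exp ((b - 1) * t)) ∧
      ∀ X : ℂ, 0 < (X * Complex.exp (α * I)).re →
        Integrable (fun t : ℝ => lapKer X (onLog b (borelFn b)) (t + α * I)) ∧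
        HasSum (fun k : ℕ => ∑ σ : ℤˣ, weight σ k *
          ∫ t : ℝ, lapKer X (branchSlope b σ (k + 1)) (t + α * I))
          (∫ t : ℝ, lapKer X (onLog b (borelFn b)) (t + α * I)) := by
  have hb1 : 0 < b - 1 := by linarith
  obtain ⟨η, hη, hdist⟩ := exists_phase_dist hb hα
  obtain ⟨C, hC, hbd⟩ := exists_norm_branchSlope_le_exp hb hη
  have hs := summable_succ_rpow hb
  set S : ℝ := ∑' k : ℕ, ((k + 1 : ℕ) : ℝ) ^ (-b) with hS
  have hterm : ∀ (k : ℕ) (t : ℝ), ‖∑ σ : ℤˣ, weight σ k * branchSlope b σ (k + 1) (t + α * I)‖ ≤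
      (2 * C * Real.exp ((b - 1) * t)) * ((k + 1 : ℕ) : ℝ) ^ (-b) := by
    intro k t
    refine (norm_sum_weight_le fun σ => hbd σ k (t + α * I) (fun n => by
      simpa using hdist σ n)).trans (le_of_eq ?_)
    simp
    ring
  have hsumm : ∀ t : ℝ, HasSum (fun k : ℕ => ∑ σ : ℤˣ, weight σ k *
      branchSlope b σ (k + 1) (t + α * I)) (onLog b (borelFn b) (t + α * I)) := by
    intro t
    rw [onLog_borelFn]
    exact (Summable.of_norm_bounded (hs.mul_left _) (hterm · t)).hasSum
  refine ⟨2 * C * S, by positivity, fun t => ?_, fun X hX => ?_⟩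
  · rw [← (hsumm t).tsum_eq]
    refine (tsum_of_norm_bounded (hs.mul_left _).hasSum (hterm · t)).trans (le_of_eq ?_)
    rw [tsum_mul_left]
    ring
  have hcont : ∀ (k : ℕ), Continuous fun t : ℝ => ∑ σ : ℤˣ, weight σ k *
      branchSlope b σ (k + 1) (t + α * I) := fun k =>
    continuous_finsetSum _ fun σ _ => continuous_const.mul
      (continuous_branchSlope hb σ (k + 1) (phase_ne_of_dist hη (hdist σ)))
  -- The majorant factors into an integrable function of t and a summable sequence in k, which
  -- justifies termwise integration.
  have hker : ∀ (k : ℕ) (t : ℝ), ‖lapKer X (fun l => ∑ σ : ℤˣ, weight σ k *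
      branchSlope b σ (k + 1) l) (t + α * I)‖ ≤ (2 * C * (Real.exp (-(X * Complex.exp (α * I)).re *
        Real.exp t) * Real.exp (b * t))) * ((k + 1 : ℕ) : ℝ) ^ (-b) := by
    intro k t
    have := norm_lapKer_le (X := X) (Y := fun l => ∑ σ : ℤˣ, weight σ k *
      branchSlope b σ (k + 1) l) (l := t + α * I) (c := (X * Complex.exp (α * I)).re)
      (by simp [-Complex.mul_re]) (hterm k t)
    refine this.trans (le_of_eq ?_)
    simp only [Complex.add_re, Complex.ofReal_re, Complex.re_ofReal_mul, Complex.I_re, mul_zero,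
      add_zero]
    rw [show b * t = (b - 1) * t + t by ring, Real.exp_add]
    ring
  have hint : Integrable fun t : ℝ => (2 * C * (Real.exp (-(X * Complex.exp (α * I)).re *
        Real.exp t) * Real.exp (b * t))) :=
    (integrable_exp_exp hX (by linarith)).const_mul _
  have hlim : ∀ t : ℝ, HasSum (fun k : ℕ => lapKer X (fun l => ∑ σ : ℤˣ, weight σ k *
      branchSlope b σ (k + 1) l) (t + α * I)) (lapKer X (onLog b (borelFn b)) (t + α * I)) := by
    intro t
    exact ((hsumm t).mul_left _).mul_right _
  have hmain := hasSum_integral_of_dominated_convergence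
    (F := fun (k : ℕ) (t : ℝ) => lapKer X (fun l => ∑ σ : ℤˣ, weight σ k *
      branchSlope b σ (k + 1) l) (t + α * I))
    (f := fun t : ℝ => lapKer X (onLog b (borelFn b)) (t + α * I)) (μ := volume)
    (fun k t => (2 * C * (Real.exp (-(X * Complex.exp (α * I)).re *
        Real.exp t) * Real.exp (b * t))) * ((k + 1 : ℕ) : ℝ) ^ (-b))
    (fun k => (continuous_lapKer (hcont k)).aestronglyMeasurable)
    (fun k => Eventually.of_forall fun t => hker k t)
    (Eventually.of_forall fun t => hs.mul_left _)
    (by simp_rw [tsum_mul_left]; exact hint.mul_const _)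
    (Eventually.of_forall hlim)
  refine ⟨?_, ?_⟩
  · refine (hint.mul_const S).mono' ?_ (Eventually.of_forall fun t => ?_)
    · refine aestronglyMeasurable_of_tendsto_ae atTop
        (f := fun (N : ℕ) (t : ℝ) => ∑ k ∈ Finset.range N, lapKer X (fun l => ∑ σ : ℤˣ, weight σ k *
          branchSlope b σ (k + 1) l) (t + α * I)) (fun N => ?_)
        (Eventually.of_forall fun t => (hlim t).tendsto_sum_nat)
      exact (continuous_finsetSum _ fun k _ => continuous_lapKer (hcont k)).aestronglyMeasurable
    · rw [← (hlim t).tsum_eq]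
      refine (tsum_of_norm_bounded (hs.mul_left _).hasSum (hker · t)).trans (le_of_eq ?_)
      rw [tsum_mul_left]
  · refine Eq.mpr (congrArg (fun f => HasSum f _) (funext fun k => ?_)) hmain
    simp_rw [← integral_const_mul]
    rw [← integral_finsetSum]
    · congr 1
      ext t
      simp only [lapKer]
      rw [Finset.mul_sum, Finset.sum_mul]
      refine Finset.sum_congr rfl fun σ _ => by ring
    · intro σ _
      exact (integrable_branchSlope hb σ (k + 1) hη (hdist σ) hX).const_mul _

end

/-! ### The Borel sum -/

section

variable {b : ℝ} (hb : 1 < b)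

include hb

theorem integrableOn_onLog_borelFn {α : ℝ} (hα : ¬ IsStokes b α) {X : ℂ}
    (hX : 0 < (X * Complex.exp (α * I)).re) :
    IntegrableOn (rayIntegrand α (onLog b (borelFn b)) X) (Ioi 0) := by
  obtain ⟨C, _, _, h⟩ := onLog_borelFn_ray hb hα
  exact (integrableOn_rayIntegrand_iff _ _ _).2 (h X hX).1

omit hb in
theorem neg_div_ofReal_im (Z : ℂ) (c : ℝ) : (-(Z / (c : ℂ))).im = -(Z.im / c) := by
  rw [Complex.neg_im, Complex.div_ofReal_im]

/-- The Borel sum, as a sum of Laplace integrals of the branches. -/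
theorem hasSum_borelSum {Z : ℂ} (hZ : ¬ IsStokes b (Z.im / (b - 1))) :
    HasSum (fun k : ℕ => ∑ σ : ℤˣ, weight σ k * amp b σ (k + 1) (Z.im / (b - 1)) Z)
      (borelSum b (borelFn b) Z - leading b Z) := by
  obtain ⟨C, _, _, h⟩ := onLog_borelFn_ray hb hZ
  have h2 := (h (critVar b Z) (re_exp_mul_exp_pos (by
    rw [neg_div_ofReal_im, neg_add_cancel, abs_zero]; positivity))).2.mul_left (critVar b Z)
  rw [borelSum, add_sub_cancel_left, critVar, rayLaplace_exp]
  refine Eq.mpr (congrArg (fun f => HasSum f _) (funext fun k => ?_)) h2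
  rw [Finset.mul_sum]
  refine Finset.sum_congr rfl fun σ _ => ?_
  rw [amp, lap, critVar]
  ring

theorem borelSum_asymptotic {α : ℝ} (hα : ¬ IsStokes b α) (N : ℕ) :
    (fun r : ℝ => borelSum b (borelFn b) ((Real.log r : ℂ) + (((b - 1) * α : ℝ) : ℂ) * I) -
        partialSum b N ((Real.log r : ℂ) + (((b - 1) * α : ℝ) : ℂ) * I))
      =O[𝓝[>] (0 : ℝ)] fun r : ℝ => r ^ (N + 1) := by
  have hb1 : b - 1 ≠ 0 := by linarith
  have hπ := Real.pi_pos
  obtain ⟨η', hη', hdist'⟩ := exists_phase_dist hb hα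
  set η := min η' (π / 4) with hη_def
  have hη : 0 < η := lt_min hη' (by positivity)
  have hη2 : η < π / 2 := (min_le_right _ _).trans_lt (by linarith)
  have hdist : ∀ (σ : ℤˣ) (n : ℤ), η ≤ |phase b σ α - 2 * π * n| :=
    fun σ n => (min_le_left _ _).trans (hdist' σ n)
  obtain ⟨C, hC, h⟩ := exists_norm_amp_sub_le hb hη hη2 (N + 1)
  refine Asymptotics.IsBigO.of_bound
    (2 * C * (∑' k : ℕ, ((k + 1 : ℕ) : ℝ) ^ (-(b * (N + 1 : ℕ))))) ?_
  filter_upwards [self_mem_nhdsWithin] with r hr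
  have hr0 : (0 : ℝ) < r := hr
  set Z : ℂ := (Real.log r : ℂ) + (((b - 1) * α : ℝ) : ℂ) * I with hZ
  have hre : Z.re = Real.log r := by
    rw [hZ, Complex.add_re, Complex.ofReal_re, Complex.re_ofReal_mul]; simp
  have him : Z.im / (b - 1) = α := by
    rw [hZ, Complex.add_im, Complex.ofReal_im, Complex.im_ofReal_mul]
    simp
    field_simp
  have h1 := (hasSum_borelSum hb (Z := Z) (by rw [him]; exact hα)).tsum_eq
  have h2 := norm_leading_add_sub_partialSum_le hb (Z := Z) (N := N) (C := C)
    (a := fun σ k => amp b σ (k + 1) (Z.im / (b - 1)) Z)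
    (fun σ k => h σ (k + 1) _ _ (Nat.le_add_left 1 k) (by rw [him]; exact hdist σ)
      (by rw [sub_self, abs_zero]; linarith))
  rw [h1, add_sub_cancel] at h2
  refine h2.trans (le_of_eq ?_)
  rw [Real.exp_nat_mul, hre, Real.exp_log hr0, Real.norm_of_nonneg (by positivity)]

end

/-! ### Square root singularities -/

/-- `f` continues analytically to the point `l₀` of its domain's boundary, from the side `ε`. -/
def ContinuesFrom (ε : ℤˣ) (f : ℂ → ℂ) (l₀ : ℂ) : Prop :=
  ∃ G : ℂ → ℂ, AnalyticAt ℂ G l₀ ∧ ∀ᶠ l in 𝓝 l₀, 0 < (ε : ℤ) * (l - l₀).im → f l = G l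

/-- `f` is a power series in the square root of `l - l₀`, divided by this root and with constant
term `c`, on the side `ε`. -/
def HasRootSeries (ε : ℤˣ) (f : ℂ → ℂ) (l₀ c : ℂ) : Prop :=
  ∃ G : ℂ → ℂ, AnalyticAt ℂ G 0 ∧ G 0 = c ∧ ∀ᶠ l in 𝓝 l₀, 0 < (ε : ℤ) * (l - l₀).im →
    f l = G ((l - l₀) ^ (1 / 2 : ℂ)) / (l - l₀) ^ (1 / 2 : ℂ)

theorem half_cpow_sq (z : ℂ) : (z ^ (1 / 2 : ℂ)) ^ 2 = z := by
  rw [one_div]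
  exact Complex.cpow_ofNat_inv_pow z 2

theorem half_cpow_ne_zero {z : ℂ} (hz : z ≠ 0) : z ^ (1 / 2 : ℂ) ≠ 0 := by
  rw [Complex.cpow_ne_zero_iff]; exact Or.inl hz

theorem _root_.AnalyticAt.continuesFrom {f : ℂ → ℂ} {l₀ : ℂ} (h : AnalyticAt ℂ f l₀) (ε : ℤˣ) :
    ContinuesFrom ε f l₀ := ⟨f, h, Eventually.of_forall fun _ _ => rfl⟩

section

variable {ε : ℤˣ} {f g : ℂ → ℂ} {l₀ c d : ℂ}

theorem ContinuesFrom.add (hf : ContinuesFrom ε f l₀) (hg : ContinuesFrom ε g l₀) :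
    ContinuesFrom ε (fun l => f l + g l) l₀ := by
  obtain ⟨F, hF, hF'⟩ := hf
  obtain ⟨G, hG, hG'⟩ := hg
  refine ⟨fun l => F l + G l, hF.add hG, ?_⟩
  filter_upwards [hF', hG'] with l h1 h2 h
  rw [h1 h, h2 h]

theorem ContinuesFrom.const_mul (a : ℂ) (hf : ContinuesFrom ε f l₀) :
    ContinuesFrom ε (fun l => a * f l) l₀ := by
  obtain ⟨F, hF, hF'⟩ := hf
  refine ⟨fun l => a * F l, analyticAt_const.mul hF, ?_⟩
  filter_upwards [hF'] with l h1 h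
  rw [h1 h]

theorem ContinuesFrom.sum {ι : Type*} {s : Finset ι} {u : ι → ℂ → ℂ}
    (h : ∀ i ∈ s, ContinuesFrom ε (u i) l₀) : ContinuesFrom ε (fun l => ∑ i ∈ s, u i l) l₀ := by
  classical
  induction s using Finset.induction_on with
  | empty => simpa using analyticAt_const.continuesFrom (f := fun _ => (0 : ℂ)) ε
  | insert i s hi ih =>
    simp_rw [Finset.sum_insert hi]
    exact (h i (Finset.mem_insert_self i s)).add
      (ih fun j hj => h j (Finset.mem_insert_of_mem hj))

/-- With η the square root of l - l₀, a function analytic at l₀ is η F(l₀ + η²) divided by η, so its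
constant term is zero. Regular branches thus do not affect the leading coefficient of a singular
one. -/
theorem ContinuesFrom.hasRootSeries (hf : ContinuesFrom ε f l₀) : HasRootSeries ε f l₀ 0 := by
  obtain ⟨F, hF, hF'⟩ := hf
  refine ⟨fun η => η * F (l₀ + η ^ 2), analyticAt_id.mul (AnalyticAt.fun_comp (g := F) ?_
    (by fun_prop)), by simp, ?_⟩
  · simpa using hF
  · filter_upwards [hF'] with l h1 h
    have h0 : l - l₀ ≠ 0 := fun h0 => by simp [h0] at h
    rw [half_cpow_sq, add_sub_cancel, h1 h, mul_div_cancel_left₀ _ (half_cpow_ne_zero h0)]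

theorem HasRootSeries.add (hf : HasRootSeries ε f l₀ c) (hg : HasRootSeries ε g l₀ d) :
    HasRootSeries ε (fun l => f l + g l) l₀ (c + d) := by
  obtain ⟨F, hF, hF0, hF'⟩ := hf
  obtain ⟨G, hG, hG0, hG'⟩ := hg
  refine ⟨fun l => F l + G l, hF.add hG, by simp only [hF0, hG0], ?_⟩
  filter_upwards [hF', hG'] with l h1 h2 h
  rw [h1 h, h2 h, add_div]

theorem HasRootSeries.const_mul (a : ℂ) (hf : HasRootSeries ε f l₀ c) :
    HasRootSeries ε (fun l => a * f l) l₀ (a * c) := by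
  obtain ⟨F, hF, hF0, hF'⟩ := hf
  refine ⟨fun l => a * F l, analyticAt_const.mul hF, by simp only [hF0], ?_⟩
  filter_upwards [hF'] with l h1 h
  rw [h1 h, mul_div_assoc]

theorem HasRootSeries.sum {ι : Type*} {s : Finset ι} {u : ι → ℂ → ℂ} {e : ι → ℂ}
    (h : ∀ i ∈ s, HasRootSeries ε (u i) l₀ (e i)) :
    HasRootSeries ε (fun l => ∑ i ∈ s, u i l) l₀ (∑ i ∈ s, e i) := by
  classical
  induction s using Finset.induction_on with
  | empty =>
    simpa using (analyticAt_const.continuesFrom (f := fun _ => (0 : ℂ)) ε).hasRootSeries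
  | insert i s hi ih =>
    simp_rw [Finset.sum_insert hi]
    exact (h i (Finset.mem_insert_self i s)).add
      (ih fun j hj => h j (Finset.mem_insert_of_mem hj))

theorem tendsto_affine {a : ℝ} {p : ℂ} (l₀ : ℂ) :
    Tendsto (fun l : ℂ => (a : ℂ) * (l - p)) (𝓝 l₀) (𝓝 ((a : ℂ) * (l₀ - p))) :=
  Continuous.tendsto (by fun_prop) l₀

theorem affine_im_pos {a : ℝ} (ha : 0 < a) {p l : ℂ} (h : 0 < (ε : ℤ) * (l - l₀).im) :
    0 < (ε : ℤ) * ((a : ℂ) * (l - p) - (a : ℂ) * (l₀ - p)).im := by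
  rw [← mul_sub, sub_sub_sub_cancel_right, Complex.im_ofReal_mul]
  have := mul_pos ha h
  linarith

theorem ContinuesFrom.comp_affine {a : ℝ} (ha : 0 < a) {p : ℂ}
    (hf : ContinuesFrom ε f ((a : ℂ) * (l₀ - p))) :
    ContinuesFrom ε (fun l => f ((a : ℂ) * (l - p))) l₀ := by
  obtain ⟨F, hF, hF'⟩ := hf
  refine ⟨fun l => F ((a : ℂ) * (l - p)), AnalyticAt.fun_comp (g := F)
    (f := fun l => (a : ℂ) * (l - p)) hF (by fun_prop), ?_⟩
  filter_upwards [(tendsto_affine l₀).eventually hF'] with l h1 h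
  exact h1 (affine_im_pos ha h)

theorem HasRootSeries.comp_affine {a : ℝ} (ha : 0 < a) {p : ℂ} (hc : c ≠ 0)
    (hf : HasRootSeries ε f ((a : ℂ) * (l₀ - p)) c) :
    ∃ c' ≠ 0, HasRootSeries ε (fun l => f ((a : ℂ) * (l - p))) l₀ c' := by
  obtain ⟨F, hF, hF0, hF'⟩ := hf
  have hs : (a : ℂ) ^ (1 / 2 : ℂ) ≠ 0 := half_cpow_ne_zero (by exact_mod_cast ha.ne')
  refine ⟨c / (a : ℂ) ^ (1 / 2 : ℂ), div_ne_zero hc hs,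
    fun η => F ((a : ℂ) ^ (1 / 2 : ℂ) * η) / (a : ℂ) ^ (1 / 2 : ℂ), ?_, by simp [hF0], ?_⟩
  · refine AnalyticAt.div ?_ analyticAt_const hs
    exact AnalyticAt.fun_comp (g := F) (by simpa using hF) (by fun_prop)
  · filter_upwards [(tendsto_affine l₀).eventually hF'] with l h1 h
    have h0 : l - l₀ ≠ 0 := fun h0 => by simp [h0] at h
    have haC : (a : ℂ) ≠ 0 := by exact_mod_cast ha.ne'
    have h2 : ((a : ℂ) * (l - l₀)) ^ (1 / 2 : ℂ) =
        (a : ℂ) ^ (1 / 2 : ℂ) * (l - l₀) ^ (1 / 2 : ℂ) := by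
      rw [Complex.cpow_def_of_ne_zero (mul_ne_zero haC h0), Complex.log_ofReal_mul ha h0,
        Complex.cpow_def_of_ne_zero haC, Complex.cpow_def_of_ne_zero h0, ← Complex.exp_add,
        Complex.ofReal_log ha.le, add_mul]
    rw [h1 (affine_im_pos ha h), ← mul_sub, sub_sub_sub_cancel_right, h2]
    rw [div_div]

end

section

variable {b : ℝ} (hb : 1 < b)

include hb

omit hb in
theorem exp_sub_two_pi_int (ζ : ℂ) (n : ℤ) :
    Complex.exp (ζ - n * (2 * π * I)) = Complex.exp ζ := by
  rw [Complex.exp_sub, Complex.exp_int_mul_two_pi_mul_I, div_one]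

theorem slope_exp_side {ε : ℤˣ} {ζ : ℂ} (h0 : 0 < (ε : ℤ) * ζ.im) (h1 : (ε : ℤ) * ζ.im < 2 * π) :
    slope b (Complex.exp ζ) = slopeLog b (ζ - (ε : ℤ) * (π * I)) := by
  rcases Int.units_eq_one_or ε with rfl | rfl
  · simp only [Units.val_one, Int.cast_one, one_mul] at h0 h1 ⊢
    exact slope_exp_of_pos hb h0 h1
  · simp only [Units.val_neg, Units.val_one, Int.cast_neg, Int.cast_one, neg_mul, one_mul,
      sub_neg_eq_add] at h0 h1 ⊢
    exact slope_exp_of_neg hb (by linarith) (by linarith)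

/-- On each side of a cut the function is `slopeLog` near a point with imaginary part π or -π and
positive real part. `critDom` continues past these lines up to |Im ζ| = bπ, which gives the
continuation. -/
theorem continuesFrom_slope_exp (ε : ℤˣ) {ζ₀ : ℂ} (h : ∀ n : ℤ, ζ₀ ≠ n * (2 * π * I)) :
    ContinuesFrom ε (fun ζ => slope b (Complex.exp ζ)) ζ₀ := by
  by_cases h1 : 1 - Complex.exp ζ₀ ∈ Complex.slitPlane
  · exact ((analyticAt_slope hb h1).fun_comp (by fun_prop)).continuesFrom ε
  have h2 : ∃ n : ℤ, ζ₀.im = 2 * π * n ∧ 0 ≤ ζ₀.re := by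
    by_contra hcon
    push Not at hcon
    exact h1 (one_sub_exp_mem_slitPlane hcon)
  obtain ⟨n, him, hre⟩ := h2
  have hre' : 0 < ζ₀.re := by
    refine lt_of_le_of_ne hre fun h3 => h n ?_
    apply Complex.ext
    · simp [← h3]
    · simp [him]; ring
  have hπ := Real.pi_pos
  have hs1 : ((ε : ℤ) : ℝ) = 1 ∨ ((ε : ℤ) : ℝ) = -1 := units_cast_cases ε
  refine ⟨fun ζ => slopeLog b (ζ - n * (2 * π * I) - (ε : ℤ) * (π * I)),
    AnalyticAt.fun_comp (g := slopeLog b) ?_ (by fun_prop), ?_⟩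
  · refine analyticAt_slopeLog hb ?_
    have him' : (ζ₀ - n * (2 * π * I) - (ε : ℤ) * (π * I)).im = -((ε : ℤ) * π) := by
      simp [him]; ring
    have hre'' : (ζ₀ - n * (2 * π * I) - (ε : ℤ) * (π * I)).re = ζ₀.re := by simp
    have habs : |-(((ε : ℤ) : ℝ) * π)| = π := by
      rcases hs1 with h | h <;> rw [h] <;> simp [abs_of_pos hπ]
    constructor
    · rw [him', habs]
      nlinarith
    · intro _
      rw [hre'']; exact hre'
  · have hnear : ∀ᶠ ζ in 𝓝 ζ₀, (ε : ℤ) * (ζ - ζ₀).im < 2 * π := by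
      have : ContinuousAt (fun ζ : ℂ => ((ε : ℤ) : ℝ) * (ζ - ζ₀).im) ζ₀ := by fun_prop
      exact this.eventually_lt_const (by simpa using hπ)
    filter_upwards [hnear] with ζ h3 h4
    have him' : (ζ - n * (2 * π * I)).im = (ζ - ζ₀).im := by
      simp [him]; ring
    rw [← exp_sub_two_pi_int ζ n]
    exact slope_exp_side hb (by rw [him']; exact h4) (by rw [him']; exact h3)

/-- The square root singularity of the slope function. -/
theorem hasRootSeries_slope_exp_zero (ε : ℤˣ) :
    ∃ c ≠ 0, HasRootSeries ε (fun ζ => slope b (Complex.exp ζ)) 0 c := by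
  have hb1 : 0 < b - 1 := by linarith
  have hb1C : ((b - 1 : ℝ) : ℂ) ≠ 0 := by exact_mod_cast hb1.ne'
  have hπ := Real.pi_pos
  obtain ⟨-, n, -, -, -, -, hn, hn0, -, hS⟩ := exists_branch hb
  have hs1 : ((ε : ℤ) : ℝ) = 1 ∨ ((ε : ℤ) : ℝ) = -1 := units_cast_cases ε
  have hεsq : ((ε : ℤ) : ℂ) * ((ε : ℤ) : ℂ) = 1 := by
    rcases Int.units_eq_one_or ε with rfl | rfl <;> simp
  have hε0 : ((ε : ℤ) : ℂ) ≠ 0 := left_ne_zero_of_mul_eq_one hεsq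
  have hside : ∀ᶠ w in 𝓝 (0 : ℂ), ‖w‖ < -(2 * ((ε : ℤ) * w.im)) →
      slopeLog b (((b - 1 : ℝ) : ℂ) * Complex.log (1 - w ^ 2) - (ε : ℤ) * (π * I)) =
        1 + n w / w := by
    filter_upwards [hS] with w hw h
    rcases Int.units_eq_one_or ε with rfl | rfl
    · simpa using hw.2 (by simpa using h)
    · simpa using hw.1 (by simpa using h)
  -- the square root of `exp (η ^ 2 / (b - 1)) - 1`, divided by `η`
  set e : ℂ → ℂ := fun x => Complex.exp (x / ((b - 1 : ℝ) : ℂ)) with he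
  have hea : AnalyticAt ℂ e 0 := by simp only [he]; fun_prop
  have he' : HasDerivAt e (((1 / (b - 1) : ℝ)) : ℂ) 0 := by
    have := ((hasDerivAt_id (0 : ℂ)).div_const ((b - 1 : ℝ) : ℂ)).cexp
    refine this.congr_deriv ?_
    simp
  have hD : AnalyticAt ℂ (dslope e 0) 0 := by
    obtain ⟨p, hp⟩ := hea
    exact ⟨_, hp.has_fpower_series_dslope_fslope⟩
  have hD0 : dslope e 0 0 = ((1 / (b - 1) : ℝ) : ℂ) := by rw [dslope_same, he'.deriv]
  set h : ℂ → ℂ := fun η => dslope e 0 (η ^ 2) ^ (1 / 2 : ℂ) with hh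
  have h0 : h 0 = ((Real.sqrt (1 / (b - 1)) : ℝ) : ℂ) := by
    simp only [hh]
    rw [zero_pow two_ne_zero, hD0, Real.sqrt_eq_rpow, Complex.ofReal_cpow (by positivity)]
    norm_num
  have hpos : 0 < Real.sqrt (1 / (b - 1)) := Real.sqrt_pos.2 (by positivity)
  have hne : h 0 ≠ 0 := by rw [h0]; exact_mod_cast hpos.ne'
  have hha : AnalyticAt ℂ h 0 := by
    refine AnalyticAt.cpow (AnalyticAt.fun_comp (g := dslope e 0) (by simpa using hD)
      (by fun_prop)) analyticAt_const ?_
    rw [zero_pow two_ne_zero, hD0, Complex.ofReal_mem_slitPlane]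
    positivity
  have hsq : ∀ η : ℂ, η ^ 2 * h η ^ 2 = e (η ^ 2) - 1 := by
    intro η
    simp only [hh]
    rw [half_cpow_sq]
    have := sub_smul_dslope e 0 (η ^ 2)
    simp only [sub_zero, smul_eq_mul] at this
    rw [this]
    simp [he]
  -- Of the two square roots this one points into the cone belonging to the side ε when η has
  -- positive real part and η² lies in direction εi.
  set w : ℂ → ℂ := fun η => -((ε : ℤ) * I * (η * h η)) with hw
  have hwa : AnalyticAt ℂ w 0 := by
    simp only [hw]; fun_prop
  have hw0 : w 0 = 0 := by simp [hw]
  have hwsq : ∀ η, 1 - w η ^ 2 = e (η ^ 2) := by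
    intro η
    have : w η ^ 2 = -(((ε : ℤ) : ℂ) * ((ε : ℤ) : ℂ) * (η ^ 2 * h η ^ 2)) := by
      simp only [hw]
      linear_combination ((ε : ℤ) * (η * h η) : ℂ) ^ 2 * Complex.I_sq
    rw [this, hsq, hεsq]
    ring
  have hden : -((ε : ℤ) * I * h 0) ≠ 0 := neg_ne_zero.2 (mul_ne_zero (mul_ne_zero hε0
      Complex.I_ne_zero) hne)
  set G : ℂ → ℂ := fun η => η + n (w η) / (-((ε : ℤ) * I * h η)) with hG
  have hGa : AnalyticAt ℂ G 0 := by
    refine analyticAt_id.add (AnalyticAt.div (AnalyticAt.fun_comp (g := n) (by rwa [hw0]) hwa)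
      (by fun_prop) hden)
  have hG0 : G 0 = n 0 / (-((ε : ℤ) * I * h 0)) := by simp only [hG, hw0, zero_add]
  refine ⟨G 0, by rw [hG0]; exact div_ne_zero hn0 hden, G, hGa, rfl, ?_⟩
  -- The direction of η for which η² points along εi, perpendicular to the cut. There the cone
  -- condition holds strictly because 2 Re κ = √2 > 1.
  set κ : ℂ := Complex.exp (((ε : ℤ) * (π / 4) : ℝ) * I) with hκ
  have hκre : κ.re = Real.sqrt 2 / 2 := by
    rw [hκ, Complex.exp_ofReal_mul_I_re]
    rcases hs1 with h | h <;> rw [h] <;> simp [Real.cos_pi_div_four]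
  have hκsq : κ ^ 2 = (ε : ℤ) * I := by
    rw [hκ, ← Complex.exp_nat_mul]
    rcases Int.units_eq_one_or ε with rfl | rfl
    · rw [← Complex.exp_pi_div_two_mul_I.trans (by simp : I = ((1 : ℤˣ) : ℤ) * I)]
      congr 1; push_cast; ring
    · rw [show (((-1 : ℤˣ) : ℤ) : ℂ) * I = Complex.exp (-(π / 2 * I)) by
        rw [Complex.exp_neg, Complex.exp_pi_div_two_mul_I, Complex.inv_I]; simp]
      congr 1; push_cast; ring
  have hE1 : ∀ᶠ η in 𝓝 (0 : ℂ), ‖h η‖ - 2 * (κ * h η).re < 0 := by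
    have hc : ContinuousAt (fun η => ‖h η‖ - 2 * (κ * h η).re) 0 := by
      have := hha.continuousAt
      fun_prop
    refine hc.eventually_lt_const ?_
    simp only []
    rw [h0, Complex.re_mul_ofReal, hκre, Complex.norm_real, Real.norm_of_nonneg hpos.le]
    have : 1 < Real.sqrt 2 := by
      rw [Real.lt_sqrt] <;> norm_num
    nlinarith
  have hE2 : ∀ᶠ η in 𝓝 (0 : ℂ), ‖w η‖ < -(2 * ((ε : ℤ) * (w η).im)) →
      slopeLog b (((b - 1 : ℝ) : ℂ) * Complex.log (1 - w η ^ 2) - (ε : ℤ) * (π * I)) =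
        1 + n (w η) / w η := by
    have := hwa.continuousAt.tendsto
    rw [hw0] at this
    exact this.eventually hside
  have hE3 : ∀ᶠ η in 𝓝 (0 : ℂ), h η ≠ 0 := hha.continuousAt.eventually_ne hne
  obtain ⟨ρ, hρ, hall⟩ := Metric.eventually_nhds_iff.1
    (hE1.and (hE2.and (hE3.and (hGa.eventually_analyticAt.and hha.eventually_analyticAt))))
  -- The bound ρ² keeps the root in the disc of analyticity, 1 keeps Im ζ within one period, and b -
  -- 1 makes ζ/(b - 1) a principal logarithm.
  set r : ℝ := min (min (ρ ^ 2) 1) (b - 1) with hr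
  have hr0 : 0 < r := lt_min (lt_min (by positivity) one_pos) hb1
  have hr1 : r ≤ 1 := (min_le_left _ _).trans (min_le_right _ _)
  have hrρ : r ≤ ρ ^ 2 := (min_le_left _ _).trans (min_le_left _ _)
  have hrb : r ≤ b - 1 := min_le_right _ _
  have hroot : ∀ ζ : ℂ, ‖ζ‖ < r → dist (ζ ^ (1 / 2 : ℂ)) 0 < ρ := by
    intro ζ hζ
    rw [dist_zero_right]
    have h1 : ‖ζ ^ (1 / 2 : ℂ)‖ ^ 2 = ‖ζ‖ := by rw [← norm_pow, half_cpow_sq]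
    refine lt_of_pow_lt_pow_left₀ 2 hρ.le ?_
    rw [h1]; linarith
  set U : Set ℂ := {ζ | 0 < (ε : ℤ) * ζ.im} ∩ Metric.ball 0 r with hU
  have hUo : IsOpen U := (isOpen_lt continuous_const (by fun_prop)).inter Metric.isOpen_ball
  have hUc : Convex ℝ U := by
    refine Convex.inter ?_ (convex_ball 0 r)
    intro x hx y hy s t hs ht hst
    simp only [mem_ofPred_eq] at hx hy ⊢
    rw [Complex.add_im, Complex.smul_im, Complex.smul_im, smul_eq_mul, smul_eq_mul, mul_add]
    have e1 := mul_nonneg hs hx.le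
    have e2 := mul_nonneg ht hy.le
    rcases hs.eq_or_lt with h | h
    · subst h
      have : t = 1 := by linarith
      subst this
      linarith
    · have := mul_pos h hx
      linarith
  have hslit : ∀ ζ ∈ U, ζ ∈ Complex.slitPlane := fun ζ hζ =>
    Or.inr fun h => by have := hζ.1; simp only [mem_ofPred_eq, h, mul_zero, lt_irrefl] at this
  have hUim : ∀ ζ ∈ U, (ε : ℤ) * ζ.im < 1 := by
    intro ζ hζ
    have h1 := (Complex.abs_im_le_norm ζ).trans_lt (mem_ball_zero_iff.1 hζ.2)
    have h2 := abs_lt.1 h1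
    rcases hs1 with h | h <;> rw [h] <;> linarith [h2.1, h2.2]
  have hAL : AnalyticOnNhd ℂ (fun ζ => slopeLog b (ζ - (ε : ℤ) * (π * I))) U := by
    intro ζ hζ
    refine AnalyticAt.fun_comp (g := slopeLog b) (analyticAt_slopeLog hb
      (mem_critDom_of_abs_lt hb ?_)) (by fun_prop)
    have h1 := hUim ζ hζ
    have h2 : 0 < (ε : ℤ) * ζ.im := hζ.1
    have h3 := Real.pi_gt_three
    have h4 : (ζ - (ε : ℤ) * (π * I)).im = ζ.im - (ε : ℤ) * π := by simp
    rw [h4, abs_lt]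
    rcases hs1 with h | h <;> rw [h] at h1 h2 ⊢ <;> constructor <;> linarith
  have hAR : AnalyticOnNhd ℂ (fun ζ => G (ζ ^ (1 / 2 : ℂ)) / ζ ^ (1 / 2 : ℂ)) U := by
    intro ζ hζ
    have h1 := hall (hroot ζ (mem_ball_zero_iff.1 hζ.2))
    have h2 : AnalyticAt ℂ (fun ζ : ℂ => ζ ^ (1 / 2 : ℂ)) ζ :=
      analyticAt_id.cpow analyticAt_const (hslit ζ hζ)
    exact (AnalyticAt.fun_comp (g := G) (f := fun ζ : ℂ => ζ ^ (1 / 2 : ℂ)) h1.2.2.2.1 h2).div h2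
      (half_cpow_ne_zero (Complex.slitPlane_ne_zero (hslit ζ hζ)))
  have hkey : EqOn (fun ζ => slopeLog b (ζ - (ε : ℤ) * (π * I)))
      (fun ζ => G (ζ ^ (1 / 2 : ℂ)) / ζ ^ (1 / 2 : ℂ)) U := by
    set τ : ℝ := Real.sqrt (r / 2) with hτ
    have hτ0 : 0 < τ := Real.sqrt_pos.2 (by linarith)
    have hτ2 : τ ^ 2 = r / 2 := Real.sq_sqrt (by linarith)
    set η₁ : ℂ := τ * κ with hη₁
    have hsq1 : η₁ ^ 2 = ((r / 2 : ℝ) : ℂ) * ((ε : ℤ) * I) := by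
      rw [hη₁, mul_pow, hκsq, ← hτ2]; push_cast; ring
    have hεnorm : ‖((ε : ℤ) : ℂ)‖ = 1 := by rcases Int.units_eq_one_or ε with rfl | rfl <;> simp
    have hmem : η₁ ^ 2 ∈ U := by
      rw [hsq1]
      refine ⟨?_, ?_⟩
      · simp only [mem_ofPred_eq]
        rw [Complex.im_ofReal_mul]
        have : (((ε : ℤ) : ℂ) * I).im = (ε : ℤ) := by simp
        rw [this]
        rcases hs1 with h | h <;> rw [h] <;> linarith
      · rw [mem_ball_zero_iff, norm_mul, norm_mul, hεnorm, Complex.norm_I, Complex.norm_real,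
          Real.norm_of_nonneg (by linarith)]
        linarith
    have hre1 : 0 < η₁.re := by
      rw [hη₁, Complex.re_ofReal_mul, hκre]; positivity
    have hroot1 : (η₁ ^ 2) ^ (1 / 2 : ℂ) = η₁ := by
      rw [one_div]; exact Complex.sq_cpow_two_inv hre1
    -- The cone condition does not cover directions close to the cut. The identity is checked near
    -- one point of the half disc and spread by the identity theorem.
    refine hAL.eqOn_of_preconnected_of_eventuallyEq hAR hUc.isPreconnected hmem ?_
    have hc1 : ContinuousAt (fun ζ : ℂ => ζ ^ (1 / 2 : ℂ)) (η₁ ^ 2) :=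
      (analyticAt_id.cpow analyticAt_const (hslit _ hmem)).continuousAt
    have hnear : dist η₁ 0 < ρ := by
      have := hroot _ (mem_ball_zero_iff.1 hmem.2); rwa [hroot1] at this
    have hcond : ‖w η₁‖ < -(2 * ((ε : ℤ) * (w η₁).im)) := by
      have h1 := (hall hnear).1
      have e1 : ‖w η₁‖ = τ * ‖h η₁‖ := by
        have hκn : ‖κ‖ = 1 := by rw [hκ, Complex.norm_exp_ofReal_mul_I]
        simp only [hw]
        rw [norm_neg, norm_mul, norm_mul, hεnorm, Complex.norm_I, norm_mul, hη₁, norm_mul, hκn,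
          Complex.norm_real, Real.norm_of_nonneg hτ0.le]
        ring
      have e2 : (ε : ℤ) * (w η₁).im = -(τ * (κ * h η₁).re) := by
        have e3 : w η₁ = ((ε : ℤ) : ℝ) * (-(I * (τ * (κ * h η₁)))) := by
          simp only [hw, hη₁]; push_cast; ring
        rw [e3, Complex.im_ofReal_mul, Complex.neg_im, Complex.I_mul_im, Complex.re_ofReal_mul]
        rcases hs1 with h | h <;> rw [h] <;> ring
      rw [e1, e2]
      nlinarith
    have hcw : ContinuousAt (fun ζ : ℂ => ‖w (ζ ^ (1 / 2 : ℂ))‖ +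
        2 * ((ε : ℤ) * (w (ζ ^ (1 / 2 : ℂ))).im)) (η₁ ^ 2) := by
      have h1 : AnalyticAt ℂ h η₁ := (hall hnear).2.2.2.2
      have h2 : ContinuousAt w η₁ := by
        have := h1.continuousAt
        simp only [hw]; fun_prop
      have h3 : ContinuousAt (fun ζ : ℂ => w (ζ ^ (1 / 2 : ℂ))) (η₁ ^ 2) :=
        ContinuousAt.comp (g := w) (by rw [hroot1]; exact h2) hc1
      exact h3.norm.add (continuousAt_const.mul (continuousAt_const.mul
        (Complex.continuous_im.continuousAt.comp h3)))
    have hcond' := hcw.eventually_lt_const (u := 0) (by simp only [hroot1]; linarith)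
    filter_upwards [hcond', hUo.mem_nhds hmem] with ζ h1 h2
    have hζr := mem_ball_zero_iff.1 h2.2
    obtain ⟨-, h4, h5, -, -⟩ := hall (hroot ζ hζr)
    have h6 := h4 (by linarith)
    have h7 : ζ ^ (1 / 2 : ℂ) ≠ 0 := half_cpow_ne_zero (Complex.slitPlane_ne_zero (hslit ζ h2))
    have h8 : Complex.log (1 - w (ζ ^ (1 / 2 : ℂ)) ^ 2) = ζ / ((b - 1 : ℝ) : ℂ) := by
      rw [hwsq, half_cpow_sq]
      have h9 : |(ζ / ((b - 1 : ℝ) : ℂ)).im| < π := by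
        refine (Complex.abs_im_le_norm _).trans_lt ?_
        rw [norm_div, Complex.norm_real, Real.norm_of_nonneg hb1.le, div_lt_iff₀ hb1]
        nlinarith [Real.pi_gt_three]
      rw [abs_lt] at h9
      exact Complex.log_exp h9.1 h9.2.le
    rw [h8, mul_div_cancel₀ _ hb1C] at h6
    rw [h6]
    simp only [hG, hw]
    rw [add_div, div_self h7, div_div]
    congr 2
    ring
  filter_upwards [Metric.ball_mem_nhds (0 : ℂ) hr0] with ζ hζ h1
  rw [sub_zero] at h1 ⊢
  have hmem : ζ ∈ U := ⟨h1, hζ⟩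
  rw [slope_exp_side hb h1 ((hUim ζ hmem).trans (by linarith [Real.pi_gt_three]))]
  exact hkey hmem

theorem hasRootSeries_slope_exp (ε : ℤˣ) (n : ℤ) :
    ∃ c ≠ 0, HasRootSeries ε (fun ζ => slope b (Complex.exp ζ)) (n * (2 * π * I)) c := by
  obtain ⟨c, hc, G, hG, hG0, h⟩ := hasRootSeries_slope_exp_zero hb ε
  refine ⟨c, hc, G, hG, hG0, ?_⟩
  have ht : Tendsto (fun ζ : ℂ => ζ - n * (2 * π * I)) (𝓝 (n * (2 * π * I))) (𝓝 0) := by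
    have : Continuous fun ζ : ℂ => ζ - n * (2 * π * I) := by fun_prop
    simpa using this.tendsto (n * (2 * π * I))
  filter_upwards [ht.eventually h] with ζ h1 h2
  have := h1 (by rwa [sub_zero])
  rwa [sub_zero, exp_sub_two_pi_int] at this

end

/-! ### Singularities of the Borel transform -/

theorem units_coe_mul_mul (σ : ℤˣ) (n : ℤ) : (σ : ℤ) * ((σ : ℤ) * n) = n := by
  rcases Int.units_eq_one_or σ with rfl | rfl <;> simp

section

variable {b : ℝ} (hb : 1 < b)

include hb

theorem analyticAt_branchSlope (σ : ℤˣ) (k : ℕ) {l : ℂ}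
    (h : ∀ n : ℤ, phase b σ l.im = 2 * π * n → l.re < (branchPt b σ 0 k).re) :
    AnalyticAt ℂ (branchSlope b σ k) l := by
  have hb1 : 0 < b - 1 := by linarith
  refine AnalyticAt.fun_comp (g := slope b) (analyticAt_slope hb
    (one_sub_exp_mem_slitPlane fun n hn => ?_)) (by fun_prop)
  rw [im_branch_arg' hb] at hn
  have := h n hn
  rw [Complex.re_ofReal_mul, Complex.sub_re]
  nlinarith

theorem mul_branchPt_sub (σ : ℤˣ) (m : ℤ) (k : ℕ) :
    ((b - 1 : ℝ) : ℂ) * (branchPt b σ m k - branchPt b σ 0 k) = ((σ * m : ℤ) : ℂ) * (2 * π * I) :=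
        by
  have hb1 : ((b : ℂ) - 1) ≠ 0 := by exact_mod_cast (by linarith : b - 1 ≠ 0)
  rw [branchPt, branchPt, critLog, critLog]
  push_cast
  field_simp
  ring

theorem eq_branchPt_of_mul_sub {σ : ℤˣ} {k : ℕ} {n : ℤ} {l : ℂ}
    (h : ((b - 1 : ℝ) : ℂ) * (l - branchPt b σ 0 k) = n * (2 * π * I)) :
    l = branchPt b σ (σ * n) k := by
  have hb1 : (((b - 1 : ℝ) : ℂ)) ≠ 0 := by exact_mod_cast (by linarith : b - 1 ≠ 0)
  have h1 := mul_branchPt_sub hb σ (σ * n) k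
  rw [units_coe_mul_mul, ← h] at h1
  have := mul_left_cancel₀ hb1 h1
  linear_combination -this

theorem im_eq_of_phase {σ : ℤˣ} {n : ℤ} {α : ℝ} (k : ℕ) (h : phase b σ α = 2 * π * n) :
    α = (branchPt b σ (σ * n) k).im := by
  have hb1 : b - 1 ≠ 0 := by linarith
  have h1 := congrArg Complex.im (mul_branchPt_sub hb σ (σ * n) k)
  rw [units_coe_mul_mul, Complex.im_ofReal_mul, Complex.sub_im] at h1
  have h2 : ((n : ℂ) * (2 * π * I)).im = 2 * π * n := by simp; ring
  rw [h2, ← h, phase_eq hb σ k] at h1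
  have := mul_left_cancel₀ hb1 h1
  linarith

theorem mem_cutSet_of_phase {σ : ℤˣ} {n : ℤ} {k : ℕ} (hk : 1 ≤ k) {l : ℂ}
    (h : phase b σ l.im = 2 * π * n) (hre : (branchPt b σ 0 k).re ≤ l.re) : l ∈ cutSet b := by
  refine ⟨σ, σ * n, k, hk, l.re - (branchPt b σ 0 k).re, by linarith, ?_⟩
  apply Complex.ext
  · rw [Complex.add_re, Complex.ofReal_re, re_branchPt, re_branchPt]
    ring
  · rw [Complex.add_im, Complex.ofReal_im, add_zero]
    exact im_eq_of_phase hb k h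

/-- Near any point the Borel transform is a finite sum of branches, up to an analytic function. -/
theorem exists_local_sum (l₀ : ℂ) (M : ℕ) : ∃ K ≥ M, ∃ T : ℂ → ℂ, AnalyticAt ℂ T l₀ ∧
    ∀ l, onLog b (borelFn b) l =
      ∑ k ∈ Finset.range K, ∑ σ : ℤˣ, weight σ k * branchSlope b σ (k + 1) l + T l := by
  set ξ₀ := Complex.exp (((b - 1 : ℝ) : ℂ) * l₀) with hξ₀
  obtain ⟨K, hK⟩ := exists_tail hb (‖ξ₀‖ + 1)
  have h1 := (hK (max K M) (le_max_left _ _)).1.analyticAt (z := ξ₀)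
    (Metric.isOpen_ball.mem_nhds (by simp))
  refine ⟨max K M, le_max_right _ _, _, AnalyticAt.fun_comp
    (f := fun l => Complex.exp (((b - 1 : ℝ) : ℂ) * l)) h1 (by fun_prop), fun l => ?_⟩
  rw [onLog, borelFn_eq_add hb (max K M)]
  congr 1
  refine Finset.sum_congr rfl fun k _ => Finset.sum_congr rfl fun σ _ => ?_
  rw [branchSlope, scale, ← Complex.exp_add]
  congr 3
  ring

theorem analyticOnNhd_onLog_borelFn : AnalyticOnNhd ℂ (onLog b (borelFn b)) (cutSet b)ᶜ := by
  intro l hl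
  obtain ⟨K, -, T, hT, h⟩ := exists_local_sum hb l 0
  have hT' : onLog b (borelFn b) = _ := funext h
  rw [hT']
  refine AnalyticAt.add (Finset.analyticAt_fun_sum _ fun k _ => Finset.analyticAt_fun_sum _
    fun σ _ => analyticAt_const.mul (analyticAt_branchSlope hb σ (k + 1) fun n hn => ?_)) hT
  by_contra hcon
  exact hl (mem_cutSet_of_phase hb (Nat.le_add_left 1 k) hn (not_lt.1 hcon))

theorem continuesFrom_branchSlope (ε σ : ℤˣ) (k : ℕ) {l₀ : ℂ}
    (h : ∀ m : ℤ, l₀ ≠ branchPt b σ m k) : ContinuesFrom ε (branchSlope b σ k) l₀ :=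
  ContinuesFrom.comp_affine (f := fun ζ => slope b (Complex.exp ζ)) (a := b - 1) (by linarith)
    (continuesFrom_slope_exp hb ε fun n hn => h _ (eq_branchPt_of_mul_sub hb hn))

theorem continuesFrom_onLog_borelFn (ε : ℤˣ) {l₀ : ℂ}
    (h : ∀ (σ : ℤˣ) (m : ℤ) (k : ℕ), 1 ≤ k → l₀ ≠ branchPt b σ m k) :
    ContinuesFrom ε (onLog b (borelFn b)) l₀ := by
  obtain ⟨K, -, T, hT, hsum⟩ := exists_local_sum hb l₀ 0
  have hT' : onLog b (borelFn b) = _ := funext hsum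
  rw [hT']
  exact (ContinuesFrom.sum fun k _ => ContinuesFrom.sum fun σ _ =>
    (continuesFrom_branchSlope hb ε σ (k + 1) fun m =>
      h σ m (k + 1) (Nat.le_add_left 1 k)).const_mul _).add (hT.continuesFrom ε)

theorem exists_hasRootSeries_branchSlope (ε σ : ℤˣ) (m : ℤ) (k : ℕ) :
    ∃ c ≠ 0, HasRootSeries ε (branchSlope b σ k) (branchPt b σ m k) c := by
  obtain ⟨c, hc, h⟩ := hasRootSeries_slope_exp hb ε (σ * m)
  rw [← mul_branchPt_sub hb σ m k] at h
  exact h.comp_affine (by linarith) hc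

theorem eq_of_branchPt_re_eq {σ σ' : ℤˣ} {m m' : ℤ} {k k' : ℕ} (hk : 1 ≤ k)
    (hk' : 1 ≤ k') (h : (branchPt b σ m k).re = (branchPt b σ' m' k').re) : k = k' := by
  have hb1 : 0 < b - 1 := by linarith
  have hb0 : 0 < b / (b - 1) := by positivity
  rw [re_branchPt, re_branchPt] at h
  have h1 : b / (b - 1) * Real.log k = b / (b - 1) * Real.log k' := by linarith
  have h2 := mul_left_cancel₀ hb0.ne' h1
  have := Real.log_injOn_pos (by simpa using (by exact_mod_cast hk : (0 : ℝ) < k))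
    (by simpa using (by exact_mod_cast hk' : (0 : ℝ) < k')) h2
  exact_mod_cast this

/-- Equality of the arguments for opposite signs amounts to b = 2(1 + m + m'). For even b the two
families of branch points can therefore coincide, and their leading coefficients might cancel. -/
theorem eq_sign_of_branchPt_eq (heven : ¬ ∃ n : ℕ, b = 2 * n) {σ σ' : ℤˣ} {m m' : ℤ} {k k' : ℕ}
    (h : branchPt b σ m k = branchPt b σ' m' k') : σ = σ' := by
  by_contra hne
  have hb1 : b - 1 ≠ 0 := by linarith
  have h1 := congrArg Complex.im h
  rw [im_branchPt, im_branchPt] at h1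
  have hσ : ((σ' : ℤ) : ℝ) = -((σ : ℤ) : ℝ) := by
    rcases Int.units_eq_one_or σ with rfl | rfl <;> rcases Int.units_eq_one_or σ' with rfl | rfl <;>
      simp_all
  rw [hσ, neg_mul, ← mul_neg] at h1
  have hσ0 : ((σ : ℤ) : ℝ) ≠ 0 := by
    rcases units_cast_cases σ with h | h <;> rw [h] <;> norm_num
  have h2 := mul_left_cancel₀ hσ0 h1
  have hπ := Real.pi_pos.ne'
  field_simp at h2
  have h3 : b = ((2 * (1 + m + m') : ℤ) : ℝ) := by push_cast; linarith
  have h4 : 0 ≤ 1 + m + m' := by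
    by_contra hneg
    have : ((2 * (1 + m + m') : ℤ) : ℝ) ≤ 0 := by exact_mod_cast (by omega)
    linarith
  refine heven ⟨(1 + m + m').toNat, ?_⟩
  have h5 : (((1 + m + m').toNat : ℤ) : ℝ) = ((1 + m + m' : ℤ) : ℝ) := by rw [Int.toNat_of_nonneg
      h4]
  rw [Int.cast_natCast] at h5
  rw [h5, h3]
  push_cast
  ring

/-- Near the point only finitely many branches matter. The modulus determines k, and unless b is
even the argument determines σ, so exactly one branch is singular there and its nonzero leading
coefficient survives. -/
theorem exists_hasRootSeries_onLog_borelFn (ε σ : ℤˣ) (m : ℤ) {k : ℕ} (hk : 1 ≤ k) :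
    ∃ c, ((¬ ∃ n : ℕ, b = 2 * n) → c ≠ 0) ∧
      HasRootSeries ε (onLog b (borelFn b)) (branchPt b σ m k) c := by
  set p := branchPt b σ m k with hp
  obtain ⟨K, hK, T, hT, hsum⟩ := exists_local_sum hb p k
  have hT' : onLog b (borelFn b) = _ := funext hsum
  have hterm : ∀ (j : ℕ) (τ : ℤˣ), ∃ c, HasRootSeries ε (branchSlope b τ (j + 1)) p c ∧
      ((∀ m', p ≠ branchPt b τ m' (j + 1)) → c = 0) ∧
      ((∃ m', p = branchPt b τ m' (j + 1)) → c ≠ 0) := by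
    intro j τ
    by_cases h : ∃ m', p = branchPt b τ m' (j + 1)
    · obtain ⟨m', hm'⟩ := h
      obtain ⟨c, hc, hs⟩ := exists_hasRootSeries_branchSlope hb ε τ m' (j + 1)
      exact ⟨c, hm' ▸ hs, fun hcon => absurd hm' (hcon m'), fun _ => hc⟩
    · push Not at h
      exact ⟨0, (continuesFrom_branchSlope hb ε τ (j + 1) h).hasRootSeries, fun _ => rfl,
        fun ⟨m', hm'⟩ => absurd hm' (h m')⟩
  choose c hc hc0 hc1 using hterm
  refine ⟨∑ j ∈ Finset.range K, ∑ τ : ℤˣ, weight τ j * c j τ + 0, fun heven => ?_, ?_⟩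
  · obtain ⟨i, rfl⟩ : ∃ i, k = i + 1 := ⟨k - 1, by omega⟩
    have h1 : ∀ (j : ℕ) (τ : ℤˣ), ¬ (j = i ∧ τ = σ) → c j τ = 0 := by
      intro j τ hne
      refine hc0 j τ fun m' hm' => hne ⟨?_, ?_⟩
      · have := eq_of_branchPt_re_eq hb hk (Nat.le_add_left 1 j) (congrArg Complex.re (hp ▸ hm'))
        omega
      · exact (eq_sign_of_branchPt_eq hb heven (hp ▸ hm')).symm
    rw [add_zero, Finset.sum_eq_single i, Finset.sum_eq_single σ]
    · exact mul_ne_zero (weight_ne_zero σ i) (hc1 i σ ⟨m, hp⟩)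
    · intro τ _ hτ
      rw [h1 i τ (fun h => hτ h.2), mul_zero]
    · intro h
      exact absurd (Finset.mem_univ σ) h
    · intro j _ hj
      exact Finset.sum_eq_zero fun τ _ => by rw [h1 j τ (fun h => hj h.1), mul_zero]
    · intro h
      exact absurd (Finset.mem_range.2 (by omega)) h
  · rw [hT']
    exact (HasRootSeries.sum fun j _ => HasRootSeries.sum fun τ _ => (hc j τ).const_mul _).add
      (hT.continuesFrom ε).hasRootSeries

end

/-! ### Growth of the Borel transform -/

theorem summable_abs_int_rpow {s : ℝ} (hs : 1 < s) :
    Summable fun m : ℤ => (|(m : ℝ)| + 1) ^ (-s) := by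
  have h := summable_succ_rpow hs
  refine Summable.of_nat_of_neg ?_ ?_
  · simpa using h
  · simpa using h

/-- The sums of the powers of the distances to the integers are bounded. -/
theorem exists_tsum_dist_le {s : ℝ} (hs : 1 < s) : ∃ S : ℝ, ∀ x : ℝ,
    (Summable fun k : ℕ => (max 1 |x - (k + 1 : ℕ)|) ^ (-s)) ∧
      ∑' k : ℕ, (max 1 |x - (k + 1 : ℕ)|) ^ (-s) ≤ S := by
  have hsum := summable_abs_int_rpow hs
  refine ⟨3 ^ s * ∑' m : ℤ, (|(m : ℝ)| + 1) ^ (-s), fun x => ?_⟩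
  set i : ℕ → ℤ := fun k => ⌊x⌋ - (k + 1 : ℕ) with hi
  have hinj : Function.Injective i := fun j k h => by simp only [hi] at h; omega
  have hle : ∀ k : ℕ, (max 1 |x - (k + 1 : ℕ)|) ^ (-s) ≤
      3 ^ s * (|((i k : ℤ) : ℝ)| + 1) ^ (-s) := by
    intro k
    -- Replacing x by its integer part changes distances by at most 1, which the factor 3 absorbs in
    -- view of the lower cut-off at 1.
    have h1 : (|((i k : ℤ) : ℝ)| + 1) / 3 ≤ max 1 |x - (k + 1 : ℕ)| := by
      have h2 : |((i k : ℤ) : ℝ)| ≤ |x - (k + 1 : ℕ)| + 1 := by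
        have h3 := Int.floor_le x
        have h4 := Int.lt_floor_add_one x
        have h5 : ((i k : ℤ) : ℝ) = (x - (k + 1 : ℕ)) - (x - ⌊x⌋) := by
          simp only [hi]; push_cast; ring
        rw [h5]
        refine (abs_sub _ _).trans ?_
        have : |x - ⌊x⌋| ≤ 1 := abs_le.2 ⟨by linarith, by linarith⟩
        linarith
      have h6 := le_max_left 1 |x - (k + 1 : ℕ)|
      have h7 := le_max_right 1 |x - (k + 1 : ℕ)|
      linarith
    calc (max 1 |x - (k + 1 : ℕ)|) ^ (-s) ≤ ((|((i k : ℤ) : ℝ)| + 1) / 3) ^ (-s) :=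
          Real.rpow_le_rpow_of_nonpos (by positivity) h1 (by linarith)
      _ = _ := by
          rw [Real.div_rpow (by positivity) (by norm_num), Real.rpow_neg (x := 3) (by norm_num),
              div_inv_eq_mul,
            mul_comm]
  have hs' : Summable fun k : ℕ => 3 ^ s * (|((i k : ℤ) : ℝ)| + 1) ^ (-s) :=
    (hsum.comp_injective hinj).mul_left _
  have hs'' := Summable.of_nonneg_of_le (fun k => by positivity) hle hs'
  refine ⟨hs'', (hs''.tsum_le_tsum hle hs').trans ?_⟩
  rw [tsum_mul_left]
  refine mul_le_mul_of_nonneg_left ?_ (by positivity)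
  exact tsum_comp_le_tsum_of_inj hsum (fun m => by positivity) hinj

theorem rpow_neg_half_le {x : ℝ} (h0 : 0 < x) (h1 : x ≤ 1) : x ^ (-(1 / 2) : ℝ) ≤ x⁻¹ := by
  rw [← Real.rpow_neg_one]
  exact Real.rpow_le_rpow_of_exponent_ge h0 h1 (by norm_num)

section

variable {b : ℝ} (hb : 1 < b)

include hb

theorem exists_norm_slope_exp_le_exp : ∃ C ≥ 0, ∀ ζ : ℂ, ζ.re ≤ -1 →
    ‖slope b (Complex.exp ζ)‖ ≤ C * Real.exp ζ.re := by
  obtain ⟨ρ, hρ, C₁, hC₁, h₁⟩ := exists_norm_slope_le_linear hb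
  obtain ⟨C₂, -, h₂⟩ := exists_norm_slope_exp_le hb
  refine ⟨max C₁ (2 * |C₂| / ρ), le_max_of_le_left hC₁, fun ζ hζ => ?_⟩
  rcases lt_or_ge (Real.exp ζ.re) ρ with h | h
  · have := (h₁ (Complex.exp ζ) (by rwa [Complex.norm_exp])).2
    rw [Complex.norm_exp] at this
    exact this.trans (mul_le_mul_of_nonneg_right (le_max_left _ _) (Real.exp_pos _).le)
  · have h3 := h₂ ζ (one_sub_exp_mem_slitPlane fun n _ => by linarith) (by linarith)
    have h4 : |ζ.re| ^ (-(1 / 2) : ℝ) ≤ 1 :=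
      Real.rpow_le_one_of_one_le_of_nonpos (by rw [abs_of_neg (by linarith)]; linarith)
        (by norm_num)
    have h5 : 0 ≤ |ζ.re| ^ (-(1 / 2) : ℝ) := by positivity
    calc ‖slope b (Complex.exp ζ)‖ ≤ C₂ * (1 + |ζ.re| ^ (-(1 / 2) : ℝ)) := h3
      _ ≤ |C₂| * 2 := mul_le_mul (le_abs_self _) (by linarith) (by positivity) (abs_nonneg _)
      _ = 2 * |C₂| / ρ * ρ := by field_simp
      _ ≤ max C₁ (2 * |C₂| / ρ) * Real.exp ζ.re :=
          mul_le_mul (le_max_right _ _) h hρ.le (le_max_of_le_left hC₁)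

/-- The exponent -1/2 is weakened to -1, which suffices: at the allowed distance of order 1/k, the
loss k is compensated by the weight 1/k. -/
theorem exists_norm_slope_exp_le_div : ∃ C ≥ 0, ∀ (ζ : ℂ) (d : ℝ),
    1 - Complex.exp ζ ∈ Complex.slitPlane → 0 < d → d ≤ 1 →
    (∀ n : ℤ, d ≤ ‖ζ - n * (2 * π * I)‖) → ‖slope b (Complex.exp ζ)‖ ≤ C / d := by
  have hπ := Real.pi_pos
  obtain ⟨C₁, hC₁, h₁⟩ := exists_norm_slopeLog_le hb
  obtain ⟨C₂, -, h₂⟩ := exists_norm_slope_exp_le hb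
  refine ⟨3 * C₁ + 2 * |C₂|, by positivity, fun ζ d hs hd0 hd1 hd => ?_⟩
  have hd' : d ^ (-(1 / 2) : ℝ) ≤ 1 / d := (rpow_neg_half_le hd0 hd1).trans_eq (one_div d).symm
  have hd'' : 1 ≤ 1 / d := by rw [le_div_iff₀ hd0]; linarith
  -- Reducing Im ζ to [0, 2π) leaves the two neighbouring singularities 0 and 2πi. For Im ζ = 0 the
  -- bound in terms of Re ζ is used instead.
  set n : ℤ := ⌊ζ.im / (2 * π)⌋ with hn
  set ω : ℂ := ζ - n * (2 * π * I) with hω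
  have hexp : Complex.exp ω = Complex.exp ζ := exp_sub_two_pi_int ζ n
  have him : ω.im = ζ.im - 2 * π * n := by simp [hω]; ring
  have h0 : 0 ≤ ω.im := by
    have := Int.floor_le (ζ.im / (2 * π))
    rw [le_div_iff₀ (by positivity)] at this
    rw [him]; linarith
  have h1 : ω.im < 2 * π := by
    have := Int.lt_floor_add_one (ζ.im / (2 * π))
    rw [div_lt_iff₀ (by positivity)] at this
    rw [him]; linarith
  have hdω : d ≤ ‖ω‖ := hd n
  have hdω' : d ≤ ‖ω - 2 * π * I‖ := by
    have := hd (n + 1)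
    have e : ζ - ((n + 1 : ℤ) : ℂ) * (2 * π * I) = ω - 2 * π * I := by
      rw [hω]; push_cast; ring
    rwa [e] at this
  rw [← hexp] at hs ⊢
  have hpow : ∀ x : ℝ, d ≤ x → x ^ (-(1 / 2) : ℝ) ≤ 1 / d := fun x hx =>
    (Real.rpow_le_rpow_of_nonpos hd0 hx (by norm_num)).trans hd'
  rcases h0.eq_or_lt with h2 | h2
  · have hre : ω.re ≠ 0 := by
      intro h3
      have : ω = 0 := Complex.ext h3 h2.symm
      rw [this, norm_zero] at hdω
      linarith
    have hnorm : ‖ω‖ = |ω.re| := by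
      rw [← Complex.re_add_im ω, ← h2]; simp
    have h4 := h₂ ω hs hre
    rw [hnorm] at hdω
    have h5 := hpow _ hdω
    have h6 : 0 ≤ |ω.re| ^ (-(1 / 2) : ℝ) := by positivity
    calc ‖slope b (Complex.exp ω)‖ ≤ C₂ * (1 + |ω.re| ^ (-(1 / 2) : ℝ)) := h4
      _ ≤ |C₂| * (1 / d + 1 / d) := mul_le_mul (le_abs_self _) (by linarith) (by positivity)
          (abs_nonneg _)
      _ = 2 * |C₂| / d := by ring
      _ ≤ (3 * C₁ + 2 * |C₂|) / d := by gcongr; linarith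
  · rw [slope_exp_of_pos hb h2 h1]
    have h4 := h₁ (ω - π * I) (mem_critDom_of_abs_lt hb (by
      rw [Complex.sub_im, Complex.im_ofReal_mul, Complex.I_im, abs_lt]; constructor <;> linarith))
    have e1 : ω - π * I - π * I = ω - 2 * π * I := by ring
    have e2 : ω - π * I + π * I = ω := by ring
    rw [e1, e2] at h4
    calc _ ≤ _ := h4
      _ ≤ C₁ * (1 / d + 1 / d + 1 / d) :=
        mul_le_mul_of_nonneg_left (by linarith [hpow _ hdω, hpow _ hdω']) hC₁
      _ = 3 * C₁ / d := by ring
      _ ≤ (3 * C₁ + 2 * |C₂|) / d := by gcongr; linarith [abs_nonneg C₂]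

omit hb in
theorem abs_sub_le_abs_log {x y : ℝ} (hx : 0 < x) (hy : 0 < y) (h : |Real.log x - Real.log y| ≤ 1) :
    x ≤ 3 * y ∧ y ≤ 3 * x ∧ |x - y| ≤ 3 * y * |Real.log x - Real.log y| := by
  have he : Real.exp 1 ≤ 3 := by linarith [Real.exp_one_lt_d9]
  have h3 : ∀ {x y : ℝ}, 0 < x → 0 < y → |Real.log x - Real.log y| ≤ 1 → x ≤ 3 * y := by
    intro x y hx hy h
    have h1 : Real.log x ≤ 1 + Real.log y := by linarith [(abs_le.1 h).2]
    have h2 := Real.exp_le_exp.2 h1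
    rw [Real.exp_add, Real.exp_log hx, Real.exp_log hy] at h2
    exact h2.trans (mul_le_mul_of_nonneg_right he hy.le)
  refine ⟨h3 hx hy h, h3 hy hx (by rwa [abs_sub_comm]), ?_⟩
  have hxy := h3 hx hy h
  rcases le_total y x with hle | hle
  · have h1 := Real.one_sub_inv_le_log_of_pos (div_pos hx hy)
    rw [Real.log_div hx.ne' hy.ne', inv_div] at h1
    have hl : 0 ≤ Real.log x - Real.log y := sub_nonneg.2 (Real.log_le_log hy hle)
    rw [abs_of_nonneg (sub_nonneg.2 hle), abs_of_nonneg hl]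
    have h2 : x - y = x * (1 - y / x) := by field_simp
    rw [h2]
    exact mul_le_mul hxy h1 (by rw [sub_nonneg, div_le_one hx]; exact hle) (by positivity)
  · have h1 := Real.one_sub_inv_le_log_of_pos (div_pos hy hx)
    rw [Real.log_div hy.ne' hx.ne', inv_div] at h1
    have hl : Real.log x - Real.log y ≤ 0 := sub_nonpos.2 (Real.log_le_log hx hle)
    rw [abs_of_nonpos (sub_nonpos.2 hle), abs_of_nonpos hl]
    have h2 : -(x - y) = y * (1 - x / y) := by field_simp; ring
    rw [h2]
    exact mul_le_mul (by linarith) (by linarith) (by rw [sub_nonneg, div_le_one hy]; exact hle)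
      (by positivity)

/-- The bounds of a single branch, in terms of the distance of its index to `x`. -/
theorem exists_div_le_of_dist {κ ρ : ℝ} (hκ : 0 < κ) (hρ : 0 < ρ) (hρ1 : ρ ≤ 1) : ∃ C ≥ 0, ∀ (x k
    : ℝ) (ζ : ℂ), κ ≤ x →
    1 ≤ k → ζ.re = b * (Real.log x - Real.log k) → 1 - Complex.exp ζ ∈ Complex.slitPlane →
    (∀ n : ℤ, ρ / k ≤ ‖ζ - n * (2 * π * I)‖) →
    1 / k * ‖slope b (Complex.exp ζ)‖ ≤
      C * x ^ (b - 1) * (k ^ (-b) + (max 1 |x - k|) ^ (-b)) := by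
  have hb1 : 0 < b - 1 := by linarith
  obtain ⟨C₁, hC₁, h₁⟩ := exists_norm_slope_exp_le_exp hb
  obtain ⟨C₂, hC₂, h₂⟩ := exists_norm_slope_exp_le hb
  obtain ⟨C₃, hC₃, h₃⟩ := exists_norm_slope_exp_le_div hb
  set C : ℝ := C₁ + 6 * C₂ * 6 ^ (b - 1) + C₃ / ρ / κ ^ (b - 1) with hC
  have hC0 : 0 ≤ C := by positivity
  have hCC₁ : C₁ ≤ C := by
    have : 0 ≤ 6 * C₂ * 6 ^ (b - 1) + C₃ / ρ / κ ^ (b - 1) := by positivity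
    linarith
  have hone : (1 : ℝ) ≤ 6 ^ (b - 1) := Real.one_le_rpow (by norm_num) hb1.le
  have hCC₂ : 6 * C₂ * 6 ^ (b - 1) ≤ C := by
    have : 0 ≤ C₁ + C₃ / ρ / κ ^ (b - 1) := by positivity
    linarith
  have hCC₂' : 2 * C₂ ≤ C := by nlinarith
  have hCC₃ : C₃ / ρ / κ ^ (b - 1) ≤ C := by
    have : 0 ≤ C₁ + 6 * C₂ * 6 ^ (b - 1) := by positivity
    linarith
  refine ⟨C, hC0, fun x k ζ hx hk hre hs hd => ?_⟩
  have hx0 : 0 < x := hκ.trans_le hx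
  have hk0 : 0 < k := by linarith
  have hA : 0 ≤ k ^ (-b) := by positivity
  have hB : 0 ≤ (max 1 |x - k|) ^ (-b) := by positivity
  have hX : 0 < x ^ (b - 1) := by positivity
  have hkpow : 1 / k = k ^ (b - 1) * k ^ (-b) := by
    rw [← Real.rpow_add hk0, show b - 1 + -b = -1 by ring, Real.rpow_neg_one, one_div]
  have hfin : ∀ {a : ℝ}, a ≤ C * x ^ (b - 1) * k ^ (-b) →
      a ≤ C * x ^ (b - 1) * (k ^ (-b) + (max 1 |x - k|) ^ (-b)) := fun h => h.trans
    (mul_le_mul_of_nonneg_left (by linarith) (by positivity))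
  have hfin' : ∀ {a : ℝ}, a ≤ C * x ^ (b - 1) * (max 1 |x - k|) ^ (-b) →
      a ≤ C * x ^ (b - 1) * (k ^ (-b) + (max 1 |x - k|) ^ (-b)) := fun h => h.trans
    (mul_le_mul_of_nonneg_left (by linarith) (by positivity))
  -- There are four regimes. If k is much larger than x, the function vanishes linearly; if k is
  -- much smaller, it is bounded. If k is comparable with |x - k| ≥ 1, the singularity costs at most
  -- k/|x - k|. If |x - k| < 1, only the assumed distance ρ/k helps.
  rcases le_or_gt ζ.re (-1) with hm | hm
  · refine hfin ?_
    have hlt : x ≤ k := by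
      by_contra hcon
      have := Real.log_le_log hk0 (not_le.1 hcon).le
      nlinarith
    have h4 : Real.exp ζ.re ≤ x ^ (b - 1) * k ^ (-(b - 1)) := by
      rw [Real.rpow_def_of_pos hx0, Real.rpow_def_of_pos hk0, ← Real.exp_add, hre]
      have := Real.log_le_log hx0 hlt
      exact Real.exp_le_exp.2 (by nlinarith)
    have h5 := (h₁ ζ hm).trans (mul_le_mul_of_nonneg_left h4 hC₁)
    have h6 : k ^ (-b) = 1 / k * k ^ (-(b - 1)) := by
      rw [hkpow, mul_right_comm, ← Real.rpow_add hk0, add_neg_cancel, Real.rpow_zero, one_mul]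
    rw [h6]
    calc 1 / k * ‖slope b (Complex.exp ζ)‖ ≤ 1 / k * (C₁ * (x ^ (b - 1) * k ^ (-(b - 1)))) :=
          mul_le_mul_of_nonneg_left h5 (by positivity)
      _ = C₁ * (x ^ (b - 1) * (1 / k * k ^ (-(b - 1)))) := by ring
      _ ≤ C * (x ^ (b - 1) * (1 / k * k ^ (-(b - 1)))) :=
          mul_le_mul_of_nonneg_right hCC₁ (by positivity)
      _ = _ := by ring
  rcases le_or_gt 1 ζ.re with hp | hp
  · refine hfin ?_
    have hle : k ≤ x := by
      by_contra hcon
      have := Real.log_le_log hx0 (not_le.1 hcon).le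
      nlinarith
    have h4 : |ζ.re| ^ (-(1 / 2) : ℝ) ≤ 1 :=
      Real.rpow_le_one_of_one_le_of_nonpos (by rw [abs_of_pos (by linarith)]; exact hp)
        (by norm_num)
    have h5 : ‖slope b (Complex.exp ζ)‖ ≤ 2 * C₂ := by
      refine (h₂ ζ hs (by linarith)).trans ?_
      nlinarith
    have h6 : k ^ (b - 1) ≤ x ^ (b - 1) := Real.rpow_le_rpow hk0.le hle hb1.le
    calc 1 / k * ‖slope b (Complex.exp ζ)‖ ≤ 1 / k * C :=
          mul_le_mul_of_nonneg_left (h5.trans hCC₂') (by positivity)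
      _ = C * (k ^ (b - 1) * k ^ (-b)) := by rw [hkpow]; ring
      _ ≤ C * (x ^ (b - 1) * k ^ (-b)) := by gcongr
      _ = _ := by ring
  have hlog : |Real.log x - Real.log k| ≤ |ζ.re| := by
    rw [hre, abs_mul, abs_of_pos (by linarith : 0 < b)]
    exact le_mul_of_one_le_left (abs_nonneg _) hb.le
  have hζ1 : |ζ.re| ≤ 1 := abs_le.2 ⟨by linarith, by linarith⟩
  obtain ⟨h4, h5, h6⟩ := abs_sub_le_abs_log hx0 hk0 (hlog.trans hζ1)
  refine hfin' ?_
  rcases le_or_gt 1 |x - k| with hD | hD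
  · set D := |x - k| with hD'
    rw [max_eq_right hD]
    have hD0 : 0 < D := by linarith
    have h7 : D ≤ 3 * k * |ζ.re| := h6.trans (mul_le_mul_of_nonneg_left hlog (by positivity))
    have hζ0 : 0 < |ζ.re| := by
      by_contra hcon
      have : |ζ.re| = 0 := le_antisymm (not_lt.1 hcon) (abs_nonneg _)
      rw [this, mul_zero] at h7
      linarith
    have h8 : |ζ.re|⁻¹ ≤ 3 * k / D := by
      rw [inv_le_comm₀ hζ0 (by positivity), inv_div, div_le_iff₀ (by positivity)]
      linarith
    have h9 : 1 ≤ 3 * k / D := (one_le_inv_iff₀.2 ⟨hζ0, hζ1⟩).trans h8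
    have h10 : ‖slope b (Complex.exp ζ)‖ ≤ C₂ * (2 * (3 * k / D)) := by
      refine (h₂ ζ hs (abs_pos.1 hζ0)).trans (mul_le_mul_of_nonneg_left ?_ hC₂)
      linarith [rpow_neg_half_le hζ0 hζ1]
    have h11 : D ≤ 6 * x := by
      rw [hD', abs_le]; constructor <;> linarith
    have h12 : 1 / D = D ^ (b - 1) * D ^ (-b) := by
      rw [← Real.rpow_add hD0, show b - 1 + -b = -1 by ring, Real.rpow_neg_one, one_div]
    have h13 : D ^ (b - 1) ≤ 6 ^ (b - 1) * x ^ (b - 1) := by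
      rw [← Real.mul_rpow (by norm_num) hx0.le]
      exact Real.rpow_le_rpow hD0.le h11 hb1.le
    calc 1 / k * ‖slope b (Complex.exp ζ)‖ ≤ 1 / k * (C₂ * (2 * (3 * k / D))) :=
          mul_le_mul_of_nonneg_left h10 (by positivity)
      _ = 6 * C₂ * (1 / D) := by field_simp; ring
      _ ≤ 6 * C₂ * (6 ^ (b - 1) * x ^ (b - 1) * D ^ (-b)) := by
          rw [h12]
          gcongr
      _ = 6 * C₂ * 6 ^ (b - 1) * (x ^ (b - 1) * D ^ (-b)) := by ring
      _ ≤ C * (x ^ (b - 1) * D ^ (-b)) := mul_le_mul_of_nonneg_right hCC₂ (by positivity)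
      _ = _ := by ring
  · rw [max_eq_left hD.le, Real.one_rpow, mul_one]
    have h7 := h₃ ζ (ρ / k) hs (by positivity) ((div_le_one hk0).2 (hρ1.trans hk)) hd
    have h8 : κ ^ (b - 1) ≤ x ^ (b - 1) := Real.rpow_le_rpow hκ.le hx hb1.le
    have hκ' : 0 < κ ^ (b - 1) := by positivity
    calc 1 / k * ‖slope b (Complex.exp ζ)‖ ≤ 1 / k * (C₃ / (ρ / k)) :=
          mul_le_mul_of_nonneg_left h7 (by positivity)
      _ = C₃ / ρ / κ ^ (b - 1) * κ ^ (b - 1) := by field_simp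
      _ ≤ C * x ^ (b - 1) := mul_le_mul hCC₃ h8 hκ'.le hC0

theorem exists_norm_onLog_borelFn_le {δ : ℝ} (hδ : 0 < δ) : ∃ C : ℝ, ∀ l : ℂ, l ∉ cutSet b →
    0 ≤ l.re → (∀ (σ : ℤˣ) (m : ℤ) (k : ℕ), 1 ≤ k → δ / k ≤ ‖l - branchPt b σ m k‖) →
    ‖onLog b (borelFn b) l‖ ≤ C * Real.exp ((b - 1) ^ 2 / b * l.re) := by
  have hb0 : 0 < b := by linarith
  have hb1 : 0 < b - 1 := by linarith
  set c₀ : ℝ := Real.log (2 * π * (1 - 1 / b)) + Real.log (2 * π / b) / (b - 1) with hc₀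
  set κ : ℝ := Real.exp (-((b - 1) / b * c₀)) with hκ
  set ρ : ℝ := min 1 ((b - 1) * δ) with hρ
  have hρ0 : 0 < ρ := lt_min one_pos (by positivity)
  obtain ⟨C, hC, h⟩ := exists_div_le_of_dist hb (Real.exp_pos _ : 0 < κ) hρ0 (min_le_left _ _)
  obtain ⟨S, hS⟩ := exists_tsum_dist_le hb
  have hs := summable_succ_rpow hb
  refine ⟨2 * (C * Real.exp (-((b - 1) ^ 2 / b * c₀)) * (∑' k : ℕ, ((k + 1 : ℕ) : ℝ) ^ (-b) + S)),
      fun l hl hre hd => ?_⟩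
  -- This is the real index at which a branch point would have the modulus of p. Hence x^(b-1) is a
  -- constant times |p|^((b-1)²/b), and κ is its least value for |p| ≥ 1.
  set x : ℝ := Real.exp ((b - 1) / b * (l.re - c₀)) with hx
  have hxκ : κ ≤ x := Real.exp_le_exp.2 (by
    rw [mul_sub]
    have : 0 ≤ (b - 1) / b * l.re := by positivity
    linarith)
  have hxpow : x ^ (b - 1) = Real.exp (-((b - 1) ^ 2 / b * c₀)) * Real.exp ((b - 1) ^ 2 / b *
      l.re) := by
    rw [hx, ← Real.exp_mul, ← Real.exp_add]
    congr 1
    ring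
  have hterm : ∀ (σ : ℤˣ) (k : ℕ), ‖weight σ k * branchSlope b σ (k + 1) l‖ ≤
      C * x ^ (b - 1) * (((k + 1 : ℕ) : ℝ) ^ (-b) + (max 1 |x - (k + 1 : ℕ)|) ^ (-b)) := by
    intro σ k
    have hk : (1 : ℝ) ≤ ((k + 1 : ℕ) : ℝ) := by exact_mod_cast Nat.le_add_left 1 k
    have h1 := h x (k + 1 : ℕ) (((b - 1 : ℝ) : ℂ) * (l - branchPt b σ 0 (k + 1))) hxκ hk (by
        rw [Complex.re_ofReal_mul, Complex.sub_re, re_branchPt, hx, Real.log_exp, ← hc₀]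
        field_simp
        ring)
      (one_sub_exp_mem_slitPlane fun n hn => by
        rw [im_branch_arg' hb] at hn
        by_contra hcon
        rw [Complex.re_ofReal_mul, Complex.sub_re, not_lt] at hcon
        exact hl (mem_cutSet_of_phase hb (Nat.le_add_left 1 k) hn (by nlinarith)))
      (fun n => by
        have h2 := hd σ (σ * n) (k + 1) (Nat.le_add_left 1 k)
        have h3 := mul_branchPt_sub hb σ (σ * n) (k + 1)
        rw [units_coe_mul_mul] at h3
        rw [← h3, ← mul_sub, sub_sub_sub_cancel_right, norm_mul, Complex.norm_real,
          Real.norm_of_nonneg hb1.le]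
        refine le_trans ?_ (mul_le_mul_of_nonneg_left h2 hb1.le)
        rw [← mul_div_assoc]
        gcongr
        exact min_le_right _ _)
    refine le_trans ?_ h1
    rw [norm_mul, norm_weight]
    refine mul_le_mul_of_nonneg_right ?_ (norm_nonneg _)
    push_cast
    refine one_div_le_one_div_of_le (by positivity) ?_
    have : (0 : ℝ) ≤ k := by positivity
    nlinarith [Real.pi_gt_three]
  have hsum : HasSum (fun k : ℕ => 2 * (C * x ^ (b - 1) * (((k + 1 : ℕ) : ℝ) ^ (-b) +
      (max 1 |x - (k + 1 : ℕ)|) ^ (-b)))) (2 * (C * x ^ (b - 1) *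
        (∑' k : ℕ, ((k + 1 : ℕ) : ℝ) ^ (-b) + ∑' k : ℕ, (max 1 |x - (k + 1 : ℕ)|) ^ (-b)))) :=
    ((hs.hasSum.add (hS x).1.hasSum).mul_left _).mul_left _
  rw [onLog_borelFn]
  refine (tsum_of_norm_bounded hsum fun k => ?_).trans ?_
  · rw [sum_units]
    refine (norm_add_le _ _).trans ?_
    linarith [hterm 1 k, hterm (-1) k]
  · rw [hxpow]
    calc _ ≤ 2 * (C * (Real.exp (-((b - 1) ^ 2 / b * c₀)) * Real.exp ((b - 1) ^ 2 / b * l.re)) *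
          (∑' k : ℕ, ((k + 1 : ℕ) : ℝ) ^ (-b) + S)) := by
          gcongr
          exact (hS x).2
      _ = _ := by ring

end

/-! ### Crossing a cut -/

theorem integrable_lapKer_of_continuousOn {α : ℝ} {X : ℂ} {Y : ℂ → ℂ} {C a t₀ : ℝ} (ha : 0 ≤ a)
    (hX : 0 < (X * Complex.exp (α * I)).re)
    (hc : ContinuousOn (fun t : ℝ => Y (t + α * I)) {t₀}ᶜ)
    (hY : ∀ t : ℝ, t ≠ t₀ → ‖Y (t + α * I)‖ ≤ C * rayBound a t₀ t) :
    Integrable fun t : ℝ => lapKer X Y (t + α * I) := by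
  have hae : ∀ᵐ t : ℝ, t ∈ ({t₀}ᶜ : Set ℝ) := compl_mem_ae_iff.2 (measure_singleton t₀)
  refine ((integrable_rayBound hX ha t₀).const_mul C).mono' ?_ ?_
  · have h1 : ContinuousOn (fun t : ℝ => lapKer X Y (t + α * I)) {t₀}ᶜ := by
      unfold lapKer
      exact ((by fun_prop : Continuous fun t : ℝ => Complex.exp (-(X * Complex.exp (t + α *
          I)))).continuousOn.mul
        hc).mul (by fun_prop : Continuous fun t : ℝ => Complex.exp (t + α * I)).continuousOn
    have h2 := h1.aestronglyMeasurable (μ := volume) (measurableSet_singleton t₀).compl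
    rwa [Measure.restrict_eq_self_of_ae_mem hae] at h2
  · filter_upwards [hae] with t ht
    have := norm_lapKer_le (X := X) (Y := Y) (l := t + α * I) (c := (X * Complex.exp (α * I)).re)
      (by simp [-Complex.mul_re]) (hY t ht)
    refine this.trans (le_of_eq ?_)
    simp only [Complex.add_re, Complex.ofReal_re, Complex.re_ofReal_mul, Complex.I_re, mul_zero,
      add_zero]
    ring

theorem add_im_mul_I_sub (t : ℝ) (p : ℂ) : (t : ℂ) + p.im * I - p = ((t - p.re : ℝ) : ℂ) := by
  apply Complex.ext <;> simp

/-- Moving the origin of a Laplace integral to a point of the path. -/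
theorem lap_shift_origin (E : ℂ → ℂ) (p W : ℂ) :
    lap (fun l => if p.re < l.re then E (Complex.exp (l - p) - 1) else 0) p.im W =
      Complex.exp (-(Complex.exp p * Complex.exp W)) *
        lap (fun l => E (Complex.exp (l - p))) p.im W := by
  rw [← rayLaplace_exp, ← rayLaplace_exp]
  set X := Complex.exp W with hX
  set c := Real.exp p.re with hc
  have hc0 : 0 < c := Real.exp_pos _
  have hcC : (c : ℂ) ≠ 0 := by exact_mod_cast hc0.ne'
  have hp : Complex.exp p = c * Complex.exp (p.im * I) := by
    rw [hc, Complex.ofReal_exp, ← Complex.exp_add, Complex.re_add_im]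
  have hexp : ∀ r : ℝ, 0 < r → Complex.exp ((Real.log r : ℂ) + p.im * I - p) = (r / c : ℝ) := by
    intro r hr
    rw [add_im_mul_I_sub, ← Complex.ofReal_exp, Real.exp_sub, Real.exp_log hr]
  rw [rayLaplace, rayLaplace, ← integral_const_mul, ← integral_indicator measurableSet_Ioi,
    ← integral_indicator measurableSet_Ioi, ← integral_sub_right_eq_self
      ((Ioi (0 : ℝ)).indicator fun r => Complex.exp (-(Complex.exp p * X)) *
        rayIntegrand p.im (fun l => E (Complex.exp (l - p))) X r) c]
  congr 1
  funext r
  by_cases hr : c < r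
  · have hr0 : 0 < r := hc0.trans hr
    have hrc : 0 < r - c := by linarith
    rw [indicator_of_mem (mem_Ioi.2 hr0), indicator_of_mem (mem_Ioi.2 hrc), rayIntegrand,
      rayIntegrand, hexp r hr0, hexp _ hrc, if_pos]
    · have e1 : ((r / c : ℝ) : ℂ) - 1 = ((r - c) / c : ℝ) := by
        push_cast; field_simp
      have e2 : Complex.exp (-(X * (r * Complex.exp (p.im * I)))) = Complex.exp (-(Complex.exp p *
          X)) *
          Complex.exp (-(X * (((r - c : ℝ) : ℂ) * Complex.exp (p.im * I)))) := by
        rw [← Complex.exp_add, hp]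
        congr 1
        push_cast
        ring
      rw [e1, e2]
      ring
    · simpa using (Real.lt_log_iff_exp_lt hr0).2 hr
  · have hrc : r - c ∉ Ioi (0 : ℝ) := by simpa using hr
    rw [indicator_of_notMem hrc]
    by_cases hr0 : 0 < r
    · rw [indicator_of_mem (mem_Ioi.2 hr0), rayIntegrand, if_neg]
      · simp
      · simpa [Real.lt_log_iff_exp_lt hr0] using hr
    · rw [indicator_of_notMem (by simpa using hr0)]

/-- The boundary values of a branch on a cut, from the side `ε`. -/
noncomputable def sideValue (b : ℝ) (σ : ℤˣ) (m : ℤ) (k : ℕ) (ε : ℤˣ) (l : ℂ) : ℂ :=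
  if (branchPt b σ m k).re < l.re then
    slopeLog b (((b - 1 : ℝ) : ℂ) * (l - branchPt b σ m k) - (ε : ℤ) * (π * I))
  else branchSlope b σ k l

section

variable {b : ℝ} (hb : 1 < b)

include hb

theorem branchSlope_eq_slope_exp (σ : ℤˣ) (m : ℤ) (k : ℕ) (l : ℂ) : branchSlope b σ k l =
    slope b (Complex.exp (((b - 1 : ℝ) : ℂ) * (l - branchPt b σ m k))) := by
  rw [branchSlope, ← exp_sub_two_pi_int _ (σ * m), ← mul_branchPt_sub hb, ← mul_sub,
    sub_sub_sub_cancel_right]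

theorem exists_norm_branchSlope_le_rayBound : ∃ C ≥ 0, ∀ (σ : ℤˣ) (k : ℕ) (l : ℂ),
    (∀ n : ℤ, phase b σ l.im ≠ 2 * π * n) → l.re ≠ (branchPt b σ 0 k).re →
      ‖branchSlope b σ k l‖ ≤ C * rayBound 0 (branchPt b σ 0 k).re l.re := by
  have hb1 : 0 < b - 1 := by linarith
  obtain ⟨C, hC, h⟩ := exists_norm_slope_exp_le hb
  refine ⟨C * (1 + (b - 1) ^ (-(1 / 2) : ℝ)), by positivity, fun σ k l hl hre => ?_⟩
  have e1 : (((b - 1 : ℝ) : ℂ) * (l - branchPt b σ 0 k)).re =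
      (b - 1) * (l.re - (branchPt b σ 0 k).re) := by rw [Complex.re_ofReal_mul, Complex.sub_re]
  have h1 := h (((b - 1 : ℝ) : ℂ) * (l - branchPt b σ 0 k))
    (one_sub_exp_mem_slitPlane fun n hn => by
      rw [im_branch_arg' hb] at hn
      exact absurd hn (hl n))
    (by rw [e1]; exact mul_ne_zero hb1.ne' (sub_ne_zero.2 hre))
  refine h1.trans ?_
  rw [e1, abs_mul, abs_of_pos hb1, Real.mul_rpow hb1.le (abs_nonneg _), mul_assoc]
  refine mul_le_mul_of_nonneg_left ?_ hC
  rw [rayBound, zero_mul, Real.exp_zero]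
  have h2 := Real.exp_pos (-l.re / 2)
  have h3 : 0 ≤ |l.re - (branchPt b σ 0 k).re| ^ (-(1 / 2) : ℝ) := by positivity
  have h4 : 0 < (b - 1) ^ (-(1 / 2) : ℝ) := by positivity
  nlinarith [mul_pos h4 h2]

/-- Up to a cut, the Laplace integral of a branch is the integral of its boundary values. -/
theorem lap_branchSlope_eq_sideValue (σ ε : ℤˣ) (m : ℤ) (k : ℕ) {β : ℝ} {W : ℂ}
    (h0 : 0 < (ε : ℤ) * ((b - 1) * (β - (branchPt b σ m k).im)))
    (h1 : (ε : ℤ) * ((b - 1) * (β - (branchPt b σ m k).im)) < 2 * π)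
    (hβ : |W.im + β| < π / 2) (hm : |W.im + (branchPt b σ m k).im| < π / 2) :
    lap (branchSlope b σ k) β W = lap (sideValue b σ m k ε) (branchPt b σ m k).im W ∧
      Integrable fun t : ℝ => lapKer (Complex.exp W) (sideValue b σ m k ε)
        (t + (branchPt b σ m k).im * I) := by
  have hb1 : 0 < b - 1 := by linarith
  have hb1C : ((b - 1 : ℝ) : ℂ) ≠ 0 := by exact_mod_cast hb1.ne'
  have hπ := Real.pi_pos
  set p := branchPt b σ m k with hp
  have hs1 : ((ε : ℤ) : ℝ) = 1 ∨ ((ε : ℤ) : ℝ) = -1 := units_cast_cases ε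
  have hre : (branchPt b σ 0 k).re = p.re := by rw [hp, re_branchPt, re_branchPt]
  set w := 2 * π / (b - 1) with hw
  have hw0 : 0 < w := by positivity
  have hwb : (b - 1) * w = 2 * π := by rw [hw]; field_simp
  -- The open sector of width 2π/(b - 1) adjacent to the cut on the side ε: above it for ε = 1,
  -- below it for ε = -1.
  set α₁ := p.im + (((ε : ℤ) : ℝ) - 1) / 2 * w with hα₁
  set α₂ := p.im + (((ε : ℤ) : ℝ) + 1) / 2 * w with hα₂
  have hmem : ∀ x : ℝ, x ∈ Ioo α₁ α₂ ↔
      0 < (ε : ℤ) * ((b - 1) * (x - p.im)) ∧ (ε : ℤ) * ((b - 1) * (x - p.im)) < 2 * π := by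
    intro x
    rw [← hwb, hα₁, hα₂, mem_Ioo]
    rcases hs1 with h | h <;> rw [h]
    · rw [one_mul, mul_pos_iff_of_pos_left hb1, mul_lt_mul_iff_right₀ hb1]
      constructor <;> rintro ⟨h2, h3⟩ <;> constructor <;> linarith
    · rw [neg_one_mul, ← mul_neg, mul_pos_iff_of_pos_left hb1, mul_lt_mul_iff_right₀ hb1]
      constructor <;> rintro ⟨h2, h3⟩ <;> constructor <;> linarith
  have hpI : p.im ∈ Icc α₁ α₂ := by
    rw [hα₁, hα₂]
    rcases hs1 with h | h <;> rw [h] <;> constructor <;> linarith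
  -- Another cut of the same branch inside the sector would give an integer strictly between 0 and
  -- 1.
  have hphase : ∀ l : ℂ, l.im ∈ Ioo α₁ α₂ → ∀ n : ℤ, phase b σ l.im ≠ 2 * π * n := by
    intro l hl n hn
    rw [hmem] at hl
    have e1 := im_eq_of_phase hb k hn
    have e2 := congrArg Complex.im (mul_branchPt_sub hb σ (σ * n) k)
    have e3 := congrArg Complex.im (mul_branchPt_sub hb σ m k)
    rw [Complex.im_ofReal_mul, Complex.sub_im] at e2 e3
    have e4 : ∀ j : ℤ, ((j : ℂ) * (2 * π * I)).im = 2 * π * j := fun j => by simp; ring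
    rw [e4] at e2 e3
    have e5 : (ε : ℤ) * ((b - 1) * (l.im - p.im)) =
        2 * π * ((ε * (σ * (σ * n) - σ * m) : ℤ) : ℝ) := by
      rw [e1]
      push_cast at e2 e3 ⊢
      linear_combination ((ε : ℤ) : ℝ) * (e2 - e3)
    rw [e5] at hl
    generalize (ε * (σ * (σ * n) - σ * m) : ℤ) = j at hl
    have h2 : (0 : ℝ) < j := by
      by_contra hcon
      nlinarith [hl.1, not_lt.1 hcon]
    have h3 : (j : ℝ) < 1 := by
      by_contra hcon
      nlinarith [hl.2, not_lt.1 hcon]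
    have h4 : 0 < j := by exact_mod_cast h2
    have h5 : j < 1 := by exact_mod_cast h3
    omega
  obtain ⟨C, hC, hbd⟩ := exists_norm_branchSlope_le_rayBound hb
  have hY : DifferentiableOn ℂ (branchSlope b σ k) {l | α₁ < l.im ∧ l.im < α₂} := fun l hl =>
    (differentiableAt_branchSlope hb σ k fun n hn =>
      absurd hn (hphase l hl n)).differentiableWithinAt
  have hbd' : ∀ l : ℂ, α₁ < l.im → l.im < α₂ → l.re ≠ p.re →
      ‖branchSlope b σ k l‖ ≤ C * rayBound 0 p.re l.re := by
    intro l h2 h3 h4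
    have := hbd σ k l (hphase l ⟨h2, h3⟩) (by rwa [hre])
    rwa [hre] at this
  have hζ : ∀ t : ℝ, ((b - 1 : ℝ) : ℂ) * (t + p.im * I - p) = (((b - 1) * (t - p.re) : ℝ) : ℂ) := by
    intro t
    rw [add_im_mul_I_sub, Complex.ofReal_mul]
  have hdom : ∀ t : ℝ, p.re < t →
      (((b - 1) * (t - p.re) : ℝ) : ℂ) - (ε : ℤ) * (π * I) ∈ critDom b := by
    intro t ht
    have him : ((((b - 1) * (t - p.re) : ℝ) : ℂ) - (ε : ℤ) * (π * I)).im = -((ε : ℤ) * π) := by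
      rw [Complex.sub_im, Complex.ofReal_im]; simp
    have hre' : ((((b - 1) * (t - p.re) : ℝ) : ℂ) - (ε : ℤ) * (π * I)).re = (b - 1) * (t -
        p.re) := by
      rw [Complex.sub_re, Complex.ofReal_re]; simp
    have habs : |-(((ε : ℤ) : ℝ) * π)| = π := by
      rcases hs1 with h | h <;> rw [h] <;> simp [abs_of_pos hπ]
    constructor
    · rw [him, habs]; nlinarith
    · intro _
      rw [hre']
      exact mul_pos hb1 (by linarith)
  have hcb : ∀ t : ℝ, t < p.re → ContinuousAt (branchSlope b σ k) (t + p.im * I) := fun t ht =>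
    (analyticAt_branchSlope hb σ k fun n _ => by rw [hre]; simpa using ht).continuousAt
  have hcs : ∀ t : ℝ, p.re < t → ContinuousAt
      (fun l : ℂ => slopeLog b (((b - 1 : ℝ) : ℂ) * (l - p) - (ε : ℤ) * (π * I))) (t + p.im *
          I) := by
    intro t ht
    refine ContinuousAt.comp (g := slopeLog b) (AnalyticAt.continuousAt (𝕜 := ℂ) ?_) (by fun_prop)
    rw [hζ]
    exact analyticAt_slopeLog hb (hdom t ht)
  have hline : ∀ t : ℝ, Tendsto (fun γ : ℝ => (t : ℂ) + γ * I) (𝓝[Ioo α₁ α₂] p.im)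
      (𝓝 (t + p.im * I)) := fun t =>
    ((by fun_prop : Continuous fun γ : ℝ => (t : ℂ) + γ * I).tendsto p.im).mono_left
      nhdsWithin_le_nhds
  have hlim : ∀ t : ℝ, t ≠ p.re → Tendsto (fun γ : ℝ => branchSlope b σ k (t + γ * I))
      (𝓝[Ioo α₁ α₂] p.im) (𝓝 (sideValue b σ m k ε (t + p.im * I))) := by
    intro t ht
    rcases ht.lt_or_gt with h | h
    · rw [sideValue, if_neg (by simpa using h.le)]
      exact (hcb t h).tendsto.comp (hline t)
    · rw [sideValue, if_pos (by simpa using h)]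
      refine ((hcs t h).tendsto.comp (hline t)).congr' ?_
      filter_upwards [self_mem_nhdsWithin] with γ hγ
      rw [hmem] at hγ
      have him : (((b - 1 : ℝ) : ℂ) * (t + γ * I - p)).im = (b - 1) * (γ - p.im) := by
        rw [Complex.im_ofReal_mul]; simp
      rw [Function.comp_apply, branchSlope_eq_slope_exp hb σ m, ← hp]
      exact (slope_exp_side hb (by rw [him]; exact hγ.1) (by rw [him]; exact hγ.2)).symm
  refine ⟨lap_eq_boundary_of_le le_rfl hY hbd' ((hmem β).2 ⟨h0, h1⟩) hpI hβ hm hlim, ?_⟩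
  refine integrable_lapKer_of_continuousOn (C := C) (t₀ := p.re) le_rfl (re_exp_mul_exp_pos hm)
    (fun t ht => ContinuousAt.continuousWithinAt ?_) fun t ht => ?_
  · have hcl : ContinuousAt (fun s : ℝ => (s : ℂ) + p.im * I) t := by fun_prop
    rcases (show t ≠ p.re from ht).lt_or_gt with h | h
    · have h2 : ContinuousAt (fun s : ℝ => branchSlope b σ k (s + p.im * I)) t :=
        ContinuousAt.comp (g := branchSlope b σ k) (hcb t h) hcl
      refine h2.congr ?_
      filter_upwards [eventually_lt_nhds h] with s hs
      rw [sideValue, if_neg (by simpa using hs.le)]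
    · have h2 := ContinuousAt.comp (f := fun s : ℝ => (s : ℂ) + p.im * I) (hcs t h) hcl
      refine h2.congr ?_
      filter_upwards [eventually_gt_nhds h] with s hs
      rw [sideValue, if_pos (by simpa using hs)]
      rfl
  · have hne : (𝓝[Ioo α₁ α₂] p.im).NeBot := by
      rw [← mem_closure_iff_nhdsWithin_neBot, closure_Ioo]
      · exact hpI
      · rw [hα₁, hα₂]; intro h; nlinarith
    refine le_of_tendsto (hlim t ht).norm ?_
    filter_upwards [self_mem_nhdsWithin] with γ hγ
    have := hbd' (t + γ * I) (by simpa using hγ.1) (by simpa using hγ.2) (by simpa using ht)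
    simpa using this

omit hb in
-- Before the branch point the two boundary values agree. Beyond it they are `slopeLog` at the same
-- real point shifted by πi and -πi, which is the jump with 1 + u = exp(l - p).
theorem sideValue_sub (σ : ℤˣ) (m : ℤ) (k : ℕ) (t : ℝ) :
    sideValue b σ m k (-1) (t + (branchPt b σ m k).im * I) -
      sideValue b σ m k 1 (t + (branchPt b σ m k).im * I) =
    2 * I * (if (branchPt b σ m k).re < ((t : ℂ) + (branchPt b σ m k).im * I).re then
      cutJump b (Complex.exp (t + (branchPt b σ m k).im * I - branchPt b σ m k) - 1) else 0) := by
  set p := branchPt b σ m k with hp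
  have h2I : (2 * I : ℂ) ≠ 0 := by simp
  rw [sideValue, sideValue, ← hp]
  split_ifs with h
  · have e1 := add_im_mul_I_sub t p
    have e2 : Complex.log (1 + (Complex.exp ((t - p.re : ℝ) : ℂ) - 1)) = ((t - p.re : ℝ) : ℂ) := by
      rw [add_sub_cancel, ← Complex.ofReal_exp, ← Complex.ofReal_log (Real.exp_pos _).le,
        Real.log_exp]
    rw [e1, cutJump, e2, mul_div_cancel₀ _ h2I]
    simp
  · simp

/-- Both rays are pushed onto the cut, where the integrals of the two boundary values differ by the
jump over the part beyond the branch point. Moving the origin of p there extracts the exponential of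
minus the branch point times X. -/
theorem lap_sub_lap (σ : ℤˣ) (m : ℤ) (k : ℕ) {β₁ β₂ : ℝ} {W : ℂ}
    (h1 : (b - 1) * (β₁ - (branchPt b σ m k).im) < 0)
    (h1' : -(2 * π) < (b - 1) * (β₁ - (branchPt b σ m k).im))
    (h2 : 0 < (b - 1) * (β₂ - (branchPt b σ m k).im))
    (h2' : (b - 1) * (β₂ - (branchPt b σ m k).im) < 2 * π)
    (hβ₁ : |W.im + β₁| < π / 2) (hβ₂ : |W.im + β₂| < π / 2)
    (hm : |W.im + (branchPt b σ m k).im| < π / 2) :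
    lap (branchSlope b σ k) β₁ W - lap (branchSlope b σ k) β₂ W =
      2 * I * (Complex.exp (-(Complex.exp (branchPt b σ m k) * Complex.exp W)) *
        lap (fun l => cutJump b (Complex.exp (l - branchPt b σ m k))) (branchPt b σ m k).im W) := by
  obtain ⟨e1, i1⟩ := lap_branchSlope_eq_sideValue hb σ (-1) m k (β := β₁) (W := W)
    (by push_cast; linarith) (by push_cast; linarith) hβ₁ hm
  obtain ⟨e2, i2⟩ := lap_branchSlope_eq_sideValue hb σ 1 m k (β := β₂) (W := W)
    (by push_cast; linarith) (by push_cast; linarith) hβ₂ hm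
  rw [e1, e2, ← lap_shift_origin]
  simp only [lap]
  rw [← integral_sub i1 i2, ← integral_const_mul]
  congr 1
  funext t
  have := sideValue_sub (b := b) σ m k t
  simp only [lapKer]
  linear_combination (Complex.exp (-(Complex.exp W * Complex.exp (t + (branchPt b σ m k).im * I))) *
    Complex.exp (t + (branchPt b σ m k).im * I)) * this

end

/-! ### The transseries -/

theorem re_exp_pos {l : ℂ} (h : |l.im| < π / 2) : 0 < (Complex.exp l).re := by
  rw [abs_lt] at h
  rw [Complex.exp_re]
  exact mul_pos (Real.exp_pos _) (Real.cos_pos_of_mem_Ioo h)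

section

variable {b : ℝ} {E : ℂ → ℂ} {d : ℕ → ℂ}

theorem IsCutJump.exists_norm_le (h : IsCutJump b E d) (p : ℂ) : ∃ C ≥ 0, ∀ l : ℂ,
    |l.im - p.im| < π / 2 → ‖E (Complex.exp (l - p))‖ ≤ C * rayBound 0 p.re l.re := by
  obtain ⟨C, hC⟩ := h.bound
  refine ⟨|C| * (1 + Real.exp (p.re / 2)), by positivity, fun l hl => ?_⟩
  have h1 := hC _ (re_exp_pos (l := l - p) (by rwa [Complex.sub_im]))
  have h2 : ‖Complex.exp (l - p)‖ ^ (-(1 / 2) : ℝ) = Real.exp (p.re / 2) * Real.exp (-l.re / 2) :=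
      by
    rw [Complex.norm_exp, ← Real.exp_mul, ← Real.exp_add, Complex.sub_re]
    congr 1
    ring
  rw [h2] at h1
  have h3 := Real.exp_pos (p.re / 2)
  have h4 := Real.exp_pos (-l.re / 2)
  have h5 : 0 ≤ |l.re - p.re| ^ (-(1 / 2) : ℝ) := by positivity
  refine h1.trans ?_
  rw [mul_assoc, rayBound, zero_mul, Real.exp_zero]
  refine mul_le_mul (le_abs_self C) ?_ (by positivity) (abs_nonneg _)
  nlinarith [mul_nonneg h3.le h5]

theorem IsCutJump.differentiableOn (h : IsCutJump b E d) (p : ℂ) :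
    DifferentiableOn ℂ (fun l => E (Complex.exp (l - p)))
      {l | p.im - π / 2 < l.im ∧ l.im < p.im + π / 2} := by
  intro l hl
  have hre : 0 < (Complex.exp (l - p)).re := re_exp_pos (by
    rw [Complex.sub_im, abs_lt]; constructor <;> linarith [hl.1, hl.2])
  exact (DifferentiableAt.comp l (g := E) (h.analytic _ hre).differentiableAt
    (by fun_prop)).differentiableWithinAt

theorem critVar_mul_rayLaplace (Y : ℂ → ℂ) (Z : ℂ) :
    critVar b Z * rayLaplace (Z.im / (b - 1)) Y (critVar b Z) =
      Complex.exp (-(Z / ((b - 1 : ℝ) : ℂ))) * lap Y (Z.im / (b - 1)) (-(Z / ((b - 1 : ℝ) :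
          ℂ))) := by
  rw [critVar, rayLaplace_exp]

/-- E is analytic in the whole right half plane, so its Laplace integral may be rotated from the
direction of the cut to arg p = -arg X as long as the two differ by less than π/2. -/
theorem IsCutJump.transTerm_eq (h : IsCutJump b E d) (σ : ℤˣ) (m : ℤ) (k : ℕ) {Z : ℂ}
    (hZ : |(branchPt b σ m k).im - Z.im / (b - 1)| < π / 2) :
    transTerm b E σ m k Z = 1 / (π * k) * (Complex.exp (-(Z / ((b - 1 : ℝ) : ℂ))) *
      (Complex.exp (-(Complex.exp (branchPt b σ m k) * Complex.exp (-(Z / ((b - 1 : ℝ) : ℂ))))) *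
        lap (fun l => E (Complex.exp (l - branchPt b σ m k))) (branchPt b σ m k).im
          (-(Z / ((b - 1 : ℝ) : ℂ))))) := by
  set p := branchPt b σ m k with hp
  obtain ⟨C, -, hC⟩ := h.exists_norm_le p
  have hπ := Real.pi_pos
  obtain ⟨h1, h2⟩ := abs_lt.1 hZ
  have h3 : lap (fun l => E (Complex.exp (l - p))) p.im (-(Z / ((b - 1 : ℝ) : ℂ))) =
      lap (fun l => E (Complex.exp (l - p))) (Z.im / (b - 1)) (-(Z / ((b - 1 : ℝ) : ℂ))) := by
    refine lap_eq_of_strip (C := C) (t₀ := p.re) (α₁ := p.im - π / 2) (α₂ := p.im + π / 2) le_rfl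
      (h.differentiableOn p) (fun l h4 h5 _ => hC l ?_) ?_ ?_ ?_ ?_
    · rw [abs_lt]; constructor <;> linarith
    · constructor <;> linarith
    · constructor <;> linarith
    · rw [neg_div_ofReal_im, neg_add_eq_sub]; exact hZ
    · rw [neg_div_ofReal_im, neg_add_cancel, abs_zero]; positivity
  have h4 : lap (transBorel b E σ m k) (Z.im / (b - 1)) (-(Z / ((b - 1 : ℝ) : ℂ))) =
      1 / (π * k) * lap (fun l => E (Complex.exp (l - p))) (Z.im / (b - 1))
        (-(Z / ((b - 1 : ℝ) : ℂ))) := by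
    rw [lap, lap, ← integral_const_mul]
    congr 1
    funext t
    rw [lapKer, lapKer, transBorel, ← hp]
    ring
  rw [transTerm, transFactor, critVar_mul_rayLaplace, h4, h3, critVar, ← hp]
  ring

end

section

variable {b : ℝ} (hb : 1 < b)

include hb

theorem phase_sub_eq (σ : ℤˣ) (m : ℤ) (k : ℕ) (β : ℝ) :
    (σ : ℤ) * ((b - 1) * (β - (branchPt b σ m k).im)) = (σ : ℤ) * phase b σ β - 2 * π * m := by
  have e3 := congrArg Complex.im (mul_branchPt_sub hb σ m k)
  rw [Complex.im_ofReal_mul, Complex.sub_im] at e3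
  have e4 : (((σ * m : ℤ) : ℂ) * (2 * π * I)).im = 2 * π * (σ * m : ℤ) := by simp; ring
  rw [e4] at e3
  rw [phase_eq hb σ k]
  push_cast at e3
  rcases units_cast_cases σ with h | h <;> rw [h] at e3 ⊢
  · linear_combination -e3
  · linear_combination e3

/-- The Laplace integrals of a branch on both sides of a cut differ by a term of the transseries. -/
theorem weight_mul_amp_sub_amp (σ : ℤˣ) (m : ℤ) (k : ℕ) {β₁ β₂ : ℝ} {Z : ℂ}
    (h1 : (σ : ℤ) * phase b σ β₁ < 2 * π * m) (h1' : 2 * π * (m - 1) < (σ : ℤ) * phase b σ β₁)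
    (h2 : 2 * π * m < (σ : ℤ) * phase b σ β₂) (h2' : (σ : ℤ) * phase b σ β₂ < 2 * π * (m + 1))
    (hβ₁ : |β₁ - Z.im / (b - 1)| < π / 2) (hβ₂ : |β₂ - Z.im / (b - 1)| < π / 2) :
    weight σ k * (amp b σ (k + 1) β₁ Z - amp b σ (k + 1) β₂ Z) =
      transTerm b (cutJump b) σ m (k + 1) Z := by
  have hb1 : 0 < b - 1 := by linarith
  obtain ⟨d, hd⟩ := isCutJump_cutJump hb
  have hπC : (π : ℂ) ≠ 0 := by exact_mod_cast Real.pi_pos.ne'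
  have hk : ((k + 1 : ℕ) : ℂ) ≠ 0 := Nat.cast_ne_zero.2 k.succ_ne_zero
  have e1 := phase_sub_eq hb σ m (k + 1) β₁
  have e2 := phase_sub_eq hb σ m (k + 1) β₂
  set W : ℂ := -(Z / ((b - 1 : ℝ) : ℂ)) with hW
  have hWim : W.im = -(Z.im / (b - 1)) := neg_div_ofReal_im _ _
  set p := branchPt b σ m (k + 1) with hp
  -- The direction of the cut lies between β₁ and β₂, both of which are within π/2 of the Borel
  -- direction.
  have hm : |p.im - Z.im / (b - 1)| < π / 2 := by
    have e3 : ∀ x, |x - Z.im / (b - 1)| = |(σ : ℤ) * (x - Z.im / (b - 1))| := fun x => by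
      rw [abs_mul]; rcases units_cast_cases σ with h | h <;> rw [h] <;> simp
    rw [e3] at hβ₁ hβ₂ ⊢
    rw [abs_lt] at hβ₁ hβ₂ ⊢
    have h3 : 0 < (b - 1) * ((σ : ℤ) * (p.im - β₁)) := by linarith
    have h4 : 0 < (b - 1) * ((σ : ℤ) * (β₂ - p.im)) := by linarith
    rw [mul_pos_iff_of_pos_left hb1] at h3 h4
    constructor <;> linarith [hβ₁.1, hβ₁.2, hβ₂.1, hβ₂.2]
  have hm' : |W.im + p.im| < π / 2 := by rw [hWim, neg_add_eq_sub]; exact hm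
  have hβ₁' : |W.im + β₁| < π / 2 := by rw [hWim, neg_add_eq_sub]; exact hβ₁
  have hβ₂' : |W.im + β₂| < π / 2 := by rw [hWim, neg_add_eq_sub]; exact hβ₂
  have key : lap (branchSlope b σ (k + 1)) β₁ W - lap (branchSlope b σ (k + 1)) β₂ W =
      (σ : ℤ) * (2 * I * (Complex.exp (-(Complex.exp p * Complex.exp W)) *
        lap (fun l => cutJump b (Complex.exp (l - p))) p.im W)) := by
    -- For σ = -1 increasing signed phase means decreasing angle, so the two sides exchange and a
    -- factor σ appears. With the weight, σ · σ/(2πik) · 2i = 1/(πk).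
    rcases Int.units_eq_one_or σ with hσ | hσ
    · have hs : ((σ : ℤ) : ℝ) = 1 := by rw [hσ]; simp
      rw [hs, one_mul, one_mul] at e1 e2
      rw [hs, one_mul] at h1 h1' h2 h2'
      rw [lap_sub_lap hb σ m (k + 1) (by linarith) (by linarith) (by linarith) (by linarith)
        hβ₁' hβ₂' hm', show ((σ : ℤ) : ℂ) = 1 by rw [hσ]; simp, one_mul]
    · have hs : ((σ : ℤ) : ℝ) = -1 := by rw [hσ]; simp
      rw [hs] at e1 e2 h1 h1' h2 h2'
      rw [← neg_sub, lap_sub_lap hb σ m (k + 1) (by linarith) (by linarith) (by linarith)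
        (by linarith) hβ₂' hβ₁' hm', show ((σ : ℤ) : ℂ) = -1 by rw [hσ]; simp, neg_one_mul]
  rw [hd.transTerm_eq σ m (k + 1) hm, amp, amp, ← mul_sub, ← hW, key, ← hp, weight]
  have hσ2 : ((σ : ℤ) : ℂ) * ((σ : ℤ) : ℂ) = 1 := by
    rcases Int.units_eq_one_or σ with rfl | rfl <;> simp
  have hI := Complex.I_ne_zero
  generalize Complex.exp (-(Complex.exp p * Complex.exp W)) *
    lap (fun l => cutJump b (Complex.exp (l - p))) p.im W = Q
  field_simp
  linear_combination Q * hσ2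

theorem sign_mul_phase_div (σ : ℤˣ) (θ : ℝ) :
    (σ : ℤ) * phase b σ (θ / (b - 1)) = (σ : ℤ) * θ - (2 - b) * π / 2 := by
  have hb1 : b - 1 ≠ 0 := by linarith
  rw [phase, mul_div_cancel₀ _ hb1]
  rcases units_cast_cases σ with h | h <;> rw [h] <;> ring

/-- The lower bound -2π shows that no cut with negative m is ever crossed; the upper bound leaves
room to choose admissible directions on both sides of every crossed cut. -/
theorem sign_mul_phase_lt {θ : ℝ} (hθ : |θ| < π / 2) (σ : ℤˣ) :
    (σ : ℤ) * phase b σ (θ / (b - 1)) < (b - 1) * (π / 2) ∧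
      -(2 * π) < (σ : ℤ) * phase b σ (θ / (b - 1)) := by
  have hπ := Real.pi_pos
  obtain ⟨h1, h2⟩ := abs_lt.1 hθ
  rw [sign_mul_phase_div hb]
  rcases units_cast_cases σ with h | h <;> rw [h] <;> constructor <;> nlinarith

/-- A direction with given phase. -/
theorem exists_phase_eq (σ : ℤˣ) {x θ : ℝ}
    (h : |x - (σ : ℤ) * phase b σ (θ / (b - 1))| < (b - 1) * (π / 2)) :
    ∃ β, (σ : ℤ) * phase b σ β = x ∧ |β - θ / (b - 1)| < π / 2 := by
  have hb1 : 0 < b - 1 := by linarith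
  have hs : ((σ : ℤ) : ℝ) * ((σ : ℤ) : ℝ) = 1 := by
    rcases units_cast_cases σ with h | h <;> rw [h] <;> norm_num
  set y := (σ : ℤ) * phase b σ (θ / (b - 1)) with hy
  have hphase : (σ : ℤ) * phase b σ (θ / (b - 1) + (σ : ℤ) * ((x - y) / (b - 1))) = x := by
    have : phase b σ (θ / (b - 1) + (σ : ℤ) * ((x - y) / (b - 1))) =
        phase b σ (θ / (b - 1)) + (σ : ℤ) * (x - y) := by
      simp only [phase]; field_simp; ring
    rw [this, mul_add, ← hy, ← mul_assoc, hs]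
    ring
  refine ⟨_, hphase, ?_⟩
  rw [add_sub_cancel_left, abs_mul, abs_div, abs_of_pos hb1]
  have : |((σ : ℤ) : ℝ)| = 1 := by
    rcases units_cast_cases σ with h | h <;> rw [h] <;> simp
  rw [this, one_mul, div_lt_iff₀ hb1]
  linarith

/-- Induction on the number of cuts between the first sector and the direction β: with M = 0 the ray
lies in the first sector, and each further crossing adds one term of the transseries. -/
theorem weight_mul_osc_eq_of_phase_mem (σ : ℤˣ) (k : ℕ) {Z : ℂ} (hZ : |Z.im| < π / 2) (M : ℕ) :
    ∀ β : ℝ, 2 * π * ((M : ℝ) - 1) < (σ : ℤ) * phase b σ β → (σ : ℤ) * phase b σ β < 2 * π * M →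
      2 * π * ((M : ℝ) - 1) < (σ : ℤ) * phase b σ (Z.im / (b - 1)) →
      |β - Z.im / (b - 1)| < π / 2 →
      weight σ k * osc b σ (k + 1) Z = weight σ k * amp b σ (k + 1) β Z +
        ∑ m ∈ Finset.range M, transTerm b (cutJump b) σ (m : ℤ) (k + 1) Z := by
  have hb1 : 0 < b - 1 := by linarith
  have hπ := Real.pi_pos
  obtain ⟨hy1, hy2⟩ := sign_mul_phase_lt hb hZ σ
  induction M with
  | zero =>
    intro β h1 h2 _ h4
    push_cast at h1 h2
    rw [Finset.range_zero, Finset.sum_empty, add_zero, osc_eq_amp hb σ (Nat.le_add_left 1 k) hZ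
      (by linarith) (by linarith) h4]
  | succ M ih =>
    intro β h1 h2 h3 h4
    push_cast at h1 h2 h3
    rw [add_sub_cancel_right] at h1 h3
    set y := (σ : ℤ) * phase b σ (Z.im / (b - 1)) with hy
    have hM : (0 : ℝ) ≤ M := by positivity
    have hMπ : 0 ≤ 2 * π * M := by positivity
    -- The intermediate ray has signed phase 2πM - e, just before the cut m = M. The second entry
    -- keeps it within π/2 of the Borel direction.
    set e := min π (((b - 1) * (π / 2) - y) / 2) with he
    have he0 : 0 < e := lt_min hπ (by linarith)
    have he1 : e ≤ π := min_le_left _ _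
    have he2 : e ≤ ((b - 1) * (π / 2) - y) / 2 := min_le_right _ _
    obtain ⟨β', hβ', hβ''⟩ := exists_phase_eq hb σ (x := 2 * π * M - e) (θ := Z.im) (by
      rw [← hy, abs_lt]; constructor <;> linarith)
    rw [ih β' (by rw [hβ']; linarith) (by rw [hβ']; linarith) (by linarith) hβ'',
      Finset.sum_range_succ, ← weight_mul_amp_sub_amp hb σ M k (β₁ := β') (β₂ := β)
        (by rw [hβ']; push_cast; linarith) (by rw [hβ']; push_cast; linarith)
        (by push_cast; exact h1) (by push_cast; exact h2) hβ'' h4]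
    ring

/-- The number of cuts below the phase of the Borel direction is the ceiling that defines `active`.
Off the Stokes rays the phase is not a multiple of 2π, so the direction lies strictly between
consecutive cuts. -/
theorem weight_mul_osc_eq (σ : ℤˣ) (k : ℕ) {Z : ℂ} (hZ : |Z.im| < π / 2)
    (hS : ¬ IsStokes b (Z.im / (b - 1))) :
    weight σ k * osc b σ (k + 1) Z = weight σ k * amp b σ (k + 1) (Z.im / (b - 1)) Z +
      ∑ m ∈ active b σ Z.im, transTerm b (cutJump b) σ (m : ℤ) (k + 1) Z := by
  have hπ := Real.pi_pos
  have h2π : 0 < 2 * π := by positivity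
  obtain ⟨η, hη, hdist⟩ := exists_phase_dist hb hS
  obtain ⟨-, hy2⟩ := sign_mul_phase_lt hb hZ σ
  have hy := sign_mul_phase_div hb σ Z.im
  set M := ⌈((σ : ℤ) * Z.im - (2 - b) * π / 2) / (2 * π)⌉₊ with hM
  have hle : (σ : ℤ) * phase b σ (Z.im / (b - 1)) ≤ 2 * π * M := by
    rw [hy, ← div_le_iff₀' h2π]
    exact Nat.le_ceil _
  have hne : (σ : ℤ) * phase b σ (Z.im / (b - 1)) ≠ 2 * π * M := by
    intro h
    refine phase_ne_of_dist hη (hdist σ) (σ * M) ?_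
    push_cast
    rcases units_cast_cases σ with hs | hs <;> rw [hs] at h ⊢ <;> linarith
  have hgt : 2 * π * ((M : ℝ) - 1) < (σ : ℤ) * phase b σ (Z.im / (b - 1)) := by
    rcases Nat.eq_zero_or_pos M with h0 | h0
    · rw [h0]; push_cast; linarith
    · have h1 : (M : ℝ) < ((σ : ℤ) * Z.im - (2 - b) * π / 2) / (2 * π) + 1 :=
        Nat.ceil_lt_add_one (Nat.ceil_pos.1 h0).le
      have h2 : (M : ℝ) - 1 < ((σ : ℤ) * Z.im - (2 - b) * π / 2) / (2 * π) := by linarith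
      rw [lt_div_iff₀ h2π] at h2
      rw [hy]; linarith
  exact weight_mul_osc_eq_of_phase_mem hb σ k hZ M _ hgt (lt_of_le_of_ne hle hne) hgt
    (by rw [sub_self, abs_zero]; positivity)

omit hb in
theorem abs_sub_ge_of_between {x e : ℝ} {m : ℤ} (h1 : 2 * π * m + e ≤ x)
    (h2 : x ≤ 2 * π * (m + 1) - e) (n : ℤ) : e ≤ |x - 2 * π * n| := by
  have hπ := Real.pi_pos
  rcases le_or_gt n m with h | h
  · have : (n : ℝ) ≤ m := by exact_mod_cast h
    exact (by nlinarith : e ≤ x - 2 * π * n).trans (le_abs_self _)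
  · have : (m : ℝ) + 1 ≤ n := by exact_mod_cast h
    exact (by nlinarith : e ≤ -(x - 2 * π * n)).trans (neg_le_abs _)

/-- Each term is the difference of two Laplace integrals of a branch along fixed rays on the two
sides of its cut, and both are O(k^(-b)); no estimate of the exponentials is needed. -/
theorem summable_transTerm (σ : ℤˣ) {Z : ℂ} (hZ : |Z.im| < π / 2) {m : ℕ}
    (hm : m ∈ active b σ Z.im) :
    Summable fun k : ℕ => transTerm b (cutJump b) σ (m : ℤ) (k + 1) Z := by
  have hb1 : 0 < b - 1 := by linarith
  have hπ := Real.pi_pos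
  obtain ⟨hy1, -⟩ := sign_mul_phase_lt hb hZ σ
  rw [mem_active] at hm
  have hy := sign_mul_phase_div hb σ Z.im
  set y := (σ : ℤ) * phase b σ (Z.im / (b - 1)) with hy'
  have hmy : 2 * π * m < y := by linarith
  have hm0 : (0 : ℝ) ≤ m := by positivity
  have hMπ : 0 ≤ 2 * π * m := by positivity
  set e := min π (min (((b - 1) * (π / 2) - y) / 2) (y - 2 * π * m)) with he
  have he0 : 0 < e := lt_min hπ (lt_min (by linarith) (by linarith))
  have he1 : e ≤ π := min_le_left _ _
  have he2 : e ≤ ((b - 1) * (π / 2) - y) / 2 := (min_le_right _ _).trans (min_le_left _ _)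
  have he3 : e ≤ y - 2 * π * m := (min_le_right _ _).trans (min_le_right _ _)
  obtain ⟨β₁, hβ₁, hβ₁'⟩ := exists_phase_eq hb σ (x := 2 * π * m - e) (θ := Z.im) (by
    rw [← hy', abs_lt]; constructor <;> linarith)
  obtain ⟨β₂, hβ₂, hβ₂'⟩ := exists_phase_eq hb σ (x := 2 * π * m + e) (θ := Z.im) (by
    rw [← hy', abs_lt]; constructor <;> linarith)
  have hbd : ∀ β : ℝ, (∀ n : ℤ, e ≤ |(σ : ℤ) * phase b σ β - 2 * π * n|) →
      |β - Z.im / (b - 1)| < π / 2 → ∃ C ≥ 0, ∀ k : ℕ, ‖amp b σ (k + 1) β Z‖ ≤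
        C * ((k + 1 : ℕ) : ℝ) ^ (-b) := by
    intro β h1 h2
    set η := min (min e (π / 4)) (π / 2 - |β - Z.im / (b - 1)|) with hη
    have hη0 : 0 < η := lt_min (lt_min he0 (by positivity)) (by linarith)
    have hη1 : η ≤ e := (min_le_left _ _).trans (min_le_left _ _)
    have hη2 : η ≤ π / 4 := (min_le_left _ _).trans (min_le_right _ _)
    have hη3 : η ≤ π / 2 - |β - Z.im / (b - 1)| := min_le_right _ _
    obtain ⟨C, hC, h⟩ := exists_norm_amp_sub_le hb hη0 (by linarith) 1
    refine ⟨C * Real.exp Z.re, by positivity, fun k => ?_⟩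
    have h3 := h σ (k + 1) β Z (Nat.le_add_left 1 k) (fun n => hη1.trans ((h1 (σ * n)).trans_eq (by
      push_cast
      rcases units_cast_cases σ with hs | hs <;> rw [hs]
      · ring_nf
      · rw [← abs_neg]; ring_nf))) (by linarith)
    rw [Finset.sum_range_one, ampCoeff, slopeCoeff, if_pos rfl, zero_mul, zero_mul, zero_mul,
      sub_zero, Nat.cast_one, one_mul, mul_one] at h3
    linarith
  obtain ⟨C₁, hC₁, h₁⟩ := hbd β₁ (by
    rw [hβ₁]
    refine abs_sub_ge_of_between (m := (m : ℤ) - 1) ?_ ?_ <;> push_cast <;> linarith) hβ₁'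
  obtain ⟨C₂, hC₂, h₂⟩ := hbd β₂ (by
    rw [hβ₂]
    refine abs_sub_ge_of_between (m := (m : ℤ)) ?_ ?_ <;> push_cast <;> linarith) hβ₂'
  refine Summable.of_norm_bounded ((summable_succ_rpow hb).mul_left (C₁ + C₂)) fun k => ?_
  rw [← weight_mul_amp_sub_amp hb σ m k (β₁ := β₁) (β₂ := β₂) (by rw [hβ₁]; push_cast; linarith)
    (by rw [hβ₁]; push_cast; linarith) (by rw [hβ₂]; push_cast; linarith)
    (by rw [hβ₂]; push_cast; linarith) hβ₁' hβ₂', norm_mul]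
  refine (mul_le_of_le_one_left (norm_nonneg _) (norm_weight_le_one σ k)).trans
    ((norm_sub_le _ _).trans ?_)
  linarith [h₁ k, h₂ k]

theorem lacunary_exp_eq_transseries {Z : ℂ} (hZ : |Z.im| < π / 2)
    (hS : ¬ IsStokes b (Z.im / (b - 1))) :
    lacunary b (Complex.exp Z) = borelSum b (borelFn b) Z +
      ∑ σ : ℤˣ, ∑ m ∈ active b σ Z.im, ∑' k : ℕ,
        transTerm b (cutJump b) σ (m : ℤ) (k + 1) Z := by
  have h1 := hasSum_borelSum hb hS
  have h2 : HasSum (fun k : ℕ => ∑ σ : ℤˣ, ∑ m ∈ active b σ Z.im,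
      transTerm b (cutJump b) σ (m : ℤ) (k + 1) Z) (∑ σ : ℤˣ, ∑ m ∈ active b σ Z.im, ∑' k : ℕ,
        transTerm b (cutJump b) σ (m : ℤ) (k + 1) Z) :=
    hasSum_sum fun σ _ => hasSum_sum fun m hm => (summable_transTerm hb σ hZ hm).hasSum
  have h3 := (h1.add h2).tsum_eq
  rw [lacunary_exp_eq hb hZ]
  have h4 : ∀ k : ℕ, ∑ σ : ℤˣ, ((σ : ℤ) : ℂ) / (2 * π * I * ((k + 1 : ℕ) : ℂ)) * osc b σ (k + 1) Z =
      ∑ σ : ℤˣ, weight σ k * amp b σ (k + 1) (Z.im / (b - 1)) Z +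
        ∑ σ : ℤˣ, ∑ m ∈ active b σ Z.im, transTerm b (cutJump b) σ (m : ℤ) (k + 1) Z := by
    intro k
    rw [← Finset.sum_add_distrib]
    exact Finset.sum_congr rfl fun σ _ => weight_mul_osc_eq hb σ k hZ hS
  rw [tsum_congr h4, h3]
  ring

end

/-! ### The series that multiply the exponentials -/

theorem norm_cpow_sub_half (u : ℂ) (j : ℕ) :
    ‖u ^ ((j : ℂ) - 1 / 2)‖ = ‖u‖ ^ ((j : ℝ) - 1 / 2) := by
  rw [← Complex.norm_cpow_real]
  push_cast
  rfl

theorem exp_cpow_sub_half {l : ℂ} (h : |l.im| < π / 2) (j : ℕ) :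
    Complex.exp l ^ ((j : ℂ) - 1 / 2) = Complex.exp ((((j : ℝ) - 1 / 2 : ℝ) : ℂ) * l) := by
  have hπ := Real.pi_pos
  rw [abs_lt] at h
  rw [Complex.cpow_def_of_ne_zero (Complex.exp_ne_zero _), Complex.log_exp (by linarith)
    (by linarith)]
  congr 1
  push_cast
  ring

section

variable {b : ℝ} {E : ℂ → ℂ} {d : ℕ → ℂ}

/-- The Puiseux expansion, with a bound of the remainder in the whole half plane. -/
theorem IsCutJump.exists_norm_sub_le (h : IsCutJump b E d) (N : ℕ) : ∃ C : ℝ, ∀ u : ℂ,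
    0 < u.re → ‖E u - ∑ j ∈ Finset.range (N + 1), d j * u ^ ((j : ℂ) - 1 / 2)‖ ≤
      C * ‖u‖ ^ (((N + 1 : ℕ) : ℝ) - 1 / 2) := by
  obtain ⟨ρ, hρ, hP⟩ := h.puiseux
  obtain ⟨C, hC⟩ := h.bound
  -- Convergence at radius r bounds the terms of the series there, so for |u| < r/2 the tail is
  -- dominated by a geometric series of ratio 1/2.
  set r := ρ / 2 with hr
  have hr0 : 0 < r := by positivity
  have hrC : ‖(r : ℂ)‖ = r := by rw [Complex.norm_real, Real.norm_of_nonneg hr0.le]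
  obtain ⟨M, hM⟩ : ∃ M : ℝ, ∀ j, ‖d j‖ * r ^ ((j : ℝ) - 1 / 2) ≤ M := by
    have h1 := (hP r (by simpa using hr0) (by rw [hrC]; linarith)).summable.tendsto_atTop_zero
    obtain ⟨M, hM⟩ := h1.norm.bddAbove_range
    refine ⟨M, fun j => ?_⟩
    have := hM ⟨j, rfl⟩
    simp only [norm_mul, norm_cpow_sub_half, hrC] at this
    exact this
  have hM0 : 0 ≤ M := le_trans (by positivity) (hM 0)
  set e : ℝ := ((N + 1 : ℕ) : ℝ) - 1 / 2 with he
  have hN0 : (0 : ℝ) ≤ N := by positivity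
  have he0 : 0 < e := by rw [he]; push_cast; linarith
  set s := r / 2 with hs
  have hs0 : 0 < s := by positivity
  -- For |u| ≥ s every power with exponent at most e is bounded by a constant times |u|^e, in
  -- particular those in the global bound of E.
  set B := |C| * (s ^ (-e) + s ^ (-(1 / 2) - e)) +
    ∑ j ∈ Finset.range (N + 1), ‖d j‖ * s ^ ((j : ℝ) - 1 / 2 - e) with hB
  refine ⟨max (M * r ^ (-e) * 2) B, fun u hu => ?_⟩
  have hu0 : 0 < ‖u‖ := norm_pos_iff.2 fun h0 => by simp [h0] at hu
  rcases lt_or_ge ‖u‖ s with hus | hus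
  · refine le_trans ?_ (mul_le_mul_of_nonneg_right (le_max_left _ _) (by positivity))
    have h1 := (hasSum_nat_add_iff' (N + 1)).2 (hP u hu (by linarith))
    have h2 : ∀ j : ℕ, ‖d (j + (N + 1)) * u ^ (((j + (N + 1) : ℕ) : ℂ) - 1 / 2)‖ ≤
        M * r ^ (-e) * ‖u‖ ^ e * (1 / 2) ^ j := by
      intro j
      rw [norm_mul, norm_cpow_sub_half]
      have e1 : (((j + (N + 1) : ℕ) : ℝ) - 1 / 2) = j + e := by rw [he]; push_cast; ring
      have h3 := hM (j + (N + 1))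
      rw [e1, Real.rpow_add hr0, Real.rpow_natCast] at h3
      rw [e1, Real.rpow_add hu0, Real.rpow_natCast]
      have h4 : ‖u‖ ^ j ≤ r ^ j * (1 / 2) ^ j := by
        rw [← mul_pow]
        exact pow_le_pow_left₀ hu0.le (by linarith) j
      have h5 : r ^ (-e) * r ^ e = 1 := by rw [← Real.rpow_add hr0]; simp
      calc ‖d (j + (N + 1))‖ * (‖u‖ ^ j * ‖u‖ ^ e)
          ≤ ‖d (j + (N + 1))‖ * (r ^ j * (1 / 2) ^ j * ‖u‖ ^ e) := by gcongr
        _ = ‖d (j + (N + 1))‖ * (r ^ j * (r ^ (-e) * r ^ e)) * ((1 / 2) ^ j * ‖u‖ ^ e) := by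
            rw [h5]; ring
        _ = ‖d (j + (N + 1))‖ * (r ^ j * r ^ e) * (r ^ (-e) * (1 / 2) ^ j * ‖u‖ ^ e) := by ring
        _ ≤ M * (r ^ (-e) * (1 / 2) ^ j * ‖u‖ ^ e) :=
            mul_le_mul_of_nonneg_right h3 (by positivity)
        _ = _ := by ring
    have h3 := (hasSum_geometric_two).mul_left (M * r ^ (-e) * ‖u‖ ^ e)
    have h4 := h1.norm_le_of_bounded h3 h2
    linarith
  · refine le_trans ?_ (mul_le_mul_of_nonneg_right (le_max_right _ _) (by positivity))
    have hx : ∀ a : ℝ, a ≤ e → ‖u‖ ^ a ≤ s ^ (a - e) * ‖u‖ ^ e := by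
      intro a ha
      have : ‖u‖ ^ a = ‖u‖ ^ (a - e) * ‖u‖ ^ e := by rw [← Real.rpow_add hu0]; congr 1; ring
      rw [this]
      exact mul_le_mul_of_nonneg_right
        (Real.rpow_le_rpow_of_nonpos hs0 hus (by linarith)) (by positivity)
    have h1 : ‖E u‖ ≤ |C| * (s ^ (-e) + s ^ (-(1 / 2) - e)) * ‖u‖ ^ e := by
      have h2 := hx 0 he0.le
      have h3 := hx (-(1 / 2)) (by linarith)
      rw [Real.rpow_zero, zero_sub] at h2
      calc ‖E u‖ ≤ C * (1 + ‖u‖ ^ (-(1 / 2) : ℝ)) := hC u hu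
        _ ≤ |C| * (s ^ (-e) * ‖u‖ ^ e + s ^ (-(1 / 2) - e) * ‖u‖ ^ e) :=
          mul_le_mul (le_abs_self C) (by linarith) (by positivity) (abs_nonneg _)
        _ = _ := by ring
    refine (norm_sub_le _ _).trans ?_
    rw [hB, add_mul, Finset.sum_mul]
    refine add_le_add h1 ((norm_sum_le _ _).trans (Finset.sum_le_sum fun j hj => ?_))
    rw [norm_mul, norm_cpow_sub_half, mul_assoc]
    refine mul_le_mul_of_nonneg_left (hx _ ?_) (norm_nonneg _)
    have : (j : ℝ) ≤ ((N + 1 : ℕ) : ℝ) := by exact_mod_cast (Finset.mem_range.1 hj).le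
    rw [he]; linarith

theorem critLog_im_eq (b : ℝ) (σ : ℤˣ) (m : ℤ) (k : ℕ) :
    (critLog b σ m).im = (branchPt b σ m k).im := by
  rw [branchPt, Complex.add_im, Complex.ofReal_im, zero_add]

theorem IsCutJump.integrable_transBorel (h : IsCutJump b E d) (σ : ℤˣ) (m : ℤ) (k : ℕ) {α : ℝ}
    (hα : |α - (branchPt b σ m k).im| < π / 2) {X : ℂ} (hX : 0 < (X * Complex.exp (α * I)).re) :
    Integrable fun t : ℝ => lapKer X (transBorel b E σ m k) (t + α * I) := by
  obtain ⟨C, -, hC⟩ := h.exists_norm_le (branchPt b σ m k)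
  have h1 : Integrable fun t : ℝ =>
      lapKer X (fun l => E (Complex.exp (l - branchPt b σ m k))) (t + α * I) := by
    refine integrable_lapKer (C := C) (t₀ := (branchPt b σ m k).re) le_rfl hX
      (continuous_line (h.differentiableOn _) (by
        rw [abs_lt] at hα; constructor <;> linarith [hα.1, hα.2])) fun t _ => ?_
    have := hC (t + α * I) (by simpa using hα)
    simpa using this
  refine (h1.div_const (π * k)).congr (Eventually.of_forall fun t => ?_)
  simp only [lapKer, transBorel]
  ring

/-- This is the form in which Watson's lemma delivers the term with exponent j - 1/2. The power of k
is k^(-q(j-1/2)) from the branch point times 1/k from the weight. -/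
theorem transSeriesTerm_eq (hb : 1 < b) (d : ℕ → ℂ) (σ : ℤˣ) (m : ℤ) {k : ℕ} (hk : 1 ≤ k) (j : ℕ)
    (Z : ℂ) : transSeriesTerm b d σ m k j Z =
      d j * Complex.exp (-((((j : ℝ) - 1 / 2 : ℝ) : ℂ) * branchPt b σ m k)) / (π * k) *
        (Real.Gamma ((j : ℝ) - 1 / 2 + 1) *
          Complex.exp (-((((j : ℝ) - 1 / 2 : ℝ) : ℂ) * -(Z / ((b - 1 : ℝ) : ℂ))))) := by
  have hk0 : (0 : ℝ) < k := by exact_mod_cast hk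
  have hkC : (k : ℂ) = Complex.exp (Real.log k) := by
    rw [← Complex.ofReal_exp, Real.exp_log hk0]; simp
  have hb1 : (b : ℂ) - 1 ≠ 0 := by exact_mod_cast (by linarith : b - 1 ≠ 0)
  have hπ : (π : ℂ) ≠ 0 := by exact_mod_cast Real.pi_pos.ne'
  have e1 : Complex.exp ((1 / 2 - (j : ℂ)) * critLog b σ m) *
      (((k : ℝ) ^ ((-2 * j * b + 2 - b) / (2 * (b - 1))) : ℝ) : ℂ) *
      Complex.exp ((((2 * (j : ℝ) - 1) / (2 * (b - 1)) : ℝ) : ℂ) * Z) =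
      Complex.exp (-((((j : ℝ) - 1 / 2 : ℝ) : ℂ) * branchPt b σ m k)) * Complex.exp (-Real.log k) *
        Complex.exp (-((((j : ℝ) - 1 / 2 : ℝ) : ℂ) * -(Z / ((b - 1 : ℝ) : ℂ)))) := by
    rw [Real.rpow_def_of_pos hk0, Complex.ofReal_exp, ← Complex.exp_add, ← Complex.exp_add,
      ← Complex.exp_add, ← Complex.exp_add, branchPt]
    congr 1
    push_cast
    field_simp
    ring
  have e2 : (j : ℝ) - 1 / 2 + 1 = j + 1 / 2 := by ring
  have e3 : Complex.exp (-Real.log k) = 1 / (k : ℂ) := by rw [Complex.exp_neg, ← hkC, one_div]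
  rw [e3] at e1
  rw [transSeriesTerm, transCoeff, e2]
  linear_combination (d j * Real.Gamma (j + 1 / 2) / π) * e1

theorem IsCutJump.transFactor_asymptotic (h : IsCutJump b E d) (hb : 1 < b) (σ : ℤˣ) (m : ℤ)
    {k : ℕ} (hk : 1 ≤ k) {α : ℝ} (hα : |α - (branchPt b σ m k).im| < π / 2) (N : ℕ) :
    (fun r : ℝ => transFactor b E σ m k ((Real.log r : ℂ) + (((b - 1) * α : ℝ) : ℂ) * I) -
        ∑ j ∈ Finset.range N, transSeriesTerm b d σ m k j
          ((Real.log r : ℂ) + (((b - 1) * α : ℝ) : ℂ) * I))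
      =O[𝓝[>] (0 : ℝ)] fun r : ℝ => r ^ ((2 * (N : ℝ) - 1) / (2 * (b - 1))) := by
  have hb1 : 0 < b - 1 := by linarith
  have hπ := Real.pi_pos
  set p := branchPt b σ m k with hp
  obtain ⟨C, hC⟩ := h.exists_norm_sub_le N
  have hre : ∀ r : ℝ, ((Real.log r : ℂ) + (((b - 1) * α : ℝ) : ℂ) * I).re = Real.log r := by
    intro r; rw [Complex.add_re, Complex.ofReal_re, Complex.re_ofReal_mul]; simp
  have him : ∀ r : ℝ, ((Real.log r : ℂ) + (((b - 1) * α : ℝ) : ℂ) * I).im / (b - 1) = α := by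
    intro r
    rw [Complex.add_im, Complex.ofReal_im, Complex.im_ofReal_mul]
    simp
    field_simp
  have hpow : ∀ r : ℝ, 0 < r → ∀ x : ℝ, Real.exp (x * Real.log r) = r ^ x := fun r hr x => by
    rw [Real.rpow_def_of_pos hr, mul_comm]
  -- One term more is subtracted than the claim requires, to match the remainder estimate for E. The
  -- extra term is exactly of the claimed order and is added back afterwards.
  have h1 : (fun r : ℝ => transFactor b E σ m k ((Real.log r : ℂ) + (((b - 1) * α : ℝ) : ℂ) * I) -
        ∑ j ∈ Finset.range (N + 1), transSeriesTerm b d σ m k j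
          ((Real.log r : ℂ) + (((b - 1) * α : ℝ) : ℂ) * I))
      =O[𝓝[>] (0 : ℝ)] fun r : ℝ => r ^ ((2 * (N : ℝ) - 1) / (2 * (b - 1))) := by
    refine Asymptotics.IsBigO.of_bound (|C / (π * k) * Real.exp (-((((N + 1 : ℕ) : ℝ) - 1 / 2) *
        p.re))| *
      Real.Gamma (((N + 1 : ℕ) : ℝ) - 1 / 2 + 1)) ?_
    filter_upwards [Ioo_mem_nhdsGT one_pos] with r hr
    have hr0 : 0 < r := hr.1
    set Z : ℂ := (Real.log r : ℂ) + (((b - 1) * α : ℝ) : ℂ) * I with hZ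
    set W : ℂ := -(Z / ((b - 1 : ℝ) : ℂ)) with hW
    have hWim : W.im + α = 0 := by rw [hW, neg_div_ofReal_im, him, neg_add_cancel]
    have hWre : W.re = -(Real.log r / (b - 1)) := by
      rw [hW, Complex.neg_re, Complex.div_ofReal_re, hre]
    have hWα : |W.im + α| < π / 2 := by rw [hWim, abs_zero]; positivity
    have hN0 : (0 : ℝ) ≤ N := by positivity
    have ha : -1 < ((N + 1 : ℕ) : ℝ) - 1 / 2 := by push_cast; linarith
    have hΓ : 0 < Real.Gamma (((N + 1 : ℕ) : ℝ) - 1 / 2 + 1) :=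
      Real.Gamma_pos_of_pos (by linarith)
    have hj : ∀ j ∈ Finset.range (N + 1), -(1 / 2) ≤ (j : ℝ) - 1 / 2 := fun j _ => by
      have : (0 : ℝ) ≤ j := by positivity
      linarith
    have key := norm_lap_sub_le (Y := transBorel b E σ m k) (β := α) (W := W)
      (a := ((N + 1 : ℕ) : ℝ) - 1 / 2)
      (C := C / (π * k) * Real.exp (-((((N + 1 : ℕ) : ℝ) - 1 / 2) * p.re)))
      (Finset.range (N + 1))
      (fun j => d j * Complex.exp (-((((j : ℝ) - 1 / 2 : ℝ) : ℂ) * p)) / (π * k))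
      (fun j => (j : ℝ) - 1 / 2) ha hj hWα
      (h.integrable_transBorel σ m k hα (re_exp_mul_exp_pos hWα)) (fun t => ?_)
    · rw [hWim, Real.cos_zero, Real.one_rpow, mul_one, hWre] at key
      have e1 : ∀ j ∈ Finset.range (N + 1), transSeriesTerm b d σ m k j Z = _ :=
        fun j _ => transSeriesTerm_eq hb d σ m hk j Z
      rw [transFactor, critVar_mul_rayLaplace, him, Finset.sum_congr rfl e1, ← hp, ← hW]
      refine key.trans ?_
      have e2 : Real.exp (-(((N + 1 : ℕ) : ℝ) - 1 / 2) * -(Real.log r / (b - 1))) ≤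
          ‖r ^ ((2 * (N : ℝ) - 1) / (2 * (b - 1)))‖ := by
        rw [Real.norm_of_nonneg (by positivity), ← hpow r hr0]
        refine Real.exp_le_exp.2 ?_
        have hlog : Real.log r ≤ 0 := Real.log_nonpos hr0.le hr.2.le
        have e3 : -(((N + 1 : ℕ) : ℝ) - 1 / 2) * -(Real.log r / (b - 1)) =
            (2 * (N : ℝ) - 1) / (2 * (b - 1)) * Real.log r + Real.log r / (b - 1) := by
          push_cast; field_simp; ring
        rw [e3]
        linarith [div_nonpos_of_nonpos_of_nonneg hlog hb1.le]
      exact mul_le_mul (mul_le_mul_of_nonneg_right (le_abs_self _) hΓ.le) e2 (Real.exp_pos _).le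
        (by positivity)
    · have hl : |((t : ℂ) + α * I - p).im| < π / 2 := by simpa using hα
      have h2 := hC _ (re_exp_pos hl)
      have e1 : transBorel b E σ m k (t + α * I) - ∑ j ∈ Finset.range (N + 1),
          d j * Complex.exp (-((((j : ℝ) - 1 / 2 : ℝ) : ℂ) * p)) / (π * k) *
            Complex.exp ((((j : ℝ) - 1 / 2 : ℝ) : ℂ) * (t + α * I)) =
          (E (Complex.exp (t + α * I - p)) - ∑ j ∈ Finset.range (N + 1),
            d j * Complex.exp (t + α * I - p) ^ ((j : ℂ) - 1 / 2)) / (π * k) := by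
        rw [sub_div, Finset.sum_div, transBorel]
        congr 1
        refine Finset.sum_congr rfl fun j _ => ?_
        rw [exp_cpow_sub_half hl, mul_sub, Complex.exp_sub, Complex.exp_neg]
        ring
      rw [e1, norm_div, norm_mul, Complex.norm_real, Real.norm_of_nonneg hπ.le,
          Complex.norm_natCast]
      have e2 : ‖Complex.exp (t + α * I - p)‖ ^ (((N + 1 : ℕ) : ℝ) - 1 / 2) =
          Real.exp (-((((N + 1 : ℕ) : ℝ) - 1 / 2) * p.re)) *
            Real.exp ((((N + 1 : ℕ) : ℝ) - 1 / 2) * t) := by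
        rw [Complex.norm_exp, ← Real.exp_mul, ← Real.exp_add]
        congr 1
        simp
        ring
      rw [e2] at h2
      refine (div_le_div_of_nonneg_right h2 (by positivity)).trans (le_of_eq ?_)
      ring
  have h2 : (fun r : ℝ => transSeriesTerm b d σ m k N
      ((Real.log r : ℂ) + (((b - 1) * α : ℝ) : ℂ) * I))
      =O[𝓝[>] (0 : ℝ)] fun r : ℝ => r ^ ((2 * (N : ℝ) - 1) / (2 * (b - 1))) := by
    refine Asymptotics.IsBigO.of_bound (‖transCoeff b d σ m N *
      (((k : ℝ) ^ ((-2 * N * b + 2 - b) / (2 * (b - 1))) : ℝ) : ℂ)‖) ?_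
    filter_upwards [self_mem_nhdsWithin] with r hr
    have hr0 : (0 : ℝ) < r := hr
    rw [transSeriesTerm, norm_mul, Complex.norm_exp, Complex.re_ofReal_mul, hre, hpow r hr0,
      Real.norm_of_nonneg (by positivity : 0 ≤ r ^ ((2 * (N : ℝ) - 1) / (2 * (b - 1))))]
  refine (h1.add h2).congr_left fun r => ?_
  rw [Finset.sum_range_succ]
  ring

end

end LacBorel

/-! ### Assembly of the theorem -/

theorem theorem4 (b : ℝ) (hb : 1 < b) :
    -- the series defining `f` converges in the open right half plane
    (∀ z : ℂ, 0 < z.re →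
      Summable fun j : ℕ => Complex.exp (-(z * ((((j : ℝ) + 1) ^ b : ℝ) : ℂ)))) ∧
    -- its asymptotic series as `z → 0`, uniformly in closed subsectors
    (∀ δ : ℝ, 0 < δ → ∀ N : ℕ, ∃ C : ℝ, ∀ z : ℂ, z ≠ 0 → ‖z‖ ≤ 1 → |z.arg| ≤ Real.pi / 2 - δ →
      ‖LacBorel.lacunary b z - LacBorel.partialSum b N (Complex.log z)‖ ≤ C * ‖z‖ ^ (N + 1)) ∧
    ∃ Hb : ℂ → ℂ,
      -- `H_b` is analytic at zero, with the Taylor series given by the Borel transform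
      AnalyticAt ℂ Hb 0 ∧ Hb 0 = 0 ∧
      (∃ ρ : ℝ, 0 < ρ ∧ ∀ ξ : ℂ, ‖ξ‖ < ρ →
        HasSum (fun j : ℕ => LacBorel.seriesCoeff b (j + 1) /
          (Real.Gamma (((j : ℝ) + 1) * (b - 1) + 1) : ℂ) * ξ ^ (j + 1)) (Hb ξ)) ∧
      -- `H` is analytic on the surface of the logarithm with radial cuts from its branch points
      AnalyticOnNhd ℂ (LacBorel.onLog b Hb) (LacBorel.cutSet b)ᶜ ∧
      -- the branch points are square root branch points, on both sides of the cuts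
      (∀ (σ : ℤˣ) (m : ℤ) (k : ℕ), 1 ≤ k → ∀ ε : ℤˣ, ∃ G : ℂ → ℂ, AnalyticAt ℂ G 0 ∧
        ((¬ ∃ n : ℕ, b = 2 * n) → G 0 ≠ 0) ∧
        ∀ᶠ l in 𝓝 (LacBorel.branchPt b σ m k),
          0 < (ε : ℤ) * (l - LacBorel.branchPt b σ m k).im →
          LacBorel.onLog b Hb l = G ((l - LacBorel.branchPt b σ m k) ^ (1 / 2 : ℂ)) /
            (l - LacBorel.branchPt b σ m k) ^ (1 / 2 : ℂ)) ∧
      -- elsewhere on the cuts `H` continues analytically across, from both sides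
      (∀ l₀ ∈ LacBorel.cutSet b,
        (∀ (σ : ℤˣ) (m : ℤ) (k : ℕ), 1 ≤ k → l₀ ≠ LacBorel.branchPt b σ m k) →
        ∀ ε : ℤˣ, ∃ G : ℂ → ℂ, AnalyticAt ℂ G l₀ ∧
          ∀ᶠ l in 𝓝 l₀, 0 < (ε : ℤ) * (l - l₀).im → LacBorel.onLog b Hb l = G l) ∧
      -- `H(p) = O(p ^ ((b - 1) ^ 2 / b))` up to the cuts, away from the branch points
      (∀ δ : ℝ, 0 < δ → ∃ C : ℝ, ∀ l : ℂ, l ∉ LacBorel.cutSet b → 0 ≤ l.re →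
        (∀ (σ : ℤˣ) (m : ℤ) (k : ℕ), 1 ≤ k → δ / k ≤ ‖l - LacBorel.branchPt b σ m k‖) →
        ‖LacBorel.onLog b Hb l‖ ≤ C * Real.exp ((b - 1) ^ 2 / b * l.re)) ∧
      -- Borel summability along all rays but those through the branch points
      (∀ α : ℝ, ¬ LacBorel.IsStokes b α →
        (∀ X : ℂ, 0 < (X * Complex.exp (α * Complex.I)).re →
          IntegrableOn (LacBorel.rayIntegrand α (LacBorel.onLog b Hb) X) (Ioi 0)) ∧
        ∀ N : ℕ, (fun r : ℝ =>
            LacBorel.borelSum b Hb ((Real.log r : ℂ) + (((b - 1) * α : ℝ) : ℂ) * Complex.I) -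
            LacBorel.partialSum b N ((Real.log r : ℂ) + (((b - 1) * α : ℝ) : ℂ) * Complex.I))
          =O[𝓝[>] (0 : ℝ)] fun r : ℝ => r ^ (N + 1)) ∧
      -- `f` is the Borel sum of its asymptotic series between the first Stokes rays
      (∀ z : ℂ, 0 < z.re → |z.arg| < (2 - b) * Real.pi / 2 →
        LacBorel.lacunary b z = LacBorel.borelSum b Hb (Complex.log z)) ∧
      -- the transseries
      ∃ (E : ℂ → ℂ) (d : ℕ → ℂ), LacBorel.IsCutJump b E d ∧
        -- the power series multiplying the exponentials are Borel summable
        (∀ (σ : ℤˣ) (m : ℤ) (k : ℕ), 1 ≤ k → ∀ α : ℝ,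
          |α - (LacBorel.critLog b σ m).im| < Real.pi / 2 →
          (∀ X : ℂ, 0 < (X * Complex.exp (α * Complex.I)).re →
            IntegrableOn (LacBorel.rayIntegrand α (LacBorel.transBorel b E σ m k) X) (Ioi 0)) ∧
          ∀ N : ℕ, (fun r : ℝ =>
              LacBorel.transFactor b E σ m k
                ((Real.log r : ℂ) + (((b - 1) * α : ℝ) : ℂ) * Complex.I) -
              ∑ j ∈ Finset.range N, LacBorel.transSeriesTerm b d σ m k j
                ((Real.log r : ℂ) + (((b - 1) * α : ℝ) : ℂ) * Complex.I))
            =O[𝓝[>] (0 : ℝ)] fun r : ℝ => r ^ ((2 * (N : ℝ) - 1) / (2 * (b - 1)))) ∧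
        -- and `f` is the sum of its Borel summed transseries off the Stokes rays
        (∀ z : ℂ, 0 < z.re → ¬ LacBorel.IsStokes b (z.arg / (b - 1)) →
          (∀ σ : ℤˣ, ∀ m ∈ LacBorel.active b σ z.arg, Summable fun k : ℕ =>
            LacBorel.transTerm b E σ (m : ℤ) (k + 1) (Complex.log z)) ∧
          LacBorel.lacunary b z = LacBorel.borelSum b Hb (Complex.log z) +
            ∑ σ : ℤˣ, ∑ m ∈ LacBorel.active b σ z.arg, ∑' k : ℕ,
              LacBorel.transTerm b E σ (m : ℤ) (k + 1) (Complex.log z)) := by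
  have hb1 : 0 < b - 1 := by linarith
  obtain ⟨d, hd⟩ := LacBorel.isCutJump_cutJump hb
  have hre : ∀ {z : ℂ}, 0 < z.re → z ≠ 0 ∧ |z.arg| < Real.pi / 2 ∧
      (Complex.log z).im = z.arg ∧ Complex.exp (Complex.log z) = z := fun {z} hz => by
    have hz0 : z ≠ 0 := fun h => by simp [h] at hz
    exact ⟨hz0, Complex.abs_arg_lt_pi_div_two_iff.2 (Or.inl hz), Complex.log_im z,
      Complex.exp_log hz0⟩
  have htrans : ∀ z : ℂ, 0 < z.re → ¬ LacBorel.IsStokes b (z.arg / (b - 1)) →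
      LacBorel.lacunary b z = LacBorel.borelSum b (LacBorel.borelFn b) (Complex.log z) +
        ∑ σ : ℤˣ, ∑ m ∈ LacBorel.active b σ z.arg, ∑' k : ℕ,
          LacBorel.transTerm b (LacBorel.cutJump b) σ (m : ℤ) (k + 1) (Complex.log z) := by
    intro z hz hS
    obtain ⟨-, h1, h2, h3⟩ := hre hz
    have := LacBorel.lacunary_exp_eq_transseries hb (Z := Complex.log z) (by rwa [h2])
      (by rwa [h2])
    rwa [h3, h2] at this
  refine ⟨fun z hz => LacBorel.summable_lacunary hb hz, fun δ hδ N =>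
    LacBorel.lacunary_asymptotic hb hδ N, LacBorel.borelFn b, LacBorel.analyticAt_borelFn_zero hb,
    LacBorel.borelFn_zero hb, LacBorel.exists_hasSum_borelFn hb,
    LacBorel.analyticOnNhd_onLog_borelFn hb, fun σ m k hk ε => ?_, fun l₀ _ h ε =>
    LacBorel.continuesFrom_onLog_borelFn hb ε h, fun δ hδ =>
    LacBorel.exists_norm_onLog_borelFn_le hb hδ, fun α hα => ⟨fun X hX =>
    LacBorel.integrableOn_onLog_borelFn hb hα hX, LacBorel.borelSum_asymptotic hb hα⟩,
    fun z hz harg => ?_, LacBorel.cutJump b, d, hd, fun σ m k hk α hα => ?_,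
    fun z hz hS => ⟨fun σ m hm => ?_, htrans z hz hS⟩⟩
  · obtain ⟨c, hc, G, hG, hG0, h⟩ := LacBorel.exists_hasRootSeries_onLog_borelFn hb ε σ m hk
    exact ⟨G, hG, fun hev => hG0 ▸ hc hev, h⟩
  · have hπ := Real.pi_pos
    obtain ⟨h1, h2⟩ := abs_lt.1 harg
    -- Between the first Stokes rays no exponential is present, so the transseries reduces to the
    -- Borel sum.
    have hact : ∀ σ : ℤˣ, LacBorel.active b σ z.arg = ∅ := by
      intro σ
      rw [Finset.eq_empty_iff_forall_notMem]
      intro m hm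
      rw [LacBorel.mem_active] at hm
      have hm0 : (0 : ℝ) ≤ 2 * Real.pi * m := by positivity
      rcases LacBorel.units_cast_cases σ with h | h <;> rw [h] at hm <;> linarith
    -- A Stokes ray in this sector would need an integer m strictly between -1 and 0, since (2 -
    -- b)π/2 < π.
    have hS : ¬ LacBorel.IsStokes b (z.arg / (b - 1)) := by
      rintro ⟨σ, m, hm⟩
      rw [LacBorel.im_critLog, div_eq_iff hb1.ne'] at hm
      have hm' : z.arg = (σ : ℤ) * ((2 - b) * Real.pi / 2 + 2 * Real.pi * m) := by
        rw [hm]; field_simp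
      have harg' := (hre hz).2.1
      have h3 : |(2 - b) * Real.pi / 2 + 2 * Real.pi * m| < (2 - b) * Real.pi / 2 := by
        rw [hm', abs_mul] at harg
        rcases LacBorel.units_cast_cases σ with h | h <;> rw [h] at harg <;> simpa using harg
      obtain ⟨h4, h5⟩ := abs_lt.1 h3
      have h6 : (m : ℝ) < 0 := by
        by_contra hcon
        nlinarith [not_lt.1 hcon]
      have h7 : (-1 : ℝ) < m := by
        by_contra hcon
        nlinarith [not_lt.1 hcon]
      have h8 : m < 0 := by exact_mod_cast h6
      have h9 : -1 < m := by exact_mod_cast h7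
      omega
    rw [htrans z hz hS]
    simp [hact]
  · rw [LacBorel.critLog_im_eq b σ m k] at hα
    exact ⟨fun X hX => (LacBorel.integrableOn_rayIntegrand_iff _ _ _).2
      (hd.integrable_transBorel σ m k hα hX), hd.transFactor_asymptotic hb σ m hk hα⟩
  · obtain ⟨-, h1, h2, h3⟩ := hre hz
    exact LacBorel.summable_transTerm hb σ (Z := Complex.log z) (by rwa [h2]) (by rwa [h2])
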